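/- Identify a differential form $\omega=P\,dx+Q\,dy$ with the pair of polynomials $P,Q\in\mathbb C[x,y]$; it is *cubic* if $\deg P,\deg Q\le 3$, so that cubic forms constitute a space $\mathbb C^{20}$. A curve $G=0$ is an *integral curve* of $\omega$ if $dG\wedge\omega=G\,K_G$ for a polynomial $2$-form $K_G$, its *cofactor*. A rational function $\mu$ is an *integrating factor* of $\omega$ if at every point outside a fixed denominator of $\mu$ there is a power series $F$ with $dF=\mu\,\omega$. *Special configurations.* Let $L_1,\dots,L_4$ be lines and $Q$ an irreducible conic in $\mathbb P^2$, with affine part $\mathbb C^2$, such that: $L_1,L_2,L_4,Q$ meet in an ordinary $4$-fold point $C\in\mathbb C^2$ not on $L_3$; $L_3,L_4,Q$ meet in an ordinary triple point $D$ on the line at infinity, not on $L_1\cup L_2$; and the five remaining intersection points $E\in L_1\cap L_3$, $F\in L_2\cap L_3$, $H\in L_1\cap Q$, $I\in L_2\cap Q$, $J\in L_3\cap Q$ are nodes of the union of the five curves and lie in $\mathbb C^2$. Put $\Gamma=L_1\cup L_2\cup L_3\cup Q$. *Center variety.* Let $\mathbb C^{14}$ be the space of forms $(x+p)\,dx+(y+q)\,dy$,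 where $p,q$ have only terms of degree $2$ and $3$. For the general such form, with indeterminate coefficients, there is a formal power series $F=x^2+y^2+f_3+f_4+\cdots$, with coefficients in the ring of rational polynomials in these $14$ indeterminates, such that $$F_xQ-F_yP=\sum_{j\ge1}s_j\,(x^{2j+2}+y^{2j+2}),$$ where here $\omega=P\,dx+Q\,dy$. The rational polynomials $s_1,s_2,\dots$ are the *focal values*, and their common zero set $Z\subset\mathbb C^{14}$ is the *degree-$3$ center variety*. The following statements hold for every choice of such an $F$. 1. For every special configuration, the points $C,E,F,H,I,J$ do not lie on a conic (including degenerate conics), and the vector space of cubic forms that have all five curves as integral curves is $1$-dimensional. Every form $\omega$ in it has $\Gamma$ as an integral curve and satisfies $$K_{L_4}-K_\Gamma+d\omega=0,$$ and the rational function $L_4/(L_1L_2L_3Q)$ (written with affine equations of the curves) is an integrating factor of $\omega$. 2. Let $\Omega\subset\mathbb C^{20}$ be the set of nonzero cubic forms that have all curves of some special configuration as integral curves. Its Zariski closure is irreducible of dimension $10$; that is, up to scaling these forms constitute an irreducible $9$-dimensional family. 3. Let $N\subset\mathbb C^{14}$ be the set of those forms in $\mathbb C^{14}$ that have all curves of some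 special configuration, none of which passes through the origin, as integral curves. The set of cubic forms that an affine change of coordinates and scaling transforms into an element of $N$ has the same Zariski closure as $\Omega$. The Zariski closure of $N$ has dimension $5$, i.e. codimension $9$ in $\mathbb C^{14}$, and it is an irreducible component of the center variety $Z$. 4. The lines and the conic $$L_1=y+2,\quad L_2=4x+y+4,\quad L_3=4x+1,\quad L_4=2x+1,\quad Q=2x^2+2xy+x+2y+2$$ form a special configuration and are integral curves of $$\begin{aligned}\omega={}&(-40x^2y-36xy^2-4y^3-80x^2-102xy-34y^2-60x-72y-40)\,dx\\&+(24x^3+16x^2y+2x^2+12xy-9x+2y-2)\,dy.\end{aligned}$$ An affine change of coordinates and scaling transforms $\omega$ into an element $n\in N$ at which the common kernel of the derivatives of the first $10$ focal values $s_1,\dots,s_{10}$ has dimension $5$, i.e. codimension $9$ in $\mathbb C^{14}$. -/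

import Mathlib

open MvPolynomial

noncomputable section

namespace CenterProblem

/-! Polynomial differential forms in the affine plane, with coordinates `x = X 0`, `y = X 1`. -/

/-- The pair `(P, Q)` stands for the differential form `P dx + Q dy`. -/
abbrev PolyForm (A : Type) [CommRing A] : Type :=
  MvPolynomial (Fin 2) A × MvPolynomial (Fin 2) A

/-- The coefficient of `dx ∧ dy` in `dG ∧ ω`. -/
def dWedge (G : MvPolynomial (Fin 2) ℂ) (ω : PolyForm ℂ) : MvPolynomial (Fin 2) ℂ :=
  pderiv 0 G * ω.2 - pderiv 1 G * ω.1

/-- The coefficient of `dx ∧ dy` in `dω`. -/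
def dForm (ω : PolyForm ℂ) : MvPolynomial (Fin 2) ℂ :=
  pderiv 0 ω.2 - pderiv 1 ω.1

/-- `K dx ∧ dy` is the cofactor of the curve `G = 0` with respect to `ω`: `dG ∧ ω = G K dx ∧ dy`. -/
def IsCofactor (ω : PolyForm ℂ) (G K : MvPolynomial (Fin 2) ℂ) : Prop :=
  dWedge G ω = G * K

/-- The curve `G = 0` is an algebraic integral curve of `ω`. -/
def IsAlgebraicIntegralCurve (ω : PolyForm ℂ) (G : MvPolynomial (Fin 2) ℂ) : Prop :=
  ∃ K, IsCofactor ω G K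

/-- The Taylor expansion of a polynomial at the point `p`. -/
def expansionAt (p : Fin 2 → ℂ) (G : MvPolynomial (Fin 2) ℂ) : MvPowerSeries (Fin 2) ℂ :=
  ((aeval (fun i => (X i + C (p i) : MvPolynomial (Fin 2) ℂ)) G : MvPolynomial (Fin 2) ℂ) :
    MvPowerSeries (Fin 2) ℂ)

/-- The rational function `A / B` is an integrating factor of `ω`: at every point `p` with
`B(p) ≠ 0`, with `μ` the power series expansion of `A / B` at `p`, there is a power series `F`
(a first integral) with `dF = μ ω`. -/
def IsRationalIntegratingFactor (A B : MvPolynomial (Fin 2) ℂ) (ω : PolyForm ℂ) : Prop :=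
  A ≠ 0 ∧ B ≠ 0 ∧ ∀ p : Fin 2 → ℂ, eval p B ≠ 0 →
    ∃ F μ : MvPowerSeries (Fin 2) ℂ,
      μ * expansionAt p B = expansionAt p A ∧
      MvPowerSeries.pderiv ℂ 0 F = μ * expansionAt p ω.1 ∧
      MvPowerSeries.pderiv ℂ 1 F = μ * expansionAt p ω.2

/-! Four lines and a conic in the projective plane, with homogeneous coordinates
`x = X 0`, `y = X 1`, `z = X 2` and line at infinity `z = 0`. -/

/-- The point of the projective plane with affine coordinates `p`. -/
def affinePoint (p : Fin 2 → ℂ) : Fin 3 → ℂ := ![p 0, p 1, 1]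

/-- The point at infinity in the direction `v`. -/
def infinitePoint (v : Fin 2 → ℂ) : Fin 3 → ℂ := ![v 0, v 1, 0]

/-- The affine equation of a projective curve. -/
def affinePart (G : MvPolynomial (Fin 3) ℂ) : MvPolynomial (Fin 2) ℂ :=
  aeval (![X 0, X 1, 1] : Fin 3 → MvPolynomial (Fin 2) ℂ) G

def gradAt (p : Fin 3 → ℂ) (G : MvPolynomial (Fin 3) ℂ) : Fin 3 → ℂ :=
  fun i => eval p (pderiv i G)

/-- The curves `G₁ = 0` and `G₂ = 0` pass through `p`, are smooth there and have
distinct tangent lines there. -/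
def TransversalAt (p : Fin 3 → ℂ) (G₁ G₂ : MvPolynomial (Fin 3) ℂ) : Prop :=
  eval p G₁ = 0 ∧ eval p G₂ = 0 ∧ LinearIndependent ℂ ![gradAt p G₁, gradAt p G₂]

/-- The curves in the list `S` all pass through `p`, with pairwise distinct tangents, and those in
the list `T` do not pass through `p`. If `S` has `m ≥ 2` members, then `p` is an ordinary `m`-fold
point of the union of all the curves of `S` and `T`. -/
def OrdinaryPoint (p : Fin 3 → ℂ) (S T : List (MvPolynomial (Fin 3) ℂ)) : Prop :=
  S.Pairwise (TransversalAt p) ∧ ∀ G ∈ T, eval p G ≠ 0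

/-- Homogeneous equations of four lines and a conic. -/
structure Configuration where
  L₁ : MvPolynomial (Fin 3) ℂ
  L₂ : MvPolynomial (Fin 3) ℂ
  L₃ : MvPolynomial (Fin 3) ℂ
  L₄ : MvPolynomial (Fin 3) ℂ
  Q : MvPolynomial (Fin 3) ℂ

/-- The special position: `L₁, L₂, L₄, Q` meet in an ordinary 4-fold point `C` of the affine plane,
`L₃, L₄, Q` meet in an ordinary triple point `D` at infinity, and the remaining intersection points
`E, F, H, I, J` are nodes in the affine plane. (`D` is given by its direction.) -/
structure Configuration.IsSpecial (c : Configuration) (C D E F H I J : Fin 2 → ℂ) : Prop where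
  line₁ : c.L₁.IsHomogeneous 1
  line₂ : c.L₂.IsHomogeneous 1
  line₃ : c.L₃.IsHomogeneous 1
  line₄ : c.L₄.IsHomogeneous 1
  conic : c.Q.IsHomogeneous 2
  irreducible : Irreducible c.Q
  direction : D ≠ 0
  fourfold : OrdinaryPoint (affinePoint C) [c.L₁, c.L₂, c.L₄, c.Q] [c.L₃]
  triple : OrdinaryPoint (infinitePoint D) [c.L₃, c.L₄, c.Q] [c.L₁, c.L₂]
  nodeE : OrdinaryPoint (affinePoint E) [c.L₁, c.L₃] [c.L₂, c.L₄, c.Q]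
  nodeF : OrdinaryPoint (affinePoint F) [c.L₂, c.L₃] [c.L₁, c.L₄, c.Q]
  nodeH : OrdinaryPoint (affinePoint H) [c.L₁, c.Q] [c.L₂, c.L₃, c.L₄]
  nodeI : OrdinaryPoint (affinePoint I) [c.L₂, c.Q] [c.L₁, c.L₃, c.L₄]
  nodeJ : OrdinaryPoint (affinePoint J) [c.L₃, c.Q] [c.L₁, c.L₂, c.L₄]

/-- The affine equation of `Γ = L₁ ∪ L₂ ∪ L₃ ∪ Q`. -/
def Configuration.Γ (c : Configuration) : MvPolynomial (Fin 2) ℂ :=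
  affinePart c.L₁ * affinePart c.L₂ * affinePart c.L₃ * affinePart c.Q

/-- All four lines and the conic are integral curves of `ω`. -/
def Configuration.HasIntegralCurves (c : Configuration) (ω : PolyForm ℂ) : Prop :=
  IsAlgebraicIntegralCurve ω (affinePart c.L₁) ∧ IsAlgebraicIntegralCurve ω (affinePart c.L₂) ∧
  IsAlgebraicIntegralCurve ω (affinePart c.L₃) ∧ IsAlgebraicIntegralCurve ω (affinePart c.L₄) ∧
  IsAlgebraicIntegralCurve ω (affinePart c.Q)

lemma isAlgebraicIntegralCurve_zero (G : MvPolynomial (Fin 2) ℂ) : IsAlgebraicIntegralCurve 0 G :=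
  ⟨0, by simp [IsCofactor, dWedge]⟩

lemma IsAlgebraicIntegralCurve.add {ω η : PolyForm ℂ} {G : MvPolynomial (Fin 2) ℂ}
    (h : IsAlgebraicIntegralCurve ω G) (k : IsAlgebraicIntegralCurve η G) : IsAlgebraicIntegralCurve (ω + η) G := by
  obtain ⟨K, hK⟩ := h
  obtain ⟨M, hM⟩ := k
  refine ⟨K + M, ?_⟩
  simp only [IsCofactor, dWedge, Prod.fst_add, Prod.snd_add] at *
  linear_combination hK + hM

lemma IsAlgebraicIntegralCurve.smul {ω : PolyForm ℂ} {G : MvPolynomial (Fin 2) ℂ} (t : ℂ)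
    (h : IsAlgebraicIntegralCurve ω G) : IsAlgebraicIntegralCurve (t • ω) G := by
  obtain ⟨K, hK⟩ := h
  refine ⟨MvPolynomial.C t * K, ?_⟩
  simp only [IsCofactor, dWedge, Prod.smul_fst, Prod.smul_snd, smul_eq_C_mul] at *
  linear_combination MvPolynomial.C t * hK

/-- The vector space of differential forms `P dx + Q dy` with `deg P, deg Q ≤ d` that have all
curves of the configuration among their integral curves. -/
def Configuration.forms (c : Configuration) (d : ℕ) : Submodule ℂ (PolyForm ℂ) where
  carrier := {ω | ω.1.totalDegree ≤ d ∧ ω.2.totalDegree ≤ d ∧ c.HasIntegralCurves ω}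
  zero_mem' := by
    refine ⟨by simp, by simp, ?_⟩
    exact ⟨isAlgebraicIntegralCurve_zero _, isAlgebraicIntegralCurve_zero _, isAlgebraicIntegralCurve_zero _,
      isAlgebraicIntegralCurve_zero _, isAlgebraicIntegralCurve_zero _⟩
  add_mem' := by
    rintro ω η ⟨h1, h2, a1, a2, a3, a4, a5⟩ ⟨k1, k2, b1, b2, b3, b4, b5⟩
    exact ⟨(totalDegree_add _ _).trans (max_le h1 k1), (totalDegree_add _ _).trans (max_le h2 k2),
      a1.add b1, a2.add b2, a3.add b3, a4.add b4, a5.add b5⟩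
  smul_mem' := by
    rintro t ω ⟨h1, h2, a1, a2, a3, a4, a5⟩
    exact ⟨(totalDegree_smul_le t _).trans h1, (totalDegree_smul_le t _).trans h2,
      a1.smul t, a2.smul t, a3.smul t, a4.smul t, a5.smul t⟩

/-! Coordinates on the space of cubic forms and on the space of forms in Poincaré's normal form. -/

/-- Exponents `(i, j)` of the monomials `x ^ i * y ^ j` of degree at most 3. -/
abbrev CubicExp : Type := {e : Fin 4 × Fin 4 // (e.1 : ℕ) + (e.2 : ℕ) ≤ 3}

/-- Exponents `(i, j)` of the monomials `x ^ i * y ^ j` of degree 2 or 3. -/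
abbrev HigherExp : Type :=
  {e : Fin 4 × Fin 4 // 2 ≤ (e.1 : ℕ) + (e.2 : ℕ) ∧ (e.1 : ℕ) + (e.2 : ℕ) ≤ 3}

/-- The differential form of degree at most 3 with the given 20 coefficients. -/
def cubicForm (a : Fin 2 × CubicExp → ℂ) : PolyForm ℂ :=
  (∑ e : CubicExp, C (a (0, e)) * (X 0 ^ (e.1.1 : ℕ) * X 1 ^ (e.1.2 : ℕ)),
   ∑ e : CubicExp, C (a (1, e)) * (X 0 ^ (e.1.1 : ℕ) * X 1 ^ (e.1.2 : ℕ)))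

/-- The differential form `(x + p) dx + (y + q) dy`, where `p` and `q` consist of monomials of
degree 2 and 3 and have the given 14 coefficients. -/
def normalForm {A : Type} [CommRing A] (a : Fin 2 × HigherExp → A) : PolyForm A :=
  (X 0 + ∑ e : HigherExp, C (a (0, e)) * (X 0 ^ (e.1.1 : ℕ) * X 1 ^ (e.1.2 : ℕ)),
   X 1 + ∑ e : HigherExp, C (a (1, e)) * (X 0 ^ (e.1.1 : ℕ) * X 1 ^ (e.1.2 : ℕ)))

/-! Focal values and the center variety. -/

/-- The formal power series `F = x² + y² + f₃ + f₄ + ⋯` over the coefficient ring `A` satisfies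
`F_x Q - F_y P = ∑_{j ≥ 1} s_j (x ^ (2 j + 2) + y ^ (2 j + 2))`, where `ω = P dx + Q dy`.
(In the last sum only indices `j ≤ m 0 + m 1` can contribute to the coefficient at `m`.) -/
structure IsPoincareSeries {A : Type} [CommRing A] (ω : PolyForm A)
    (F : MvPowerSeries (Fin 2) A) (s : ℕ → A) : Prop where
  two_jet : ∀ m : Fin 2 →₀ ℕ, m 0 + m 1 ≤ 2 →
    MvPowerSeries.coeff m F =
      MvPowerSeries.coeff m (MvPowerSeries.X 0 ^ 2 + MvPowerSeries.X 1 ^ 2)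
  det_eq : ∀ m : Fin 2 →₀ ℕ,
    MvPowerSeries.coeff m (MvPowerSeries.pderiv A 0 F * (ω.2 : MvPowerSeries (Fin 2) A) -
        MvPowerSeries.pderiv A 1 F * (ω.1 : MvPowerSeries (Fin 2) A)) =
      ∑ j ∈ Finset.Icc 1 (m 0 + m 1), s j *
        MvPowerSeries.coeff m
          (MvPowerSeries.X 0 ^ (2 * j + 2) + MvPowerSeries.X 1 ^ (2 * j + 2))

/-- Rational polynomials in the 14 coefficients of a form in Poincaré's normal form. -/
abbrev CoeffPoly : Type := MvPolynomial (Fin 2 × HigherExp) ℚ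

/-- `s 1, s 2, …` are focal values (focal polynomials) of the general form in Poincaré's normal form
of degree 3, whose 14 coefficients are the variables, obtained from some series `F` with
coefficients in the ring of rational polynomials in these variables. -/
def IsFocalSequence (s : ℕ → CoeffPoly) : Prop :=
  ∃ F : MvPowerSeries (Fin 2) CoeffPoly,
    IsPoincareSeries (normalForm (fun i => (X i : CoeffPoly))) F s

/-- The center variety in degree 3: the common zeros of all focal polynomials. -/
def centerVariety (s : ℕ → CoeffPoly) : Set (Fin 2 × HigherExp → ℂ) :=
  {a | ∀ j, 1 ≤ j → aeval a (s j) = 0}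

/-- The vectors annihilated by the derivatives at `a` of the first `k` focal polynomials. -/
def focalTangentSpace (s : ℕ → CoeffPoly) (k : ℕ) (a : Fin 2 × HigherExp → ℂ) :
    Submodule ℂ (Fin 2 × HigherExp → ℂ) :=
  LinearMap.ker (Matrix.mulVecLin
    (Matrix.of fun (j : Fin k) (i : Fin 2 × HigherExp) => aeval a (pderiv i (s ((j : ℕ) + 1)))))

/-! The family defined by the configurations in special position. -/

/-- The nonzero cubic forms that have some configuration in special position among their
integral curves. -/
def specialForms : Set (Fin 2 × CubicExp → ℂ) :=
  {a | a ≠ 0 ∧ ∃ (c : Configuration) (C D E F H I J : Fin 2 → ℂ),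
    c.IsSpecial C D E F H I J ∧ cubicForm a ∈ c.forms 3}

/-- The forms in Poincaré's normal form that have some configuration in special position among their
integral curves, none of whose curves passes through the origin. -/
def specialNormalForms : Set (Fin 2 × HigherExp → ℂ) :=
  {a | ∃ (c : Configuration) (C D E F H I J : Fin 2 → ℂ),
    c.IsSpecial C D E F H I J ∧ normalForm a ∈ c.forms 3 ∧
    eval 0 (c.Γ * affinePart c.L₄) ≠ 0}

/-- The pullback of `ω` under the affine map `v ↦ p + M v`. -/
def pullback (p : Fin 2 → ℂ) (M : Matrix (Fin 2) (Fin 2) ℂ) (ω : PolyForm ℂ) : PolyForm ℂ :=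
  let φ : Fin 2 → MvPolynomial (Fin 2) ℂ := fun i => C (p i) + C (M i 0) * X 0 + C (M i 1) * X 1
  (C (M 0 0) * aeval φ ω.1 + C (M 1 0) * aeval φ ω.2,
   C (M 0 1) * aeval φ ω.1 + C (M 1 1) * aeval φ ω.2)

/-- `η` arises from `ω` by an invertible affine change of coordinates, up to a nonzero factor. -/
def AffinelyEquivalent (ω η : PolyForm ℂ) : Prop :=
  ∃ (p : Fin 2 → ℂ) (M : Matrix (Fin 2) (Fin 2) ℂ) (t : ℂ),
    M.det ≠ 0 ∧ t ≠ 0 ∧ pullback p M ω = t • η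

/-- The cubic forms that can be brought into a Poincaré normal form belonging to `N`. -/
def affineOrbit (N : Set (Fin 2 × HigherExp → ℂ)) : Set (Fin 2 × CubicExp → ℂ) :=
  {a | ∃ n ∈ N, AffinelyEquivalent (cubicForm a) (normalForm n)}

/-! An explicit member of the family. -/

def exampleConfiguration : Configuration where
  L₁ := X 1 + 2 * X 2
  L₂ := 4 * X 0 + X 1 + 4 * X 2
  L₃ := 4 * X 0 + X 2
  L₄ := 2 * X 0 + X 2
  Q := 2 * X 0 ^ 2 + 2 * X 0 * X 1 + X 0 * X 2 + 2 * X 1 * X 2 + 2 * X 2 ^ 2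

def exampleForm : PolyForm ℂ :=
  (-40 * X 0 ^ 2 * X 1 - 36 * X 0 * X 1 ^ 2 - 4 * X 1 ^ 3 - 80 * X 0 ^ 2 - 102 * X 0 * X 1
      - 34 * X 1 ^ 2 - 60 * X 0 - 72 * X 1 - 40,
   24 * X 0 ^ 3 + 16 * X 0 ^ 2 * X 1 + 2 * X 0 ^ 2 + 12 * X 0 * X 1 - 9 * X 0 + 2 * X 1 - 2)

end CenterProblem

end

open CenterProblem

noncomputable section

/-! Standard position. An affine change of coordinates moves `C` to the origin and `D` to the
vertical direction, and turns the curves into `y = m₁ x`, `y = m₂ x`, `x = 1`, `x = 0` and the conic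
`y (1 + b x) = x²` (`exists_standard`). Everything about special configurations is checked for this
three-parameter family and transported by pullback. A cubic form with these integral curves has a
dy-component divisible by `x (x - 1)`, and the linear quotient vanishes at `H` and `I`, because a
form vanishes where two integral curves cross transversally. So the dy-component is unique up to a
factor. If it is zero, the dx-component is divisible by `L₁ L₂ Q`, of degree 4, and vanishes too
(`exists_smul_stdForm`). The cofactor identity is a polynomial identity for the explicit form
`stdForm`; it says that `L₄ / (L₁ L₂ L₃ Q)` times the form is closed.

Dimensions. The special forms lie in the image of a polynomial map in ten parameters and contain the
image of a nonempty open set. Hence their vanishing ideal is the kernel of a homomorphism of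
polynomial rings, which is prime, and the dimension is 10 because the differential is injective at
one point (`ringKrullDim_quotient_ker_of_jacobian`). For the normal forms, the zero of the standard
form outside the curves is moved to the origin. After a square root `θ` is adjoined, the linear part
becomes a multiple of `x dx + y dy`; the parameters `b`, `θ`, `ε` and two parameters of a similarity
give a polynomial map in five parameters (`Linked.pullback_eq`, `pullback_normalizedForm`).

Center variety. An integrating factor that is regular and nonzero at the origin yields a first
integral `x² + y² + ⋯`, and such an integral forces all focal values to vanish
(`focal_eq_zero_of_firstIntegral`). So `N` lies in the center variety. It is a component as soon as
the derivatives of finitely many focal values have a kernel of dimension at most 5 at one point of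
`N`, by the Jacobian criterion `ringKrullDim_quotient_le_of_jacobian`.

Tangent space. The focal values are never computed. If a direction `η` is annihilated by the
derivatives of the first ten of them, then `η ∧ ω = dG ∧ ω - G dω` below degree 24 for some series
`G` of order at least 3 (`exists_inverseIntegratingFactor_deformation`). Nine explicit functionals
annihilate all right-hand sides of this kind, and on nine coordinates of `η` they form a matrix that
is invertible modulo 17. This leaves at most five dimensions; at least five are guaranteed by the
dimension of the family. -/

namespace CenterProblem

/-! ### Krull dimension, transcendence degree and Jacobian criteria. -/

section Dimension

open Cardinal

/-- A finitely generated domain over a field has Krull dimension equal to its transcendence degree. -/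
theorem exists_ringKrullDim_eq_trdeg (k D : Type) [Field k] [CommRing D] [IsDomain D] [Algebra k D]
    [Algebra.FiniteType k D] : ∃ d : ℕ, ringKrullDim D = d ∧ Algebra.trdeg k D = d := by
  -- Noether normalization: `D` is integral over a polynomial ring in `d` variables, and inherits
  -- both dimensions from it.
  obtain ⟨d, g, hg, hint⟩ := exists_integral_inj_algHom_of_fg k D
  refine ⟨d, ?_, ?_⟩
  · have hdim : ringKrullDim (MvPolynomial (Fin d) k) = d := by simp
    algebraize [g.toRingHom]
    have hint' : Algebra.IsIntegral (MvPolynomial (Fin d) k) D := ⟨hint⟩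
    rw [← hdim]
    apply le_antisymm
    -- Incomparability: contraction to the polynomial ring keeps inclusions of primes strict.
    · refine Order.krullDim_le_of_strictMono
        (PrimeSpectrum.comap (algebraMap (MvPolynomial (Fin d) k) D)) ?_
      intro I J h
      exact Ideal.IsIntegral.comap_lt_comap (R := MvPolynomial (Fin d) k) (A := D)
        (I := I.asIdeal) (J := J.asIdeal) h
    -- Lying over for the smallest prime, followed by going up, lifts every chain of primes to `D`
    -- with the same length.
    · refine iSup_le fun l => ?_
      obtain ⟨P, -, hP, hP'⟩ := Ideal.exists_ideal_over_prime_of_isIntegral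
        (R := MvPolynomial (Fin d) k) (S := D) l.head.asIdeal (⊥ : Ideal D) (by
          intro x hx
          have : g x = 0 := hx
          rw [(map_eq_zero_iff g hg).1 this]
          exact zero_mem _)
      have : P.LiesOver l.head.asIdeal := ⟨hP'.symm⟩
      obtain ⟨L, hL, -, -⟩ := Ideal.exists_ltSeries_of_hasGoingUp (S := D) l P
      rw [← hL]
      exact le_iSup (fun L : LTSeries (PrimeSpectrum D) => ((L.length : ℕ) : WithBot ℕ∞)) L
  · have h1 : Algebra.trdeg k (MvPolynomial (Fin d) k) = d := by
      simp [MvPolynomial.trdeg_of_isDomain]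
    algebraize [g.toRingHom]
    have : IsScalarTower k (MvPolynomial (Fin d) k) D := IsScalarTower.of_algebraMap_eq fun x => by
      simp [RingHom.algebraMap_toAlgebra]
    have hint' : Algebra.IsIntegral (MvPolynomial (Fin d) k) D := ⟨hint⟩
    have : FaithfulSMul (MvPolynomial (Fin d) k) D :=
      (faithfulSMul_iff_algebraMap_injective _ _).2 hg
    have h2 := trdeg_add_eq k (MvPolynomial (Fin d) k) (A := D)
    have h3 : Algebra.trdeg (MvPolynomial (Fin d) k) D = 0 := trdeg_eq_zero
    rw [← h2, h1, h3, add_zero]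

open IntermediateField.algebraAdjoinAdjoin in
/-- If a finitely generated domain in characteristic zero is such that every derivation of its
fraction field `K` that kills the set `T` kills the generators, then `K` is algebraic over `T`. -/
theorem isAlgebraic_adjoin_of_derivation (k D K : Type) [Field k] [CharZero k] [CommRing D]
    [IsDomain D] [Algebra k D] [Field K] [Algebra k K] [Algebra D K] [IsScalarTower k D K]
    [IsFractionRing D K] {σ : Type} [Finite σ] (x : σ → D)
    (hx : Algebra.adjoin k (Set.range x) = ⊤) (T : Set K)
    (h : ∀ (M : Type) [AddCommGroup M] [Module k M] [Module K M] [IsScalarTower k K M]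
      (d : Derivation k K M), (∀ y ∈ T, d y = 0) → ∀ i, d (algebraMap D K (x i)) = 0) :
    Algebra.IsAlgebraic (Algebra.adjoin k T) K := by
  have hft : Algebra.FiniteType k D :=
    ⟨⟨(Set.finite_range x).toFinset, by simpa using hx⟩⟩
  have hess' : Algebra.EssFiniteType D K :=
    Algebra.EssFiniteType.of_isLocalization K (nonZeroDivisors D)
  have hess : Algebra.EssFiniteType k K := Algebra.EssFiniteType.comp k D K
  -- The universal derivation of `K` over `E = k(T)` kills `T`, hence the generators, hence all of
  -- `K`. So `K` has no differentials over `E`; being essentially of finite type, it is separable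
  -- algebraic.
  let E := IntermediateField.adjoin k T
  have hessE : Algebra.EssFiniteType E K := Algebra.EssFiniteType.of_comp k E K
  have hunr : Algebra.FormallyUnramified E K := by
    refine ⟨?_⟩
    have key : ∀ a : K, KaehlerDifferential.D E K a = 0 := by
      let d : Derivation k K (Ω[K⁄E]) := (KaehlerDifferential.D E K).restrictScalars k
      have hd : ∀ i, d (algebraMap D K (x i)) = 0 := h _ d fun y hy =>
        (KaehlerDifferential.D E K).map_algebraMap (⟨y, IntermediateField.subset_adjoin k T hy⟩ : E)
      -- The constants of a derivation form a subfield.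
      let F : IntermediateField k K :=
        { carrier := {a | d a = 0}
          mul_mem' := fun {a b} ha hb => by
            have ha' : d a = 0 := ha
            have hb' : d b = 0 := hb
            show d (a * b) = 0
            simp [ha', hb']
          add_mem' := fun {a b} ha hb => by
            have ha' : d a = 0 := ha
            have hb' : d b = 0 := hb
            show d (a + b) = 0
            simp [ha', hb']
          algebraMap_mem' := fun r => d.map_algebraMap r
          inv_mem' := fun a ha => by
            have ha' : d a = 0 := ha
            show d a⁻¹ = 0
            simp [Derivation.leibniz_inv, ha'] }
      have hD : ∀ a : D, algebraMap D K a ∈ F := by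
        intro a
        have ha : a ∈ Algebra.adjoin k (Set.range x) := hx ▸ Algebra.mem_top
        induction ha using Algebra.adjoin_induction with
        | mem y hy => obtain ⟨i, rfl⟩ := hy; exact hd i
        | algebraMap r =>
          rw [← IsScalarTower.algebraMap_apply k D K]
          exact F.algebraMap_mem r
        | add y z _ _ hy hz => rw [map_add]; exact F.add_mem hy hz
        | mul y z _ _ hy hz => rw [map_mul]; exact F.mul_mem hy hz
      intro a
      obtain ⟨y, z, -, rfl⟩ := IsFractionRing.div_surjective (A := D) a
      exact F.div_mem (hD y) (hD z)
    have : (⊤ : Submodule K (Ω[K⁄E])) = ⊥ := by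
      rw [← KaehlerDifferential.span_range_derivation, Submodule.span_eq_bot]
      rintro _ ⟨a, rfl⟩
      exact key a
    exact (Submodule.subsingleton_iff K).1 (subsingleton_of_bot_eq_top this.symm)
  have hsep : Algebra.IsSeparable E K := Algebra.FormallyUnramified.isSeparable E K
  have halg : Algebra.IsAlgebraic E K := inferInstance
  exact (IsFractionRing.comap_isAlgebraic_iff (A := Algebra.adjoin k T) (K := E) (C := K)).2 halg

/-- If the matrix `J` over a ring becomes injective after evaluation, it is injective on modules over
a field through which the evaluation is faithful. -/
theorem eq_zero_of_mulVec_injective {k A K M : Type} [Field k] [CommRing A] [Field K] [Algebra k A]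
    [AddCommGroup M] [Module K M] {ι σ : Type} [Fintype ι] [Fintype σ] [DecidableEq σ]
    (J : Matrix ι σ A) (ev : A →ₐ[k] k) (j : A →+* K) (hj : ∀ f, j f = 0 → ev f = 0)
    (hJ : ∀ v : σ → k, (J.map ev).mulVec v = 0 → v = 0) (w : σ → M)
    (hw : ∀ a, ∑ i, j (J a i) • w i = 0) : w = 0 := by
  classical
  obtain ⟨l, hl⟩ := LinearMap.exists_leftInverse_of_injective (Matrix.toLin' (J.map ev))
    (LinearMap.ker_eq_bot'.2 fun v hv => hJ v (by simpa using hv))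
  -- With a left inverse `L` of the evaluated matrix, `N = L J` is a square matrix that evaluates to
  -- the identity. Its determinant evaluates to 1, so `j N.det ≠ 0`, and multiplication by the
  -- adjugate turns `N w = 0` into `w = 0`.
  let L : Matrix σ ι k := LinearMap.toMatrix' l
  have hL : L * J.map ev = 1 := by
    have := congrArg LinearMap.toMatrix' hl
    simpa [LinearMap.toMatrix'_comp, L] using this
  let N : Matrix σ σ A := L.map (algebraMap k A) * J
  have hN : N.map ev = 1 := by
    rw [← hL]
    ext b c
    simp [N, Matrix.mul_apply]
  have hdet : j N.det ≠ 0 := fun h => by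
    have h1 := hj _ h
    rw [AlgHom.map_det, AlgHom.mapMatrix_apply, hN, Matrix.det_one] at h1
    exact one_ne_zero h1
  have hNw : ∀ b, ∑ i, j (N b i) • w i = 0 := fun b => by
    simp only [N, Matrix.mul_apply, map_sum, map_mul, Finset.sum_smul]
    rw [Finset.sum_comm]
    refine Finset.sum_eq_zero fun a _ => ?_
    simp only [mul_smul, ← Finset.smul_sum, hw, smul_zero]
  funext c
  have h1 : ∑ b, j (N.adjugate c b) • ∑ i, j (N b i) • w i = j N.det • w c := by
    simp only [Finset.smul_sum, smul_smul]
    rw [Finset.sum_comm]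
    simp only [← Finset.sum_smul, ← map_mul, ← map_sum, ← Matrix.mul_apply, Matrix.adjugate_mul,
      Matrix.smul_apply, Matrix.one_apply, smul_eq_mul, mul_ite, mul_one, mul_zero]
    rw [Finset.sum_eq_single c] <;> simp +contextual [eq_comm]
  rw [Finset.sum_eq_zero (fun b _ => by rw [hNw, smul_zero])] at h1
  exact (smul_eq_zero.1 h1.symm).resolve_left hdet

/-- A derivation on the image of a polynomial is given by the chain rule. -/
theorem derivation_map_eq_sum {k K M σ : Type} [Field k] [Field K] [Algebra k K] [AddCommGroup M]
    [Module k M] [Module K M] [IsScalarTower k K M] [Fintype σ] (d : Derivation k K M)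
    (q : MvPolynomial σ k →ₐ[k] K) (f : MvPolynomial σ k) :
    d (q f) = ∑ i, q (pderiv i f) • d (q (X i)) := by
  classical
  induction f using MvPolynomial.induction_on with
  | C a => simp [← MvPolynomial.algebraMap_eq]
  | add f g hf hg => simp [hf, hg, add_smul, Finset.sum_add_distrib]
  | mul_X f i hf =>
    simp only [map_mul, Derivation.leibniz, hf, pderiv_X, smul_eq_mul, map_add, add_smul,
      Finset.sum_add_distrib, Finset.smul_sum, smul_smul]
    congr 1
    rw [Finset.sum_eq_single i] <;> simp +contextual

/-- The derivative of `f` at `a` in the direction `v`. -/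
def dirDeriv {k σ : Type} [CommRing k] [Fintype σ] (a v : σ → k) (f : MvPolynomial σ k) : k :=
  ∑ i, eval a (pderiv i f) * v i

/-- **Jacobian criterion**: a prime ideal vanishing at `a` and containing polynomials whose derivatives
at `a` have a common kernel of dimension at most `d` has dimension at most `d`. -/
theorem ringKrullDim_quotient_le_of_jacobian {k σ ι : Type} [Field k] [CharZero k] [Fintype σ]
    [Fintype ι] (P : Ideal (MvPolynomial σ k)) [P.IsPrime] (a : σ → k)
    (ha : ∀ f ∈ P, eval a f = 0) (g : ι → MvPolynomial σ k) (hg : ∀ i, g i ∈ P)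
    (W : Submodule k (σ → k)) (hW : ∀ v, (∀ i, dirDeriv a v (g i) = 0) → v ∈ W) :
    ringKrullDim (MvPolynomial σ k ⧸ P) ≤ Module.finrank k W := by
  classical
  set D := MvPolynomial σ k ⧸ P
  let K := FractionRing D
  let q : MvPolynomial σ k →ₐ[k] K :=
    (IsScalarTower.toAlgHom k D K).comp (Ideal.Quotient.mkₐ k P)
  have hq : ∀ f, q f = 0 ↔ f ∈ P := fun f =>
    (map_eq_zero_iff _ (IsFractionRing.injective D K)).trans Ideal.Quotient.eq_zero_iff_mem
  obtain ⟨d, hd1, hd2⟩ := exists_ringKrullDim_eq_trdeg k D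
  rw [hd1]
  -- The linear forms `y b` below are the coordinates of a projection onto `W`. The common kernel of
  -- the differentials of the `g i` lies in `W`, where the `y b` vanish together only at 0; so the
  -- `g i` and `y b` together have an injective Jacobian matrix at `a`. As the `g i` are zero modulo
  -- `P`, the function field is algebraic over the images of the `y b`. Smoothness at `a` plays no
  -- role.
  obtain ⟨π, hπ⟩ := LinearMap.exists_leftInverse_of_injective W.subtype (by simp)
  let B := Module.finBasis k W
  let y : Fin (Module.finrank k W) → MvPolynomial σ k :=
    fun b => ∑ i, C (B.repr (π (Pi.single i 1)) b) * X i
  have hy : ∀ b i, pderiv i (y b) = C (B.repr (π (Pi.single i 1)) b) := fun b i => by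
    simp only [y, map_sum, pderiv_C_mul, pderiv_X]
    rw [Finset.sum_eq_single i] <;> simp +contextual [MvPolynomial.C_eq_smul_one]
  have hyv : ∀ b v, ∑ i, B.repr (π (Pi.single i 1)) b * v i = B.repr (π v) b := fun b v => by
    conv_rhs => rw [← Finset.univ_sum_single v]
    simp only [map_sum, Finsupp.coe_finsetSum, Finset.sum_apply]
    refine Finset.sum_congr rfl fun i _ => ?_
    have : Pi.single i (v i) = v i • (Pi.single i 1 : σ → k) := by
      rw [← Pi.single_smul, smul_eq_mul, mul_one]
    rw [this, map_smul, map_smul, Finsupp.smul_apply, smul_eq_mul, mul_comm]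
  let T : Set K := Set.range fun b => q (y b)
  have halg : Algebra.IsAlgebraic (Algebra.adjoin k T) K := by
    refine isAlgebraic_adjoin_of_derivation k D K (fun i : σ => Ideal.Quotient.mkₐ k P (X i)) ?_ T ?_
    · rw [Set.range_comp' (Ideal.Quotient.mkₐ k P) X, ← AlgHom.map_adjoin, adjoin_range_X,
        Algebra.map_top, AlgHom.range_eq_top]
      exact Ideal.Quotient.mkₐ_surjective k P
    · intro M _ _ _ _ δ hδ
      let J : Matrix (ι ⊕ Fin (Module.finrank k W)) σ (MvPolynomial σ k) :=
        fun s i => pderiv i (Sum.elim g y s)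
      have := eq_zero_of_mulVec_injective J (aeval a) q.toRingHom
        (fun f hf => ha f ((hq f).1 hf)) (fun v hv => ?_) (fun i => δ (q (X i))) ?_
      · exact fun i => congrFun this i
      · have h1 : v ∈ W := hW v fun i => by
          exact congrFun hv (Sum.inl i)
        have h2 : π v = 0 := B.repr.injective (by
          ext b
          have : ∑ i, aeval a (pderiv i (y b)) * v i = 0 := congrFun hv (Sum.inr b)
          simpa [hy, hyv] using this)
        have h3 := LinearMap.congr_fun hπ ⟨v, h1⟩
        simp only [LinearMap.comp_apply, Submodule.subtype_apply, h2, LinearMap.id_apply] at h3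
        exact (congrArg Subtype.val h3).symm
      · rintro (i | b)
        · have := derivation_map_eq_sum δ q (g i)
          rw [(hq _).2 (hg i), map_zero] at this
          exact this.symm
        · have := derivation_map_eq_sum δ q (y b)
          rw [hδ _ ⟨b, rfl⟩] at this
          exact this.symm
  have h1 : Algebra.trdeg k D ≤ Algebra.trdeg k K :=
    trdeg_le_of_injective (IsScalarTower.toAlgHom k D K) (IsFractionRing.injective D K)
  have h2 := Algebra.IsAlgebraic.trdeg_le_cardinalMk k T
  have h3 : #T ≤ #(Fin (Module.finrank k W)) := mk_range_le
  rw [mk_fin] at h3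
  have := (h1.trans h2).trans h3
  rw [hd2] at this
  exact_mod_cast this

/-- The image of a polynomial map whose derivative at `t` is injective has the dimension of the
parameter space. -/
theorem ringKrullDim_quotient_ker_of_jacobian {k σ τ : Type} [Field k] [CharZero k] [Fintype σ]
    [Fintype τ] (φ : MvPolynomial σ k →ₐ[k] MvPolynomial τ k) (t : τ → k)
    (ht : ∀ v, (∀ i, dirDeriv t v (φ (X i)) = 0) → v = 0) :
    ringKrullDim (MvPolynomial σ k ⧸ RingHom.ker φ) = Fintype.card τ := by
  classical
  let D := MvPolynomial σ k ⧸ RingHom.ker φ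
  have : (RingHom.ker φ).IsPrime := RingHom.ker_isPrime φ
  let A := MvPolynomial τ k
  let K := FractionRing A
  let f : D →ₐ[k] A := Ideal.kerLiftAlg φ
  have hf : Function.Injective f := Ideal.kerLiftAlg_injective φ
  let F : D →ₐ[k] K := (IsScalarTower.toAlgHom k A K).comp f
  obtain ⟨d, hd1, hd2⟩ := exists_ringKrullDim_eq_trdeg k D
  rw [hd1]
  have hA : Algebra.trdeg k A = Fintype.card τ := by
    simp [A, MvPolynomial.trdeg_of_isDomain]
  have hle : Algebra.trdeg k D ≤ Fintype.card τ := hA ▸ trdeg_le_of_injective f hf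
  -- A derivation of the field of rational functions in the parameters that kills the coordinate
  -- functions of the image kills the parameters, by injectivity of the Jacobian matrix. So this
  -- field is algebraic over `T`.
  let T : Set K := Set.range fun i => F (Ideal.Quotient.mk _ (X i))
  have halg : Algebra.IsAlgebraic (Algebra.adjoin k T) K := by
    refine isAlgebraic_adjoin_of_derivation k A K X (adjoin_range_X ..) T ?_
    intro M _ _ _ _ δ hδ
    let J : Matrix σ τ A := fun s i => pderiv i (φ (X s))
    let q := IsScalarTower.toAlgHom k A K
    have := eq_zero_of_mulVec_injective J (aeval t) q.toRingHom
        (fun g hg => by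
          have : g = 0 := (map_eq_zero_iff _ (IsFractionRing.injective A K)).1 hg
          rw [this, map_zero]) (fun v hv => ?_) (fun i => δ (q (X i))) ?_
    · exact fun i => congrFun this i
    · refine ht v fun i => ?_
      exact congrFun hv i
    · intro s
      have := derivation_map_eq_sum δ q (φ (X s))
      exact this.symm.trans (hδ _ ⟨s, by simp [F, f, q, Ideal.kerLiftAlg]; rfl⟩)
  -- A transcendence basis chosen among the coordinate functions is already algebraically
  -- independent in `D`; this is the lower bound.
  obtain ⟨u, huT, hu⟩ := exists_isTranscendenceBasis_subset (R := k) T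
  have h1 : Algebra.trdeg k A ≤ Algebra.trdeg k K :=
    trdeg_le_of_injective (IsScalarTower.toAlgHom k A K) (IsFractionRing.injective A K)
  choose w hw using fun z : u => huT z.2
  have hind : AlgebraicIndependent k (fun z : u => (Ideal.Quotient.mk _ (X (w z)) : D)) := by
    refine AlgebraicIndependent.of_comp F ?_
    convert! hu.1 using 1
    funext z
    exact hw z
  have h2 := hind.cardinalMk_le_trdeg
  rw [hu.cardinalMk_eq_trdeg] at h2
  have h3 := (hA ▸ h1).trans h2
  have h4 := le_antisymm hle h3
  rw [hd2] at h4
  have h5 : d = Fintype.card τ := by exact_mod_cast h4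
  rw [h5]

end Dimension

/-! ### Coefficients and the order filtration of power series in two variables. -/

section PowerSeries

variable {A : Type} [CommRing A]

/-- The exponent of the monomial `x ^ i * y ^ j`. -/
def expo (i j : ℕ) : Fin 2 →₀ ℕ := Finsupp.single 0 i + Finsupp.single 1 j

@[simp] lemma expo_zero (i j : ℕ) : expo i j 0 = i := by simp [expo]
@[simp] lemma expo_one (i j : ℕ) : expo i j 1 = j := by simp [expo]
lemma expo_eta (m : Fin 2 →₀ ℕ) : expo (m 0) (m 1) = m := by
  ext k; fin_cases k <;> simp
lemma expo_inj {i j k l : ℕ} : expo i j = expo k l ↔ i = k ∧ j = l := by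
  refine ⟨fun h => ?_, by rintro ⟨rfl, rfl⟩; rfl⟩
  exact ⟨by simpa using DFunLike.congr_fun h 0, by simpa using DFunLike.congr_fun h 1⟩
lemma expo_add_single_zero (i j : ℕ) : expo i j + Finsupp.single 0 1 = expo (i + 1) j := by
  ext k; fin_cases k <;> simp [expo]
lemma expo_add_single_one (i j : ℕ) : expo i j + Finsupp.single 1 1 = expo i (j + 1) := by
  ext k; fin_cases k <;> simp [expo]

/-- The coefficient of `x ^ i * y ^ j`. -/
def cf (f : MvPowerSeries (Fin 2) A) (i j : ℕ) : A := MvPowerSeries.coeff (expo i j) f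

lemma cf_ext {f g : MvPowerSeries (Fin 2) A} (h : ∀ i j, cf f i j = cf g i j) : f = g :=
  MvPowerSeries.ext fun m => by simpa [cf, expo_eta] using h (m 0) (m 1)

@[simp] lemma cf_add (f g : MvPowerSeries (Fin 2) A) (i j) : cf (f + g) i j = cf f i j + cf g i j :=
  map_add _ _ _
@[simp] lemma cf_sub (f g : MvPowerSeries (Fin 2) A) (i j) : cf (f - g) i j = cf f i j - cf g i j :=
  map_sub _ _ _
@[simp] lemma cf_zero (i j) : cf (0 : MvPowerSeries (Fin 2) A) i j = 0 := map_zero _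
@[simp] lemma cf_C_mul (a : A) (f : MvPowerSeries (Fin 2) A) (i j) :
    cf (MvPowerSeries.C a * f) i j = a * cf f i j := by simp [cf]
lemma cf_pderiv_zero (f : MvPowerSeries (Fin 2) A) (i j) :
    cf (MvPowerSeries.pderiv A 0 f) i j = (i + 1) * cf f (i + 1) j := by
  simp [cf, MvPowerSeries.coeff_pderiv, expo_add_single_zero, mul_comm]
lemma cf_pderiv_one (f : MvPowerSeries (Fin 2) A) (i j) :
    cf (MvPowerSeries.pderiv A 1 f) i j = (j + 1) * cf f i (j + 1) := by
  simp [cf, MvPowerSeries.coeff_pderiv, expo_add_single_one, mul_comm]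
@[simp] lemma cf_mul_X_zero_succ (f : MvPowerSeries (Fin 2) A) (i j) :
    cf (f * MvPowerSeries.X 0) (i + 1) j = cf f i j := by
  rw [cf, ← expo_add_single_zero, MvPowerSeries.X, MvPowerSeries.coeff_add_mul_monomial, mul_one, cf]
@[simp] lemma cf_mul_X_one_succ (f : MvPowerSeries (Fin 2) A) (i j) :
    cf (f * MvPowerSeries.X 1) i (j + 1) = cf f i j := by
  rw [cf, ← expo_add_single_one, MvPowerSeries.X, MvPowerSeries.coeff_add_mul_monomial, mul_one, cf]
@[simp] lemma cf_mul_X_zero_zero (f : MvPowerSeries (Fin 2) A) (j) :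
    cf (f * MvPowerSeries.X 0) 0 j = 0 := by
  classical
  rw [cf, MvPowerSeries.X, MvPowerSeries.coeff_mul_monomial, if_neg]
  intro h
  have := h 0
  simp at this
@[simp] lemma cf_mul_X_one_zero (f : MvPowerSeries (Fin 2) A) (i) :
    cf (f * MvPowerSeries.X 1) i 0 = 0 := by
  classical
  rw [cf, MvPowerSeries.X, MvPowerSeries.coeff_mul_monomial, if_neg]
  intro h
  have := h 1
  simp at this
lemma cf_X_zero_pow (n i j : ℕ) :
    cf (MvPowerSeries.X 0 ^ n : MvPowerSeries (Fin 2) A) i j = if i = n ∧ j = 0 then 1 else 0 := by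
  classical
  rw [cf, MvPowerSeries.coeff_X_pow, show Finsupp.single (0 : Fin 2) n = expo n 0 by simp [expo]]
  simp [expo_inj]
lemma cf_X_one_pow (n i j : ℕ) :
    cf (MvPowerSeries.X 1 ^ n : MvPowerSeries (Fin 2) A) i j = if i = 0 ∧ j = n then 1 else 0 := by
  classical
  rw [cf, MvPowerSeries.coeff_X_pow, show Finsupp.single (1 : Fin 2) n = expo 0 n by simp [expo]]
  simp [expo_inj]

lemma cf_mul (f g : MvPowerSeries (Fin 2) A) (i j : ℕ) :
    cf (f * g) i j = ∑ p ∈ Finset.HasAntidiagonal.antidiagonal (expo i j), MvPowerSeries.coeff p.1 f *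
      MvPowerSeries.coeff p.2 g := by
  classical
  rw [cf, MvPowerSeries.coeff_mul]

/-- The ideal of power series without terms of degree less than `N`. -/
def lowIdeal (A : Type) [CommRing A] (N : ℕ) : Ideal (MvPowerSeries (Fin 2) A) where
  carrier := {f | ∀ i j, i + j < N → cf f i j = 0}
  zero_mem' _ _ _ := cf_zero _ _
  add_mem' hf hg i j h := by rw [cf_add, hf i j h, hg i j h, add_zero]
  smul_mem' a f hf i j h := by
    rw [smul_eq_mul, cf_mul]
    refine Finset.sum_eq_zero fun p hp => ?_
    have hp := Finset.HasAntidiagonal.mem_antidiagonal.1 hp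
    have h0 := DFunLike.congr_fun hp 0
    have h1 := DFunLike.congr_fun hp 1
    simp only [Finsupp.coe_add, Pi.add_apply, expo_zero, expo_one] at h0 h1
    have := hf (p.2 0) (p.2 1) (by omega)
    rw [cf, expo_eta] at this
    rw [this, mul_zero]

lemma lowIdeal_anti {M N : ℕ} (h : M ≤ N) : lowIdeal A N ≤ lowIdeal A M :=
  fun _ hf i j hij => hf i j (by omega)

lemma mem_lowIdeal_zero (f : MvPowerSeries (Fin 2) A) : f ∈ lowIdeal A 0 := fun _ _ h => by omega

lemma mul_mem_lowIdeal {a b : ℕ} {f g : MvPowerSeries (Fin 2) A} (hf : f ∈ lowIdeal A a)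
    (hg : g ∈ lowIdeal A b) : f * g ∈ lowIdeal A (a + b) := fun i j h => by
  rw [cf_mul]
  refine Finset.sum_eq_zero fun p hp => ?_
  have hp := Finset.HasAntidiagonal.mem_antidiagonal.1 hp
  have h0 := DFunLike.congr_fun hp 0
  have h1 := DFunLike.congr_fun hp 1
  simp only [Finsupp.coe_add, Pi.add_apply, expo_zero, expo_one] at h0 h1
  by_cases hc : p.1 0 + p.1 1 < a
  · have := hf _ _ hc
    rw [cf, expo_eta] at this
    rw [this, zero_mul]
  · have := hg (p.2 0) (p.2 1) (by omega)
    rw [cf, expo_eta] at this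
    rw [this, mul_zero]

/-- For `N = 0` the truncated difference `N - 1` is 0 and nothing is claimed. -/
lemma pderiv_mem_lowIdeal {N : ℕ} {f : MvPowerSeries (Fin 2) A} (hf : f ∈ lowIdeal A N)
    (k : Fin 2) : MvPowerSeries.pderiv A k f ∈ lowIdeal A (N - 1) := fun i j h => by
  fin_cases k
  · simp only [Fin.zero_eta]
    rw [cf_pderiv_zero, hf _ _ (by omega), mul_zero]
  · simp only [Fin.mk_one]
    rw [cf_pderiv_one, hf _ _ (by omega), mul_zero]

lemma X_mem_lowIdeal (k : Fin 2) : (MvPowerSeries.X k : MvPowerSeries (Fin 2) A) ∈ lowIdeal A 1 :=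
  fun i j h => by
    obtain ⟨rfl, rfl⟩ : i = 0 ∧ j = 0 := by omega
    fin_cases k
    · simpa using cf_X_zero_pow (A := A) 1 0 0
    · simpa using cf_X_one_pow (A := A) 1 0 0

lemma sub_cf_mem_lowIdeal (f : MvPowerSeries (Fin 2) A) :
    f - MvPowerSeries.C (cf f 0 0) ∈ lowIdeal A 1 := fun i j h => by
  obtain ⟨rfl, rfl⟩ : i = 0 ∧ j = 0 := by omega
  have : expo 0 0 = 0 := by simp [expo]
  simp [cf, this]

/-- The coefficient of `dx ∧ dy` in `dF ∧ (P dx + Q dy)`. -/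
def serWedge (P Q F : MvPowerSeries (Fin 2) A) : MvPowerSeries (Fin 2) A :=
  MvPowerSeries.pderiv A 0 F * Q - MvPowerSeries.pderiv A 1 F * P

lemma serWedge_add (P Q F G : MvPowerSeries (Fin 2) A) :
    serWedge P Q (F + G) = serWedge P Q F + serWedge P Q G := by
  simp only [serWedge, map_add]; ring

lemma serWedge_sub (P Q F G : MvPowerSeries (Fin 2) A) :
    serWedge P Q (F - G) = serWedge P Q F - serWedge P Q G := by
  simp only [serWedge, map_sub]; ring

lemma serWedge_C_mul (P Q F : MvPowerSeries (Fin 2) A) (a : A) :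
    serWedge P Q (MvPowerSeries.C a * F) = MvPowerSeries.C a * serWedge P Q F := by
  simp only [serWedge, Derivation.leibniz, MvPowerSeries.pderiv_C, smul_eq_mul]; ring

lemma serWedge_pow (P Q F : MvPowerSeries (Fin 2) A) (h : serWedge P Q F = 0) (n : ℕ) :
    serWedge P Q (F ^ n) = 0 := by
  simp only [serWedge, Derivation.leibniz_pow, smul_eq_mul, nsmul_eq_mul] at *
  linear_combination (n * F ^ (n - 1)) * h

/-- The coefficients of `y f_x - x f_y` for a form `f` of degree `N`. -/
def rotCoeff (N : ℕ) (c : ℕ → A) (i : ℕ) : A :=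
  (if i < N then (i + 1) * c (i + 1) else 0) - if 1 ≤ i then (N - i + 1) * c (i - 1) else 0

variable {P Q : MvPowerSeries (Fin 2) A}

lemma serWedge_mem (hP : P - MvPowerSeries.X 0 ∈ lowIdeal A 2)
    (hQ : Q - MvPowerSeries.X 1 ∈ lowIdeal A 2) {N : ℕ} {F : MvPowerSeries (Fin 2) A}
    (hF : F ∈ lowIdeal A N) : serWedge P Q F ∈ lowIdeal A N := by
  have hP1 : P ∈ lowIdeal A 1 := by
    rw [← sub_add_cancel P (MvPowerSeries.X 0)]
    exact add_mem (lowIdeal_anti (by norm_num) hP) (X_mem_lowIdeal 0)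
  have hQ1 : Q ∈ lowIdeal A 1 := by
    rw [← sub_add_cancel Q (MvPowerSeries.X 1)]
    exact add_mem (lowIdeal_anti (by norm_num) hQ) (X_mem_lowIdeal 1)
  exact sub_mem (lowIdeal_anti (by omega) (mul_mem_lowIdeal (pderiv_mem_lowIdeal hF 0) hQ1))
    (lowIdeal_anti (by omega) (mul_mem_lowIdeal (pderiv_mem_lowIdeal hF 1) hP1))

/-- In the lowest degree only the linear parts `x` and `y` of `P` and `Q` contribute, so `serWedge`
acts there as the rotation field `y ∂/∂x - x ∂/∂y`. All arguments on focal values rest on this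
leading term. -/
lemma cf_serWedge (hP : P - MvPowerSeries.X 0 ∈ lowIdeal A 2)
    (hQ : Q - MvPowerSeries.X 1 ∈ lowIdeal A 2) {N : ℕ} {F : MvPowerSeries (Fin 2) A}
    (hF : F ∈ lowIdeal A N) {i j : ℕ} (hij : i + j = N) :
    cf (serWedge P Q F) i j = rotCoeff N (fun k => cf F k (N - k)) i := by
  have h : serWedge P Q F - (MvPowerSeries.pderiv A 0 F * MvPowerSeries.X 1 -
      MvPowerSeries.pderiv A 1 F * MvPowerSeries.X 0) ∈ lowIdeal A (N + 1) := by
    have : serWedge P Q F - (MvPowerSeries.pderiv A 0 F * MvPowerSeries.X 1 -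
      MvPowerSeries.pderiv A 1 F * MvPowerSeries.X 0) =
      MvPowerSeries.pderiv A 0 F * (Q - MvPowerSeries.X 1) -
        MvPowerSeries.pderiv A 1 F * (P - MvPowerSeries.X 0) := by
      simp only [serWedge]; ring
    rw [this]
    exact sub_mem (lowIdeal_anti (by omega) (mul_mem_lowIdeal (pderiv_mem_lowIdeal hF 0) hQ))
      (lowIdeal_anti (by omega) (mul_mem_lowIdeal (pderiv_mem_lowIdeal hF 1) hP))
  have h1 := h i j (by omega)
  rw [cf_sub, sub_eq_zero] at h1
  rw [h1, cf_sub, rotCoeff]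
  congr 1
  · rcases j with _ | j
    · rw [cf_mul_X_one_zero, if_neg (by omega)]
    · rw [cf_mul_X_one_succ, cf_pderiv_zero, if_pos (by omega), show N - (i + 1) = j by omega]
  · rcases i with _ | i
    · rw [cf_mul_X_zero_zero, if_neg (by omega)]
    · rw [cf_mul_X_zero_succ, cf_pderiv_one, if_pos (by omega), Nat.add_sub_cancel,
        show N - i = j + 1 by omega, ← hij]
      push_cast
      ring

end PowerSeries

/-! ### The rotation operator on homogeneous forms, as a two-step recursion for coefficients. -/

section Rotation

/-- A homogeneous polynomial with rotational derivative `s (x ^ N + y ^ N)` forces `s = 0`, has no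
monomial odd in `x`, and vanishes if it has no term `y ^ N` or is of odd degree. -/
lemma rotCoeff_kernel {K : Type} [Field K] [CharZero K] {N : ℕ} (hN : 1 ≤ N) (c : ℕ → K) (s : K)
    (hs : Odd N → s = 0)
    (h : ∀ i ≤ N, rotCoeff N c i = if i = 0 ∨ i = N then s else 0) :
    s = 0 ∧ ((Even N → c 0 = 0) → ∀ i ≤ N, c i = 0) := by
  -- The equation with index `i` links only `c (i - 1)` and `c (i + 1)`, so odd and even indices
  -- form separate chains. The odd chain starts with `c 1 = s` and continues with positive rational
  -- factors.
  have hodd : ∀ k, 2 * k + 1 ≤ N → ∃ ρ : ℚ, 0 < ρ ∧ c (2 * k + 1) = s * ρ := by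
    intro k
    induction k with
    | zero =>
      intro hk
      refine ⟨1, one_pos, ?_⟩
      have := h 0 (by omega)
      rw [rotCoeff, if_pos (by omega), if_neg (by omega), if_pos (Or.inl rfl)] at this
      simpa using this
    | succ k ih =>
      intro hk
      obtain ⟨ρ, hρ, hc⟩ := ih (by omega)
      have := h (2 * (k + 1)) (by omega)
      rw [rotCoeff, if_pos (by omega), if_pos (by omega), if_neg (by omega),
        show 2 * (k + 1) - 1 = 2 * k + 1 by omega, hc] at this
      have hN' : (2 * (k + 1) : ℚ) + 1 ≤ N := by exact_mod_cast hk
      refine ⟨(N - 2 * (k + 1) + 1) / (2 * (k + 1) + 1) * ρ, ?_, ?_⟩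
      · have : (0 : ℚ) < N - 2 * (k + 1) + 1 := by linarith
        positivity
      · have h3 : (2 * (k + 1) + 1 : K) ≠ 0 := by exact_mod_cast Nat.succ_ne_zero (2 * (k + 1))
        push_cast at this ⊢
        field_simp
        linear_combination this
  have hs0 : s = 0 := by
    -- For even `N` the odd chain ends in the equation `-c (N - 1) = s`, which reads `(1 + ρ) s = 0`
    -- with `ρ > 0`.
    rcases Nat.even_or_odd' N with ⟨K', hK | hK⟩
    · obtain ⟨ρ, hρ, hc⟩ := hodd (K' - 1) (by omega)
      have := h N le_rfl
      rw [rotCoeff, if_neg (by omega), if_pos hN, if_pos (Or.inr rfl),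
        show N - 1 = 2 * (K' - 1) + 1 by omega, hc] at this
      have h1 : s * ((1 + ρ : ℚ) : K) = 0 := by push_cast; linear_combination -this
      refine (mul_eq_zero.1 h1).resolve_right ?_
      exact_mod_cast (by positivity : (1 + ρ) ≠ 0)
    · exact hs ⟨K', hK⟩
  refine ⟨hs0, fun h0 => ?_⟩
  subst hs0
  -- The even chain is governed by `c 0`. For odd `N` it ends in `c (N - 1) = 0`, which forces `c 0
  -- = 0`. For even `N` it is the true kernel, the multiples of `(x² + y²) ^ (N / 2)`, and `c 0 = 0`
  -- has to be assumed.
  have heven : ∀ k, 2 * k ≤ N → ∃ ρ : ℚ, 0 < ρ ∧ c (2 * k) = c 0 * ρ := by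
    intro k
    induction k with
    | zero => exact fun _ => ⟨1, one_pos, by simp⟩
    | succ k ih =>
      intro hk
      obtain ⟨ρ, hρ, hc⟩ := ih (by omega)
      have := h (2 * k + 1) (by omega)
      rw [rotCoeff, if_pos (by omega), if_pos (by omega), ite_self,
        show 2 * k + 1 - 1 = 2 * k by omega, hc] at this
      have hN' : (2 * (k + 1) : ℚ) ≤ N := by exact_mod_cast hk
      refine ⟨(N - 2 * k) / (2 * k + 2) * ρ, ?_, ?_⟩
      · have : (0 : ℚ) < N - 2 * k := by linarith
        positivity
      · have h3 : (2 * k + 2 : K) ≠ 0 := by exact_mod_cast Nat.succ_ne_zero (2 * k + 1)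
        rw [show 2 * (k + 1) = 2 * k + 1 + 1 by ring]
        push_cast at this ⊢
        field_simp
        linear_combination this
  have hc0 : c 0 = 0 := by
    rcases Nat.even_or_odd' N with ⟨K', hK | hK⟩
    · exact h0 ⟨K', by omega⟩
    · obtain ⟨ρ, hρ, hc⟩ := heven K' (by omega)
      have := h N le_rfl
      rw [rotCoeff, if_neg (by omega), if_pos hN, ite_self,
        show N - 1 = 2 * K' by omega, hc] at this
      have h1 : c 0 * (ρ : K) = 0 := by linear_combination -this
      refine (mul_eq_zero.1 h1).resolve_right ?_
      exact_mod_cast hρ.ne'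
  intro i hi
  rcases Nat.even_or_odd' i with ⟨k, rfl | rfl⟩
  · obtain ⟨ρ, -, hc⟩ := heven k hi
    rw [hc, hc0, zero_mul]
  · obtain ⟨ρ, -, hc⟩ := hodd k hi
    rw [hc, zero_mul]

variable {A : Type} [CommRing A] [Algebra ℚ A]

/-- The coefficients with odd index of the primitive of `g` under the rotational derivative. -/
def oddChain (N : ℕ) (g : ℕ → A) : ℕ → A
  | 0 => g 0
  | k + 1 => (1 / (2 * k + 3) : ℚ) • (((N : ℚ) - 2 * k - 1) • oddChain N g k + g (2 * k + 2))

/-- The coefficients with even index of the primitive of `g` under the rotational derivative. -/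
def evenChain (N : ℕ) (t : A) (g : ℕ → A) : ℕ → A
  | 0 => t
  | k + 1 => (1 / (2 * k + 2) : ℚ) • (((N : ℚ) - 2 * k) • evenChain N t g k + g (2 * k + 1))

lemma oddChain_add (N : ℕ) (g g' : ℕ → A) (k : ℕ) :
    oddChain N (g + g') k = oddChain N g k + oddChain N g' k := by
  induction k with
  | zero => rfl
  | succ k ih => simp only [oddChain, ih, Pi.add_apply]; module

/-- The sign of `ρ` matters: for even `N` the last equation is solved for `s` by division by `1 +
ρ`. -/
lemma exists_oddChain_single (N k : ℕ) (hk : 2 * k + 1 ≤ N) : ∃ ρ : ℚ, 0 < ρ ∧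
    ∀ s : A, oddChain N (fun i => if i = 0 ∨ i = N then s else 0) k = ρ • s := by
  induction k with
  | zero => exact ⟨1, one_pos, by simp [oddChain]⟩
  | succ k ih =>
    obtain ⟨ρ, hρ, h⟩ := ih (by omega)
    have hN' : (2 * (k + 1) : ℚ) + 1 ≤ N := by exact_mod_cast hk
    have h1 : (0 : ℚ) < N - 2 * k - 1 := by linarith
    refine ⟨1 / (2 * k + 3) * ((N - 2 * k - 1) * ρ), by positivity, fun s => ?_⟩
    rw [oddChain, h, if_neg (by omega), add_zero, smul_smul, smul_smul, mul_assoc]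

/-- The nonzero slope in the starting value allows `t` to be adjusted so that the last equation
holds for odd `N`. -/
lemma exists_evenChain (N : ℕ) (g : ℕ → A) (k : ℕ) (hk : 2 * k ≤ N) : ∃ ρ : ℚ, 0 < ρ ∧
    ∀ t, evenChain N t g k = ρ • t + evenChain N 0 g k := by
  induction k with
  | zero => exact ⟨1, one_pos, by simp [evenChain]⟩
  | succ k ih =>
    obtain ⟨ρ, hρ, h⟩ := ih (by omega)
    have hN' : (2 * (k + 1) : ℚ) ≤ N := by exact_mod_cast hk
    have h1 : (0 : ℚ) < N - 2 * k := by linarith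
    refine ⟨1 / (2 * k + 2) * ((N - 2 * k) * ρ), by positivity, fun t => ?_⟩
    rw [evenChain, evenChain, h]
    module

/-- The two chains interlaced. -/
def chain (N : ℕ) (t : A) (g : ℕ → A) (i : ℕ) : A :=
  if Even i then evenChain N t g (i / 2) else oddChain N g (i / 2)

lemma chain_even (N : ℕ) (t : A) (g : ℕ → A) (k : ℕ) : chain N t g (2 * k) = evenChain N t g k := by
  simp [chain]

lemma chain_odd (N : ℕ) (t : A) (g : ℕ → A) (k : ℕ) :
    chain N t g (2 * k + 1) = oddChain N g k := by
  rw [chain, if_neg (by simp), show (2 * k + 1) / 2 = k by omega]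

/-- The chains arise by solving the equation with index `i` for the coefficient with index `i + 1`.
Only the equation with index `N` is left, to be met by a choice of `s` or `t`. -/
lemma rotCoeff_chain (N : ℕ) (t : A) (g : ℕ → A) (i : ℕ) (hi : i < N) :
    rotCoeff N (chain N t g) i = g i := by
  have hcast : ∀ (n : ℕ) (a : A), (n : A) * a = (n : ℚ) • a := fun n a => by
    rw [Algebra.smul_def, map_natCast]
  rw [rotCoeff, if_pos hi]
  rcases Nat.even_or_odd' i with ⟨k, rfl | rfl⟩
  · rcases k with _ | k
    · simp [chain, oddChain]
    · rw [if_pos (by omega), show 2 * (k + 1) - 1 = 2 * k + 1 by omega, chain_odd, chain_odd]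
      have h1 : ((2 * (k + 1) : ℕ) : A) + 1 = ((2 * k + 3 : ℕ) : A) := by push_cast; ring
      have h2 : (N : A) - ((2 * (k + 1) : ℕ) : A) + 1 = ((N - 2 * k - 1 : ℕ) : A) := by
        rw [Nat.cast_sub (by omega), Nat.cast_sub (by omega)]; push_cast; ring
      rw [h1, h2, hcast, hcast, oddChain, Nat.cast_sub (by omega), Nat.cast_sub (by omega),
        show 2 * (k + 1) = 2 * k + 2 by ring]
      push_cast
      match_scalars <;> field_simp <;> ring
  · rw [if_pos (by omega), show 2 * k + 1 + 1 = 2 * (k + 1) by ring, Nat.add_sub_cancel, chain_even,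
      chain_even]
    have h1 : ((2 * k + 1 : ℕ) : A) + 1 = ((2 * k + 2 : ℕ) : A) := by push_cast; ring
    have h2 : (N : A) - ((2 * k + 1 : ℕ) : A) + 1 = ((N - 2 * k : ℕ) : A) := by
      rw [Nat.cast_sub (by omega)]; push_cast; ring
    rw [h1, h2, hcast, hcast, evenChain, Nat.cast_sub (by omega)]
    push_cast
    match_scalars <;> field_simp <;> ring

/-- Every form of degree `N` is a rotational derivative up to a multiple of `x ^ N + y ^ N`, which is
only needed for even `N`. -/
lemma exists_rotCoeff_eq {N : ℕ} (hN : 1 ≤ N) (g : ℕ → A) : ∃ (c : ℕ → A) (s : A), (Odd N → s = 0) ∧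
    ∀ i ≤ N, rotCoeff N c i = g i + if i = 0 ∨ i = N then s else 0 := by
  rcases Nat.even_or_odd' N with ⟨K, hK | hK⟩
  · obtain ⟨ρ, hρ, hlin⟩ := exists_oddChain_single (A := A) N (K - 1) (by omega)
    -- The solution of the last equation `-c (N - 1) = g N + s`, where `c (N - 1)` itself contains
    -- `ρ • s`.
    let s : A := (1 / (1 + ρ)) • (-(g N) - oddChain N g (K - 1))
    let g' : ℕ → A := g + fun i => if i = 0 ∨ i = N then s else 0
    refine ⟨chain N 0 g', s, fun h => ?_, fun i hi => ?_⟩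
    · exact absurd h (by simp [hK])
    · rcases hi.lt_or_eq with hi | rfl
      · exact rotCoeff_chain N 0 g' i hi
      · have h1 : 1 + ρ ≠ 0 := by positivity
        have h2 : oddChain i g' (K - 1) = oddChain i g (K - 1) + ρ • s := by
          rw [oddChain_add, hlin]
        rw [rotCoeff, if_neg (by omega), if_pos (by omega),
          show i - 1 = 2 * (K - 1) + 1 by omega, chain_odd, h2, if_pos (Or.inr rfl)]
        have h4 : (1 + ρ) • s = -(g i) - oddChain i g (K - 1) := by
          simp only [s, smul_smul]
          rw [mul_one_div_cancel h1, one_smul]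
        rw [add_smul, one_smul] at h4
        linear_combination -h4
  · obtain ⟨ρ, hρ, hlin⟩ := exists_evenChain N g K (by omega)
    -- The solution of the last equation `-c (N - 1) = g N`; now `N - 1 = 2 K` belongs to the even
    -- chain.
    let t : A := (1 / ρ) • (-(g N) - evenChain N 0 g K)
    refine ⟨chain N t g, 0, fun _ => rfl, fun i hi => ?_⟩
    rw [ite_self, add_zero]
    rcases hi.lt_or_eq with hi | rfl
    · exact rotCoeff_chain N t g i hi
    · have h4 : ρ • t = -(g i) - evenChain i 0 g K := by
        simp only [t, smul_smul]
        rw [mul_one_div_cancel hρ.ne', one_smul]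
      rw [rotCoeff, if_neg (by omega), if_pos (by omega),
        show i - 1 = 2 * K by omega, chain_even, hlin]
      linear_combination -h4

end Rotation

/-! ### Poincaré's formal series, built degree by degree. -/

section Poincare

variable {A : Type} [CommRing A] {P Q : MvPowerSeries (Fin 2) A}

/-- The quadratic form `x² + y²` as a power series. -/
def quad (A : Type) [CommRing A] : MvPowerSeries (Fin 2) A :=
  MvPowerSeries.X 0 ^ 2 + MvPowerSeries.X 1 ^ 2

/-- The power series with the given coefficients. -/
def mkSeries (f : ℕ → ℕ → A) : MvPowerSeries (Fin 2) A := fun m => f (m 0) (m 1)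

@[simp] lemma cf_mkSeries (f : ℕ → ℕ → A) (i j : ℕ) : cf (mkSeries f) i j = f i j := by
  change f (expo i j 0) (expo i j 1) = f i j
  simp

/-- In degree `2 k` only the summand with index `k - 1` contributes. As the indices start at 1,
nothing happens below degree 4. -/
lemma cf_focal_sum (s : ℕ → A) (i j : ℕ) :
    ∑ k ∈ Finset.Icc 1 (i + j), s k * cf (MvPowerSeries.X 0 ^ (2 * k + 2) +
      MvPowerSeries.X 1 ^ (2 * k + 2) : MvPowerSeries (Fin 2) A) i j =
    if 4 ≤ i + j ∧ Even (i + j) ∧ (i = 0 ∨ j = 0) then s ((i + j) / 2 - 1) else 0 := by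
  simp only [cf_add, cf_X_zero_pow, cf_X_one_pow]
  split_ifs with h
  · obtain ⟨h4, ⟨n, hn⟩, h0⟩ := h
    rw [Finset.sum_eq_single ((i + j) / 2 - 1)]
    · have : 2 * ((i + j) / 2 - 1) + 2 = i + j := by omega
      rw [this]
      rcases h0 with rfl | rfl
      · rw [if_neg (by omega), if_pos (by omega)]; ring
      · rw [if_pos (by omega), if_neg (by omega)]; ring
    · intro k hk hne
      rw [if_neg (by omega), if_neg (by omega)]; ring
    · intro hk
      exact absurd (Finset.mem_Icc.2 (by omega)) hk
  · refine Finset.sum_eq_zero fun k hk => ?_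
    have := Finset.mem_Icc.1 hk
    rw [if_neg, if_neg]
    · ring
    · rintro ⟨rfl, rfl⟩
      exact h ⟨by omega, by simp [parity_simps], Or.inl rfl⟩
    · rintro ⟨rfl, rfl⟩
      exact h ⟨by omega, by simp [parity_simps], Or.inr rfl⟩

lemma isPoincareSeries_iff (ω : PolyForm A) (F : MvPowerSeries (Fin 2) A) (s : ℕ → A) :
    IsPoincareSeries ω F s ↔ F - quad A ∈ lowIdeal A 3 ∧ ∀ i j,
      cf (serWedge ω.1 ω.2 F) i j =
        if 4 ≤ i + j ∧ Even (i + j) ∧ (i = 0 ∨ j = 0) then s ((i + j) / 2 - 1) else 0 := by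
  constructor
  · rintro ⟨h1, h2⟩
    refine ⟨fun i j h => ?_, fun i j => ?_⟩
    · have := h1 (expo i j) (by simp; omega)
      rw [cf_sub, sub_eq_zero]
      exact this
    · rw [← cf_focal_sum]
      have := h2 (expo i j)
      simp only [expo_zero, expo_one] at this
      exact this
  · rintro ⟨h1, h2⟩
    refine ⟨fun m hm => ?_, fun m => ?_⟩
    · have := h1 (m 0) (m 1) (by omega)
      rw [cf_sub, sub_eq_zero] at this
      simp only [cf, expo_eta] at this
      exact this
    · have := h2 (m 0) (m 1)
      rw [← cf_focal_sum] at this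
      simp only [cf, expo_eta] at this
      exact this

lemma quad_mem : quad A ∈ lowIdeal A 2 :=
  add_mem (by rw [pow_two]; exact mul_mem_lowIdeal (X_mem_lowIdeal 0) (X_mem_lowIdeal 0))
    (by rw [pow_two]; exact mul_mem_lowIdeal (X_mem_lowIdeal 1) (X_mem_lowIdeal 1))

lemma serWedge_quad_mem (hP : P - MvPowerSeries.X 0 ∈ lowIdeal A 2)
    (hQ : Q - MvPowerSeries.X 1 ∈ lowIdeal A 2) : serWedge P Q (quad A) ∈ lowIdeal A 3 := by
  have : serWedge P Q (quad A) = 2 * (MvPowerSeries.X 0 * (Q - MvPowerSeries.X 1)) -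
      2 * (MvPowerSeries.X 1 * (P - MvPowerSeries.X 0)) := by
    simp only [serWedge, quad, map_add, Derivation.leibniz_pow, MvPowerSeries.pderiv_X_self,
      MvPowerSeries.pderiv_X_of_ne (show (1 : Fin 2) ≠ 0 by decide),
      MvPowerSeries.pderiv_X_of_ne (show (0 : Fin 2) ≠ 1 by decide), smul_eq_mul, nsmul_eq_mul]
    push_cast
    ring
  rw [this]
  exact sub_mem (Ideal.mul_mem_left _ _ (mul_mem_lowIdeal (X_mem_lowIdeal 0) hQ))
    (Ideal.mul_mem_left _ _ (mul_mem_lowIdeal (X_mem_lowIdeal 1) hP))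

/-- Adding a form of degree `N` changes `serWedge` in degree `N` by its rotational derivative and
leaves lower degrees alone. By `exists_rotCoeff_eq` everything in degree `N` can be removed except a
multiple of `x ^ N + y ^ N`. -/
lemma exists_step [Algebra ℚ A] (hP : P - MvPowerSeries.X 0 ∈ lowIdeal A 2)
    (hQ : Q - MvPowerSeries.X 1 ∈ lowIdeal A 2) {N : ℕ} (hN : 1 ≤ N) (F : MvPowerSeries (Fin 2) A) :
    ∃ E ∈ lowIdeal A N, ∃ s : A, (∀ i j, i + j ≠ N → cf E i j = 0) ∧ (Odd N → s = 0) ∧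
      ∀ i j, i + j = N → cf (serWedge P Q (F + E)) i j = if i = 0 ∨ j = 0 then s else 0 := by
  obtain ⟨c, s, hs, hc⟩ := exists_rotCoeff_eq hN fun i => -cf (serWedge P Q F) i (N - i)
  let E : MvPowerSeries (Fin 2) A := mkSeries fun i j => if i + j = N then c i else 0
  have hE : ∀ i j, cf E i j = if i + j = N then c i else 0 := fun i j => cf_mkSeries _ i j
  have hEm : E ∈ lowIdeal A N := fun i j h => by rw [hE, if_neg (by omega)]
  refine ⟨E, hEm, s, fun i j h => by rw [hE, if_neg h], hs, fun i j h => ?_⟩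
  rw [serWedge_add, cf_add, cf_serWedge hP hQ hEm h]
  have h1 : rotCoeff N (fun k => cf E k (N - k)) i = rotCoeff N c i := by
    simp only [rotCoeff, hE]
    congr 1
    · split_ifs <;> first | rfl | omega
    · split_ifs <;> first | rfl | omega
  rw [h1, hc i (by omega), show N - i = j by omega]
  have : (i = 0 ∨ i = N) ↔ (i = 0 ∨ j = 0) := by omega
  simp only [this]
  ring

/-- Poincaré's formal first integral up to the obstructions `s`. -/
theorem exists_isPoincareSeries [Algebra ℚ A] (ω : PolyForm A)
    (hP : (ω.1 : MvPowerSeries (Fin 2) A) - MvPowerSeries.X 0 ∈ lowIdeal A 2)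
    (hQ : (ω.2 : MvPowerSeries (Fin 2) A) - MvPowerSeries.X 1 ∈ lowIdeal A 2) :
    ∃ F s, IsPoincareSeries ω F s := by
  choose! E hEm σ hE hσ hw using fun (N : ℕ) (F : MvPowerSeries (Fin 2) A) (hN : 1 ≤ N) =>
    exists_step hP hQ hN F
  -- `G n` is final in all degrees up to `n + 2`.
  let G : ℕ → MvPowerSeries (Fin 2) A := fun n =>
    Nat.rec (quad A) (fun n F => F + E (n + 3) F) n
  have hG : ∀ n, G (n + 1) = G n + E (n + 3) (G n) := fun n => rfl
  have hGmn : ∀ k n i j, i + j < n + 3 → cf (G (n + k)) i j = cf (G n) i j := by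
    intro k n i j hij
    induction k with
    | zero => rfl
    | succ k ih =>
      rw [← add_assoc, hG, cf_add, ih, hE _ _ (by omega) _ _ (by omega), add_zero]
  let F : MvPowerSeries (Fin 2) A := mkSeries fun i j => cf (G (i + j)) i j
  have hF : ∀ i j, cf F i j = cf (G (i + j)) i j := fun i j => cf_mkSeries _ i j
  have hFG : ∀ n, F - G n ∈ lowIdeal A (n + 3) := fun n i j h => by
    rw [cf_sub, hF, sub_eq_zero]
    rcases le_total (i + j) n with h1 | h1
    · obtain ⟨k, rfl⟩ := Nat.exists_eq_add_of_le h1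
      exact (hGmn _ _ _ _ (by omega)).symm
    · obtain ⟨k, hk⟩ := Nat.exists_eq_add_of_le h1
      rw [hk]
      exact hGmn _ _ _ _ (by omega)
  -- Degree `2 j + 2` is treated in the passage from `G (2 j - 1)` to `G (2 j)`.
  refine ⟨F, fun j => σ (2 * j + 2) (G (2 * j - 1)), (isPoincareSeries_iff _ _ _).2
    ⟨hFG 0, fun i j => ?_⟩⟩
  by_cases hij : i + j < 3
  · have h1 : serWedge ω.1 ω.2 F ∈ lowIdeal A 3 := by
      rw [← sub_add_cancel F (quad A), serWedge_add]
      exact add_mem (serWedge_mem hP hQ (hFG 0)) (serWedge_quad_mem hP hQ)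
    rw [h1 i j hij, if_neg (by omega)]
  · obtain ⟨n, hn⟩ := Nat.exists_eq_add_of_le (not_lt.1 hij)
    have h1 := serWedge_mem hP hQ (hFG (n + 1)) i j (by omega)
    rw [serWedge_sub, cf_sub, sub_eq_zero] at h1
    rw [h1, hG, hw (n + 3) (G n) (by omega) i j (by omega)]
    rcases Nat.even_or_odd (n + 3) with he | ho
    · obtain ⟨k, hk⟩ := he
      have : i + j = 2 * k := by omega
      have h2 : 2 * (k - 1) + 2 = n + 3 := by omega
      have h3 : 2 * (k - 1) - 1 = n := by omega
      have h4 : 2 * k / 2 = k := by omega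
      simp only [this, h4, h2, h3, show 4 ≤ 2 * k by omega, even_two_mul, true_and]
    · rw [hσ _ _ (by omega) ho, ite_self, if_neg]
      rintro ⟨-, h, -⟩
      rw [show i + j = n + 3 by omega] at h
      exact Nat.not_even_iff_odd.2 ho h

end Poincare

/-! ### A formal first integral makes all focal values vanish. -/

section Center

variable {P Q : MvPowerSeries (Fin 2) ℂ}

lemma coeff_pow_quad (k : ℕ) : cf (quad ℂ ^ k) 0 (2 * k) = 1 := by
  induction k with
  | zero =>
    have : expo 0 0 = 0 := by simp [expo]
    simp [cf, this]
  | succ k ih =>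
    have h : quad ℂ ^ (k + 1) = quad ℂ ^ k * (MvPowerSeries.X 0 ^ 2 + MvPowerSeries.X 1 ^ 2) :=
      pow_succ _ _
    rw [h, mul_add, cf_add, pow_two, pow_two, ← mul_assoc, ← mul_assoc,
      cf_mul_X_zero_zero, show 2 * (k + 1) = 2 * k + 1 + 1 by ring, cf_mul_X_one_succ,
      cf_mul_X_one_succ, zero_add]
    exact ih

lemma pow_sub_pow_quad_mem {F : MvPowerSeries (Fin 2) ℂ} (hF : F - quad ℂ ∈ lowIdeal ℂ 3) (k : ℕ) :
    F ^ k - quad ℂ ^ k ∈ lowIdeal ℂ (2 * k + 1) := by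
  have hF2 : F ∈ lowIdeal ℂ 2 := by
    rw [← sub_add_cancel F (quad ℂ)]
    exact add_mem (lowIdeal_anti (by norm_num) hF) quad_mem
  have hFk : ∀ k, F ^ k ∈ lowIdeal ℂ (2 * k) := fun k => by
    induction k with
    | zero => exact mem_lowIdeal_zero _
    | succ k ih => rw [pow_succ]; exact mul_mem_lowIdeal ih hF2
  induction k with
  | zero => simp
  | succ k ih =>
    have : F ^ (k + 1) - quad ℂ ^ (k + 1) = F ^ k * (F - quad ℂ) + (F ^ k - quad ℂ ^ k) * quad ℂ := by
      ring
    rw [this]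
    exact add_mem (lowIdeal_anti (by omega) (mul_mem_lowIdeal (hFk k) hF)) (lowIdeal_anti (by omega) (mul_mem_lowIdeal ih quad_mem))

/-- If the form `P dx + Q dy` has a first integral `x² + y² + ⋯`, then all obstructions vanish. -/
theorem focal_eq_zero_of_firstIntegral (hP : P - MvPowerSeries.X 0 ∈ lowIdeal ℂ 2)
    (hQ : Q - MvPowerSeries.X 1 ∈ lowIdeal ℂ 2) {F₀ F : MvPowerSeries (Fin 2) ℂ}
    (h₀ : F₀ - quad ℂ ∈ lowIdeal ℂ 3) (hF₀ : serWedge P Q F₀ = 0) {s : ℕ → ℂ}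
    (hF : ∀ i j, cf (serWedge P Q F) i j =
        if 4 ≤ i + j ∧ Even (i + j) ∧ (i = 0 ∨ j = 0) then s ((i + j) / 2 - 1) else 0)
    {j : ℕ} (hj : 1 ≤ j) : s j = 0 := by
  induction j using Nat.strong_induction_on with
  | _ j ih =>
  -- Since the earlier values vanish, `serWedge P Q F` starts in degree `2 j + 2`.
  have hlow : serWedge P Q F ∈ lowIdeal ℂ (2 * j + 2) := fun i l h => by
    rw [hF]
    split_ifs with hc
    · obtain ⟨h4, ⟨n, hn⟩, -⟩ := hc
      exact ih _ (by omega) (by omega)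
    · rfl
  -- Subtracting multiples of powers of the first integral does not change `serWedge`. In this way
  -- the order of `F` is raised to `2 j + 2`, because a lowest form with zero rotational derivative
  -- is a multiple of a power of `x² + y²`.
  have key : ∀ N ≤ 2 * j + 2, ∃ E ∈ lowIdeal ℂ N, serWedge P Q E = serWedge P Q F := by
    intro N
    induction N with
    | zero => exact fun _ => ⟨F, mem_lowIdeal_zero _, rfl⟩
    | succ N ihN =>
      intro hN
      obtain ⟨E, hE, hw⟩ := ihN (by omega)
      rcases Nat.eq_zero_or_pos N with rfl | hpos
      · refine ⟨E - MvPowerSeries.C (cf E 0 0), sub_cf_mem_lowIdeal E, ?_⟩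
        rw [← hw, serWedge_sub]
        simp [serWedge]
      -- By `coeff_pow_quad` the coefficient of `y ^ N` is the multiple to subtract; in odd degree
      -- the kernel is zero.
      let e : ℂ := if Even N then cf E 0 N else 0
      let E' := E - MvPowerSeries.C e * F₀ ^ (N / 2)
      have hw' : serWedge P Q E' = serWedge P Q F := by
        rw [serWedge_sub, serWedge_C_mul, serWedge_pow _ _ _ hF₀, mul_zero, sub_zero, hw]
      have hF₀k : MvPowerSeries.C e * F₀ ^ (N / 2) ∈ lowIdeal ℂ N ∧
          (Even N → cf (MvPowerSeries.C e * F₀ ^ (N / 2)) 0 N = cf E 0 N) := by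
        by_cases hev : Even N
        · obtain ⟨k, hk⟩ := hev
          have h2 : N = 2 * (N / 2) := by omega
          have h3 := pow_sub_pow_quad_mem h₀ (N / 2)
          have h4 := h3 0 N (by omega)
          rw [cf_sub, sub_eq_zero] at h4
          have h5 : cf (quad ℂ ^ (N / 2)) 0 N = 1 := by
            conv_lhs => rw [h2]
            simpa using coeff_pow_quad (N / 2)
          have h6 : quad ℂ ^ (N / 2) ∈ lowIdeal ℂ (2 * (N / 2)) := by
            generalize N / 2 = k
            induction k with
            | zero => exact mem_lowIdeal_zero _
            | succ k ih => rw [pow_succ]; exact mul_mem_lowIdeal ih quad_mem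
          refine ⟨Ideal.mul_mem_left _ _ ?_, fun hev => ?_⟩
          · rw [← sub_add_cancel (F₀ ^ (N / 2)) (quad ℂ ^ (N / 2))]
            exact add_mem (lowIdeal_anti (by omega) h3) (lowIdeal_anti (by omega) h6)
          · rw [cf_C_mul, h4, h5, mul_one]
            simp only [e, if_pos hev]
        · have : e = 0 := if_neg hev
          rw [this]
          simp [hev]
      have hE' : E' ∈ lowIdeal ℂ N := sub_mem hE hF₀k.1
      have hker := rotCoeff_kernel hpos (fun k => cf E' k (N - k)) 0 (fun _ => rfl) (fun i hi => by
        rw [ite_self, ← cf_serWedge hP hQ hE' (show i + (N - i) = N by omega), hw']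
        exact hlow _ _ (by omega))
      have hz := hker.2 (fun hev => by simp only [E', cf_sub]; rw [Nat.sub_zero, hF₀k.2 hev, sub_self])
      refine ⟨E', fun i l h => ?_, hw'⟩
      rcases lt_or_eq_of_le (Nat.lt_succ_iff.1 h) with h | h
      · exact hE' i l h
      · have := hz i (by omega)
        rwa [show N - i = l by omega] at this
  obtain ⟨E, hE, hw⟩ := key _ le_rfl
  -- Now the lowest form of `E` has the rotational derivative `s j (x ^ (2 j + 2) + y ^ (2 j + 2))`,
  -- which is possible only for `s j = 0`.
  refine (rotCoeff_kernel (N := 2 * j + 2) (by omega) (fun k => cf E k (2 * j + 2 - k)) (s j)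
    (fun h => absurd h (by simp [parity_simps])) (fun i hi => ?_)).1
  rw [← cf_serWedge hP hQ hE (show i + (2 * j + 2 - i) = 2 * j + 2 by omega), hw, hF,
    show i + (2 * j + 2 - i) = 2 * j + 2 by omega]
  have h1 : (i = 0 ∨ 2 * j + 2 - i = 0) ↔ (i = 0 ∨ i = 2 * j + 2) := by omega
  simp only [h1, show (2 * j + 2) / 2 - 1 = j by omega, show 4 ≤ 2 * j + 2 by omega,
    show Even (2 * j + 2) by simp [parity_simps], true_and]

end Center

/-! ### Infinitesimal deformations of a center. -/

section Tangent

/-- A form proportional to `P dx + Q dy` is a multiple of it, because `P` and `Q` have the coprime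
linear parts `x` and `y`. The lowest forms of the remainders satisfy `A_N y = B_N x`, so `A_N = m x`
and `B_N = m y` with the same `m`, by which the quotient is corrected. -/
lemma exists_division {P Q A B : MvPowerSeries (Fin 2) ℂ}
    (hP : P - MvPowerSeries.X 0 ∈ lowIdeal ℂ 2) (hQ : Q - MvPowerSeries.X 1 ∈ lowIdeal ℂ 2)
    (h : A * Q = B * P) (N : ℕ) :
    ∃ M, A - M * P ∈ lowIdeal ℂ N ∧ B - M * Q ∈ lowIdeal ℂ N := by
  induction N with
  | zero => exact ⟨0, mem_lowIdeal_zero _, mem_lowIdeal_zero _⟩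
  | succ N ih =>
    obtain ⟨M, hA, hB⟩ := ih
    set A' := A - M * P
    set B' := B - M * Q
    have h' : A' * Q = B' * P := by simp only [A', B']; linear_combination h
    have hlead : A' * MvPowerSeries.X 1 - B' * MvPowerSeries.X 0 ∈ lowIdeal ℂ (N + 2) := by
      have : A' * MvPowerSeries.X 1 - B' * MvPowerSeries.X 0 =
          B' * (P - MvPowerSeries.X 0) - A' * (Q - MvPowerSeries.X 1) := by linear_combination h'
      rw [this]
      exact sub_mem (mul_mem_lowIdeal hB hP) (mul_mem_lowIdeal hA hQ)
    have h1 : ∀ i j, i + j + 1 = N → cf A' (i + 1) j = cf B' i (j + 1) := fun i j hij => by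
      have := hlead (i + 1) (j + 1) (by omega)
      rwa [cf_sub, cf_mul_X_one_succ, cf_mul_X_zero_succ, sub_eq_zero] at this
    have h2 : cf A' 0 N = 0 := by
      have := hlead 0 (N + 1) (by omega)
      rwa [cf_sub, cf_mul_X_one_succ, cf_mul_X_zero_zero, sub_zero] at this
    have h3 : cf B' N 0 = 0 := by
      have := hlead (N + 1) 0 (by omega)
      rwa [cf_sub, cf_mul_X_zero_succ, cf_mul_X_one_zero, zero_sub, neg_eq_zero] at this
    let m : MvPowerSeries (Fin 2) ℂ := mkSeries fun i j => if i + j + 1 = N then cf A' (i + 1) j else 0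
    have hm : m ∈ lowIdeal ℂ (N - 1) := fun i j hij => by rw [cf_mkSeries, if_neg (by omega)]
    refine ⟨M + m, ?_, ?_⟩
    · have : A - (M + m) * P = (A' - m * MvPowerSeries.X 0) - m * (P - MvPowerSeries.X 0) := by
        simp only [A']; ring
      rw [this]
      refine sub_mem (fun i j hij => ?_) (lowIdeal_anti (by omega) (mul_mem_lowIdeal hm hP))
      rcases lt_or_eq_of_le (Nat.lt_succ_iff.1 hij) with hij | hij
      · rcases i with _ | i
        · rw [cf_sub, hA _ _ hij, cf_mul_X_zero_zero, sub_zero]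
        · rw [cf_sub, hA _ _ hij, cf_mul_X_zero_succ, cf_mkSeries, if_neg (by omega), sub_zero]
      · rcases i with _ | i
        · rw [cf_sub, cf_mul_X_zero_zero, sub_zero, show j = N by omega, h2]
        · rw [cf_sub, cf_mul_X_zero_succ, cf_mkSeries, if_pos (by omega), sub_self]
    · have : B - (M + m) * Q = (B' - m * MvPowerSeries.X 1) - m * (Q - MvPowerSeries.X 1) := by
        simp only [B']; ring
      rw [this]
      refine sub_mem (fun i j hij => ?_) (lowIdeal_anti (by omega) (mul_mem_lowIdeal hm hQ))
      rcases lt_or_eq_of_le (Nat.lt_succ_iff.1 hij) with hij | hij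
      · rcases j with _ | j
        · rw [cf_sub, hB _ _ hij, cf_mul_X_one_zero, sub_zero]
        · rw [cf_sub, hB _ _ hij, cf_mul_X_one_succ, cf_mkSeries, if_neg (by omega), sub_zero]
      · rcases j with _ | j
        · rw [cf_sub, cf_mul_X_one_zero, sub_zero, show i = N by omega, h3]
        · rw [cf_sub, cf_mul_X_one_succ, cf_mkSeries, if_pos (by omega), h1 _ _ (by omega), sub_self]

lemma pderiv_comm' (f : MvPowerSeries (Fin 2) ℂ) :
    MvPowerSeries.pderiv ℂ 0 (MvPowerSeries.pderiv ℂ 1 f) =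
      MvPowerSeries.pderiv ℂ 1 (MvPowerSeries.pderiv ℂ 0 f) :=
  cf_ext fun i j => by simp only [cf_pderiv_zero, cf_pderiv_one]; ring

/-- Infinitesimal deformations of a first integral come from deformations of an inverse integrating
factor. -/
theorem exists_inverseIntegratingFactor_deformation {P Q p q F₀ F₁ : MvPowerSeries (Fin 2) ℂ}
    (hP : P - MvPowerSeries.X 0 ∈ lowIdeal ℂ 2) (hQ : Q - MvPowerSeries.X 1 ∈ lowIdeal ℂ 2)
    (hF₀ : F₀ - quad ℂ ∈ lowIdeal ℂ 3) (hF₁ : F₁ ∈ lowIdeal ℂ 3) (h₀ : serWedge P Q F₀ = 0) {N : ℕ}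
    (h₁ : serWedge P Q F₁ + serWedge p q F₀ ∈ lowIdeal ℂ N) :
    ∃ G ∈ lowIdeal ℂ 3, serWedge P Q G - G * (MvPowerSeries.pderiv ℂ 0 Q - MvPowerSeries.pderiv ℂ 1 P)
      - (p * Q - q * P) ∈ lowIdeal ℂ N := by
  -- `dF₀ = M ω` is needed to order `N + 2`: differentiation loses one order, and linear
  -- coefficients are compared even for `N = 0`.
  obtain ⟨M, hM0, hM1⟩ := exists_division hP hQ (A := MvPowerSeries.pderiv ℂ 0 F₀)
    (B := MvPowerSeries.pderiv ℂ 1 F₀) (by have := h₀; simp only [serWedge] at this; linear_combination this) (N + 2)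
  -- `∂F₀/∂x = 2 x + ⋯` and `P = x + ⋯`, so `M` is a unit.
  have hMu : cf M 0 0 = 2 := by
    have h1 := hM0 1 0 (by omega)
    have h2 : cf (M * (P - MvPowerSeries.X 0)) 1 0 = 0 :=
      Ideal.mul_mem_left _ M hP 1 0 (by omega)
    have h3 := hF₀ 2 0 (by omega)
    rw [cf_sub, quad, cf_add, cf_X_zero_pow, cf_X_one_pow, if_pos ⟨rfl, rfl⟩, if_neg (by omega)] at h3
    rw [mul_sub, cf_sub, cf_mul_X_zero_succ] at h2
    rw [cf_sub, cf_pderiv_zero] at h1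
    push_cast at h1
    linear_combination -h2 - h1 + 2 * h3
  have hMinv : M * M⁻¹ = 1 := MvPowerSeries.mul_inv_cancel M (by
    have : MvPowerSeries.constantCoeff M = cf M 0 0 := by simp [cf, expo]
    rw [this, hMu]; norm_num)
  refine ⟨F₁ * M⁻¹, Ideal.mul_mem_right _ _ hF₁, ?_⟩
  set G := F₁ * M⁻¹
  have hF₁G : F₁ = M * G := by simp only [G]; linear_combination -F₁ * hMinv
  -- `dM ∧ ω = -M dω`, since `M ω` is exact up to high order.
  have herr : serWedge P Q M - M * (MvPowerSeries.pderiv ℂ 1 P - MvPowerSeries.pderiv ℂ 0 Q) ∈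
      lowIdeal ℂ N := by
    have h1 := pderiv_mem_lowIdeal hM0 1
    have h2 := pderiv_mem_lowIdeal hM1 0
    have := lowIdeal_anti (M := N) (by omega) (sub_mem h1 h2)
    rw [map_sub, map_sub, pderiv_comm'] at this
    simp only [Derivation.leibniz, smul_eq_mul] at this
    convert this using 1
    simp only [serWedge]; ring
  -- With `F₁ = M G` and `η = p dx + q dy`, the relation `dF₁ ∧ ω + dF₀ ∧ η = 0` becomes `M (dG ∧ ω
  -- - G dω - η ∧ ω) = 0`. After cancellation of `M` the equation involves only `ω`, `η` and `G`.
  have hmain : M * (serWedge P Q G - G * (MvPowerSeries.pderiv ℂ 0 Q - MvPowerSeries.pderiv ℂ 1 P)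
      - (p * Q - q * P)) ∈ lowIdeal ℂ N := by
    have h2 : MvPowerSeries.pderiv ℂ 0 F₀ - M * P ∈ lowIdeal ℂ N := lowIdeal_anti (by omega) hM0
    have h3 : MvPowerSeries.pderiv ℂ 1 F₀ - M * Q ∈ lowIdeal ℂ N := lowIdeal_anti (by omega) hM1
    have := add_mem (sub_mem (sub_mem h₁ (Ideal.mul_mem_left _ G herr)) (Ideal.mul_mem_left _ q h2))
      (Ideal.mul_mem_left _ p h3)
    convert this using 1
    rw [hF₁G]
    simp only [serWedge, Derivation.leibniz, smul_eq_mul]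
    ring
  have := Ideal.mul_mem_left _ M⁻¹ hmain
  rwa [← mul_assoc, mul_comm M⁻¹, hMinv, one_mul] at this

variable {A : Type} [CommRing A] (e : A →+* ℂ) (δ : A →+ ℂ)

lemma cf_map (F : MvPowerSeries (Fin 2) A) (i j : ℕ) :
    cf (MvPowerSeries.map e F) i j = e (cf F i j) := by simp [cf]

lemma map_pderiv' (F : MvPowerSeries (Fin 2) A) (k : Fin 2) :
    MvPowerSeries.map e (MvPowerSeries.pderiv A k F) = MvPowerSeries.pderiv ℂ k (MvPowerSeries.map e F) :=
  cf_ext fun i j => by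
    fin_cases k
    · simp [cf_map, cf_pderiv_zero]
    · simp [cf_map, cf_pderiv_one]

/-- Apply an additive map to the coefficients of a power series. -/
def mapCoeffs (F : MvPowerSeries (Fin 2) A) : MvPowerSeries (Fin 2) ℂ := mkSeries fun i j => δ (cf F i j)

lemma mapCoeffs_sub (F G : MvPowerSeries (Fin 2) A) :
    mapCoeffs δ (F - G) = mapCoeffs δ F - mapCoeffs δ G := cf_ext fun i j => by simp [mapCoeffs]

lemma mapCoeffs_pderiv (F : MvPowerSeries (Fin 2) A) (k : Fin 2) :
    mapCoeffs δ (MvPowerSeries.pderiv A k F) = MvPowerSeries.pderiv ℂ k (mapCoeffs δ F) :=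
  cf_ext fun i j => by
    have h : ∀ (n : ℕ) (a : A), δ ((n + 1) * a) = (n + 1) * δ a := fun n a => by
      have : ((n : A) + 1) * a = (n + 1) • a := by rw [nsmul_eq_mul]; push_cast; rfl
      rw [this, map_nsmul, nsmul_eq_mul]; push_cast; rfl
    fin_cases k
    · simp [mapCoeffs, cf_pderiv_zero, h]
    · simp [mapCoeffs, cf_pderiv_one, h]

/-- For `e` the evaluation at a point and `δ` a directional derivative there, the pair is a
homomorphism to the dual numbers; so first-order deformations of series are taken coefficient by
coefficient. -/
lemma mapCoeffs_mul (hδ : ∀ a b, δ (a * b) = e a * δ b + δ a * e b) (F G : MvPowerSeries (Fin 2) A) :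
    mapCoeffs δ (F * G) = MvPowerSeries.map e F * mapCoeffs δ G + mapCoeffs δ F * MvPowerSeries.map e G :=
  cf_ext fun i j => by
    have h : ∀ (F : MvPowerSeries (Fin 2) A) m,
        MvPowerSeries.coeff m (mapCoeffs δ F) = δ (MvPowerSeries.coeff m F) := fun F m => by
      have := cf_mkSeries (fun i j => δ (cf F i j)) (m 0) (m 1)
      simp only [cf, expo_eta] at this
      exact this
    rw [cf_add, cf_mul, cf_mul, ← Finset.sum_add_distrib, mapCoeffs, cf_mkSeries, cf_mul, map_sum]
    refine Finset.sum_congr rfl fun p _ => ?_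
    rw [hδ, h, h]
    simp

lemma map_serWedge (P Q F : MvPowerSeries (Fin 2) A) : MvPowerSeries.map e (serWedge P Q F) =
    serWedge (MvPowerSeries.map e P) (MvPowerSeries.map e Q) (MvPowerSeries.map e F) := by
  simp only [serWedge, map_sub, map_mul, map_pderiv']

lemma mapCoeffs_serWedge (hδ : ∀ a b, δ (a * b) = e a * δ b + δ a * e b)
    (P Q F : MvPowerSeries (Fin 2) A) : mapCoeffs δ (serWedge P Q F) =
    serWedge (MvPowerSeries.map e P) (MvPowerSeries.map e Q) (mapCoeffs δ F) +
      serWedge (mapCoeffs δ P) (mapCoeffs δ Q) (MvPowerSeries.map e F) := by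
  simp only [serWedge, mapCoeffs_sub, mapCoeffs_mul e δ hδ, mapCoeffs_pderiv, map_pderiv']
  ring

end Tangent

/-! ### Forms in Poincaré normal form and their focal values. -/

section Normal

variable {A : Type} [CommRing A]

/-- The terms of degree 2 and 3 of a form in Poincaré normal form. -/
def higherForm (a : Fin 2 × HigherExp → A) : PolyForm A :=
  (∑ e : HigherExp, C (a (0, e)) * (X 0 ^ (e.1.1 : ℕ) * X 1 ^ (e.1.2 : ℕ)),
   ∑ e : HigherExp, C (a (1, e)) * (X 0 ^ (e.1.1 : ℕ) * X 1 ^ (e.1.2 : ℕ)))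

lemma normalForm_eq (a : Fin 2 × HigherExp → A) :
    normalForm a = (X 0 + (higherForm a).1, X 1 + (higherForm a).2) := rfl

/-- The coefficient of `x ^ i * y ^ j` in the terms of degree 2 and 3. -/
def higherCoeff (a : Fin 2 × HigherExp → A) (k : Fin 2) (i j : ℕ) : A :=
  if h : 2 ≤ i + j ∧ i + j ≤ 3 then a (k, ⟨(⟨i, by omega⟩, ⟨j, by omega⟩), h⟩) else 0

lemma cf_coe (f : MvPolynomial (Fin 2) A) (i j : ℕ) :
    cf (f : MvPowerSeries (Fin 2) A) i j = coeff (expo i j) f := MvPolynomial.coeff_coe f _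

lemma coeff_expo_monomial (a : A) (i j k l : ℕ) :
    coeff (expo i j) (C a * (X 0 ^ k * X 1 ^ l) : MvPolynomial (Fin 2) A) =
      if i = k ∧ j = l then a else 0 := by
  have : (C a * (X 0 ^ k * X 1 ^ l) : MvPolynomial (Fin 2) A) = monomial (expo k l) a := by
    rw [X_pow_eq_monomial, X_pow_eq_monomial, monomial_mul, C_mul_monomial, expo]; simp
  rw [this, coeff_monomial]
  simp only [expo_inj, eq_comm]

lemma coeff_higher (a : HigherExp → A) (i j : ℕ) :
    coeff (expo i j) (∑ e : HigherExp, C (a e) * (X 0 ^ (e.1.1 : ℕ) * X 1 ^ (e.1.2 : ℕ)) :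
      MvPolynomial (Fin 2) A) =
    if h : 2 ≤ i + j ∧ i + j ≤ 3 then a ⟨(⟨i, by omega⟩, ⟨j, by omega⟩), h⟩ else 0 := by
  rw [coeff_sum]
  simp only [coeff_expo_monomial]
  split_ifs with h
  · rw [Finset.sum_eq_single ⟨(⟨i, by omega⟩, ⟨j, by omega⟩), h⟩]
    · simp
    · rintro ⟨⟨i', j'⟩, h'⟩ - hne
      rw [if_neg]
      rintro ⟨rfl, rfl⟩
      exact hne rfl
    · simp
  · refine Finset.sum_eq_zero fun e _ => if_neg ?_
    rintro ⟨rfl, rfl⟩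
    exact h e.2

lemma cf_higherForm_fst (a : Fin 2 × HigherExp → A) (i j : ℕ) :
    cf ((higherForm a).1 : MvPowerSeries (Fin 2) A) i j = higherCoeff a 0 i j := by
  rw [cf_coe, higherForm, coeff_higher]; rfl

lemma cf_higherForm_snd (a : Fin 2 × HigherExp → A) (i j : ℕ) :
    cf ((higherForm a).2 : MvPowerSeries (Fin 2) A) i j = higherCoeff a 1 i j := by
  rw [cf_coe, higherForm, coeff_higher]; rfl

lemma higherForm_fst_mem (a : Fin 2 × HigherExp → A) :
    ((higherForm a).1 : MvPowerSeries (Fin 2) A) ∈ lowIdeal A 2 := fun i j hij => by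
  rw [cf_higherForm_fst, higherCoeff, dif_neg (by omega)]

lemma higherForm_snd_mem (a : Fin 2 × HigherExp → A) :
    ((higherForm a).2 : MvPowerSeries (Fin 2) A) ∈ lowIdeal A 2 := fun i j hij => by
  rw [cf_higherForm_snd, higherCoeff, dif_neg (by omega)]

lemma normalForm_fst_mem (a : Fin 2 × HigherExp → A) :
    ((normalForm a).1 : MvPowerSeries (Fin 2) A) - MvPowerSeries.X 0 ∈ lowIdeal A 2 := by
  rw [normalForm_eq]; simpa using higherForm_fst_mem a

lemma normalForm_snd_mem (a : Fin 2 × HigherExp → A) :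
    ((normalForm a).2 : MvPowerSeries (Fin 2) A) - MvPowerSeries.X 1 ∈ lowIdeal A 2 := by
  rw [normalForm_eq]; simpa using higherForm_snd_mem a

theorem exists_isFocalSequence : ∃ s : ℕ → CoeffPoly, IsFocalSequence s := by
  obtain ⟨F, s, h⟩ := exists_isPoincareSeries (normalForm (fun i => (X i : CoeffPoly)))
    (normalForm_fst_mem _) (normalForm_snd_mem _)
  exact ⟨s, F, h⟩

variable {B : Type} [CommRing B] (e : A →+* B) (a : Fin 2 × HigherExp → A)

lemma map_normalForm : MvPolynomial.map e (normalForm a).1 = (normalForm fun i => e (a i)).1 ∧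
    MvPolynomial.map e (normalForm a).2 = (normalForm fun i => e (a i)).2 := by
  simp [normalForm]

lemma coe_map (f : MvPolynomial (Fin 2) A) : MvPowerSeries.map e (f : MvPowerSeries (Fin 2) A) =
    (MvPolynomial.map e f : MvPolynomial (Fin 2) B) := by
  ext m; simp [MvPolynomial.coeff_map]

/-- The coefficient formula for the series attached to a center. -/
lemma IsPoincareSeries.map {s : ℕ → CoeffPoly} {F : MvPowerSeries (Fin 2) CoeffPoly}
    (h : IsPoincareSeries (normalForm (fun i => (X i : CoeffPoly))) F s) (n : Fin 2 × HigherExp → ℂ) :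
    MvPowerSeries.map (aeval n : CoeffPoly →ₐ[ℚ] ℂ).toRingHom F - quad ℂ ∈ lowIdeal ℂ 3 ∧
    ∀ i j, cf (serWedge ((normalForm n).1 : MvPowerSeries (Fin 2) ℂ) (normalForm n).2
      (MvPowerSeries.map (aeval n : CoeffPoly →ₐ[ℚ] ℂ).toRingHom F)) i j =
      if 4 ≤ i + j ∧ Even (i + j) ∧ (i = 0 ∨ j = 0) then aeval n (s ((i + j) / 2 - 1)) else 0 := by
  rw [isPoincareSeries_iff] at h
  set e := (aeval n : CoeffPoly →ₐ[ℚ] ℂ).toRingHom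
  have hn : (fun i => e (X i : CoeffPoly)) = n := by ext i; simp [e]
  constructor
  · intro i j hij
    have h1 := h.1 i j hij
    rw [cf_sub, sub_eq_zero] at h1 ⊢
    have hq : quad ℂ = MvPowerSeries.map e (quad CoeffPoly) := by simp [quad]
    rw [hq, cf_map, cf_map, h1]
  · intro i j
    have h1 := congrArg e (h.2 i j)
    rw [← cf_map, map_serWedge, coe_map, coe_map, (map_normalForm _ _).1, (map_normalForm _ _).2,
      hn] at h1
    rw [h1]
    split_ifs <;> simp [e]

theorem mem_centerVariety_of_firstIntegral {s : ℕ → CoeffPoly} (hs : IsFocalSequence s)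
    {n : Fin 2 × HigherExp → ℂ} {F₀ : MvPowerSeries (Fin 2) ℂ} (hF₀ : F₀ - quad ℂ ∈ lowIdeal ℂ 3)
    (h₀ : serWedge ((normalForm n).1 : MvPowerSeries (Fin 2) ℂ) (normalForm n).2 F₀ = 0) :
    n ∈ centerVariety s := by
  obtain ⟨F, hF⟩ := hs
  obtain ⟨h1, h2⟩ := hF.map n
  exact fun j hj => focal_eq_zero_of_firstIntegral (s := fun j => aeval n (s j))
    (normalForm_fst_mem n) (normalForm_snd_mem n) hF₀ h₀ h2 hj

/-- Tangent vectors to the first focal values at a center come from deformations of an inverse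
integrating factor. -/
theorem exists_deformation_of_focal {s : ℕ → CoeffPoly} (hs : IsFocalSequence s)
    {n v : Fin 2 × HigherExp → ℂ} (hn : n ∈ centerVariety s)
    (hv : ∀ j, 1 ≤ j → j ≤ 10 → ∑ i, v i * aeval n (pderiv i (s j)) = 0) :
    ∃ G ∈ lowIdeal ℂ 3, serWedge ((normalForm n).1 : MvPowerSeries (Fin 2) ℂ) (normalForm n).2 G
      - G * (MvPowerSeries.pderiv ℂ 0 ((normalForm n).2 : MvPowerSeries (Fin 2) ℂ)
        - MvPowerSeries.pderiv ℂ 1 ((normalForm n).1 : MvPowerSeries (Fin 2) ℂ))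
      - ((higherForm v).1 * (normalForm n).2 - (higherForm v).2 * (normalForm n).1 :
        MvPowerSeries (Fin 2) ℂ) ∈ lowIdeal ℂ 24 := by
  obtain ⟨F, hF⟩ := hs
  obtain ⟨h1, h2⟩ := hF.map n
  rw [isPoincareSeries_iff] at hF
  set e := (aeval n : CoeffPoly →ₐ[ℚ] ℂ).toRingHom with he
  have hen : (fun i => e (X i : CoeffPoly)) = n := by ext i; simp [e]
  -- Differentiating the generic series at `n` in the direction `v` turns the focal values into
  -- their directional derivatives and the generic form into `higherForm v`.
  let δ : CoeffPoly →+ ℂ := AddMonoidHom.mk' (fun f => ∑ i, v i * aeval n (pderiv i f)) fun f g => by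
    simp only [map_add, mul_add, Finset.sum_add_distrib]
  have hδa : ∀ f, δ f = ∑ i, v i * aeval n (pderiv i f) := fun f => rfl
  have hδ : ∀ a b, δ (a * b) = e a * δ b + δ a * e b := fun a b => by
    simp only [hδa, Finset.mul_sum, Finset.sum_mul, ← Finset.sum_add_distrib, he]
    refine Finset.sum_congr rfl fun i _ => ?_
    simp only [Derivation.leibniz, smul_eq_mul, map_add, map_mul, AlgHom.toRingHom_eq_coe,
      RingHom.coe_coe]
    ring
  have hδX : ∀ i, δ (X i) = v i := fun i => by
    rw [hδa, Finset.sum_eq_single i]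
    · simp
    · intro j _ hj; rw [pderiv_X_of_ne (Ne.symm hj)]; simp
    · simp
  have hδ0 : ∀ k i j, δ (higherCoeff (fun i => (X i : CoeffPoly)) k i j) = higherCoeff v k i j := by
    intro k i j
    unfold higherCoeff
    split_ifs
    · exact hδX _
    · exact map_zero _
  have hδ1 : δ 1 = 0 := by
    have := hδ 1 1
    simp only [mul_one, map_one, one_mul] at this
    linear_combination -this
  have hδx : ∀ k i j, δ (cf (MvPowerSeries.X k : MvPowerSeries (Fin 2) CoeffPoly) i j) = 0 := by
    intro k i j
    rw [cf, MvPowerSeries.coeff_X]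
    split_ifs
    · exact hδ1
    · exact map_zero _
  have hp : mapCoeffs δ ((normalForm (fun i => (X i : CoeffPoly))).1 : MvPowerSeries (Fin 2) CoeffPoly)
      = ((higherForm v).1 : MvPolynomial (Fin 2) ℂ) := cf_ext fun i j => by
    rw [cf_higherForm_fst, mapCoeffs, cf_mkSeries, normalForm_eq, MvPolynomial.coe_add, cf_add,
      cf_higherForm_fst, map_add, hδ0, MvPolynomial.coe_X, hδx, zero_add]
  have hq : mapCoeffs δ ((normalForm (fun i => (X i : CoeffPoly))).2 : MvPowerSeries (Fin 2) CoeffPoly)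
      = ((higherForm v).2 : MvPolynomial (Fin 2) ℂ) := cf_ext fun i j => by
    rw [cf_higherForm_snd, mapCoeffs, cf_mkSeries, normalForm_eq, MvPolynomial.coe_add, cf_add,
      cf_higherForm_snd, map_add, hδ0, MvPolynomial.coe_X, hδx, zero_add]
  refine exists_inverseIntegratingFactor_deformation (F₁ := mapCoeffs δ F) (normalForm_fst_mem n)
    (normalForm_snd_mem n) h1 ?_ ?_ ?_
  · intro i j hij
    have h3 := hF.1 i j hij
    rw [cf_sub, sub_eq_zero] at h3
    rw [mapCoeffs, cf_mkSeries, h3, quad, cf_add, cf_X_zero_pow, cf_X_one_pow, map_add]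
    split_ifs <;> simp [hδ1]
  · refine cf_ext fun i j => ?_
    rw [h2, cf_zero]
    split_ifs with h
    · exact hn _ (by omega)
    · rfl
  -- The eleventh focal value first occurs in degree 24; below that degree only the first ten
  -- contribute.
  · have h3 := mapCoeffs_serWedge e δ hδ ((normalForm (fun i => (X i : CoeffPoly))).1 :
      MvPowerSeries (Fin 2) CoeffPoly) (normalForm (fun i => (X i : CoeffPoly))).2 F
    rw [hp, hq, coe_map, coe_map, (map_normalForm _ _).1, (map_normalForm _ _).2, hen] at h3
    rw [← h3]
    intro i j hij
    rw [mapCoeffs, cf_mkSeries, hF.2]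
    split_ifs with h
    · exact hv _ (by omega) (by omega)
    · exact map_zero _

end Normal

/-! ### Affine substitutions in polynomials. -/

section AffineSubstitution

variable (p : Fin 2 → ℂ) (M : Matrix (Fin 2) (Fin 2) ℂ)

/-- The affine map `v ↦ p + M v`. -/
def affMap (v : Fin 2 → ℂ) : Fin 2 → ℂ := fun i => p i + M i 0 * v 0 + M i 1 * v 1

/-- Composition with the affine map `v ↦ p + M v`. -/
def affSubst : MvPolynomial (Fin 2) ℂ →ₐ[ℂ] MvPolynomial (Fin 2) ℂ :=
  aeval fun i => C (p i) + C (M i 0) * X 0 + C (M i 1) * X 1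

lemma eval_affSubst (v : Fin 2 → ℂ) (f : MvPolynomial (Fin 2) ℂ) :
    eval v (affSubst p M f) = eval (affMap p M v) f := by
  rw [affSubst, ← MvPolynomial.coe_aeval_eq_eval, ← MvPolynomial.coe_aeval_eq_eval]
  change aeval v (aeval _ f) = aeval _ f
  rw [← AlgHom.comp_apply, MvPolynomial.comp_aeval]
  congr 2
  ext i
  simp [affMap]

lemma affMap_comp (p' : Fin 2 → ℂ) (M' : Matrix (Fin 2) (Fin 2) ℂ) (v : Fin 2 → ℂ) :
    affMap p M (affMap p' M' v) = affMap (affMap p M p') (M * M') v := by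
  ext i
  simp only [affMap, Matrix.mul_apply, Fin.sum_univ_two]
  ring

lemma affMap_zero_one (v : Fin 2 → ℂ) : affMap 0 1 v = v := by
  ext i
  fin_cases i <;> simp [affMap, Matrix.one_apply]

lemma affSubst_affSubst (p' : Fin 2 → ℂ) (M' : Matrix (Fin 2) (Fin 2) ℂ) (f : MvPolynomial (Fin 2) ℂ) :
    affSubst p' M' (affSubst p M f) = affSubst (affMap p M p') (M * M') f :=
  MvPolynomial.funext fun v => by rw [eval_affSubst, eval_affSubst, eval_affSubst, affMap_comp]

lemma affSubst_zero_one (f : MvPolynomial (Fin 2) ℂ) : affSubst 0 1 f = f :=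
  MvPolynomial.funext fun v => by rw [eval_affSubst, affMap_zero_one]

/-- The translation part of the inverse affine map. -/
def invShift : Fin 2 → ℂ := affMap 0 M⁻¹ (-p)

variable {p M}

lemma affMap_invShift (hM : M.det ≠ 0) : affMap p M (invShift p M) = 0 := by
  rw [invShift, affMap_comp, Matrix.mul_nonsing_inv _ (isUnit_iff_ne_zero.2 hM)]
  ext i
  fin_cases i <;> simp [affMap, Matrix.one_apply]

lemma affMap_surj (hM : M.det ≠ 0) (v : Fin 2 → ℂ) : ∃ w, affMap p M w = v :=
  ⟨affMap (invShift p M) M⁻¹ v, by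
    rw [affMap_comp, affMap_invShift hM, Matrix.mul_nonsing_inv _ (isUnit_iff_ne_zero.2 hM),
      affMap_zero_one]⟩

lemma affMap_inv_left : affMap (invShift p M) M⁻¹ p = 0 := by
  ext i
  fin_cases i <;> simp [affMap, invShift]

lemma affSubst_inv_affSubst (hM : M.det ≠ 0) (f : MvPolynomial (Fin 2) ℂ) :
    affSubst (invShift p M) M⁻¹ (affSubst p M f) = f := by
  rw [affSubst_affSubst, affMap_invShift hM, Matrix.mul_nonsing_inv _ (isUnit_iff_ne_zero.2 hM),
    affSubst_zero_one]

lemma affSubst_injective (hM : M.det ≠ 0) : Function.Injective (affSubst p M) :=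
  Function.LeftInverse.injective (affSubst_inv_affSubst hM)

lemma totalDegree_affSubst_le (f : MvPolynomial (Fin 2) ℂ) :
    (affSubst p M f).totalDegree ≤ f.totalDegree := by
  have hX : ∀ i, (C (p i) + C (M i 0) * X 0 + C (M i 1) * X 1 : MvPolynomial (Fin 2) ℂ).totalDegree ≤ 1 := by
    intro i
    have h : ∀ (a : ℂ) (k : Fin 2), (C a * X k : MvPolynomial (Fin 2) ℂ).totalDegree ≤ 1 := fun a k =>
      (totalDegree_mul _ _).trans (by simp)
    refine (totalDegree_add _ _).trans (max_le ((totalDegree_add _ _).trans (max_le ?_ (h _ _))) (h _ _))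
    simp
  rw [affSubst, aeval_def, eval₂_eq]
  refine totalDegree_finsetSum_le fun d hd => ?_
  refine (totalDegree_mul _ _).trans ?_
  have h1 : (algebraMap ℂ (MvPolynomial (Fin 2) ℂ) (coeff d f)).totalDegree = 0 := totalDegree_C _
  rw [h1, zero_add]
  refine (totalDegree_finsetProd _ _).trans ((Finset.sum_le_sum fun i _ =>
    (totalDegree_pow _ _).trans (Nat.mul_le_mul_left _ (hX i))).trans ?_)
  simpa [Finsupp.sum] using le_totalDegree hd

lemma pderiv_affSubst (k : Fin 2) (f : MvPolynomial (Fin 2) ℂ) :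
    pderiv k (affSubst p M f) =
      C (M 0 k) * affSubst p M (pderiv 0 f) + C (M 1 k) * affSubst p M (pderiv 1 f) := by
  induction f using MvPolynomial.induction_on with
  | C a => simp [affSubst]
  | add f g hf hg => simp only [map_add, hf, hg]; ring
  | mul_X f i hf =>
    rw [map_mul, Derivation.leibniz, hf]
    simp only [Derivation.leibniz, smul_eq_mul, map_add, map_mul]
    fin_cases i <;> fin_cases k <;> simp [affSubst, pderiv_X] <;> ring

end AffineSubstitution

/-! ### Pullback of forms, integral curves and cofactors. -/

section Pullback

variable (p : Fin 2 → ℂ) (M : Matrix (Fin 2) (Fin 2) ℂ) (ω : PolyForm ℂ)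

lemma pullback_fst : (pullback p M ω).1 = C (M 0 0) * affSubst p M ω.1 + C (M 1 0) * affSubst p M ω.2 :=
  rfl

lemma pullback_snd : (pullback p M ω).2 = C (M 0 1) * affSubst p M ω.1 + C (M 1 1) * affSubst p M ω.2 :=
  rfl

lemma pullback_pullback (p' : Fin 2 → ℂ) (M' : Matrix (Fin 2) (Fin 2) ℂ) :
    pullback p' M' (pullback p M ω) = pullback (affMap p M p') (M * M') ω := by
  ext1 <;> simp only [pullback_fst, pullback_snd, map_add, map_mul, affSubst_affSubst] <;>
  · simp only [Matrix.mul_apply, Fin.sum_univ_two, map_add, map_mul]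
    have h : ∀ a, affSubst p' M' (C a) = C a := fun a => by simp [affSubst]
    simp only [h]
    ring

lemma pullback_zero_one : pullback 0 1 ω = ω := by
  ext1 <;> simp [pullback_fst, pullback_snd, affSubst_zero_one]

lemma pullback_smul (t : ℂ) : pullback p M (t • ω) = t • pullback p M ω := by
  ext1 <;> simp only [pullback_fst, pullback_snd, Prod.smul_fst, Prod.smul_snd, map_smul, smul_add,
    mul_smul_comm]

variable {p M}

lemma pullback_inv_pullback (hM : M.det ≠ 0) :
    pullback (invShift p M) M⁻¹ (pullback p M ω) = ω := by
  rw [pullback_pullback, affMap_invShift hM, Matrix.mul_nonsing_inv _ (isUnit_iff_ne_zero.2 hM),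
    pullback_zero_one]

lemma det_inv_ne_zero (hM : M.det ≠ 0) : M⁻¹.det ≠ 0 := by
  rw [Matrix.det_nonsing_inv, Ring.inverse_eq_inv']
  exact inv_ne_zero hM

lemma pullback_pullback_inv (hM : M.det ≠ 0) :
    pullback p M (pullback (invShift p M) M⁻¹ ω) = ω := by
  rw [pullback_pullback, affMap_inv_left, Matrix.nonsing_inv_mul _ (isUnit_iff_ne_zero.2 hM),
    pullback_zero_one]

lemma totalDegree_pullback_le {d : ℕ} (h₁ : ω.1.totalDegree ≤ d) (h₂ : ω.2.totalDegree ≤ d) :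
    (pullback p M ω).1.totalDegree ≤ d ∧ (pullback p M ω).2.totalDegree ≤ d := by
  have h : ∀ (a : ℂ) (f : MvPolynomial (Fin 2) ℂ), f.totalDegree ≤ d →
      (C a * affSubst p M f).totalDegree ≤ d := fun a f hf =>
    (totalDegree_mul _ _).trans (by
      rw [totalDegree_C, zero_add]; exact (totalDegree_affSubst_le f).trans hf)
  exact ⟨(totalDegree_add _ _).trans (max_le (h _ _ h₁) (h _ _ h₂)),
    (totalDegree_add _ _).trans (max_le (h _ _ h₁) (h _ _ h₂))⟩

/-- Pullback commutes with `d` and `∧`; on the coefficient of a 2-form it contributes the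
determinant. -/
lemma dWedge_pullback (G : MvPolynomial (Fin 2) ℂ) :
    dWedge (affSubst p M G) (pullback p M ω) = C M.det * affSubst p M (dWedge G ω) := by
  simp only [dWedge, pderiv_affSubst, pullback_fst, pullback_snd, Matrix.det_fin_two, map_sub, map_mul]
  ring

lemma dForm_pullback : dForm (pullback p M ω) = C M.det * affSubst p M (dForm ω) := by
  simp only [dForm, pderiv_affSubst, pullback_fst, pullback_snd, Matrix.det_fin_two, map_sub, map_mul,
    map_add, Derivation.leibniz, smul_eq_mul, pderiv_C]
  ring

variable {ω}

lemma IsCofactor.pullback {G K : MvPolynomial (Fin 2) ℂ} (h : IsCofactor ω G K) :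
    IsCofactor (pullback p M ω) (affSubst p M G) (C M.det * affSubst p M K) := by
  rw [IsCofactor, dWedge_pullback, h, map_mul]
  ring

lemma IsAlgebraicIntegralCurve.pullback {G : MvPolynomial (Fin 2) ℂ} (h : IsAlgebraicIntegralCurve ω G) :
    IsAlgebraicIntegralCurve (pullback p M ω) (affSubst p M G) :=
  let ⟨_, hK⟩ := h; ⟨_, hK.pullback⟩

lemma IsCofactor.unique {G K K' : MvPolynomial (Fin 2) ℂ} (hG : G ≠ 0) (h : IsCofactor ω G K)
    (h' : IsCofactor ω G K') : K = K' :=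
  mul_left_cancel₀ hG (h.symm.trans h')

lemma IsCofactor.C_mul {G K : MvPolynomial (Fin 2) ℂ} (h : IsCofactor ω G K) (a : ℂ) :
    IsCofactor ω (C a * G) K := by
  simp only [IsCofactor, dWedge, Derivation.leibniz, pderiv_C, smul_eq_mul] at *
  linear_combination C a * h

lemma IsCofactor.mul {G K G' K' : MvPolynomial (Fin 2) ℂ} (h : IsCofactor ω G K)
    (h' : IsCofactor ω G' K') : IsCofactor ω (G * G') (K + K') := by
  simp only [IsCofactor, dWedge, Derivation.leibniz, smul_eq_mul] at *
  linear_combination G' * h + G * h'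

end Pullback

/-! ### Projective extension of affine maps and pullback of configurations. -/

section Projective

variable (p : Fin 2 → ℂ) (M : Matrix (Fin 2) (Fin 2) ℂ)

/-- The projective extension of the affine map `v ↦ p + M v`. -/
def projMap (v : Fin 3 → ℂ) : Fin 3 → ℂ :=
  ![M 0 0 * v 0 + M 0 1 * v 1 + p 0 * v 2, M 1 0 * v 0 + M 1 1 * v 1 + p 1 * v 2, v 2]

/-- Composition with the projective extension of the affine map `v ↦ p + M v`. -/
def projSubst : MvPolynomial (Fin 3) ℂ →ₐ[ℂ] MvPolynomial (Fin 3) ℂ :=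
  aeval ![C (M 0 0) * X 0 + C (M 0 1) * X 1 + C (p 0) * X 2,
    C (M 1 0) * X 0 + C (M 1 1) * X 1 + C (p 1) * X 2, X 2]

lemma eval_projSubst (v : Fin 3 → ℂ) (f : MvPolynomial (Fin 3) ℂ) :
    eval v (projSubst p M f) = eval (projMap p M v) f := by
  rw [projSubst, ← MvPolynomial.coe_aeval_eq_eval, ← MvPolynomial.coe_aeval_eq_eval]
  change aeval v (aeval _ f) = aeval _ f
  rw [← AlgHom.comp_apply, MvPolynomial.comp_aeval]
  congr 2
  ext i
  fin_cases i <;> simp [projMap]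

lemma projMap_comp (p' : Fin 2 → ℂ) (M' : Matrix (Fin 2) (Fin 2) ℂ) (v : Fin 3 → ℂ) :
    projMap p M (projMap p' M' v) = projMap (affMap p M p') (M * M') v := by
  ext i
  fin_cases i <;> simp [projMap, affMap, Matrix.mul_apply, Fin.sum_univ_two] <;> ring

lemma projSubst_projSubst (p' : Fin 2 → ℂ) (M' : Matrix (Fin 2) (Fin 2) ℂ) (f : MvPolynomial (Fin 3) ℂ) :
    projSubst p' M' (projSubst p M f) = projSubst (affMap p M p') (M * M') f :=
  MvPolynomial.funext fun v => by rw [eval_projSubst, eval_projSubst, eval_projSubst, projMap_comp]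

lemma projSubst_zero_one (f : MvPolynomial (Fin 3) ℂ) : projSubst 0 1 f = f :=
  MvPolynomial.funext fun v => by
    rw [eval_projSubst]
    congr 2
    ext i
    fin_cases i <;> simp [projMap]

lemma projMap_affinePoint (v : Fin 2 → ℂ) : projMap p M (affinePoint v) = affinePoint (affMap p M v) := by
  ext i
  fin_cases i <;> simp [projMap, affinePoint, affMap] <;> ring

lemma projMap_infinitePoint (v : Fin 2 → ℂ) :
    projMap p M (infinitePoint v) = infinitePoint (affMap 0 M v) := by
  ext i
  fin_cases i <;> simp [projMap, infinitePoint, affMap]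

lemma eval_affinePart (v : Fin 2 → ℂ) (f : MvPolynomial (Fin 3) ℂ) :
    eval v (affinePart f) = eval (affinePoint v) f := by
  rw [affinePart, ← MvPolynomial.coe_aeval_eq_eval, ← MvPolynomial.coe_aeval_eq_eval]
  change aeval v (aeval _ f) = aeval _ f
  rw [← AlgHom.comp_apply, MvPolynomial.comp_aeval]
  congr 2
  ext i
  fin_cases i <;> simp [affinePoint]

lemma affinePart_projSubst (f : MvPolynomial (Fin 3) ℂ) :
    affinePart (projSubst p M f) = affSubst p M (affinePart f) :=
  MvPolynomial.funext fun v => by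
    rw [eval_affinePart, eval_projSubst, projMap_affinePoint, eval_affSubst, eval_affinePart]

lemma pderiv_projSubst (k : Fin 3) (f : MvPolynomial (Fin 3) ℂ) :
    pderiv k (projSubst p M f) =
      C (![M 0 0, M 0 1, p 0] k) * projSubst p M (pderiv 0 f) +
      C (![M 1 0, M 1 1, p 1] k) * projSubst p M (pderiv 1 f) +
      C (![0, 0, 1] k) * projSubst p M (pderiv 2 f) := by
  induction f using MvPolynomial.induction_on with
  | C a => simp [projSubst]
  | add f g hf hg => simp only [map_add, hf, hg]; ring
  | mul_X f i hf =>
    rw [map_mul, Derivation.leibniz, hf]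
    simp only [Derivation.leibniz, smul_eq_mul, map_add, map_mul]
    fin_cases i <;> fin_cases k <;> simp [projSubst, pderiv_X] <;> ring

lemma gradAt_projSubst (v : Fin 3 → ℂ) (f : MvPolynomial (Fin 3) ℂ) (k : Fin 3) :
    gradAt v (projSubst p M f) k =
      ![M 0 0, M 0 1, p 0] k * gradAt (projMap p M v) f 0 +
      ![M 1 0, M 1 1, p 1] k * gradAt (projMap p M v) f 1 +
      ![0, 0, 1] k * gradAt (projMap p M v) f 2 := by
  simp only [gradAt, pderiv_projSubst, map_add, map_mul, eval_C, eval_projSubst]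

variable {p M}

/-- Gradients are multiplied by the transpose of the projective matrix, whose determinant is
`M.det`, so their independence is preserved. -/
lemma TransversalAt.projSubst (hM : M.det ≠ 0) {v : Fin 3 → ℂ} {G₁ G₂ : MvPolynomial (Fin 3) ℂ}
    (h : TransversalAt (projMap p M v) G₁ G₂) : TransversalAt v (projSubst p M G₁) (projSubst p M G₂) := by
  obtain ⟨h1, h2, h3⟩ := h
  refine ⟨by rw [eval_projSubst, h1], by rw [eval_projSubst, h2], ?_⟩
  rw [LinearIndependent.pair_iff] at h3 ⊢
  intro s t hst
  refine h3 s t ?_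
  rw [Matrix.det_fin_two] at hM
  set u := gradAt (projMap p M v) G₁
  set w := gradAt (projMap p M v) G₂
  have e : ∀ k, s * gradAt v (CenterProblem.projSubst p M G₁) k +
      t * gradAt v (CenterProblem.projSubst p M G₂) k = 0 := fun k => by
    simpa using congrFun hst k
  have e0 := e 0
  have e1 := e 1
  have e2 := e 2
  simp only [gradAt_projSubst] at e0 e1 e2
  simp at e0 e1 e2
  have f0 : s * u 0 + t * w 0 = 0 := by
    refine (mul_eq_zero.1 (?_ : (M 0 0 * M 1 1 - M 0 1 * M 1 0) * _ = 0)).resolve_left hM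
    linear_combination M 1 1 * e0 - M 1 0 * e1
  have f1 : s * u 1 + t * w 1 = 0 := by
    refine (mul_eq_zero.1 (?_ : (M 0 0 * M 1 1 - M 0 1 * M 1 0) * _ = 0)).resolve_left hM
    linear_combination M 0 0 * e1 - M 0 1 * e0
  ext k
  fin_cases k
  · simpa using f0
  · simpa using f1
  · simp
    linear_combination e2 - p 0 * f0 - p 1 * f1

lemma OrdinaryPoint.projSubst (hM : M.det ≠ 0) {v : Fin 3 → ℂ} {S T : List (MvPolynomial (Fin 3) ℂ)}
    (h : OrdinaryPoint (projMap p M v) S T) :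
    OrdinaryPoint v (S.map (projSubst p M)) (T.map (projSubst p M)) := by
  refine ⟨List.pairwise_map.2 (h.1.imp fun h => h.projSubst hM), fun G hG => ?_⟩
  obtain ⟨G', hG', rfl⟩ := List.mem_map.1 hG
  rw [eval_projSubst]
  exact h.2 G' hG'

lemma projSubst_inv_projSubst (hM : M.det ≠ 0) (f : MvPolynomial (Fin 3) ℂ) :
    projSubst (invShift p M) M⁻¹ (projSubst p M f) = f := by
  rw [projSubst_projSubst, affMap_invShift hM, Matrix.mul_nonsing_inv _ (isUnit_iff_ne_zero.2 hM),
    projSubst_zero_one]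

lemma projSubst_projSubst_inv (hM : M.det ≠ 0) (f : MvPolynomial (Fin 3) ℂ) :
    projSubst p M (projSubst (invShift p M) M⁻¹ f) = f := by
  rw [projSubst_projSubst, affMap_inv_left, Matrix.nonsing_inv_mul _ (isUnit_iff_ne_zero.2 hM),
    projSubst_zero_one]

lemma irreducible_projSubst (hM : M.det ≠ 0) {f : MvPolynomial (Fin 3) ℂ} (h : Irreducible f) :
    Irreducible (projSubst p M f) := by
  have h1 : ∀ f, projSubst (invShift p M) M⁻¹ (projSubst p M f) = f := projSubst_inv_projSubst hM
  have h2 : ∀ f, projSubst p M (projSubst (invShift p M) M⁻¹ f) = f := projSubst_projSubst_inv hM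
  generalize projSubst p M = φ at h1 h2 ⊢
  generalize projSubst (invShift p M) M⁻¹ = ψ at h1 h2
  exact (MulEquiv.irreducible_iff (⟨⟨φ, ψ, h1, h2⟩, map_mul φ⟩ :
    MvPolynomial (Fin 3) ℂ ≃* MvPolynomial (Fin 3) ℂ)).2 h

lemma isHomogeneous_projSubst {f : MvPolynomial (Fin 3) ℂ} {n : ℕ} (h : f.IsHomogeneous n) :
    (projSubst p M f).IsHomogeneous n := by
  have h1 : ∀ a b c : ℂ, (C a * X 0 + C b * X 1 + C c * X 2 : MvPolynomial (Fin 3) ℂ).IsHomogeneous 1 :=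
    fun a b c => ((isHomogeneous_C_mul_X _ _).add (isHomogeneous_C_mul_X _ _)).add
      (isHomogeneous_C_mul_X _ _)
  have h2 : ∀ i, ((![C (M 0 0) * X 0 + C (M 0 1) * X 1 + C (p 0) * X 2,
      C (M 1 0) * X 0 + C (M 1 1) * X 1 + C (p 1) * X 2, X 2] : Fin 3 → MvPolynomial (Fin 3) ℂ)
        i).IsHomogeneous 1 := by
    simp [Fin.forall_fin_succ, h1, isHomogeneous_X]
  have h3 := h.aeval _ h2
  rwa [one_mul] at h3

variable (p M)

/-- The pullback of a configuration under an affine map. -/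
def Configuration.comap (c : Configuration) : Configuration where
  L₁ := projSubst p M c.L₁
  L₂ := projSubst p M c.L₂
  L₃ := projSubst p M c.L₃
  L₄ := projSubst p M c.L₄
  Q := projSubst p M c.Q

variable {p M}

lemma Configuration.comap_inv_comap (hM : M.det ≠ 0) (c : Configuration) :
    (c.comap p M).comap (invShift p M) M⁻¹ = c := by
  simp [comap, projSubst_inv_projSubst hM]

lemma Configuration.IsSpecial.comap (hM : M.det ≠ 0) {c : Configuration} {C D E F H I J : Fin 2 → ℂ}
    (h : c.IsSpecial (affMap p M C) (affMap 0 M D) (affMap p M E) (affMap p M F) (affMap p M H)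
      (affMap p M I) (affMap p M J)) : (c.comap p M).IsSpecial C D E F H I J where
  line₁ := isHomogeneous_projSubst h.line₁
  line₂ := isHomogeneous_projSubst h.line₂
  line₃ := isHomogeneous_projSubst h.line₃
  line₄ := isHomogeneous_projSubst h.line₄
  conic := isHomogeneous_projSubst h.conic
  irreducible := irreducible_projSubst hM h.irreducible
  direction := by
    rintro rfl
    exact h.direction (by ext i; simp [affMap])
  fourfold := OrdinaryPoint.projSubst (p := p) hM (by rw [projMap_affinePoint]; exact h.fourfold)
  triple := OrdinaryPoint.projSubst (p := p) hM (by rw [projMap_infinitePoint]; exact h.triple)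
  nodeE := OrdinaryPoint.projSubst (p := p) hM (by rw [projMap_affinePoint]; exact h.nodeE)
  nodeF := OrdinaryPoint.projSubst (p := p) hM (by rw [projMap_affinePoint]; exact h.nodeF)
  nodeH := OrdinaryPoint.projSubst (p := p) hM (by rw [projMap_affinePoint]; exact h.nodeH)
  nodeI := OrdinaryPoint.projSubst (p := p) hM (by rw [projMap_affinePoint]; exact h.nodeI)
  nodeJ := OrdinaryPoint.projSubst (p := p) hM (by rw [projMap_affinePoint]; exact h.nodeJ)

lemma Configuration.forms_comap {c : Configuration} {ω : PolyForm ℂ} {d : ℕ} (h : ω ∈ c.forms d) :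
    pullback p M ω ∈ (c.comap p M).forms d := by
  obtain ⟨h1, h2, k1, k2, k3, k4, k5⟩ := h
  obtain ⟨g1, g2⟩ := totalDegree_pullback_le (p := p) (M := M) ω h1 h2
  refine ⟨g1, g2, ?_, ?_, ?_, ?_, ?_⟩ <;> simp only [comap, affinePart_projSubst]
  exacts [k1.pullback, k2.pullback, k3.pullback, k4.pullback, k5.pullback]

lemma Configuration.Γ_comap (c : Configuration) : (c.comap p M).Γ = affSubst p M c.Γ := by
  simp [Γ, comap, affinePart_projSubst]

end Projective

/-! ### Integrating factors from cofactors, and centers from integrating factors. -/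

section IntegratingFactor

/-- A closed formal `1`-form in two variables is exact. -/
lemma exists_primitive {f g : MvPowerSeries (Fin 2) ℂ}
    (h : MvPowerSeries.pderiv ℂ 0 g = MvPowerSeries.pderiv ℂ 1 f) :
    ∃ F, MvPowerSeries.pderiv ℂ 0 F = f ∧ MvPowerSeries.pderiv ℂ 1 F = g := by
  -- Integrate `g` along the axis `x = 0`, then `f` in the direction of `x`.
  refine ⟨mkSeries fun i j => if i = 0 then (if j = 0 then 0 else cf g 0 (j - 1) / j) else
    cf f (i - 1) j / i, cf_ext fun i j => ?_, cf_ext fun i j => ?_⟩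
  · have : (i + 1 : ℂ) ≠ 0 := by exact_mod_cast i.succ_ne_zero
    rw [cf_pderiv_zero, cf_mkSeries, if_neg i.succ_ne_zero, Nat.add_sub_cancel]
    push_cast
    field_simp
  · have hj : (j + 1 : ℂ) ≠ 0 := by exact_mod_cast j.succ_ne_zero
    rw [cf_pderiv_one, cf_mkSeries]
    rcases i with _ | i
    · rw [if_pos rfl, if_neg j.succ_ne_zero, Nat.add_sub_cancel]
      push_cast
      field_simp
    · have hi : (i + 1 : ℂ) ≠ 0 := by exact_mod_cast i.succ_ne_zero
      have h1 := congrArg (fun F => cf F i j) h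
      simp only [cf_pderiv_zero, cf_pderiv_one] at h1
      rw [if_neg i.succ_ne_zero, Nat.add_sub_cancel]
      push_cast
      field_simp
      linear_combination -h1

lemma expansionAt_eq (p : Fin 2 → ℂ) (G : MvPolynomial (Fin 2) ℂ) :
    expansionAt p G = (affSubst p 1 G : MvPolynomial (Fin 2) ℂ) := by
  rw [expansionAt, affSubst]
  congr 4
  ext1 i
  fin_cases i <;> simp [Matrix.one_apply] <;> ring

lemma pderiv_expansionAt (p : Fin 2 → ℂ) (k : Fin 2) (G : MvPolynomial (Fin 2) ℂ) :
    MvPowerSeries.pderiv ℂ k (expansionAt p G) = expansionAt p (pderiv k G) := by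
  rw [expansionAt_eq, expansionAt_eq, MvPowerSeries.pderiv_coe, pderiv_affSubst]
  fin_cases k <;> simp [Matrix.one_apply]

lemma cf_expansionAt_zero (p : Fin 2 → ℂ) (G : MvPolynomial (Fin 2) ℂ) :
    cf (expansionAt p G) 0 0 = eval p G := by
  rw [expansionAt_eq, cf_coe]
  have h : expo 0 0 = 0 := by ext i; fin_cases i <;> simp
  have h0 : ∀ f : MvPolynomial (Fin 2) ℂ, coeff 0 f = eval 0 f := fun f => by
    rw [← constantCoeff_eq, eval_zero]
  rw [h, h0, eval_affSubst]
  congr 2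
  ext i
  simp [affMap]

/-- The cofactors are the logarithmic derivatives `dA ∧ ω / A` and `dB ∧ ω / B`, so `K - L + dω = 0`
says that `(A / B) ω` is closed. At a point where `B` is a unit, its expansion is then exact by
`exists_primitive`. -/
theorem isRationalIntegratingFactor_of_cofactors {ω : PolyForm ℂ} {A B K L : MvPolynomial (Fin 2) ℂ}
    (hA : A ≠ 0) (hB : B ≠ 0) (hK : IsCofactor ω A K) (hL : IsCofactor ω B L) (h : K - L + dForm ω = 0) :
    IsRationalIntegratingFactor A B ω := by
  refine ⟨hA, hB, fun p hp => ?_⟩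
  have hadd : ∀ f g, expansionAt p (f + g) = expansionAt p f + expansionAt p g := fun f g => by
    simp [expansionAt]
  have hmul : ∀ f g, expansionAt p (f * g) = expansionAt p f * expansionAt p g := fun f g => by
    simp [expansionAt]
  have hsub : ∀ f g, expansionAt p (f - g) = expansionAt p f - expansionAt p g := fun f g => by
    rw [eq_sub_iff_add_eq, ← hadd, sub_add_cancel]
  have hinv : expansionAt p B * (expansionAt p B)⁻¹ = 1 := MvPowerSeries.mul_inv_cancel _ (by
    have : MvPowerSeries.constantCoeff (expansionAt p B) = cf (expansionAt p B) 0 0 := by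
      simp [cf, expo]
    rwa [this, cf_expansionAt_zero])
  set b := (expansionAt p B)⁻¹
  set μ := expansionAt p A * b
  have hμ : μ * expansionAt p B = expansionAt p A := by
    simp only [μ]; linear_combination expansionAt p A * hinv
  have hμ' : ∀ k, MvPowerSeries.pderiv ℂ k μ * expansionAt p B + μ * expansionAt p (pderiv k B) =
      expansionAt p (pderiv k A) := fun k => by
    have := congrArg (MvPowerSeries.pderiv ℂ k) hμ
    simp only [Derivation.leibniz, smul_eq_mul, pderiv_expansionAt] at this
    linear_combination this
  have e1 := congrArg (expansionAt p) hK
  have e2 := congrArg (expansionAt p) hL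
  have e3 := congrArg (expansionAt p) h
  have h0 : expansionAt p 0 = 0 := by simp [expansionAt]
  simp only [dWedge, dForm, hadd, hmul, hsub, h0] at e1 e2 e3
  have key : MvPowerSeries.pderiv ℂ 0 (μ * expansionAt p ω.2) =
      MvPowerSeries.pderiv ℂ 1 (μ * expansionAt p ω.1) := by
    simp only [Derivation.leibniz, smul_eq_mul, pderiv_expansionAt]
    refine sub_eq_zero.1 ?_
    -- Closedness is proved after multiplication by the unit `B`, which avoids derivatives of its
    -- inverse.
    have : (μ * expansionAt p (pderiv 0 ω.2) + expansionAt p ω.2 * MvPowerSeries.pderiv ℂ 0 μ -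
        (μ * expansionAt p (pderiv 1 ω.1) + expansionAt p ω.1 * MvPowerSeries.pderiv ℂ 1 μ)) *
          expansionAt p B = 0 := by
      linear_combination expansionAt p ω.2 * hμ' 0 - expansionAt p ω.1 * hμ' 1 + e1 - μ * e2 +
        μ * expansionAt p B * e3 - expansionAt p K * hμ
    rw [← mul_one (_ - _), ← hinv, ← mul_assoc, this, zero_mul]
  obtain ⟨F, h1, h2⟩ := exists_primitive key
  exact ⟨F, μ, hμ, h1, h2⟩

/-- At the origin the integrating factor has a nonzero constant term `m`, so the primitive is a
constant plus `(m / 2) (x² + y²) + ⋯`. Without its constant term and multiplied by `2 / m`, it is a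
first integral of the required shape. -/
theorem mem_centerVariety_of_integratingFactor {s : ℕ → CoeffPoly} (hs : IsFocalSequence s)
    {n : Fin 2 × HigherExp → ℂ} {A B : MvPolynomial (Fin 2) ℂ}
    (h : IsRationalIntegratingFactor A B (normalForm n)) (hA : eval 0 A ≠ 0) (hB : eval 0 B ≠ 0) :
    n ∈ centerVariety s := by
  obtain ⟨-, -, h⟩ := h
  obtain ⟨F, μ, hμ, h1, h2⟩ := h 0 hB
  have hexp : ∀ G : MvPolynomial (Fin 2) ℂ, expansionAt 0 G = G := fun G => by
    rw [expansionAt_eq, affSubst_zero_one]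
  simp only [hexp] at h1 h2
  have hcf00 : ∀ f g : MvPowerSeries (Fin 2) ℂ, cf (f * g) 0 0 = cf f 0 0 * cf g 0 0 := fun f g => by
    simp [cf, expo]
  have hμ0 : cf μ 0 0 ≠ 0 := by
    have := congrArg (fun F => cf F 0 0) hμ
    simp only [hcf00, cf_expansionAt_zero] at this
    exact fun h0 => hA (by rw [← this, h0, zero_mul])
  set m := cf μ 0 0
  have e1 : ∀ i j, i + j < 2 → (i + 1) * cf F (i + 1) j = cf (μ * MvPowerSeries.X 0) i j :=
    fun i j hij => by
      have h3 := Ideal.mul_mem_left _ μ (normalForm_fst_mem n) i j hij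
      rw [mul_sub, ← h1, cf_sub, sub_eq_zero, cf_pderiv_zero] at h3
      exact h3
  have e2 : ∀ i j, i + j < 2 → (j + 1) * cf F i (j + 1) = cf (μ * MvPowerSeries.X 1) i j :=
    fun i j hij => by
      have h3 := Ideal.mul_mem_left _ μ (normalForm_snd_mem n) i j hij
      rw [mul_sub, ← h2, cf_sub, sub_eq_zero, cf_pderiv_one] at h3
      exact h3
  refine mem_centerVariety_of_firstIntegral hs
    (F₀ := MvPowerSeries.C (2 / m) * (F - MvPowerSeries.C (cf F 0 0))) ?_ ?_
  · have hC : ∀ i j, cf (MvPowerSeries.C (cf F 0 0) : MvPowerSeries (Fin 2) ℂ) i j =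
        if i = 0 ∧ j = 0 then cf F 0 0 else 0 := fun i j => by
      rw [cf, MvPowerSeries.coeff_C]
      have : expo i j = 0 ↔ i = 0 ∧ j = 0 := by
        rw [← expo_inj (i := i) (j := j) (k := 0) (l := 0)]; simp [expo]
      simp only [this]
    have c10 := e1 0 0 (by omega)
    have c20 := e1 1 0 (by omega)
    have c11 := e1 0 1 (by omega)
    have c01 := e2 0 0 (by omega)
    have c02 := e2 0 1 (by omega)
    simp only [cf_mul_X_zero_zero, cf_mul_X_zero_succ, cf_mul_X_one_zero, cf_mul_X_one_succ] at *
    intro i j hij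
    have hi : i = 0 ∨ i = 1 ∨ i = 2 := by omega
    have hj : j = 0 ∨ j = 1 ∨ j = 2 := by omega
    rw [cf_sub, cf_C_mul, cf_sub, hC, quad, cf_add, cf_X_zero_pow, cf_X_one_pow]
    rcases hi with rfl | rfl | rfl <;> rcases hj with rfl | rfl | rfl <;> simp at *
    · exact Or.inr c01
    · rw [show cf F 0 2 = m / 2 by linear_combination c02 / 2]
      field_simp
      ring
    · exact Or.inr c10
    · exact Or.inr c11
    · rw [show cf F 2 0 = m / 2 by linear_combination c20 / 2]
      field_simp
      ring
  · simp only [serWedge, Derivation.leibniz, smul_eq_mul, map_sub, MvPowerSeries.pderiv_C, h1, h2]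
    ring

end IntegratingFactor

/-! ### The standard special configurations. -/

section Standard

/-- The lines `y = m₁ x`, `y = m₂ x`, `x = 1`, `x = 0` and the conic `y (1 + b x) = x²`. -/
def stdConfig (b m₁ m₂ : ℂ) : Configuration where
  L₁ := X 1 - C m₁ * X 0
  L₂ := X 1 - C m₂ * X 0
  L₃ := X 0 - X 2
  L₄ := X 0
  Q := X 1 * (X 2 + C b * X 0) - X 0 ^ 2

/-- The parameters for which the standard configuration is in special position. -/
structure Admissible (b m₁ m₂ : ℂ) : Prop where
  hb : 1 + b ≠ 0
  h₁ : m₁ ≠ 0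
  h₂ : m₂ ≠ 0
  h₁₂ : m₁ - m₂ ≠ 0
  hb₁ : 1 - b * m₁ ≠ 0
  hb₂ : 1 - b * m₂ ≠ 0
  hc₁ : (1 + b) * m₁ - 1 ≠ 0
  hc₂ : (1 + b) * m₂ - 1 ≠ 0

/-- The `x`-coordinate of the second intersection point of `y = m x` and `y (1 + b x) = x²`. -/
def nodeX (b m : ℂ) : ℂ := m / (1 - b * m)

lemma linearIndependent_of_minor {u v : Fin 3 → ℂ} (i j : Fin 3) (h : u i * v j - u j * v i ≠ 0) :
    LinearIndependent ℂ ![u, v] := by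
  rw [LinearIndependent.pair_iff]
  intro s t hst
  have hi := congrFun hst i
  have hj := congrFun hst j
  simp at hi hj
  constructor
  · refine (mul_eq_zero.1 (?_ : s * (u i * v j - u j * v i) = 0)).resolve_right h
    linear_combination v j * hi - v i * hj
  · refine (mul_eq_zero.1 (?_ : t * (u i * v j - u j * v i) = 0)).resolve_right h
    linear_combination u i * hj - u j * hi

/-- The equation is linear in `y`, with coprime coefficients `z + b x` and `-x²`. -/
lemma irreducible_stdConic (b : ℂ) :
    Irreducible (X 1 * (X 2 + C b * X 0) - X 0 ^ 2 : MvPolynomial (Fin 3) ℂ) := by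
  have h : (X 1 * (X 2 + C b * X 0) - X 0 ^ 2 : MvPolynomial (Fin 3) ℂ) =
      (X 2 + C b * X 0) * X 1 + (-X 0 ^ 2) := by ring
  have hne : (X 2 + C b * X 0 : MvPolynomial (Fin 3) ℂ) ≠ 0 := fun h => by
    have := congrArg (eval ![0, 0, 1]) h
    simp at this
  rw [h]
  refine irreducible_mul_X_add _ _ 1 hne ?_ ?_ ?_
  · intro h1
    have := vars_add_subset _ _ h1
    rw [Finset.mem_union, vars_X] at this
    rcases this with h2 | h2
    · simp at h2
    · have := vars_mul _ _ h2
      simp [vars_C, vars_X] at this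
  · intro h1
    rw [vars_neg] at h1
    have := vars_pow _ _ h1
    simp [vars_X] at this
  · intro d h1 h2
    rw [dvd_neg] at h2
    obtain ⟨i, -, hi⟩ := (dvd_prime_pow (MvPolynomial.X_prime (R := ℂ) (i := (0 : Fin 3))) 2).1 h2
    rcases i with _ | i
    · simpa using hi.isUnit_iff
    · have h3 : (X 0 : MvPolynomial (Fin 3) ℂ) ∣ X 2 + C b * X 0 :=
        ((dvd_pow_self _ i.succ_ne_zero).trans hi.symm.dvd).trans h1
      obtain ⟨g, hg⟩ := h3
      have := congrArg (eval ![0, 0, 1]) hg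
      simp at this

/-- The conditions in `Admissible` say, in their order: `J` is affine; `L₁` and `L₂` are not tangent
to the conic at the origin; they are distinct; their second intersections with the conic are affine;
these intersections do not lie on `L₃`. -/
theorem isSpecial_stdConfig {b m₁ m₂ : ℂ} (h : Admissible b m₁ m₂) :
    (stdConfig b m₁ m₂).IsSpecial 0 ![0, 1] ![1, m₁] ![1, m₂] ![nodeX b m₁, m₁ * nodeX b m₁]
      ![nodeX b m₂, m₂ * nodeX b m₂] ![1, 1 / (1 + b)] := by
  obtain ⟨hb, h₁, h₂, h₁₂, hb₁, hb₂, hc₁, hc₂⟩ := h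
  have hd1 : nodeX b m₁ ≠ 0 := div_ne_zero h₁ hb₁
  have hd2 : nodeX b m₂ ≠ 0 := div_ne_zero h₂ hb₂
  have e1 : nodeX b m₁ - 1 ≠ 0 := by
    rw [nodeX, div_sub_one hb₁]
    exact div_ne_zero (by convert hc₁ using 1; ring) hb₁
  have e2 : nodeX b m₂ - 1 ≠ 0 := by
    rw [nodeX, div_sub_one hb₂]
    exact div_ne_zero (by convert hc₂ using 1; ring) hb₂
  have f1 : m₁ * nodeX b m₁ * (1 + b * nodeX b m₁) - nodeX b m₁ ^ 2 = 0 := by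
    have : nodeX b m₁ * (1 - b * m₁) = m₁ := div_mul_cancel₀ _ hb₁
    linear_combination -nodeX b m₁ * this
  have f2 : m₂ * nodeX b m₂ * (1 + b * nodeX b m₂) - nodeX b m₂ ^ 2 = 0 := by
    have : nodeX b m₂ * (1 - b * m₂) = m₂ := div_mul_cancel₀ _ hb₂
    linear_combination -nodeX b m₂ * this
  have h21 : m₂ - m₁ ≠ 0 := fun h => h₁₂ (by linear_combination -h)
  have g : (1 + b)⁻¹ * (1 + b) - 1 = 0 := by field_simp; ring
  have hlin : ∀ a : ℂ, (X 1 - C a * X 0 : MvPolynomial (Fin 3) ℂ).IsHomogeneous 1 := fun a =>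
    (isHomogeneous_X _ _).sub (isHomogeneous_C_mul_X _ _)
  have k1 : m₁ * nodeX b m₁ - m₂ * nodeX b m₁ ≠ 0 := by
    rw [← sub_mul]; exact mul_ne_zero h₁₂ hd1
  have k2 : m₂ * nodeX b m₂ - m₁ * nodeX b m₂ ≠ 0 := by
    rw [← sub_mul]; exact mul_ne_zero h21 hd2
  have k3 : m₁ * (1 + b) - 1 ≠ 0 := by rwa [mul_comm]
  have k4 : m₂ * (1 + b) - 1 ≠ 0 := by rwa [mul_comm]
  have k5 : (1 + b)⁻¹ - m₁ ≠ 0 := fun h => hc₁ (by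
    rw [← sub_eq_zero.1 h]; field_simp; ring)
  have k6 : (1 + b)⁻¹ - m₂ ≠ 0 := fun h => hc₂ (by
    rw [← sub_eq_zero.1 h]; field_simp; ring)
  have g1 : ∀ (v : Fin 3 → ℂ) (a : ℂ), gradAt v (X 1 - C a * X 0 : MvPolynomial (Fin 3) ℂ) = ![-a, 1, 0] := by
    intro v a; ext i; fin_cases i <;> simp [gradAt]
  have g3 : ∀ v : Fin 3 → ℂ, gradAt v (X 0 - X 2 : MvPolynomial (Fin 3) ℂ) = ![1, 0, -1] := by
    intro v; ext i; fin_cases i <;> simp [gradAt]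
  have g4 : ∀ v : Fin 3 → ℂ, gradAt v (X 0 : MvPolynomial (Fin 3) ℂ) = ![1, 0, 0] := by
    intro v; ext i; fin_cases i <;> simp [gradAt]
  have g5 : ∀ v : Fin 3 → ℂ, gradAt v (X 1 * (X 2 + C b * X 0) - X 0 ^ 2 : MvPolynomial (Fin 3) ℂ) =
      ![b * v 1 - 2 * v 0, v 2 + b * v 0, v 1] := by
    intro v; ext i; fin_cases i <;> simp [gradAt] <;> ring
  refine ⟨hlin _, hlin _, (isHomogeneous_X _ _).sub (isHomogeneous_X _ _), isHomogeneous_X _ _,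
    ((isHomogeneous_X _ _).mul ((isHomogeneous_X _ _).add (isHomogeneous_C_mul_X _ _))).sub
      (isHomogeneous_X_pow _ _), irreducible_stdConic b, ?_, ?_, ?_, ?_, ?_, ?_, ?_, ?_⟩
  · intro h; simpa using congrFun h 1
  all_goals
    simp only [OrdinaryPoint, TransversalAt, stdConfig, g1, g3, g4, g5, affinePoint, infinitePoint,
      List.pairwise_cons, List.mem_cons, forall_eq_or_imp, List.not_mem_nil, false_imp_iff,
      implies_true, List.Pairwise.nil, and_true]
    simp [f1, f2, g, hd1, hd2, e1, e2, k1, k2, k3, k4, k5, k6, h₁₂, h21]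
  · refine ⟨⟨?_, ?_, ?_⟩, ⟨?_, ?_⟩, ?_⟩
    · exact linearIndependent_of_minor 0 1 (by simpa using fun h => h21 (by linear_combination h))
    · exact linearIndependent_of_minor 0 1 (by simp)
    · exact linearIndependent_of_minor 0 1 (by simpa using h₁)
    · exact linearIndependent_of_minor 0 1 (by simp)
    · exact linearIndependent_of_minor 0 1 (by simpa using h₂)
    · exact linearIndependent_of_minor 0 1 (by simp)
  · refine ⟨⟨?_, ?_⟩, ?_⟩
    · exact linearIndependent_of_minor 0 2 (by simp)
    · exact linearIndependent_of_minor 0 2 (by simpa using fun h => hb (by linear_combination h))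
    · exact linearIndependent_of_minor 0 2 (by simp)
  · exact linearIndependent_of_minor 1 2 (by simp)
  · exact linearIndependent_of_minor 1 2 (by simp)
  · exact linearIndependent_of_minor 1 2 (by simpa using ⟨h₁, hd1⟩)
  · exact linearIndependent_of_minor 1 2 (by simpa using ⟨h₂, hd2⟩)
  · exact linearIndependent_of_minor 0 1 (by simpa using hb)

end Standard

/-! ### Reduction of a special configuration to a standard one. -/

section Normalization

/-- Euler's formula: the partial derivatives are constants. -/
lemma exists_linear {f : MvPolynomial (Fin 3) ℂ} (h : f.IsHomogeneous 1) :
    ∃ a b c : ℂ, f = C a * X 0 + C b * X 1 + C c * X 2 := by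
  have h1 : ∀ i, ∃ a, pderiv i f = C a := fun i =>
    ⟨_, (totalDegree_eq_zero_iff_eq_C.1 ((totalDegree_zero_iff_isHomogeneous (p := pderiv i f)).2 h.pderiv))⟩
  obtain ⟨a, ha⟩ := h1 0
  obtain ⟨b, hb⟩ := h1 1
  obtain ⟨c, hc⟩ := h1 2
  have := h.sum_X_mul_pderiv
  rw [Fin.sum_univ_three, ha, hb, hc, one_smul] at this
  exact ⟨a, b, c, by rw [← this]; ring⟩

lemma exists_quadratic {f : MvPolynomial (Fin 3) ℂ} (h : f.IsHomogeneous 2) :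
    ∃ a b c d e g : ℂ, f = C a * X 0 ^ 2 + C b * (X 0 * X 1) + C c * (X 0 * X 2) + C d * X 1 ^ 2 +
      C e * (X 1 * X 2) + C g * X 2 ^ 2 := by
  obtain ⟨a1, b1, c1, h1⟩ := exists_linear (h.pderiv (i := 0))
  obtain ⟨a2, b2, c2, h2⟩ := exists_linear (h.pderiv (i := 1))
  obtain ⟨a3, b3, c3, h3⟩ := exists_linear (h.pderiv (i := 2))
  have := h.sum_X_mul_pderiv
  rw [Fin.sum_univ_three, h1, h2, h3] at this
  refine ⟨a1 / 2, (b1 + a2) / 2, (c1 + a3) / 2, b2 / 2, (c2 + b3) / 2, c3 / 2, ?_⟩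
  have h2' : f = C 2⁻¹ * ((2 : ℕ) • f) := by
    rw [nsmul_eq_mul, ← mul_assoc]
    have : (C 2⁻¹ * ((2 : ℕ) : MvPolynomial (Fin 3) ℂ)) = 1 := by
      rw [← map_natCast (C : ℂ →+* MvPolynomial (Fin 3) ℂ), ← map_mul]; norm_num
    rw [this, one_mul]
  have hd : ∀ a : ℂ, (C (a / 2) : MvPolynomial (Fin 3) ℂ) = C 2⁻¹ * C a := fun a => by
    rw [← map_mul]; congr 1; ring
  rw [h2', ← this]
  simp only [hd, map_add]
  ring

/-- Multiplication of the equations of a configuration by constants. -/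
def Configuration.scale (l : Fin 5 → ℂ) (c : Configuration) : Configuration where
  L₁ := C (l 0) * c.L₁
  L₂ := C (l 1) * c.L₂
  L₃ := C (l 2) * c.L₃
  L₄ := C (l 3) * c.L₄
  Q := C (l 4) * c.Q

lemma admissible_of_isSpecial {b m₁ m₂ : ℂ} {l : Fin 5 → ℂ} (hl : ∀ i, l i ≠ 0)
    {P D E F H I J : Fin 2 → ℂ} (h : ((stdConfig b m₁ m₂).scale l).IsSpecial P D E F H I J) :
    Admissible b m₁ m₂ ∧ P = 0 ∧ E = ![1, m₁] ∧ F = ![1, m₂] ∧ H = ![nodeX b m₁, m₁ * nodeX b m₁] ∧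
      I = ![nodeX b m₂, m₂ * nodeX b m₂] ∧ J = ![1, 1 / (1 + b)] := by
  obtain ⟨-, -, -, -, -, -, -, hC, -, hE, hF, hH, hI, hJ⟩ := h
  simp only [OrdinaryPoint, TransversalAt, stdConfig, Configuration.scale, affinePoint,
      List.pairwise_cons, List.mem_cons, forall_eq_or_imp, List.not_mem_nil, false_imp_iff,
      implies_true, List.Pairwise.nil, and_true] at hC hE hF hH hI hJ
  simp [hl] at hC hE hF hH hI hJ
  obtain ⟨⟨⟨c1, c2, -⟩, ⟨-, c4, -⟩, -⟩, -⟩ := hC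
  obtain ⟨⟨e1, e2, -⟩, e3, e4, e5⟩ := hE
  obtain ⟨⟨f1, f2, -⟩, f3, f4, f5⟩ := hF
  obtain ⟨⟨a1, a2, -⟩, a3, a4, a5⟩ := hH
  obtain ⟨⟨b1, b2, -⟩, b3, b4, b5⟩ := hI
  obtain ⟨⟨j1, j2, -⟩, j3, j4, j5⟩ := hJ
  have hE0 : E 0 = 1 := by linear_combination e2
  have hE1 : E 1 = m₁ := by linear_combination e1 + m₁ * e2
  have hF0 : F 0 = 1 := by linear_combination f2
  have hF1 : F 1 = m₂ := by linear_combination f1 + m₂ * f2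
  have hJ0 : J 0 = 1 := by linear_combination j1
  have hP0 : P 0 = 0 := c2.2.1
  have hP1 : P 1 = 0 := by linear_combination c4 + m₂ * hP0
  rw [hE0, hE1] at e3 e5
  rw [hF0, hF1] at f5
  rw [hJ0] at j2
  have node : ∀ (m : ℂ) (H : Fin 2 → ℂ), H 1 - m * H 0 = 0 → H 1 * (1 + b * H 0) - H 0 ^ 2 = 0 →
      H 0 ≠ 0 → m ≠ 0 ∧ 1 - b * m ≠ 0 ∧ H = ![nodeX b m, m * nodeX b m] := by
    intro m H h1 h2 h0
    have h3 : H 0 * (1 - b * m) = m := by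
      refine sub_eq_zero.1 ((mul_eq_zero.1 (?_ : H 0 * _ = 0)).resolve_left h0)
      linear_combination (1 + b * H 0) * h1 - h2
    have hm : m ≠ 0 := by
      rintro rfl
      simp at h3
      exact h0 h3
    have hbm : 1 - b * m ≠ 0 := fun h => hm (by rw [← h3, h, mul_zero])
    have hn : H 0 = nodeX b m := by rw [nodeX, eq_div_iff hbm, h3]
    refine ⟨hm, hbm, ?_⟩
    ext i
    fin_cases i
    · exact hn
    · simp only [← hn]
      simpa using (by linear_combination h1 : H 1 = m * H 0)
  obtain ⟨h1, hb1, hH'⟩ := node m₁ H a1 a2 a5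
  obtain ⟨h2, hb2, hI'⟩ := node m₂ I b1 b2 b5
  have hb : 1 + b ≠ 0 := fun h => by
    have : (1 : ℂ) = 0 := by linear_combination -j2 + J 1 * h
    exact one_ne_zero this
  refine ⟨⟨hb, h1, h2, fun h => e3 (by linear_combination h), hb1, hb2,
    fun h => e5 (by linear_combination h), fun h => f5 (by linear_combination h)⟩, ?_, ?_, ?_, hH', hI', ?_⟩
  · ext i; fin_cases i; exacts [hP0, hP1]
  · ext i; fin_cases i; exacts [hE0, hE1]
  · ext i; fin_cases i; exacts [hF0, hF1]
  · ext i; fin_cases i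
    · exact hJ0
    · have : J 1 = 1 / (1 + b) := by rw [eq_div_iff hb]; linear_combination j2
      simpa using this

/-- With `C` at the origin and `D` the vertical direction, `L₃` and `L₄` are vertical. A lower
triangular linear map, with three entries at disposal, achieves the rest. -/
lemma exists_standard_of_points {c : Configuration} {E F H I J : Fin 2 → ℂ}
    (h : c.IsSpecial 0 ![0, 1] E F H I J) :
    ∃ (M : Matrix (Fin 2) (Fin 2) ℂ) (b m₁ m₂ : ℂ) (l : Fin 5 → ℂ), M.det ≠ 0 ∧ (∀ i, l i ≠ 0) ∧
      c.comap 0 M = (stdConfig b m₁ m₂).scale l := by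
  obtain ⟨h1, h2, h3, h4, h5, hirr, -, hC, hD, hE, hF, hH, hI, hJ⟩ := h
  obtain ⟨L₁, L₂, L₃, L₄, Q⟩ := c
  dsimp only at *
  obtain ⟨a1, b1, c1, rfl⟩ := exists_linear h1
  obtain ⟨a2, b2, c2, rfl⟩ := exists_linear h2
  obtain ⟨a3, b3, c3, rfl⟩ := exists_linear h3
  obtain ⟨a4, b4, c4, rfl⟩ := exists_linear h4
  obtain ⟨q1, q2, q3, q4, q5, q6, rfl⟩ := exists_quadratic h5
  have g4 : gradAt (affinePoint 0) (C a4 * X 0 + C b4 * X 1 + C c4 * X 2) = ![a4, b4, c4] := by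
    ext i; fin_cases i <;> simp [gradAt]
  have gQ : gradAt (affinePoint 0) (C q1 * X 0 ^ 2 + C q2 * (X 0 * X 1) + C q3 * (X 0 * X 2) +
      C q4 * X 1 ^ 2 + C q5 * (X 1 * X 2) + C q6 * X 2 ^ 2) = ![q3, q5, 2 * q6] := by
    ext i; fin_cases i <;> simp [gradAt, affinePoint]; ring
  have hlin : ∀ a b c a' b' c' : ℂ, LinearIndependent ℂ ![![a, b, c], ![a', b', c']] →
      a * b' - b * a' = 0 → c = 0 → c' = 0 → False := by
    intro a b c a' b' c' hl h0 h1 h2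
    rw [LinearIndependent.pair_iff] at hl
    have k1 := hl a' (-a) (by
      ext i; fin_cases i <;> simp [h1, h2]; ring; linear_combination -h0)
    have k2 := hl b' (-b) (by
      ext i; fin_cases i <;> simp [h1, h2]; linear_combination h0; ring)
    have := hl 1 0 (by
      ext i; fin_cases i <;> simp [h1, neg_eq_zero.1 k1.2, neg_eq_zero.1 k2.2])
    exact one_ne_zero this.1
  simp only [OrdinaryPoint, TransversalAt, List.pairwise_cons, List.mem_cons, forall_eq_or_imp,
    List.not_mem_nil, false_imp_iff, implies_true, List.Pairwise.nil, and_true, g4, gQ] at hC hD hE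
  simp [affinePoint, infinitePoint] at hC hD hE
  obtain ⟨⟨⟨⟨hc1, hc2, -⟩, -⟩, -, hc4, hq6, hCQ⟩, hc3⟩ := hC
  obtain ⟨⟨⟨⟨hb3, hb4, -⟩, -⟩, -, hq4, -⟩, hb1, hb2⟩ := hD
  obtain ⟨⟨-, hE3, -⟩, -, hE4, -⟩ := hE
  have ha4 : a4 ≠ 0 := by
    rintro rfl
    exact hE4 (by rw [hb4, hc4]; ring)
  have ha3 : a3 ≠ 0 := by
    rintro rfl
    exact hc3 (by linear_combination hE3 - E 1 * hb3)
  have hq5 : q5 ≠ 0 := by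
    rintro rfl
    exact hlin _ _ _ _ _ _ hCQ (by rw [hb4]; ring) hc4 (by rw [hq6]; ring)
  subst hc1 hc2 hc4 hb3 hb4 hq4 hq6
  -- Otherwise the conic would split into two lines.
  have hdet : q1 * q5 - q2 * q3 ≠ 0 := by
    intro h0
    have hred : C q5 * (C q1 * X 0 ^ 2 + C q2 * (X 0 * X 1) + C q3 * (X 0 * X 2) + C 0 * X 1 ^ 2 +
        C q5 * (X 1 * X 2) + C 0 * X 2 ^ 2) =
        (C q5 * X 1 + C q3 * X 0) * (C q2 * X 0 + C q5 * X 2 : MvPolynomial (Fin 3) ℂ) := by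
      have h1 : (C q1 * C q5 - C q2 * C q3 : MvPolynomial (Fin 3) ℂ) = 0 := by
        rw [← map_mul, ← map_mul, ← map_sub, h0, map_zero]
      simp only [map_zero]
      linear_combination X 0 ^ 2 * h1
    have hunit : IsUnit (C q5 : MvPolynomial (Fin 3) ℂ) := (isUnit_iff_ne_zero.2 hq5).map C
    have hir := (irreducible_isUnit_mul hunit).2 hirr
    rw [hred] at hir
    rcases hir.isUnit_or_isUnit rfl with hu | hu <;>
    · have := hu.map (eval (0 : Fin 3 → ℂ))
      simp at this
  -- `a` is the abscissa of `L₃`; `σ` makes the tangent of the conic at the origin horizontal; `τ`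
  -- makes its coefficients of `y` and `x²` opposite; `b` is then the coefficient of `x y` relative
  -- to that of `y`.
  obtain ⟨a, ha⟩ : ∃ a, a3 * a = -c3 := ⟨-c3 / a3, by field_simp⟩
  obtain ⟨σ, hσ⟩ : ∃ σ, q3 * a + q5 * σ = 0 := ⟨-(q3 * a) / q5, by field_simp; ring⟩
  obtain ⟨τ, hτ⟩ : ∃ τ, q5 * τ = -(q1 * a ^ 2 + q2 * a * σ) :=
    ⟨-(q1 * a ^ 2 + q2 * a * σ) / q5, by field_simp⟩
  obtain ⟨b, hb⟩ : ∃ b, b * q5 = q2 * a := ⟨q2 * a / q5, by field_simp⟩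
  have ha0 : a ≠ 0 := by
    rintro rfl
    exact hc3 (by linear_combination ha)
  have hτ0 : τ ≠ 0 := by
    rintro rfl
    refine hdet ((mul_eq_zero.1 (?_ : a ^ 2 * _ = 0)).resolve_left (pow_ne_zero 2 ha0))
    linear_combination q5 * hτ - q2 * a * hσ
  obtain ⟨m₁, hm₁⟩ : ∃ m, (b1 * τ) * m = -(a1 * a + b1 * σ) :=
    ⟨-(a1 * a + b1 * σ) / (b1 * τ), by field_simp⟩
  obtain ⟨m₂, hm₂⟩ : ∃ m, (b2 * τ) * m = -(a2 * a + b2 * σ) :=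
    ⟨-(a2 * a + b2 * σ) / (b2 * τ), by field_simp⟩
  refine ⟨!![a, 0; σ, τ], b, m₁, m₂, ![b1 * τ, b2 * τ, -c3, a4 * a, q5 * τ], ?_, ?_, ?_⟩
  · rw [Matrix.det_fin_two]; simpa using ⟨ha0, hτ0⟩
  · simp [Fin.forall_fin_succ, hb1, hb2, hc3, ha4, hq5, ha0, hτ0]
  · rw [Configuration.comap, Configuration.scale, stdConfig, Configuration.mk.injEq]
    refine ⟨?_, ?_, ?_, ?_, ?_⟩ <;> refine MvPolynomial.funext fun v => ?_ <;> rw [eval_projSubst] <;>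
      simp [projMap]
    · linear_combination v 0 * hm₁
    · linear_combination v 0 * hm₂
    · linear_combination v 0 * ha
    · ring
    · linear_combination v 0 * v 2 * hσ + v 0 ^ 2 * hτ - v 0 * v 1 * τ * hb

theorem exists_standard {c : Configuration} {P D E F H I J : Fin 2 → ℂ} (h : c.IsSpecial P D E F H I J) :
    ∃ (p : Fin 2 → ℂ) (M : Matrix (Fin 2) (Fin 2) ℂ) (b m₁ m₂ : ℂ) (l : Fin 5 → ℂ), M.det ≠ 0 ∧
      (∀ i, l i ≠ 0) ∧ Admissible b m₁ m₂ ∧ c.comap p M = (stdConfig b m₁ m₂).scale l ∧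
      P = affMap p M 0 ∧ E = affMap p M ![1, m₁] ∧ F = affMap p M ![1, m₂] ∧
      H = affMap p M ![nodeX b m₁, m₁ * nodeX b m₁] ∧ I = affMap p M ![nodeX b m₂, m₂ * nodeX b m₂] ∧
      J = affMap p M ![1, 1 / (1 + b)] := by
  obtain ⟨w, hw⟩ : ∃ w : Fin 2 → ℂ, w 0 * D 1 - w 1 * D 0 ≠ 0 := by
    by_cases h1 : D 1 = 0
    · refine ⟨![0, 1], fun h0 => h.direction ?_⟩
      ext i
      fin_cases i
      · simpa using h0
      · exact h1
    · exact ⟨![1, 0], by simpa using h1⟩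
  set M₁ : Matrix (Fin 2) (Fin 2) ℂ := !![w 0, D 0; w 1, D 1]
  have hM₁ : M₁.det ≠ 0 := by
    rw [Matrix.det_fin_two]
    simpa [M₁] using fun h => hw (by linear_combination h)
  have hsp : ∃ E' F' H' I' J', (c.comap P M₁).IsSpecial 0 ![0, 1] E' F' H' I' J' := by
    obtain ⟨E', rfl⟩ := affMap_surj (p := P) hM₁ E
    obtain ⟨F', rfl⟩ := affMap_surj (p := P) hM₁ F
    obtain ⟨H', rfl⟩ := affMap_surj (p := P) hM₁ H
    obtain ⟨I', rfl⟩ := affMap_surj (p := P) hM₁ I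
    obtain ⟨J', rfl⟩ := affMap_surj (p := P) hM₁ J
    refine ⟨E', F', H', I', J', Configuration.IsSpecial.comap hM₁ ?_⟩
    have e1 : affMap P M₁ 0 = P := by ext i; simp [affMap]
    have e2 : affMap 0 M₁ ![0, 1] = D := by ext i; fin_cases i <;> simp [affMap, M₁]
    rw [e1, e2]
    exact h
  obtain ⟨E', F', H', I', J', hsp⟩ := hsp
  obtain ⟨M₂, b, m₁, m₂, l, hM₂, hl, hc⟩ := exists_standard_of_points hsp
  have hM : (M₁ * M₂).det ≠ 0 := by rw [Matrix.det_mul]; exact mul_ne_zero hM₁ hM₂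
  have hcc : c.comap P (M₁ * M₂) = (stdConfig b m₁ m₂).scale l := by
    rw [← hc]
    have : affMap P M₁ 0 = P := by ext i; simp [affMap]
    simp only [Configuration.comap, projSubst_projSubst, this]
  generalize hMM : M₁ * M₂ = M at hM hcc
  obtain ⟨P', hP'⟩ := affMap_surj (p := P) hM P
  obtain ⟨D', hD'⟩ := affMap_surj (p := 0) hM D
  obtain ⟨E', hE'⟩ := affMap_surj (p := P) hM E
  obtain ⟨F', hF'⟩ := affMap_surj (p := P) hM F
  obtain ⟨H', hH'⟩ := affMap_surj (p := P) hM H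
  obtain ⟨I', hI'⟩ := affMap_surj (p := P) hM I
  obtain ⟨J', hJ'⟩ := affMap_surj (p := P) hM J
  have h' : (c.comap P M).IsSpecial P' D' E' F' H' I' J' :=
    Configuration.IsSpecial.comap hM (by rw [hP', hD', hE', hF', hH', hI', hJ']; exact h)
  rw [hcc] at h'
  obtain ⟨had, rfl, rfl, rfl, rfl, rfl, rfl⟩ := admissible_of_isSpecial hl h'
  exact ⟨P, M, b, m₁, m₂, l, hM, hl, had, hcc, hP'.symm, hE'.symm, hF'.symm, hH'.symm, hI'.symm, hJ'.symm⟩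

end Normalization

/-! ### The form of the standard configuration and its cofactors. -/

section StandardForm

/-- The form having the curves of the standard configuration as integral curves. -/
def stdForm {A : Type} [CommRing A] (b m₁ m₂ : A) : PolyForm A :=
  (-C (m₁ * m₂) * (X 0 - 1) * (X 1 * (1 + C b * X 0) - X 0 ^ 2) +
      (C (b * (1 + b)) * X 1 - C (2 + b) * X 0 + 2) * (X 1 - C m₁ * X 0) * (X 1 - C m₂ * X 0),
    X 0 * (X 0 - 1) * (X 1 - C (m₁ + m₂ - b * (m₁ * m₂)) * X 0 + C (m₁ * m₂)))

lemma affinePart_std (b m₁ m₂ : ℂ) :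
    affinePart (stdConfig b m₁ m₂).L₁ = X 1 - C m₁ * X 0 ∧
    affinePart (stdConfig b m₁ m₂).L₂ = X 1 - C m₂ * X 0 ∧
    affinePart (stdConfig b m₁ m₂).L₃ = X 0 - 1 ∧ affinePart (stdConfig b m₁ m₂).L₄ = X 0 ∧
    affinePart (stdConfig b m₁ m₂).Q = X 1 * (1 + C b * X 0) - X 0 ^ 2 := by
  refine ⟨?_, ?_, ?_, ?_, ?_⟩ <;> simp [affinePart, stdConfig]

lemma C_two : (C 2 : MvPolynomial (Fin 2) ℂ) = 2 := map_ofNat C 2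

lemma isCofactor_line (b m₁ m₂ : ℂ) : IsCofactor (stdForm b m₁ m₂) (X 1 - C m₁ * X 0)
    (C (m₁ * m₂) * (X 0 - 1) * (1 + C b * X 0) - C m₁ * X 0 * (X 0 - 1) -
      (C (b * (1 + b)) * X 1 - C (2 + b) * X 0 + 2) * (X 1 - C m₂ * X 0)) := by
  simp [IsCofactor, dWedge, stdForm, C_two]
  ring

/-- By this symmetry the cofactor of `L₂` is obtained from that of `L₁`. -/
lemma stdForm_comm (b m₁ m₂ : ℂ) : stdForm b m₁ m₂ = stdForm b m₂ m₁ := by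
  ext1 <;> simp only [stdForm, mul_comm m₂ m₁, add_comm m₂ m₁]
  ring

lemma isCofactor_conic (b m₁ m₂ : ℂ) : IsCofactor (stdForm b m₁ m₂) (X 1 * (1 + C b * X 0) - X 0 ^ 2)
    (C (m₁ * m₂) * (X 0 - 1) * (1 + C b * X 0) -
      C b * X 0 * (X 1 - C (m₁ + m₂ - b * (m₁ * m₂)) * X 0 + C (m₁ * m₂)) -
      (C (b * (1 + b)) * X 1 - C (2 + b) * X 0 + 2) * (X 1 - C (m₁ + m₂) * X 0)) := by
  simp [IsCofactor, dWedge, stdForm, C_two]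
  ring

lemma isCofactor_line₃ (b m₁ m₂ : ℂ) : IsCofactor (stdForm b m₁ m₂) (X 0 - 1)
    (X 0 * (X 1 - C (m₁ + m₂ - b * (m₁ * m₂)) * X 0 + C (m₁ * m₂))) := by
  simp [IsCofactor, dWedge, stdForm, C_two]
  ring

lemma isCofactor_line₄ (b m₁ m₂ : ℂ) : IsCofactor (stdForm b m₁ m₂) (X 0)
    ((X 0 - 1) * (X 1 - C (m₁ + m₂ - b * (m₁ * m₂)) * X 0 + C (m₁ * m₂))) := by
  simp [IsCofactor, dWedge, stdForm, C_two]
  ring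

lemma hasIntegralCurves_std (b m₁ m₂ : ℂ) :
    (stdConfig b m₁ m₂).HasIntegralCurves (stdForm b m₁ m₂) := by
  obtain ⟨h1, h2, h3, h4, h5⟩ := affinePart_std b m₁ m₂
  rw [Configuration.HasIntegralCurves, h1, h2, h3, h4, h5]
  refine ⟨⟨_, isCofactor_line _ _ _⟩, ?_, ⟨_, isCofactor_line₃ _ _ _⟩, ⟨_, isCofactor_line₄ _ _ _⟩,
    ⟨_, isCofactor_conic _ _ _⟩⟩
  rw [stdForm_comm]
  exact ⟨_, isCofactor_line _ _ _⟩

section Degree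

variable {A : Type} [CommRing A] {f g : MvPolynomial (Fin 2) A} {d e : ℕ}

lemma totalDegree_mul_le' (hf : f.totalDegree ≤ d) (hg : g.totalDegree ≤ e) :
    (f * g).totalDegree ≤ d + e := (totalDegree_mul _ _).trans (add_le_add hf hg)

lemma totalDegree_add_le' (hf : f.totalDegree ≤ d) (hg : g.totalDegree ≤ d) :
    (f + g).totalDegree ≤ d := (totalDegree_add _ _).trans (max_le hf hg)

lemma totalDegree_sub_le' (hf : f.totalDegree ≤ d) (hg : g.totalDegree ≤ d) :
    (f - g).totalDegree ≤ d := (totalDegree_sub _ _).trans (max_le hf hg)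

lemma totalDegree_X_le (i : Fin 2) : (X i : MvPolynomial (Fin 2) A).totalDegree ≤ 1 := by
  exact (totalDegree_monomial_le (Finsupp.single i 1) (1 : A)).trans (by simp)

lemma totalDegree_C_le (a : A) : (C a : MvPolynomial (Fin 2) A).totalDegree ≤ d := by
  rw [totalDegree_C]; exact Nat.zero_le d

lemma totalDegree_C_mul_le (a : A) (hf : f.totalDegree ≤ d) : (C a * f).totalDegree ≤ d := by
  simpa using totalDegree_mul_le' (totalDegree_C_le (d := 0) a) hf

end Degree

lemma totalDegree_stdForm {A : Type} [CommRing A] (b m₁ m₂ : A) :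
    (stdForm b m₁ m₂).1.totalDegree ≤ 3 ∧ (stdForm b m₁ m₂).2.totalDegree ≤ 3 := by
  have h1 : (1 : MvPolynomial (Fin 2) A).totalDegree ≤ 1 := by simp
  have h2 : (2 : MvPolynomial (Fin 2) A).totalDegree ≤ 1 := by
    rw [← map_ofNat (C : A →+* MvPolynomial (Fin 2) A) 2]
    exact totalDegree_C_le _
  have hx := totalDegree_X_le (A := A) 0
  have hy := totalDegree_X_le (A := A) 1
  constructor
  · refine totalDegree_add_le' ?_ ?_
    · have : -C (m₁ * m₂) * (X 0 - 1) * (X 1 * (1 + C b * X 0) - X 0 ^ 2) =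
        (C (-(m₁ * m₂)) * (X 0 - 1)) * (X 1 * (1 + C b * X 0) - X 0 * X 0 :
          MvPolynomial (Fin 2) A) := by simp only [map_neg]; ring
      rw [this]
      exact totalDegree_mul_le' (d := 1) (e := 2) (totalDegree_C_mul_le _ (totalDegree_sub_le' hx h1))
        (totalDegree_sub_le' (totalDegree_mul_le' (d := 1) (e := 1) hy
          (totalDegree_add_le' h1 (totalDegree_C_mul_le _ hx))) (totalDegree_mul_le' hx hx))
    · exact totalDegree_mul_le' (d := 2) (e := 1) (totalDegree_mul_le' (d := 1) (e := 1)
        (totalDegree_add_le' (totalDegree_sub_le' (totalDegree_C_mul_le _ hy) (totalDegree_C_mul_le _ hx)) h2)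
        (totalDegree_sub_le' hy (totalDegree_C_mul_le _ hx)))
        (totalDegree_sub_le' hy (totalDegree_C_mul_le _ hx))
  · exact totalDegree_mul_le' (d := 2) (e := 1) (totalDegree_mul_le' (d := 1) (e := 1) hx
      (totalDegree_sub_le' hx h1)) (totalDegree_add_le' (totalDegree_sub_le' hy
        (totalDegree_C_mul_le _ hx)) (totalDegree_C_le _))

lemma stdForm_mem_forms (b m₁ m₂ : ℂ) : stdForm b m₁ m₂ ∈ (stdConfig b m₁ m₂).forms 3 :=
  ⟨(totalDegree_stdForm b m₁ m₂).1, (totalDegree_stdForm b m₁ m₂).2, hasIntegralCurves_std b m₁ m₂⟩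

lemma stdForm_ne_zero (b m₁ m₂ : ℂ) : stdForm b m₁ m₂ ≠ 0 := fun h => by
  -- At this point the linear factor of the dy-component takes the value 1.
  have := congrArg (fun ω => eval ![2, (m₁ + m₂ - b * (m₁ * m₂)) * 2 - m₁ * m₂ + 1] ω.2) h
  simp [stdForm] at this
  rcases this with h1 | h1
  · norm_num at h1
  · exact one_ne_zero (by linear_combination h1)

/-- The cofactor identity for the standard form. -/
lemma cofactor_identity_std {b m₁ m₂ : ℂ} {K₄ K : MvPolynomial (Fin 2) ℂ}
    (h₄ : IsCofactor (stdForm b m₁ m₂) (affinePart (stdConfig b m₁ m₂).L₄) K₄)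
    (h : IsCofactor (stdForm b m₁ m₂) (stdConfig b m₁ m₂).Γ K) :
    K₄ - K + dForm (stdForm b m₁ m₂) = 0 := by
  obtain ⟨e1, e2, e3, e4, e5⟩ := affinePart_std b m₁ m₂
  rw [Configuration.Γ, e1, e2, e3, e5] at h
  rw [e4] at h₄
  have hl : ∀ m : ℂ, (X 1 - C m * X 0 : MvPolynomial (Fin 2) ℂ) ≠ 0 := fun m h => by
    have := congrArg (eval ![0, 1]) h
    simp at this
  have h3 : (X 0 - 1 : MvPolynomial (Fin 2) ℂ) ≠ 0 := fun h => by
    have := congrArg (eval ![0, 1]) h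
    simp at this
  have h5 : (X 1 * (1 + C b * X 0) - X 0 ^ 2 : MvPolynomial (Fin 2) ℂ) ≠ 0 := fun h => by
    have := congrArg (eval ![0, 1]) h
    simp at this
  have hc₂ := isCofactor_line b m₂ m₁
  rw [← stdForm_comm] at hc₂
  rw [h₄.unique (X_ne_zero 0) (isCofactor_line₄ b m₁ m₂),
    h.unique (mul_ne_zero (mul_ne_zero (mul_ne_zero (hl m₁) (hl m₂)) h3) h5)
      ((((isCofactor_line b m₁ m₂).mul hc₂).mul (isCofactor_line₃ b m₁ m₂)).mul (isCofactor_conic b m₁ m₂))]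
  have h2 : pderiv 1 (2 : MvPolynomial (Fin 2) ℂ) = 0 := by rw [← C_two, pderiv_C]
  simp [dForm, stdForm, C_two, h2]
  ring

end StandardForm

/-! ### No conic through the six points, and uniqueness of the form. -/

section Uniqueness

lemma exists_linear_two {f : MvPolynomial (Fin 2) ℂ} (h : f.IsHomogeneous 1) :
    ∃ a b : ℂ, f = C a * X 0 + C b * X 1 := by
  have h1 : ∀ i, ∃ a, pderiv i f = C a := fun i =>
    ⟨_, (totalDegree_eq_zero_iff_eq_C.1 ((totalDegree_zero_iff_isHomogeneous (p := pderiv i f)).2 h.pderiv))⟩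
  obtain ⟨a, ha⟩ := h1 0
  obtain ⟨b, hb⟩ := h1 1
  have := h.sum_X_mul_pderiv
  rw [Fin.sum_univ_two, ha, hb, one_smul] at this
  exact ⟨a, b, by rw [← this]; ring⟩

lemma exists_quadratic_two {f : MvPolynomial (Fin 2) ℂ} (h : f.IsHomogeneous 2) :
    ∃ a b c : ℂ, f = C a * X 0 ^ 2 + C b * (X 0 * X 1) + C c * X 1 ^ 2 := by
  obtain ⟨a1, b1, h1⟩ := exists_linear_two (h.pderiv (i := 0))
  obtain ⟨a2, b2, h2⟩ := exists_linear_two (h.pderiv (i := 1))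
  have := h.sum_X_mul_pderiv
  rw [Fin.sum_univ_two, h1, h2] at this
  refine ⟨a1 / 2, (b1 + a2) / 2, b2 / 2, ?_⟩
  have h2' : f = C 2⁻¹ * ((2 : ℕ) • f) := by
    rw [nsmul_eq_mul, ← mul_assoc]
    have : (C 2⁻¹ * ((2 : ℕ) : MvPolynomial (Fin 2) ℂ)) = 1 := by
      rw [← map_natCast (C : ℂ →+* MvPolynomial (Fin 2) ℂ), ← map_mul]; norm_num
    rw [this, one_mul]
  have hd : ∀ a : ℂ, (C (a / 2) : MvPolynomial (Fin 2) ℂ) = C 2⁻¹ * C a := fun a => by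
    rw [← map_mul]; congr 1; ring
  rw [h2', ← this]
  simp only [hd, map_add]
  ring

lemma sum_homogeneousComponent_of_le {f : MvPolynomial (Fin 2) ℂ} {n : ℕ} (h : f.totalDegree ≤ n) :
    ∑ i ∈ Finset.range (n + 1), homogeneousComponent i f = f := by
  conv_rhs => rw [← sum_homogeneousComponent f]
  refine (Finset.sum_subset (Finset.range_mono (by omega)) fun i _ hi => ?_).symm
  exact homogeneousComponent_eq_zero _ _ (by simpa using hi)

lemma exists_of_totalDegree_le_one {f : MvPolynomial (Fin 2) ℂ} (h : f.totalDegree ≤ 1) :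
    ∃ a b c : ℂ, f = C a + C b * X 0 + C c * X 1 := by
  obtain ⟨b, c, hl⟩ := exists_linear_two (homogeneousComponent_isHomogeneous 1 f)
  refine ⟨coeff 0 f, b, c, ?_⟩
  rw [add_assoc, ← hl, ← homogeneousComponent_zero]
  conv_lhs => rw [← sum_homogeneousComponent_of_le h]
  rw [Finset.sum_range_succ, Finset.sum_range_one]

lemma exists_of_totalDegree_le_two {f : MvPolynomial (Fin 2) ℂ} (h : f.totalDegree ≤ 2) :
    ∃ a b c d e g : ℂ, f = C a + C b * X 0 + C c * X 1 +
      (C d * X 0 ^ 2 + C e * (X 0 * X 1) + C g * X 1 ^ 2) := by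
  obtain ⟨b, c, hl⟩ := exists_linear_two (homogeneousComponent_isHomogeneous 1 f)
  obtain ⟨d, e, g, hq⟩ := exists_quadratic_two (homogeneousComponent_isHomogeneous 2 f)
  refine ⟨coeff 0 f, b, c, d, e, g, ?_⟩
  rw [add_assoc (C _), ← hl, ← hq, ← homogeneousComponent_zero]
  conv_lhs => rw [← sum_homogeneousComponent_of_le h]
  rw [Finset.sum_range_succ, Finset.sum_range_succ, Finset.sum_range_one]

lemma nodeX_sub_ne_zero {b m₁ m₂ : ℂ} (h : Admissible b m₁ m₂) : nodeX b m₁ - nodeX b m₂ ≠ 0 := by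
  rw [nodeX, nodeX, div_sub_div _ _ h.hb₁ h.hb₂]
  refine div_ne_zero ?_ (mul_ne_zero h.hb₁ h.hb₂)
  convert h.h₁₂ using 1
  ring

/-- The intersection points of the standard configuration do not lie on a conic. -/
lemma eq_zero_of_conic_std {b m₁ m₂ : ℂ} (h : Admissible b m₁ m₂) {q : MvPolynomial (Fin 2) ℂ}
    (hq : q.totalDegree ≤ 2) (hC : eval 0 q = 0) (hE : eval ![1, m₁] q = 0) (hF : eval ![1, m₂] q = 0)
    (hH : eval ![nodeX b m₁, m₁ * nodeX b m₁] q = 0) (hI : eval ![nodeX b m₂, m₂ * nodeX b m₂] q = 0)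
    (hJ : eval ![1, 1 / (1 + b)] q = 0) : q = 0 := by
  obtain ⟨a, c, d, e, f, g, rfl⟩ := exists_of_totalDegree_le_two hq
  have k1 : 1 / (1 + b) - m₁ ≠ 0 := by
    rw [div_sub' h.hb]
    exact div_ne_zero (fun h0 => h.hc₁ (by linear_combination -h0)) h.hb
  have k2 : 1 / (1 + b) - m₂ ≠ 0 := by
    rw [div_sub' h.hb]
    exact div_ne_zero (fun h0 => h.hc₂ (by linear_combination -h0)) h.hb
  generalize 1 / (1 + b) = j at hJ k1 k2
  have hd1 : nodeX b m₁ ≠ 0 := div_ne_zero h.h₁ h.hb₁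
  have hd2 : nodeX b m₂ ≠ 0 := div_ne_zero h.h₂ h.hb₂
  have e1 : nodeX b m₁ - 1 ≠ 0 := by
    rw [nodeX, div_sub_one h.hb₁]
    exact div_ne_zero (by convert h.hc₁ using 1; ring) h.hb₁
  have e2 : nodeX b m₂ - 1 ≠ 0 := by
    rw [nodeX, div_sub_one h.hb₂]
    exact div_ne_zero (by convert h.hc₂ using 1; ring) h.hb₂
  generalize nodeX b m₁ = x₁ at *
  generalize nodeX b m₂ = x₂ at *
  simp at hC hE hF hH hI hJ
  subst hC
  -- A conic through `E`, `F`, `J` on the line `x = 1` contains that line. The residual line would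
  -- pass through the origin, `H` and `I`, which are not collinear.
  have hg : g = 0 := by
    refine (mul_eq_zero.1 (?_ : ((m₁ - m₂) * (j - m₁) * (j - m₂)) * g = 0)).resolve_left
      (mul_ne_zero (mul_ne_zero h.h₁₂ k1) k2)
    linear_combination (m₁ - m₂) * hJ - (j - m₂) * hE + (j - m₁) * hF
  subst hg
  have hf : f = -d := by
    refine eq_neg_of_add_eq_zero_left ((mul_eq_zero.1 (?_ : (m₁ - m₂) * _ = 0)).resolve_left h.h₁₂)
    linear_combination hE - hF
  subst hf
  have he : e = -c := by linear_combination hE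
  subst he
  have h1 : c + d * m₁ = 0 := by
    refine (mul_eq_zero.1 (?_ : (x₁ * (x₁ - 1)) * _ = 0)).resolve_left (mul_ne_zero hd1 e1)
    linear_combination -hH
  have h2 : c + d * m₂ = 0 := by
    refine (mul_eq_zero.1 (?_ : (x₂ * (x₂ - 1)) * _ = 0)).resolve_left (mul_ne_zero hd2 e2)
    linear_combination -hI
  have hd : d = 0 := by
    refine (mul_eq_zero.1 (?_ : (m₁ - m₂) * _ = 0)).resolve_left h.h₁₂
    linear_combination h1 - h2
  subst hd
  have hc : c = 0 := by linear_combination h1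
  subst hc
  simp

lemma prime_line (m : ℂ) : Prime (X 1 - C m * X 0 : MvPolynomial (Fin 2) ℂ) := by
  refine Irreducible.prime ?_
  have : (X 1 - C m * X 0 : MvPolynomial (Fin 2) ℂ) = 1 * X 1 + (-(C m * X 0)) := by ring
  rw [this]
  refine irreducible_mul_X_add _ _ _ one_ne_zero (by simp) ?_ isRelPrime_one_left
  rw [vars_neg]
  intro h
  have := vars_mul _ _ h
  simp [vars_C, vars_X] at this

lemma prime_conic (b : ℂ) : Prime (X 1 * (1 + C b * X 0) - X 0 ^ 2 : MvPolynomial (Fin 2) ℂ) := by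
  refine Irreducible.prime ?_
  have h : (X 1 * (1 + C b * X 0) - X 0 ^ 2 : MvPolynomial (Fin 2) ℂ) =
      (1 + C b * X 0) * X 1 + (-X 0 ^ 2) := by ring
  have hne : (1 + C b * X 0 : MvPolynomial (Fin 2) ℂ) ≠ 0 := fun h => by
    have := congrArg (eval ![0, 1]) h
    simp at this
  rw [h]
  refine irreducible_mul_X_add _ _ 1 hne ?_ ?_ ?_
  · intro h1
    have := vars_add_subset _ _ h1
    rw [Finset.mem_union] at this
    rcases this with h2 | h2
    · simp at h2
    · have := vars_mul _ _ h2
      simp [vars_C, vars_X] at this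
  · intro h1
    rw [vars_neg] at h1
    have := vars_pow _ _ h1
    simp [vars_X] at this
  · intro d h1 h2
    rw [dvd_neg] at h2
    obtain ⟨i, -, hi⟩ := (dvd_prime_pow (MvPolynomial.X_prime (R := ℂ) (i := (0 : Fin 2))) 2).1 h2
    rcases i with _ | i
    · simpa using hi.isUnit_iff
    · obtain ⟨g, hg⟩ : (X 0 : MvPolynomial (Fin 2) ℂ) ∣ 1 + C b * X 0 :=
        ((dvd_pow_self _ i.succ_ne_zero).trans hi.symm.dvd).trans h1
      have := congrArg (eval ![0, 1]) hg
      simp at this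

lemma not_dvd_of_eval {f g : MvPolynomial (Fin 2) ℂ} (p : Fin 2 → ℂ) (hf : eval p f = 0)
    (hg : eval p g ≠ 0) : ¬ f ∣ g := by
  rintro ⟨k, rfl⟩
  exact hg (by rw [map_mul, hf, zero_mul])

lemma totalDegree_line (m : ℂ) : (X 1 - C m * X 0 : MvPolynomial (Fin 2) ℂ).totalDegree = 1 :=
  ((isHomogeneous_X _ _).sub (isHomogeneous_C_mul_X _ _)).totalDegree (prime_line m).ne_zero

lemma two_le_totalDegree_conic (b : ℂ) :
    2 ≤ (X 1 * (1 + C b * X 0) - X 0 ^ 2 : MvPolynomial (Fin 2) ℂ).totalDegree := by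
  have h : expo 2 0 ∈ (X 1 * (1 + C b * X 0) - X 0 ^ 2 : MvPolynomial (Fin 2) ℂ).support := by
    have e : (X 1 * (1 + C b * X 0) - X 0 ^ 2 : MvPolynomial (Fin 2) ℂ) =
      C 1 * (X 0 ^ 0 * X 1 ^ 1) + C b * (X 0 ^ 1 * X 1 ^ 1) - C 1 * (X 0 ^ 2 * X 1 ^ 0) := by
      simp; ring
    rw [mem_support_iff, e, coeff_sub, coeff_add, coeff_expo_monomial, coeff_expo_monomial,
      coeff_expo_monomial]
    norm_num
  refine le_trans ?_ (le_totalDegree h)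
  rw [Finsupp.sum_fintype _ _ (fun _ => rfl)]
  simp

/-- For a form `P dx`, each integral curve divides its own `y`-derivative times `P`. The equations
of `L₁`, `L₂` and the conic are prime and do not divide these derivatives, so their product, of
degree 4, divides the cubic `P`. -/
lemma eq_zero_of_snd_eq_zero {b m₁ m₂ : ℂ} (h : Admissible b m₁ m₂) {ω : PolyForm ℂ}
    (hω : ω ∈ (stdConfig b m₁ m₂).forms 3) (h0 : ω.2 = 0) : ω.1 = 0 := by
  obtain ⟨hd, -, ⟨K₁, hK₁⟩, ⟨K₂, hK₂⟩, -, -, ⟨K₅, hK₅⟩⟩ := hω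
  obtain ⟨e1, e2, e3, e4, e5⟩ := affinePart_std b m₁ m₂
  rw [e1] at hK₁
  rw [e2] at hK₂
  rw [e5] at hK₅
  simp [IsCofactor, dWedge, h0] at hK₁ hK₂ hK₅
  obtain ⟨R, hR⟩ : (X 1 - C m₁ * X 0) ∣ ω.1 := ⟨-K₁, by linear_combination -hK₁⟩
  have hl : (X 1 - C m₂ * X 0) ∣ (X 1 - C m₁ * X 0) * R := ⟨-K₂, by linear_combination -hR - hK₂⟩
  obtain ⟨S, hS⟩ := ((prime_line m₂).dvd_or_dvd hl).resolve_left
    (not_dvd_of_eval ![1, m₂] (by simp) (by simpa using fun h0 => h.h₁₂ (by linear_combination -h0)))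
  subst hS
  by_contra hne
  have hS0 : S ≠ 0 := by
    rintro rfl
    exact hne (by rw [hR]; ring)
  have hdS : S.totalDegree ≤ 1 := by
    rw [hR, totalDegree_mul_of_isDomain (prime_line m₁).ne_zero (mul_ne_zero (prime_line m₂).ne_zero hS0),
      totalDegree_mul_of_isDomain (prime_line m₂).ne_zero hS0, totalDegree_line, totalDegree_line] at hd
    omega
  have hq : (X 1 * (1 + C b * X 0) - X 0 ^ 2) ∣
      ((1 + C b * X 0) * ((X 1 - C m₁ * X 0) * (X 1 - C m₂ * X 0))) * S := by
    refine ⟨-K₅, ?_⟩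
    rw [hR] at hK₅
    linear_combination -hK₅
  have k1 : (1 + b)⁻¹ - m₁ ≠ 0 := fun h0 => h.hc₁ (by
    rw [← sub_eq_zero.1 h0]; have := h.hb; field_simp; ring)
  have k2 : (1 + b)⁻¹ - m₂ ≠ 0 := fun h0 => h.hc₂ (by
    rw [← sub_eq_zero.1 h0]; have := h.hb; field_simp; ring)
  -- The witness is `J`, which lies on the conic but on none of the other factors.
  have hSq := ((prime_conic b).dvd_or_dvd hq).resolve_left
    (not_dvd_of_eval ![1, (1 + b)⁻¹] (by have := h.hb; simp; field_simp; ring)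
      (by simpa using ⟨h.hb, k1, k2⟩))
  obtain ⟨T, rfl⟩ := hSq
  rw [totalDegree_mul_of_isDomain (prime_conic b).ne_zero (right_ne_zero_of_mul hS0)] at hdS
  have := two_le_totalDegree_conic b
  omega

/-- The cubic forms having the standard configuration as integral curves. -/
lemma exists_smul_stdForm {b m₁ m₂ : ℂ} (h : Admissible b m₁ m₂) {ω : PolyForm ℂ}
    (hω : ω ∈ (stdConfig b m₁ m₂).forms 3) : ∃ k : ℂ, ω = k • stdForm b m₁ m₂ := by
  -- By `eq_zero_of_snd_eq_zero` the form is determined by its dy-component.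
  suffices hk : ∃ k : ℂ, ω.2 = C k * (stdForm b m₁ m₂).2 by
    obtain ⟨k, hk⟩ := hk
    refine ⟨k, ?_⟩
    have h2 : (ω - k • stdForm b m₁ m₂).2 = 0 := by
      rw [Prod.snd_sub, Prod.smul_snd, hk, smul_eq_C_mul, sub_self]
    have h1 := eq_zero_of_snd_eq_zero h
      (Submodule.sub_mem _ hω (Submodule.smul_mem _ k (stdForm_mem_forms b m₁ m₂))) h2
    exact sub_eq_zero.1 (Prod.ext h1 h2)
  obtain ⟨-, hd, ⟨K₁, hK₁⟩, ⟨K₂, hK₂⟩, ⟨K₃, hK₃⟩, ⟨K₄, hK₄⟩, ⟨K₅, hK₅⟩⟩ := hω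
  obtain ⟨e1, e2, e3, e4, e5⟩ := affinePart_std b m₁ m₂
  rw [e1] at hK₁
  rw [e2] at hK₂
  rw [e3] at hK₃
  rw [e4] at hK₄
  rw [e5] at hK₅
  simp [IsCofactor, dWedge] at hK₁ hK₂ hK₃ hK₄ hK₅
  -- The vertical lines `x = 1` and `x = 0` both divide the dy-component; the quotient `l` has
  -- degree at most 1.
  have hx : (X 0 : MvPolynomial (Fin 2) ℂ) ∣ (X 0 - 1) * K₃ := ⟨K₄, by rw [← hK₃, hK₄]⟩
  obtain ⟨l, rfl⟩ := (MvPolynomial.X_prime.dvd_or_dvd hx).resolve_left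
    (not_dvd_of_eval 0 (by simp) (by simp))
  have hl : l.totalDegree ≤ 1 := by
    by_cases hl0 : l = 0
    · simp [hl0]
    have hs : expo 2 0 ∈ ((X 0 - 1) * X 0 : MvPolynomial (Fin 2) ℂ).support := by
      have e : ((X 0 - 1) * X 0 : MvPolynomial (Fin 2) ℂ) =
        C 1 * (X 0 ^ 2 * X 1 ^ 0) - C 1 * (X 0 ^ 1 * X 1 ^ 0) := by
        simp; ring
      rw [mem_support_iff, e, coeff_sub, coeff_expo_monomial, coeff_expo_monomial]
      norm_num
    have h2 := le_totalDegree hs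
    rw [Finsupp.sum_fintype _ _ (fun _ => rfl), Fin.sum_univ_two, expo_zero, expo_one] at h2
    have h0 : ((X 0 - 1) * X 0 : MvPolynomial (Fin 2) ℂ) ≠ 0 := fun h0 => by simp [h0] at hs
    rw [hK₃, ← mul_assoc, totalDegree_mul_of_isDomain h0 hl0] at hd
    omega
  obtain ⟨a, c, d, rfl⟩ := exists_of_totalDegree_le_one hl
  -- A form vanishes where two of its integral curves cross transversally. So `l` vanishes at `H`
  -- and `I`, whose abscissas differ, and is unique up to a factor.
  have node : ∀ (m : ℂ) (K : MvPolynomial (Fin 2) ℂ), m ≠ 0 → 1 - b * m ≠ 0 → (1 + b) * m - 1 ≠ 0 →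
      -(C m * ω.2) - ω.1 = (X 1 - C m * X 0) * K →
      a + c * nodeX b m + d * (m * nodeX b m) = 0 := by
    intro m K hm hbm hcm hK
    have hx : nodeX b m * (1 - b * m) = m := div_mul_cancel₀ _ hbm
    have hx0 : nodeX b m ≠ 0 := div_ne_zero hm hbm
    have hx1 : nodeX b m - 1 ≠ 0 := by
      rw [nodeX, div_sub_one hbm]
      exact div_ne_zero (by convert hcm using 1; ring) hbm
    generalize nodeX b m = x at *
    have f1 := congrArg (eval ![x, m * x]) hK
    have f2 := congrArg (eval ![x, m * x]) hK₅
    have f3 := congrArg (eval ![x, m * x]) hK₃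
    simp at f1 f2 f3
    have hz : m * x * (1 + b * x) - x ^ 2 = 0 := by linear_combination -x * hx
    rw [hz] at f2
    have hq : eval ![x, m * x] ω.2 = 0 := by
      refine (mul_eq_zero.1 (?_ : m * _ = 0)).resolve_left hm
      linear_combination -f2 + (1 + b * x) * f1 - 2 * eval ![x, m * x] ω.2 * hx
    rw [hq] at f3
    exact ((mul_eq_zero.1 ((mul_eq_zero.1 f3.symm).resolve_left hx1)).resolve_left hx0)
  have n1 := node m₁ K₁ h.h₁ h.hb₁ h.hc₁ (by linear_combination hK₁)
  have n2 := node m₂ K₂ h.h₂ h.hb₂ h.hc₂ (by linear_combination hK₂)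
  have hx₁ : nodeX b m₁ * (1 - b * m₁) = m₁ := div_mul_cancel₀ _ h.hb₁
  have hx₂ : nodeX b m₂ * (1 - b * m₂) = m₂ := div_mul_cancel₀ _ h.hb₂
  have hx₁₂ := nodeX_sub_ne_zero h
  generalize nodeX b m₁ = x₁ at *
  generalize nodeX b m₂ = x₂ at *
  have hc : c = -(d * (m₁ + m₂ - b * (m₁ * m₂))) := by
    refine eq_neg_of_add_eq_zero_left ((mul_eq_zero.1 (?_ : (x₁ - x₂) * _ = 0)).resolve_left hx₁₂)
    linear_combination n1 - n2 + d * m₂ * hx₁ - d * m₁ * hx₂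
  have ha : a = d * (m₁ * m₂) := by
    rw [hc] at n1
    linear_combination n1 + d * m₂ * hx₁
  refine ⟨d, ?_⟩
  rw [hK₃, ha, hc]
  simp [stdForm]
  ring

end Uniqueness

/-! ### Transport to arbitrary special configurations. -/

section Special

lemma isAlgebraicIntegralCurve_C_mul {ω : PolyForm ℂ} {G : MvPolynomial (Fin 2) ℂ} {a : ℂ} (ha : a ≠ 0) :
    IsAlgebraicIntegralCurve ω (C a * G) ↔ IsAlgebraicIntegralCurve ω G := by
  constructor
  · rintro ⟨K, hK⟩
    refine ⟨K, ?_⟩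
    have := hK.C_mul a⁻¹
    rwa [← mul_assoc, ← map_mul, inv_mul_cancel₀ ha, map_one, one_mul] at this
  · rintro ⟨K, hK⟩
    exact ⟨K, hK.C_mul a⟩

lemma affinePart_C_mul (a : ℂ) (f : MvPolynomial (Fin 3) ℂ) :
    affinePart (C a * f) = C a * affinePart f := by simp [affinePart]

lemma Configuration.forms_scale {l : Fin 5 → ℂ} (hl : ∀ i, l i ≠ 0) (c : Configuration) (d : ℕ) :
    (c.scale l).forms d = c.forms d := by
  ext ω
  change _ ∧ _ ∧ _ ↔ _ ∧ _ ∧ _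
  simp only [HasIntegralCurves, scale, affinePart_C_mul, isAlgebraicIntegralCurve_C_mul (hl _)]

lemma Configuration.Γ_scale (l : Fin 5 → ℂ) (c : Configuration) :
    (c.scale l).Γ = C (l 0 * l 1 * l 2 * l 4) * c.Γ := by
  simp only [Γ, scale, affinePart_C_mul, map_mul]
  ring

/-- Every special configuration is the standard one up to an affine change of coordinates, and so are
the cubic forms having its curves as integral curves. -/
theorem exists_comap_standard {c : Configuration} {P D E F H I J : Fin 2 → ℂ}
    (h : c.IsSpecial P D E F H I J) :
    ∃ (p : Fin 2 → ℂ) (M : Matrix (Fin 2) (Fin 2) ℂ) (b m₁ m₂ : ℂ) (l : Fin 5 → ℂ), M.det ≠ 0 ∧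
      (∀ i, l i ≠ 0) ∧ Admissible b m₁ m₂ ∧ c = ((stdConfig b m₁ m₂).scale l).comap p M := by
  obtain ⟨p, M, b, m₁, m₂, l, hM, hl, had, hc, -⟩ := exists_standard h
  exact ⟨invShift p M, M⁻¹, b, m₁, m₂, l, det_inv_ne_zero hM, hl, had, by
    rw [← hc, Configuration.comap_inv_comap hM]⟩

lemma exists_smul_pullback {b m₁ m₂ : ℂ} {l : Fin 5 → ℂ} {p : Fin 2 → ℂ} {M : Matrix (Fin 2) (Fin 2) ℂ}
    (hM : M.det ≠ 0) (hl : ∀ i, l i ≠ 0) (had : Admissible b m₁ m₂) {ω : PolyForm ℂ}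
    (hω : ω ∈ (((stdConfig b m₁ m₂).scale l).comap p M).forms 3) :
    ∃ k : ℂ, ω = k • pullback p M (stdForm b m₁ m₂) := by
  have h1 := Configuration.forms_comap (p := invShift p M) (M := M⁻¹) hω
  rw [Configuration.comap_inv_comap hM, Configuration.forms_scale hl] at h1
  obtain ⟨k, hk⟩ := exists_smul_stdForm had h1
  exact ⟨k, by rw [← pullback_smul, ← hk, pullback_pullback_inv _ hM]⟩

lemma pullback_stdForm_mem {b m₁ m₂ : ℂ} {l : Fin 5 → ℂ} (p : Fin 2 → ℂ) (M : Matrix (Fin 2) (Fin 2) ℂ)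
    (hl : ∀ i, l i ≠ 0) :
    pullback p M (stdForm b m₁ m₂) ∈ (((stdConfig b m₁ m₂).scale l).comap p M).forms 3 :=
  Configuration.forms_comap (by rw [Configuration.forms_scale hl]; exact stdForm_mem_forms b m₁ m₂)

lemma pullback_ne_zero {p : Fin 2 → ℂ} {M : Matrix (Fin 2) (Fin 2) ℂ} (hM : M.det ≠ 0) {ω : PolyForm ℂ}
    (h : ω ≠ 0) : pullback p M ω ≠ 0 := fun h0 => h (by
  rw [← pullback_inv_pullback (p := p) ω hM, h0]
  ext1 <;> simp [pullback_fst, pullback_snd])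

/-- Every special configuration: the six points do not lie on a conic. -/
theorem eq_zero_of_conic {c : Configuration} {P D E F H I J : Fin 2 → ℂ} (h : c.IsSpecial P D E F H I J)
    {q : MvPolynomial (Fin 2) ℂ} (hq : q.totalDegree ≤ 2)
    (hv : ∀ v ∈ [P, E, F, H, I, J], eval v q = 0) : q = 0 := by
  obtain ⟨p, M, b, m₁, m₂, l, hM, hl, had, -, rfl, rfl, rfl, rfl, rfl, rfl⟩ := exists_standard h
  simp only [List.mem_cons, List.not_mem_nil, or_false, forall_eq_or_imp, forall_eq, ← eval_affSubst] at hv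
  obtain ⟨k1, k2, k3, k4, k5, k6⟩ := hv
  have := eq_zero_of_conic_std had ((totalDegree_affSubst_le q).trans hq) k1 k2 k3 k4 k5 k6
  exact affSubst_injective hM (by rw [this, map_zero])

theorem finrank_forms {c : Configuration} {P D E F H I J : Fin 2 → ℂ} (h : c.IsSpecial P D E F H I J) :
    Module.finrank ℂ (c.forms 3) = 1 := by
  obtain ⟨p, M, b, m₁, m₂, l, hM, hl, had, rfl⟩ := exists_comap_standard h
  refine (finrank_eq_one_iff_of_nonzero' ⟨_, pullback_stdForm_mem p M hl⟩ ?_).2 ?_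
  · intro h0
    exact pullback_ne_zero hM (stdForm_ne_zero b m₁ m₂) (congrArg Subtype.val h0)
  · rintro ⟨ω, hω⟩
    obtain ⟨k, hk⟩ := exists_smul_pullback hM hl had hω
    exact ⟨k, Subtype.ext hk.symm⟩

lemma IsCofactor.smul {ω : PolyForm ℂ} {G K : MvPolynomial (Fin 2) ℂ} (h : IsCofactor ω G K) (k : ℂ) :
    IsCofactor (k • ω) G (C k * K) := by
  simp only [IsCofactor, dWedge, Prod.smul_fst, Prod.smul_snd, smul_eq_C_mul] at *
  linear_combination C k * h

lemma cofactor_Γ {c : Configuration} {ω : PolyForm ℂ} (h : c.HasIntegralCurves ω) :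
    IsAlgebraicIntegralCurve ω c.Γ := by
  obtain ⟨⟨_, h1⟩, ⟨_, h2⟩, ⟨_, h3⟩, -, ⟨_, h5⟩⟩ := h
  exact ⟨_, ((h1.mul h2).mul h3).mul h5⟩

lemma L₄_comap_scale {b m₁ m₂ : ℂ} (l : Fin 5 → ℂ) (p : Fin 2 → ℂ) (M : Matrix (Fin 2) (Fin 2) ℂ) :
    affinePart (((stdConfig b m₁ m₂).scale l).comap p M).L₄ =
      C (l 3) * affSubst p M (affinePart (stdConfig b m₁ m₂).L₄) := by
  have hC : affSubst p M (C (l 3)) = C (l 3) := by simp [affSubst]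
  rw [← hC, ← map_mul, ← affinePart_C_mul, ← affinePart_projSubst]
  rfl

lemma Γ_comap_scale {b m₁ m₂ : ℂ} (l : Fin 5 → ℂ) (p : Fin 2 → ℂ) (M : Matrix (Fin 2) (Fin 2) ℂ) :
    (((stdConfig b m₁ m₂).scale l).comap p M).Γ =
      C (l 0 * l 1 * l 2 * l 4) * affSubst p M (stdConfig b m₁ m₂).Γ := by
  rw [Configuration.Γ_comap, Configuration.Γ_scale, map_mul]
  congr 1
  simp [affSubst]

lemma L₄_std_ne_zero (b m₁ m₂ : ℂ) : affinePart (stdConfig b m₁ m₂).L₄ ≠ 0 := by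
  rw [(affinePart_std b m₁ m₂).2.2.2.1]
  exact X_ne_zero 0

lemma Γ_std_ne_zero (b m₁ m₂ : ℂ) : (stdConfig b m₁ m₂).Γ ≠ 0 := fun h => by
  obtain ⟨e1, e2, e3, e4, e5⟩ := affinePart_std b m₁ m₂
  rw [Configuration.Γ, e1, e2, e3, e5] at h
  have := congrArg (eval ![0, 1]) h
  simp at this

lemma L₄_Γ_ne_zero {c : Configuration} {P D E F H I J : Fin 2 → ℂ} (h : c.IsSpecial P D E F H I J) :
    affinePart c.L₄ ≠ 0 ∧ c.Γ ≠ 0 := by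
  obtain ⟨p, M, b, m₁, m₂, l, hM, hl, had, rfl⟩ := exists_comap_standard h
  rw [L₄_comap_scale, Γ_comap_scale]
  have hi : ∀ f, f ≠ 0 → affSubst p M f ≠ 0 := fun f hf h0 =>
    hf (affSubst_injective hM (by rw [h0, map_zero]))
  exact ⟨mul_ne_zero (C_ne_zero.2 (hl _)) (hi _ (L₄_std_ne_zero _ _ _)),
    mul_ne_zero (C_ne_zero.2 (by simp [hl])) (hi _ (Γ_std_ne_zero _ _ _))⟩

/-- The cofactor identity. -/
theorem cofactor_identity {c : Configuration} {P D E F H I J : Fin 2 → ℂ} (h : c.IsSpecial P D E F H I J)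
    {ω : PolyForm ℂ} (hω : ω ∈ c.forms 3) {K₄ K : MvPolynomial (Fin 2) ℂ}
    (h₄ : IsCofactor ω (affinePart c.L₄) K₄) (hΓ : IsCofactor ω c.Γ K) : K₄ - K + dForm ω = 0 := by
  obtain ⟨hne₄, hneΓ⟩ := L₄_Γ_ne_zero h
  obtain ⟨p, M, b, m₁, m₂, l, hM, hl, had, rfl⟩ := exists_comap_standard h
  obtain ⟨k, rfl⟩ := exists_smul_pullback hM hl had hω
  obtain ⟨S₄, hS₄⟩ := (hasIntegralCurves_std b m₁ m₂).2.2.2.1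
  obtain ⟨S, hS⟩ := cofactor_Γ (hasIntegralCurves_std b m₁ m₂)
  have e₄ := h₄.unique hne₄ (by
    rw [L₄_comap_scale]; exact (hS₄.pullback (p := p) (M := M)).smul k |>.C_mul _)
  have eΓ := hΓ.unique hneΓ (by
    rw [Γ_comap_scale]; exact (hS.pullback (p := p) (M := M)).smul k |>.C_mul _)
  -- All three terms of the identity acquire the same factor `k * M.det` under pullback and scaling.
  have hd : dForm (k • pullback p M (stdForm b m₁ m₂)) =
      C k * (C M.det * affSubst p M (dForm (stdForm b m₁ m₂))) := by
    rw [← dForm_pullback]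
    simp only [dForm, Prod.smul_fst, Prod.smul_snd, smul_eq_C_mul, Derivation.leibniz, pderiv_C, smul_eq_mul]
    ring
  have := congrArg (affSubst p M) (cofactor_identity_std hS₄ hS)
  rw [map_zero, map_add, map_sub] at this
  rw [e₄, eΓ, hd]
  linear_combination C k * C M.det * this

theorem isRationalIntegratingFactor_of_isSpecial {c : Configuration} {P D E F H I J : Fin 2 → ℂ}
    (h : c.IsSpecial P D E F H I J) {ω : PolyForm ℂ} (hω : ω ∈ c.forms 3) :
    IsRationalIntegratingFactor (affinePart c.L₄) c.Γ ω := by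
  obtain ⟨hne₄, hneΓ⟩ := L₄_Γ_ne_zero h
  obtain ⟨K₄, h₄⟩ := hω.2.2.2.2.2.1
  obtain ⟨K, hK⟩ := cofactor_Γ hω.2.2
  exact isRationalIntegratingFactor_of_cofactors hne₄ hneΓ h₄ hK (cofactor_identity h hω h₄ hK)

end Special

/-! ### Directional derivatives of polynomials. -/

section DirectionalDerivative

variable {k σ : Type} [CommRing k] [Fintype σ] (a v : σ → k) (f g : MvPolynomial σ k)

lemma dirDeriv_add : dirDeriv a v (f + g) = dirDeriv a v f + dirDeriv a v g := by
  simp only [dirDeriv, map_add, add_mul, Finset.sum_add_distrib]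

lemma dirDeriv_neg : dirDeriv a v (-f) = -dirDeriv a v f := by
  simp only [dirDeriv, map_neg, neg_mul, Finset.sum_neg_distrib]

lemma dirDeriv_sub : dirDeriv a v (f - g) = dirDeriv a v f - dirDeriv a v g := by
  rw [sub_eq_add_neg, dirDeriv_add, dirDeriv_neg, sub_eq_add_neg]

lemma dirDeriv_mul : dirDeriv a v (f * g) = eval a f * dirDeriv a v g + dirDeriv a v f * eval a g := by
  simp only [dirDeriv, Derivation.leibniz, smul_eq_mul, map_add, map_mul, Finset.mul_sum, Finset.sum_mul,
    ← Finset.sum_add_distrib]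
  exact Finset.sum_congr rfl fun i _ => by ring

lemma dirDeriv_C (c : k) : dirDeriv a v (C c) = 0 := by simp [dirDeriv]

lemma dirDeriv_zero : dirDeriv a v 0 = 0 := by simp [dirDeriv]

lemma dirDeriv_one : dirDeriv a v 1 = 0 := by rw [← C_1, dirDeriv_C]

lemma dirDeriv_ofNat (n : ℕ) [n.AtLeastTwo] : dirDeriv a v (OfNat.ofNat n) = 0 := by
  rw [← map_ofNat (C : k →+* MvPolynomial σ k) n, dirDeriv_C]

lemma dirDeriv_two : dirDeriv a v (2 : MvPolynomial σ k) = 0 := dirDeriv_ofNat a v 2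

lemma dirDeriv_X (i : σ) : dirDeriv a v (X i) = v i := by
  classical
  rw [dirDeriv, Finset.sum_eq_single i]
  · simp
  · intro j _ hj
    rw [pderiv_X_of_ne (Ne.symm hj)]; simp
  · simp

lemma dirDeriv_sq : dirDeriv a v (f ^ 2) = 2 * (eval a f * dirDeriv a v f) := by
  rw [sq, dirDeriv_mul]; ring

/-- Values of a polynomial at constants are killed if its coefficients are. -/
lemma dirDeriv_eval_eq_zero {F : MvPolynomial (Fin 2) (MvPolynomial σ k)}
    (h : ∀ m, dirDeriv a v (coeff m F) = 0) (p : Fin 2 → k) :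
    dirDeriv a v (eval (fun i => C (p i)) F) = 0 := by
  rw [eval_eq]
  refine Finset.sum_induction _ (fun f => dirDeriv a v f = 0) (fun f g hf hg => ?_) (dirDeriv_zero a v)
    fun m _ => ?_
  · rw [dirDeriv_add, hf, hg, add_zero]
  · simp_rw [← map_pow, ← map_prod]
    rw [dirDeriv_mul, dirDeriv_C, h, zero_mul, mul_zero, add_zero]

end DirectionalDerivative

/-! ### Vanishing ideals of images of polynomial maps. -/

section VanishingIdeal

variable {σ τ : Type} (φ : MvPolynomial σ ℂ →ₐ[ℂ] MvPolynomial τ ℂ) {V : Set (σ → ℂ)}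

lemma eval_algHom (t : τ → ℂ) (f : MvPolynomial σ ℂ) :
    eval t (φ f) = aeval (fun i => eval t (φ (X i))) f := by
  have : (aeval t : MvPolynomial τ ℂ →ₐ[ℂ] ℂ).comp φ = aeval (fun i => eval t (φ (X i))) :=
    MvPolynomial.algHom_ext fun i => by simp
  have := congrArg (fun ψ => ψ f) this
  simpa [MvPolynomial.coe_aeval_eq_eval] using this

/-- Together with `vanishingIdeal_le_ker` this determines the vanishing ideal of any set between the
image of a nonempty open set and the whole image of a polynomial map. Being a kernel, it is prime.
-/
lemma ker_le_vanishingIdeal (h : ∀ v ∈ V, ∃ t, v = fun i => eval t (φ (X i))) :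
    RingHom.ker φ ≤ vanishingIdeal ℂ V := by
  intro f hf
  rw [mem_vanishingIdeal_iff]
  intro v hv
  obtain ⟨t, rfl⟩ := h v hv
  rw [← eval_algHom, (RingHom.mem_ker).1 hf, map_zero]

/-- The product `φ f * g` vanishes at every point, on `g = 0` trivially and elsewhere by assumption.
-/
lemma vanishingIdeal_le_ker {g : MvPolynomial τ ℂ} (hg : g ≠ 0)
    (h : ∀ t, eval t g ≠ 0 → (fun i => eval t (φ (X i))) ∈ V) : vanishingIdeal ℂ V ≤ RingHom.ker φ := by
  intro f hf
  rw [mem_vanishingIdeal_iff] at hf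
  refine (mul_eq_zero.1 (?_ : φ f * g = 0)).resolve_right hg
  refine MvPolynomial.funext fun t => ?_
  rw [map_mul, map_zero]
  by_cases h0 : eval t g = 0
  · rw [h0, mul_zero]
  · rw [eval_algHom, hf _ (h t h0), zero_mul]

end VanishingIdeal

/-! ### The ten-parameter family of special forms. -/

section GenericForm

variable {A B : Type} [CommRing A] [CommRing B]

/-- Base change of differential forms. -/
def mapForm (e : A →+* B) (ω : PolyForm A) : PolyForm B := (MvPolynomial.map e ω.1, MvPolynomial.map e ω.2)

/-- The substitution of an affine map over a general ring. -/
def genSubst (p : Fin 2 → A) (M : Matrix (Fin 2) (Fin 2) A) :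
    MvPolynomial (Fin 2) A →ₐ[A] MvPolynomial (Fin 2) A :=
  aeval fun i => C (p i) + C (M i 0) * X 0 + C (M i 1) * X 1

/-- The pullback under an affine map over a general ring. -/
def genPullback (p : Fin 2 → A) (M : Matrix (Fin 2) (Fin 2) A) (ω : PolyForm A) : PolyForm A :=
  (C (M 0 0) * genSubst p M ω.1 + C (M 1 0) * genSubst p M ω.2,
   C (M 0 1) * genSubst p M ω.1 + C (M 1 1) * genSubst p M ω.2)

lemma map_genSubst (e : A →+* B) (p : Fin 2 → A) (M : Matrix (Fin 2) (Fin 2) A)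
    (f : MvPolynomial (Fin 2) A) : MvPolynomial.map e (genSubst p M f) =
      genSubst (fun i => e (p i)) (M.map e) (MvPolynomial.map e f) := by
  have := MvPolynomial.map_bind₁ e
    (fun i => (C (p i) + C (M i 0) * X 0 + C (M i 1) * X 1 : MvPolynomial (Fin 2) A)) f
  simp only [map_add, map_mul, MvPolynomial.map_C, MvPolynomial.map_X] at this
  exact this

lemma eval_genSubst (v p : Fin 2 → A) (M : Matrix (Fin 2) (Fin 2) A) (f : MvPolynomial (Fin 2) A) :
    eval v (genSubst p M f) = eval (fun i => p i + M i 0 * v 0 + M i 1 * v 1) f := by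
  rw [genSubst, ← MvPolynomial.coe_aeval_eq_eval, ← MvPolynomial.coe_aeval_eq_eval]
  change aeval v (aeval _ f) = aeval _ f
  rw [← AlgHom.comp_apply, MvPolynomial.comp_aeval]
  congr 2
  ext i
  simp

/-- Base change makes it possible to use polynomial variables as parameters and to specialize the
resulting form to every member of the family. -/
lemma mapForm_genPullback (e : A →+* B) (p : Fin 2 → A) (M : Matrix (Fin 2) (Fin 2) A) (ω : PolyForm A) :
    mapForm e (genPullback p M ω) = genPullback (fun i => e (p i)) (M.map e) (mapForm e ω) := by
  simp [mapForm, genPullback, map_genSubst]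

lemma mapForm_stdForm (e : A →+* B) (b m₁ m₂ : A) :
    mapForm e (stdForm b m₁ m₂) = stdForm (e b) (e m₁) (e m₂) := by
  have h2 : e 2 = 2 := map_ofNat e 2
  simp [mapForm, stdForm, h2]

lemma totalDegree_genSubst_le [Nontrivial A] (p : Fin 2 → A) (M : Matrix (Fin 2) (Fin 2) A)
    (f : MvPolynomial (Fin 2) A) : (genSubst p M f).totalDegree ≤ f.totalDegree := by
  have hX : ∀ i, (C (p i) + C (M i 0) * X 0 + C (M i 1) * X 1 : MvPolynomial (Fin 2) A).totalDegree ≤ 1 :=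
    fun i => totalDegree_add_le' (totalDegree_add_le' (totalDegree_C_le _)
      (totalDegree_C_mul_le _ (totalDegree_X_le _))) (totalDegree_C_mul_le _ (totalDegree_X_le _))
  rw [genSubst, aeval_def, eval₂_eq]
  refine totalDegree_finsetSum_le fun d hd => ?_
  refine (totalDegree_mul _ _).trans ?_
  have h1 : (algebraMap A (MvPolynomial (Fin 2) A) (coeff d f)).totalDegree = 0 := totalDegree_C _
  rw [h1, zero_add]
  refine (totalDegree_finsetProd _ _).trans ((Finset.sum_le_sum fun i _ =>
    (totalDegree_pow _ _).trans (Nat.mul_le_mul_left _ (hX i))).trans ?_)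
  simpa [Finsupp.sum] using le_totalDegree hd

/-- A multiple of the pullback of the standard form, depending on ten parameters. -/
def tenForm (t : Fin 10 → A) : PolyForm A :=
  let η := genPullback ![t 1, t 2] !![t 3, t 4; t 5, t 6] (stdForm (t 7) (t 8) (t 9))
  (C (t 0) * η.1, C (t 0) * η.2)

lemma mapForm_tenForm (e : A →+* B) (t : Fin 10 → A) : mapForm e (tenForm t) = tenForm (fun i => e (t i)) := by
  have h := mapForm_genPullback e ![t 1, t 2] !![t 3, t 4; t 5, t 6] (stdForm (t 7) (t 8) (t 9))
  rw [mapForm_stdForm] at h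
  have hp : (fun i => e (![t 1, t 2] i)) = ![e (t 1), e (t 2)] := by ext i; fin_cases i <;> rfl
  have hM : (!![t 3, t 4; t 5, t 6]).map e = !![e (t 3), e (t 4); e (t 5), e (t 6)] := by
    ext i j; fin_cases i <;> fin_cases j <;> rfl
  rw [hp, hM] at h
  rw [mapForm, tenForm, tenForm, map_mul, map_mul, MvPolynomial.map_C, ← h]
  rfl

lemma totalDegree_tenForm [Nontrivial A] (t : Fin 10 → A) :
    (tenForm t).1.totalDegree ≤ 3 ∧ (tenForm t).2.totalDegree ≤ 3 := by
  have h := totalDegree_stdForm (t 7) (t 8) (t 9)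
  have h' : ∀ f : MvPolynomial (Fin 2) A, f.totalDegree ≤ 3 → ∀ p M, (genSubst p M f).totalDegree ≤ 3 :=
    fun f hf p M => (totalDegree_genSubst_le p M f).trans hf
  exact ⟨totalDegree_C_mul_le _ (totalDegree_add_le' (totalDegree_C_mul_le _ (h' _ h.1 _ _))
      (totalDegree_C_mul_le _ (h' _ h.2 _ _))),
    totalDegree_C_mul_le _ (totalDegree_add_le' (totalDegree_C_mul_le _ (h' _ h.1 _ _))
      (totalDegree_C_mul_le _ (h' _ h.2 _ _)))⟩

lemma tenForm_eq (t : Fin 10 → ℂ) : tenForm t =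
    t 0 • pullback ![t 1, t 2] !![t 3, t 4; t 5, t 6] (stdForm (t 7) (t 8) (t 9)) := by
  ext1 <;> rw [tenForm] <;> simp only [Prod.smul_fst, Prod.smul_snd, smul_eq_C_mul] <;> rfl

/-- The twenty coefficients of a cubic form. -/
def formCoeff (ω : PolyForm A) (i : Fin 2 × CubicExp) : A :=
  coeff (expo i.2.1.1 i.2.1.2) (if i.1 = 0 then ω.1 else ω.2)

lemma formCoeff_mapForm (e : A →+* B) (ω : PolyForm A) (i : Fin 2 × CubicExp) :
    formCoeff (mapForm e ω) i = e (formCoeff ω i) := by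
  unfold formCoeff mapForm
  split_ifs <;> rw [coeff_map]

lemma coeff_cubic (a : CubicExp → A) (i j : ℕ) :
    coeff (expo i j) (∑ e : CubicExp, C (a e) * (X 0 ^ (e.1.1 : ℕ) * X 1 ^ (e.1.2 : ℕ)) :
      MvPolynomial (Fin 2) A) =
    if h : i + j ≤ 3 then a ⟨(⟨i, by omega⟩, ⟨j, by omega⟩), h⟩ else 0 := by
  rw [coeff_sum]
  simp only [coeff_expo_monomial]
  split_ifs with h
  · rw [Finset.sum_eq_single ⟨(⟨i, by omega⟩, ⟨j, by omega⟩), h⟩]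
    · simp
    · rintro ⟨⟨i', j'⟩, h'⟩ - hne
      rw [if_neg]
      rintro ⟨rfl, rfl⟩
      exact hne rfl
    · simp
  · refine Finset.sum_eq_zero fun e _ => if_neg ?_
    rintro ⟨rfl, rfl⟩
    exact h e.2

lemma formCoeff_cubicForm (a : Fin 2 × CubicExp → ℂ) : formCoeff (cubicForm a) = a := by
  ext ⟨k, ⟨⟨i, j⟩, h⟩⟩
  fin_cases k
  · change coeff _ (if (0 : Fin 2) = 0 then _ else _) = _
    rw [if_pos rfl, cubicForm, coeff_cubic, dif_pos h]; rfl
  · change coeff _ (if (1 : Fin 2) = 0 then _ else _) = _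
    rw [if_neg (by simp), cubicForm, coeff_cubic, dif_pos h]; rfl

lemma coeff_expo_eq_zero {f : MvPolynomial (Fin 2) A} {d : ℕ} (h : f.totalDegree ≤ d) {i j : ℕ}
    (hij : d < i + j) : coeff (expo i j) f = 0 := by
  refine coeff_eq_zero_of_totalDegree_lt (lt_of_le_of_lt h ?_)
  have : ∑ k ∈ (expo i j).support, expo i j k = i + j := by
    rw [Finset.sum_subset (Finset.subset_univ _) fun k _ hk => Finsupp.notMem_support_iff.1 hk]
    simp [Fin.sum_univ_two]
  rwa [this]

lemma cubicForm_formCoeff {ω : PolyForm ℂ} (h₁ : ω.1.totalDegree ≤ 3) (h₂ : ω.2.totalDegree ≤ 3) :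
    cubicForm (formCoeff ω) = ω := by
  ext1 <;> ext m <;> rw [← expo_eta m, cubicForm, coeff_cubic] <;> split_ifs with h
  · rfl
  · rw [coeff_expo_eq_zero h₁ (by omega)]
  · rfl
  · rw [coeff_expo_eq_zero h₂ (by omega)]

/-- The parametrization of the family of special forms. -/
def tenParam : MvPolynomial (Fin 2 × CubicExp) ℂ →ₐ[ℂ] MvPolynomial (Fin 10) ℂ :=
  aeval (formCoeff (tenForm X))

lemma eval_tenParam (t : Fin 10 → ℂ) :
    (fun i => eval t (tenParam (X i))) = formCoeff (tenForm t) := by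
  ext i
  rw [tenParam, aeval_X, ← formCoeff_mapForm, mapForm_tenForm]
  simp

lemma cubicForm_eval_tenParam (t : Fin 10 → ℂ) : cubicForm (fun i => eval t (tenParam (X i))) =
    t 0 • pullback ![t 1, t 2] !![t 3, t 4; t 5, t 6] (stdForm (t 7) (t 8) (t 9)) := by
  have h := totalDegree_tenForm t
  rw [eval_tenParam, cubicForm_formCoeff h.1 h.2, tenForm_eq]

lemma scale_one (c : Configuration) : c.scale (fun _ => 1) = c := by
  simp [Configuration.scale]

theorem specialForms_subset {a : Fin 2 × CubicExp → ℂ} (ha : a ∈ specialForms) :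
    ∃ t, a = fun i => eval t (tenParam (X i)) := by
  obtain ⟨-, c, P, D, E, F, H, I, J, hc, hω⟩ := ha
  obtain ⟨p, M, b, m₁, m₂, l, hM, hl, had, rfl⟩ := exists_comap_standard hc
  obtain ⟨k, hk⟩ := exists_smul_pullback hM hl had hω
  refine ⟨![k, p 0, p 1, M 0 0, M 0 1, M 1 0, M 1 1, b, m₁, m₂], ?_⟩
  rw [← formCoeff_cubicForm a, hk, eval_tenParam, tenForm_eq]
  congr 3
  · ext i; fin_cases i <;> rfl
  · ext i j; fin_cases i <;> fin_cases j <;> rfl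

lemma isSpecial_comap {b m₁ m₂ : ℂ} (h : Admissible b m₁ m₂) (p : Fin 2 → ℂ)
    {M : Matrix (Fin 2) (Fin 2) ℂ} (hM : M.det ≠ 0) :
    ∃ P D E F H I J, ((stdConfig b m₁ m₂).comap p M).IsSpecial P D E F H I J := by
  have h := isSpecial_stdConfig h
  generalize (0 : Fin 2 → ℂ) = P at h
  generalize ![(0 : ℂ), 1] = D at h
  generalize ![1, m₁] = E at h
  generalize ![1, m₂] = F at h
  generalize ![nodeX b m₁, m₁ * nodeX b m₁] = H at h
  generalize ![nodeX b m₂, m₂ * nodeX b m₂] = I at h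
  generalize ![1, 1 / (1 + b)] = J at h
  obtain ⟨P', rfl⟩ := affMap_surj (p := p) hM P
  obtain ⟨D', rfl⟩ := affMap_surj (p := 0) hM D
  obtain ⟨E', rfl⟩ := affMap_surj (p := p) hM E
  obtain ⟨F', rfl⟩ := affMap_surj (p := p) hM F
  obtain ⟨H', rfl⟩ := affMap_surj (p := p) hM H
  obtain ⟨I', rfl⟩ := affMap_surj (p := p) hM I
  obtain ⟨J', rfl⟩ := affMap_surj (p := p) hM J
  exact ⟨P', D', E', F', H', I', J', h.comap hM⟩

lemma pullback_stdForm_mem' (b m₁ m₂ : ℂ) (p : Fin 2 → ℂ) (M : Matrix (Fin 2) (Fin 2) ℂ) :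
    pullback p M (stdForm b m₁ m₂) ∈ ((stdConfig b m₁ m₂).comap p M).forms 3 :=
  Configuration.forms_comap (stdForm_mem_forms b m₁ m₂)

/-- The product of the conditions on the parameters. -/
def admissiblePoly (b m₁ m₂ : MvPolynomial (Fin 10) ℂ) : MvPolynomial (Fin 10) ℂ :=
  (1 + b) * m₁ * m₂ * (m₁ - m₂) * (1 - b * m₁) * (1 - b * m₂) * ((1 + b) * m₁ - 1) * ((1 + b) * m₂ - 1)

/-- The product of the conditions on the ten parameters. -/
def tenPoly : MvPolynomial (Fin 10) ℂ :=
  X 0 * (X 3 * X 6 - X 4 * X 5) * admissiblePoly (X 7) (X 8) (X 9)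

lemma tenPoly_spec {t : Fin 10 → ℂ} (h : eval t tenPoly ≠ 0) :
    t 0 ≠ 0 ∧ (!![t 3, t 4; t 5, t 6]).det ≠ 0 ∧ Admissible (t 7) (t 8) (t 9) := by
  simp only [tenPoly, admissiblePoly, map_mul, map_sub, map_add, map_one, eval_X, ne_eq, mul_eq_zero,
    not_or] at h
  obtain ⟨⟨h1, h2⟩, ⟨⟨⟨⟨⟨⟨k1, k2⟩, k3⟩, k4⟩, k5⟩, k6⟩, k7⟩, k8⟩ := h
  exact ⟨h1, by rwa [Matrix.det_fin_two_of], k1, k2, k3, k4, k5, k6, k7, k8⟩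

lemma tenParam_mem {t : Fin 10 → ℂ} (h : eval t tenPoly ≠ 0) :
    (fun i => eval t (tenParam (X i))) ∈ specialForms := by
  obtain ⟨h0, hM, had⟩ := tenPoly_spec h
  have hc := cubicForm_eval_tenParam t
  refine ⟨fun h1 => ?_, ?_⟩
  · have : cubicForm (0 : Fin 2 × CubicExp → ℂ) = 0 := by ext1 <;> simp [cubicForm]
    rw [h1, this] at hc
    exact smul_ne_zero h0 (pullback_ne_zero hM (stdForm_ne_zero _ _ _)) hc.symm
  · obtain ⟨P, D, E, F, H, I, J, hs⟩ := isSpecial_comap had ![t 1, t 2] hM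
    refine ⟨_, P, D, E, F, H, I, J, hs, ?_⟩
    rw [hc]
    exact Submodule.smul_mem _ _ (pullback_stdForm_mem' _ _ _ _ _)

theorem vanishingIdeal_specialForms : vanishingIdeal ℂ specialForms = RingHom.ker tenParam := by
  refine le_antisymm (vanishingIdeal_le_ker tenParam (g := tenPoly) (fun h => ?_) fun t => tenParam_mem)
    (ker_le_vanishingIdeal tenParam fun a => specialForms_subset)
  -- The identity map with `b = 1`, `m₁ = 2`, `m₂ = 3` satisfies all conditions.
  have := congrArg (eval ![1, 0, 0, 1, 0, 0, 1, 1, 2, 3]) h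
  simp [tenPoly, admissiblePoly] at this
  norm_num at this

end GenericForm

/-! ### Dimension of the cone of special forms. -/

section Dimension

/-- The differential is taken at the identity map with `b = 0` and slopes `1` and `-1`. This point
is not admissible, because `(1 + b) m₁ = 1`, but any parameter point with injective differential
serves. -/
lemma tenForm_jacobian {v : Fin 10 → ℂ}
    (hv : ∀ i, dirDeriv ![1, 0, 0, 1, 0, 0, 1, 0, 1, -1] v (tenParam (X i)) = 0) : v = 0 := by
  have hc : ∀ (k : Fin 2) (i j : ℕ), dirDeriv ![1, 0, 0, 1, 0, 0, 1, 0, 1, -1] v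
      (coeff (expo i j) (if k = 0 then (tenForm X).1 else (tenForm X).2)) = 0 := by
    intro k i j
    by_cases hij : i + j ≤ 3
    · have := hv (k, ⟨(⟨i, by omega⟩, ⟨j, by omega⟩), hij⟩)
      rwa [tenParam, aeval_X] at this
    · have h := totalDegree_tenForm (X : Fin 10 → MvPolynomial (Fin 10) ℂ)
      rw [coeff_expo_eq_zero (d := 3) (by split_ifs; exacts [h.1, h.2]) (by omega), dirDeriv_zero]
  -- Instead of coefficients, values of the differentiated form at points with coordinates in `{-1,
  -- 0, 1}` are used. The multipliers below solve the resulting linear system.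
  have h1 := fun x y => dirDeriv_eval_eq_zero _ v (F := (tenForm X).1)
    (fun m => by have := hc 0 (m 0) (m 1); rwa [expo_eta, if_pos rfl] at this) ![x, y]
  have h2 := fun x y => dirDeriv_eval_eq_zero _ v (F := (tenForm X).2)
    (fun m => by have := hc 1 (m 0) (m 1); rwa [expo_eta, if_neg (by simp)] at this) ![x, y]
  simp only [tenForm, genPullback, stdForm, map_mul, map_add, map_sub, map_neg, eval_genSubst, eval_C,
    eval_X, map_one, map_ofNat, map_pow, dirDeriv_add, dirDeriv_sub, dirDeriv_mul, dirDeriv_neg,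
    dirDeriv_sq, dirDeriv_X, dirDeriv_C, dirDeriv_one] at h1 h2
  simp [dirDeriv_X, dirDeriv_two] at h1 h2
  ext i
  fin_cases i <;> simp only [Pi.zero_apply] <;> simp only [Fin.zero_eta, Fin.mk_one, Fin.reduceFinMk]
  · linear_combination (19/2) * (h1 0 0) + (3) * (h2 0 0) + (-1) * (h1 (-1) 0) + (-3/4) * (h1 0 (-1)) + (7/2) * (h2 0 (-1)) + (5/4) * (h1 0 1) + (-3) * (h1 1 0) + (3) * (h2 1 0)
  · linear_combination (h2 0 0)
  · linear_combination (-1) * (h1 0 0)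
  · linear_combination (-1) * (h2 0 0) + (-1) * (h2 1 0)
  · linear_combination (-2) * (h2 0 0) + (h2 0 (-1))
  · linear_combination (-5) * (h1 0 0) + (-6) * (h2 0 0) + (-1/2) * (h1 (-1) 0) + (h2 (-1) 0) + (2) * (h2 0 (-1)) + (-1) * (h1 0 1) + (-1/2) * (h1 1 0) + (1/2) * (h1 (-1) (-1))
  · linear_combination (-5) * (h1 0 0) + (1/2) * (h1 (-1) 0) + (1/2) * (h1 0 (-1)) + (-2) * (h2 0 (-1)) + (-1/2) * (h1 0 1) + (3/2) * (h1 1 0) + (-1) * (h2 1 0)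
  · linear_combination (h1 1 0) + (h2 1 0)
  · linear_combination (-33/4) * (h1 0 0) + (-1) * (h2 0 0) + (3/4) * (h2 (-1) 0) + (5/8) * (h1 0 (-1)) + (-5/4) * (h2 0 (-1)) + (-11/8) * (h1 0 1) + (h1 1 0) + (-1/4) * (h2 1 0) + (1/4) * (h1 (-1) (-1))
  · linear_combination (1/4) * (h1 0 0) + (-4) * (h2 0 0) + (-1/2) * (h1 (-1) 0) + (3/4) * (h2 (-1) 0) + (-1/8) * (h1 0 (-1)) + (9/4) * (h2 0 (-1)) + (-1/8) * (h1 0 1) + (-3/2) * (h1 1 0) + (-1/4) * (h2 1 0) + (1/4) * (h1 (-1) (-1))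

theorem ringKrullDim_specialForms :
    ringKrullDim (MvPolynomial (Fin 2 × CubicExp) ℂ ⧸ vanishingIdeal ℂ specialForms) = 10 := by
  rw [vanishingIdeal_specialForms]
  exact ringKrullDim_quotient_ker_of_jacobian tenParam _ fun v => tenForm_jacobian

theorem isPrime_specialForms : (vanishingIdeal ℂ specialForms).IsPrime := by
  rw [vanishingIdeal_specialForms]
  exact RingHom.ker_isPrime _

end Dimension

/-! ### The zero outside the curves and the normalized form there. -/

section NormalFamily

variable {R : Type} [CommRing R]

/-- The quadratic terms of the `dx`-component of the normalized form. -/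
def quadP (b θ ε x y : R) : R :=
  -(θ * (b * θ ^ 2 - 1 - θ * ε)) * x ^ 2 -
    θ * (-3 * (θ - ε) + θ * (1 + b * θ ^ 2 + θ * ε - b)) * (x * y) + (b * θ ^ 3 - (θ - ε)) * y ^ 2

/-- The quadratic terms of the `dy`-component of the normalized form. -/
def quadQ (θ ε x y : R) : R := (1 + θ ^ 2) * (θ + ε) * (x * y)

/-- The cubic terms of the `dx`-component of the normalized form. -/
def cubP (b θ ε x y : R) : R :=
  -(b * θ ^ 2) * x ^ 3 - θ * (1 + b * θ ^ 2 + θ * ε - b) * (x ^ 2 * y) +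
    (b * θ ^ 2 - 2 * θ * (θ - ε)) * (x * y ^ 2) + (θ - ε) * y ^ 3

/-- The cubic terms of the `dy`-component of the normalized form. -/
def cubQ (θ x y : R) : R := (1 + θ ^ 2) * (x ^ 2 * y)

/-- The factor in the linear part of the normalized form. -/
def linFactor (θ ε : R) : R := θ * ε * (1 + θ ^ 2)

/-- The normalized form, with a multiple of `x dx + y dy` as linear part. -/
def normalizedForm (b θ ε : ℂ) : PolyForm ℂ :=
  (C (linFactor θ ε) * X 0 + quadP (C b) (C θ) (C ε) (X 0) (X 1) + cubP (C b) (C θ) (C ε) (X 0) (X 1),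
   C (linFactor θ ε) * X 1 + quadQ (C θ) (C ε) (X 0) (X 1) + cubQ (C θ) (X 0) (X 1))

/-- The relation between the parameters of the standard form and of the normalized form. -/
structure Linked (b m₁ m₂ θ ε : ℂ) : Prop where
  hb : b ≠ 0
  hb' : 1 + b ≠ 0
  hθ : θ ≠ 0
  hε : ε ≠ 0
  hδ : θ - ε ≠ 0
  hu : 1 + θ ^ 2 ≠ 0
  prod : m₁ * m₂ = 1 / (b * (1 + b) * (1 + θ ^ 2))
  sum : m₁ + m₂ - b * (m₁ * m₂) = m₁ * m₂ * ((1 + b) * (1 + θ ^ 2) - θ * (θ - ε))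

/-- The zero of the standard form outside its integral curves. -/
def centerPoint (b m₁ m₂ θ ε : ℂ) : Fin 2 → ℂ :=
  ![θ / (θ - ε), m₁ * m₂ * (((1 + b) * (1 + θ ^ 2) - θ * (θ - ε)) * (θ / (θ - ε)) - 1)]

/-- The linear part of the normalizing coordinate change. -/
def centerMatrix (b m₁ m₂ θ ε : ℂ) : Matrix (Fin 2) (Fin 2) ℂ :=
  !![1 / (θ - ε), 0; m₁ * m₂ * ((1 + b) * (1 + θ ^ 2) - θ * (θ - ε)) / (θ - ε), m₁ * m₂]

variable {b m₁ m₂ θ ε : ℂ}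

lemma Linked.prod_ne_zero (h : Linked b m₁ m₂ θ ε) : m₁ * m₂ ≠ 0 := by
  rw [h.prod]
  exact one_div_ne_zero (mul_ne_zero (mul_ne_zero h.hb h.hb') h.hu)

lemma Linked.det_ne_zero (h : Linked b m₁ m₂ θ ε) : (centerMatrix b m₁ m₂ θ ε).det ≠ 0 := by
  rw [centerMatrix, Matrix.det_fin_two_of, zero_mul, sub_zero]
  exact mul_ne_zero (one_div_ne_zero h.hδ) h.prod_ne_zero

lemma eval_stdForm_fst (b m₁ m₂ : ℂ) (v : Fin 2 → ℂ) : eval v (stdForm b m₁ m₂).1 =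
    -(m₁ * m₂) * (v 0 - 1) * (v 1 * (1 + b * v 0) - v 0 ^ 2) +
      (b * (1 + b) * v 1 - (2 + b) * v 0 + 2) * (v 1 ^ 2 - (m₁ + m₂) * v 0 * v 1 + m₁ * m₂ * v 0 ^ 2) := by
  simp [stdForm]
  ring

lemma eval_stdForm_snd (b m₁ m₂ : ℂ) (v : Fin 2 → ℂ) : eval v (stdForm b m₁ m₂).2 =
    v 0 * (v 0 - 1) * (v 1 - (m₁ + m₂ - b * (m₁ * m₂)) * v 0 + m₁ * m₂) := by
  simp [stdForm]

/-- The factor between the pullback of the standard form and the normalized form. -/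
def centerFactor (m₁ m₂ θ ε : ℂ) : ℂ := (m₁ * m₂) ^ 2 / ((1 + θ ^ 2) * (θ - ε) ^ 2)

lemma Linked.factor_ne_zero (h : Linked b m₁ m₂ θ ε) : centerFactor m₁ m₂ θ ε ≠ 0 :=
  div_ne_zero (pow_ne_zero 2 h.prod_ne_zero) (mul_ne_zero h.hu (pow_ne_zero 2 h.hδ))

/-- The normalizing coordinate change. -/
theorem Linked.pullback_eq (h : Linked b m₁ m₂ θ ε) :
    pullback (centerPoint b m₁ m₂ θ ε) (centerMatrix b m₁ m₂ θ ε) (stdForm b m₁ m₂) =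
      centerFactor m₁ m₂ θ ε • normalizedForm b θ ε := by
  obtain ⟨hb, hb', hθ, hε, hδ, hu, hp, hs⟩ := h
  have hs' : m₁ + m₂ = m₁ * m₂ * ((1 + b) * (1 + θ ^ 2) - θ * (θ - ε)) + b * (m₁ * m₂) := by
    linear_combination hs
  have a0 (v : Fin 2 → ℂ) : affMap (centerPoint b m₁ m₂ θ ε) (centerMatrix b m₁ m₂ θ ε) v 0 =
      θ / (θ - ε) + 1 / (θ - ε) * v 0 := by
    simp [affMap, centerPoint, centerMatrix]
  have a1 (v : Fin 2 → ℂ) : affMap (centerPoint b m₁ m₂ θ ε) (centerMatrix b m₁ m₂ θ ε) v 1 =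
      m₁ * m₂ * (((1 + b) * (1 + θ ^ 2) - θ * (θ - ε)) * (θ / (θ - ε)) - 1) +
        m₁ * m₂ * ((1 + b) * (1 + θ ^ 2) - θ * (θ - ε)) / (θ - ε) * v 0 + m₁ * m₂ * v 1 := by
    simp [affMap, centerPoint, centerMatrix]
  have e0 (v : Fin 2 → ℂ) : eval v (normalizedForm b θ ε).1 =
      linFactor θ ε * v 0 + quadP b θ ε (v 0) (v 1) + cubP b θ ε (v 0) (v 1) := by
    simp only [normalizedForm, quadP, cubP, map_add, map_sub, map_neg, map_mul, map_pow, eval_C, eval_X,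
      map_one, map_ofNat]
  have e1 (v : Fin 2 → ℂ) : eval v (normalizedForm b θ ε).2 =
      linFactor θ ε * v 1 + quadQ θ ε (v 0) (v 1) + cubQ θ (v 0) (v 1) := by
    simp only [normalizedForm, quadQ, cubQ, map_add, map_mul, map_pow, eval_C, eval_X, map_one]
  have c00 : centerMatrix b m₁ m₂ θ ε 0 0 = 1 / (θ - ε) := rfl
  have c01 : centerMatrix b m₁ m₂ θ ε 0 1 = 0 := rfl
  have c10 : centerMatrix b m₁ m₂ θ ε 1 0 =
    m₁ * m₂ * ((1 + b) * (1 + θ ^ 2) - θ * (θ - ε)) / (θ - ε) := rfl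
  have c11 : centerMatrix b m₁ m₂ θ ε 1 1 = m₁ * m₂ := rfl
  ext1 <;> refine MvPolynomial.funext fun v => ?_
  · rw [pullback_fst, Prod.smul_fst, smul_eq_C_mul]
    simp only [map_add, map_mul, eval_C, eval_affSubst, eval_stdForm_fst, eval_stdForm_snd, a0, a1, e0,
      c00, c10, centerFactor]
    -- The standard form depends on the slopes only through their sum and product, which are
    -- expressed by `b`, `θ`, `ε`.
    rw [hs, hs']
    generalize m₁ * m₂ = q at *
    subst hp
    simp only [quadP, cubP, linFactor]
    field_simp
    ring
  · rw [pullback_snd, Prod.smul_snd, smul_eq_C_mul]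
    simp only [map_add, map_mul, eval_C, eval_affSubst, eval_stdForm_fst, eval_stdForm_snd, a0, a1, e1,
      c01, c11, centerFactor]
    rw [hs]
    generalize m₁ * m₂ = q at *
    simp only [quadQ, cubQ, linFactor]
    field_simp
    ring

lemma eval_std_curves (b m₁ m₂ : ℂ) (v : Fin 2 → ℂ) :
    eval v ((stdConfig b m₁ m₂).Γ * affinePart (stdConfig b m₁ m₂).L₄) =
      (v 1 - m₁ * v 0) * (v 1 - m₂ * v 0) * (v 0 - 1) * (v 1 * (1 + b * v 0) - v 0 ^ 2) * v 0 := by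
  obtain ⟨e1, e2, e3, e4, e5⟩ := affinePart_std b m₁ m₂
  rw [Configuration.Γ, e1, e2, e3, e4, e5]
  simp

/-- At this point the linear factor of the dy-component vanishes, whence `L₁ L₂ = -m₁ m₂ Q`; and
`x`, `x - 1` and `Q` become products and quotients of nonzero parameters. -/
lemma Linked.eval_ne_zero (h : Linked b m₁ m₂ θ ε) : eval (centerPoint b m₁ m₂ θ ε)
    ((stdConfig b m₁ m₂).Γ * affinePart (stdConfig b m₁ m₂).L₄) ≠ 0 := by
  have hq := h.prod_ne_zero
  obtain ⟨hb, hb', hθ, hε, hδ, hu, hp, hs⟩ := h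
  have hs' : m₁ + m₂ = m₁ * m₂ * ((1 + b) * (1 + θ ^ 2) - θ * (θ - ε)) + b * (m₁ * m₂) := by
    linear_combination hs
  set v := centerPoint b m₁ m₂ θ ε
  have hv0 : v 0 = θ / (θ - ε) := rfl
  have hv1 : v 1 = m₁ * m₂ * (((1 + b) * (1 + θ ^ 2) - θ * (θ - ε)) * (θ / (θ - ε)) - 1) := rfl
  have hc : v 1 * (1 + b * v 0) - v 0 ^ 2 = m₁ * m₂ * ((1 + θ ^ 2) * ε / (θ - ε)) := by
    have : v 0 ^ 2 = m₁ * m₂ * (b * (1 + b) * (1 + θ ^ 2)) * v 0 ^ 2 := by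
      rw [hp]; field_simp
    rw [this, hv1, hv0]
    generalize m₁ * m₂ = q
    field_simp
    ring
  have hl : (v 1 - m₁ * v 0) * (v 1 - m₂ * v 0) = -(m₁ * m₂) * (v 1 * (1 + b * v 0) - v 0 ^ 2) := by
    rw [← hv0] at hv1
    have : v 1 - (m₁ + m₂ - b * (m₁ * m₂)) * v 0 + m₁ * m₂ = 0 := by
      rw [hs, hv1]; ring
    linear_combination v 1 * this
  have h1 : v 0 - 1 = ε / (θ - ε) := by rw [hv0]; field_simp; ring
  rw [eval_std_curves, hl, hc, h1, hv0]
  have hne : m₁ * m₂ * ((1 + θ ^ 2) * ε / (θ - ε)) ≠ 0 :=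
    mul_ne_zero hq (div_ne_zero (mul_ne_zero hu hε) hδ)
  exact mul_ne_zero (mul_ne_zero (mul_ne_zero (mul_ne_zero (neg_ne_zero.2 hq) hne) (div_ne_zero hε hδ)) hne)
    (div_ne_zero hθ hδ)

/-- The conditions on `m₁` and on `m₂` are multiplied in pairs; the products are symmetric in the
slopes and thus monomials in `b`, `1 + b`, `m₁ m₂`, `θ`, `ε` and `θ - ε`. -/
lemma Linked.admissible (h : Linked b m₁ m₂ θ ε) (h₁₂ : m₁ - m₂ ≠ 0) : Admissible b m₁ m₂ := by
  have hq := h.prod_ne_zero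
  obtain ⟨hb, hb', hθ, hε, hδ, hu, hp, hs⟩ := h
  have hp' : m₁ * m₂ * (b * (1 + b) * (1 + θ ^ 2)) = 1 := by rw [hp]; field_simp
  have k1 : (1 - b * m₁) * (1 - b * m₂) = b * (m₁ * m₂) * (θ * (θ - ε)) := by
    linear_combination -b * hs - hp'
  have k2 : ((1 + b) * m₁ - 1) * ((1 + b) * m₂ - 1) = -(m₁ * m₂ * (1 + b) * (θ * ε)) := by
    linear_combination -(1 + b) * hs - hp'
  have k3 : b * (m₁ * m₂) * (θ * (θ - ε)) ≠ 0 := mul_ne_zero (mul_ne_zero hb hq) (mul_ne_zero hθ hδ)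
  have k4 : -(m₁ * m₂ * (1 + b) * (θ * ε)) ≠ 0 :=
    neg_ne_zero.2 (mul_ne_zero (mul_ne_zero hq hb') (mul_ne_zero hθ hε))
  rw [← k1] at k3
  rw [← k2] at k4
  exact ⟨hb', left_ne_zero_of_mul hq, right_ne_zero_of_mul hq, h₁₂, left_ne_zero_of_mul k3,
    right_ne_zero_of_mul k3, left_ne_zero_of_mul k4, right_ne_zero_of_mul k4⟩

/-- Existence of the normalizing parameters, in terms of the abscissa of the zero. -/
lemma exists_linked (h : Admissible b m₁ m₂) {x : ℂ} (hb : b ≠ 0) (hx : x ≠ 0) (hx1 : x - 1 ≠ 0)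
    (h0 : (1 + b) * x * ((1 - b * m₁) * (1 - b * m₂)) = 1 - b * (1 + b) * (m₁ * m₂)) :
    ∃ θ ε, Linked b m₁ m₂ θ ε ∧ x = θ / (θ - ε) := by
  have hr : b * (1 + b) * (m₁ * m₂) ≠ 0 := mul_ne_zero (mul_ne_zero hb h.hb) (mul_ne_zero h.h₁ h.h₂)
  -- With `r = b (1 + b) m₁ m₂` the choice means `(1 + θ²) r = 1`, as the product relation of
  -- `Linked` demands.
  obtain ⟨θ, hθ⟩ := IsAlgClosed.exists_pow_nat_eq
    ((1 - b * (1 + b) * (m₁ * m₂)) / (b * (1 + b) * (m₁ * m₂))) (n := 2) (by norm_num)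
  have hθ0 : θ ≠ 0 := by
    rintro rfl
    rw [← h0, eq_comm, zero_pow two_ne_zero, div_eq_zero_iff] at hθ
    exact (mul_ne_zero (mul_ne_zero h.hb hx) (mul_ne_zero h.hb₁ h.hb₂)) (hθ.resolve_right hr)
  have hu : (1 + θ ^ 2) * (b * (1 + b) * (m₁ * m₂)) = 1 := by
    rw [hθ, add_mul, div_mul_cancel₀ _ hr]; ring
  have hδ : θ - θ * (x - 1) / x = θ / x := by field_simp; ring
  have hu0 : 1 + θ ^ 2 ≠ 0 := fun h1 => by rw [h1, zero_mul] at hu; exact zero_ne_one hu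
  -- `ε` is obtained by solving `x = θ / (θ - ε)`.
  refine ⟨θ, θ * (x - 1) / x, ⟨hb, h.hb, hθ0, div_ne_zero (mul_ne_zero hθ0 hx1) hx, ?_, hu0, ?_, ?_⟩, ?_⟩
  · rw [hδ]; exact div_ne_zero hθ0 hx
  · have := h.hb
    field_simp
    linear_combination hu
  · rw [hδ]
    have e : θ * (θ / x) * x = θ ^ 2 := by field_simp
    refine sub_eq_zero.1 ((mul_eq_zero.1 (?_ : (b * (1 + b) * x) * _ = 0)).resolve_left
      (mul_ne_zero (mul_ne_zero hb h.hb) hx))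
    linear_combination -h0 - (1 + b) * x * hu + b * (1 + b) * (m₁ * m₂) * e + hu
  · rw [hδ]; field_simp

end NormalFamily

/-! ### The five-parameter family in Poincaré normal form. -/

section HigherPart

variable {A B : Type} [CommRing A] [CommRing B]

/-- Off the curves the dy-component gives one linear equation. On that line the dx-component is a
constant times the conic times `b (1 + b) y - (1 + b) x + 1`, which gives a second one. For `b = 0`
the latter would put the zero on `x = 1`. -/
lemma linked_of_zero {b m₁ m₂ : ℂ} (had : Admissible b m₁ m₂) {v : Fin 2 → ℂ}
    (h₁ : eval v (stdForm b m₁ m₂).1 = 0) (h₂ : eval v (stdForm b m₁ m₂).2 = 0)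
    (hv : eval v ((stdConfig b m₁ m₂).Γ * affinePart (stdConfig b m₁ m₂).L₄) ≠ 0) :
    ∃ θ ε, Linked b m₁ m₂ θ ε ∧ v = centerPoint b m₁ m₂ θ ε := by
  rw [eval_std_curves] at hv
  have hx : v 0 ≠ 0 := right_ne_zero_of_mul hv
  have hv' := left_ne_zero_of_mul hv
  have hq : v 1 * (1 + b * v 0) - v 0 ^ 2 ≠ 0 := right_ne_zero_of_mul hv'
  have hx1 : v 0 - 1 ≠ 0 := right_ne_zero_of_mul (left_ne_zero_of_mul hv')
  have hp : m₁ * m₂ ≠ 0 := mul_ne_zero had.h₁ had.h₂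
  rw [eval_stdForm_snd] at h₂
  have hl := (mul_eq_zero.1 h₂).resolve_left (mul_ne_zero hx hx1)
  rw [eval_stdForm_fst] at h₁
  have h3 : (m₁ * m₂ * (v 1 * (1 + b * v 0) - v 0 ^ 2)) *
      (b * (1 + b) * v 1 - (1 + b) * v 0 + 1) = 0 := by
    linear_combination -h₁ + (b * (1 + b) * v 1 - (2 + b) * v 0 + 2) * v 1 * hl
  have h4 := (mul_eq_zero.1 h3).resolve_left (mul_ne_zero hp hq)
  have hb : b ≠ 0 := by
    rintro rfl
    exact hx1 (by linear_combination -h4)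
  obtain ⟨θ, ε, hL, hxe⟩ := exists_linked had hb hx hx1 (by
    linear_combination -h4 + b * (1 + b) * hl)
  refine ⟨θ, ε, hL, ?_⟩
  have h1 : v 1 = m₁ * m₂ * (((1 + b) * (1 + θ ^ 2) - θ * (θ - ε)) * (θ / (θ - ε)) - 1) := by
    rw [← hxe]
    linear_combination hl + v 0 * hL.sum
  ext i
  fin_cases i
  · exact hxe
  · exact h1

/-- The coefficients of degree two and three. -/
def highCoeff (ω : PolyForm A) (i : Fin 2 × HigherExp) : A :=
  coeff (expo i.2.1.1 i.2.1.2) (if i.1 = 0 then ω.1 else ω.2)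

lemma highCoeff_mapForm (e : A →+* B) (ω : PolyForm A) (i : Fin 2 × HigherExp) :
    highCoeff (mapForm e ω) i = e (highCoeff ω i) := by
  unfold highCoeff mapForm
  split_ifs <;> rw [coeff_map]

/-- Sums of a quadratic and a cubic form. -/
def IsQuadCub (f : MvPolynomial (Fin 2) A) : Prop :=
  ∃ q c, f = q + c ∧ q.IsHomogeneous 2 ∧ c.IsHomogeneous 3

lemma sum_expo (i j : ℕ) : (expo i j).degree = i + j := by
  rw [Finsupp.degree_eq_sum]
  simp [Fin.sum_univ_two]

lemma IsQuadCub.coeff_eq_zero {f : MvPolynomial (Fin 2) A} (h : IsQuadCub f) {i j : ℕ}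
    (hij : ¬(2 ≤ i + j ∧ i + j ≤ 3)) : coeff (expo i j) f = 0 := by
  obtain ⟨q, c, rfl, hq, hc⟩ := h
  rw [coeff_add, hq.coeff_eq_zero (by rw [sum_expo]; omega), hc.coeff_eq_zero (by rw [sum_expo]; omega),
    add_zero]

lemma IsQuadCub.sum_eq {f : MvPolynomial (Fin 2) A} (h : IsQuadCub f) :
    ∑ e : HigherExp, C (coeff (expo e.1.1 e.1.2) f) * (X 0 ^ (e.1.1 : ℕ) * X 1 ^ (e.1.2 : ℕ)) = f := by
  ext m
  rw [← expo_eta m, coeff_higher]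
  split_ifs with hm
  · rfl
  · rw [h.coeff_eq_zero hm]

lemma normalForm_highCoeff {ω : PolyForm A} (h₁ : IsQuadCub ω.1) (h₂ : IsQuadCub ω.2) :
    normalForm (highCoeff ω) = (X 0 + ω.1, X 1 + ω.2) := by
  rw [normalForm_eq]
  congr 2
  · exact h₁.sum_eq
  · exact h₂.sum_eq

lemma normalForm_injective : Function.Injective (normalForm : (Fin 2 × HigherExp → A) → PolyForm A) := by
  intro a a' h
  rw [normalForm_eq, normalForm_eq, Prod.mk.injEq, add_right_inj, add_right_inj] at h
  ext ⟨k, ⟨⟨i, j⟩, hij⟩⟩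
  fin_cases k
  · have := congrArg (coeff (expo i j)) h.1
    rwa [higherForm, higherForm, coeff_higher, coeff_higher, dif_pos hij, dif_pos hij] at this
  · have := congrArg (coeff (expo i j)) h.2
    rwa [higherForm, higherForm, coeff_higher, coeff_higher, dif_pos hij, dif_pos hij] at this

lemma isHomogeneous_C_mul (a : A) {f : MvPolynomial (Fin 2) A} {n : ℕ} (h : f.IsHomogeneous n) :
    (C a * f).IsHomogeneous n := by
  have := (isHomogeneous_C (Fin 2) a).mul h
  rwa [zero_add] at this

lemma isHomogeneous_quadP (b θ ε : A) {x y : MvPolynomial (Fin 2) A} (hx : x.IsHomogeneous 1)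
    (hy : y.IsHomogeneous 1) : (quadP (C b) (C θ) (C ε) x y).IsHomogeneous 2 := by
  have : quadP (C b) (C θ) (C ε) x y = C (-(θ * (b * θ ^ 2 - 1 - θ * ε))) * x ^ 2 +
      C (-(θ * (-3 * (θ - ε) + θ * (1 + b * θ ^ 2 + θ * ε - b)))) * (x * y) +
      C (b * θ ^ 3 - (θ - ε)) * y ^ 2 := by
    simp only [quadP, map_add, map_sub, map_neg, map_mul, map_pow, map_one, map_ofNat]
    ring
  rw [this]
  exact ((isHomogeneous_C_mul _ (hx.pow 2)).add (isHomogeneous_C_mul _ (hx.mul hy))).add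
    (isHomogeneous_C_mul _ (hy.pow 2))

lemma isHomogeneous_quadQ (θ ε : A) {x y : MvPolynomial (Fin 2) A} (hx : x.IsHomogeneous 1)
    (hy : y.IsHomogeneous 1) : (quadQ (C θ) (C ε) x y).IsHomogeneous 2 := by
  have : quadQ (C θ) (C ε) x y = C ((1 + θ ^ 2) * (θ + ε)) * (x * y) := by
    simp only [quadQ, map_add, map_mul, map_pow, map_one]
  rw [this]
  exact isHomogeneous_C_mul _ (hx.mul hy)

lemma isHomogeneous_cubP (b θ ε : A) {x y : MvPolynomial (Fin 2) A} (hx : x.IsHomogeneous 1)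
    (hy : y.IsHomogeneous 1) : (cubP (C b) (C θ) (C ε) x y).IsHomogeneous 3 := by
  have : cubP (C b) (C θ) (C ε) x y = C (-(b * θ ^ 2)) * x ^ 3 +
      C (-(θ * (1 + b * θ ^ 2 + θ * ε - b))) * (x ^ 2 * y) +
      C (b * θ ^ 2 - 2 * θ * (θ - ε)) * (x * y ^ 2) + C (θ - ε) * y ^ 3 := by
    simp only [cubP, map_add, map_sub, map_neg, map_mul, map_pow, map_one, map_ofNat]
    ring
  rw [this]
  exact (((isHomogeneous_C_mul _ (hx.pow 3)).add (isHomogeneous_C_mul _ ((hx.pow 2).mul hy))).add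
    (isHomogeneous_C_mul _ (hx.mul (hy.pow 2)))).add (isHomogeneous_C_mul _ (hy.pow 3))

lemma isHomogeneous_cubQ (θ : A) {x y : MvPolynomial (Fin 2) A} (hx : x.IsHomogeneous 1)
    (hy : y.IsHomogeneous 1) : (cubQ (C θ) x y).IsHomogeneous 3 := by
  have : cubQ (C θ) x y = C (1 + θ ^ 2) * (x ^ 2 * y) := by
    simp only [cubQ, map_add, map_pow, map_one]
  rw [this]
  exact isHomogeneous_C_mul _ ((hx.pow 2).mul hy)

/-- The factor of the similarity by which the normalized form is pulled back. -/
def fiveFactor (t : Fin 5 → A) : A := linFactor (t 1) (t 2) * (t 3 ^ 2 + t 4 ^ 2)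

/-- The terms of degree two and three of the normalized form after a similarity. -/
def fiveForm (t : Fin 5 → A) : PolyForm A :=
  let U : MvPolynomial (Fin 2) A := C (t 3) * X 0 - C (t 4) * X 1
  let W : MvPolynomial (Fin 2) A := C (t 4) * X 0 + C (t 3) * X 1
  (C (t 3) * quadP (C (t 0)) (C (t 1)) (C (t 2)) U W + C (t 4) * quadQ (C (t 1)) (C (t 2)) U W +
     C (fiveFactor t) * (C (t 3) * cubP (C (t 0)) (C (t 1)) (C (t 2)) U W + C (t 4) * cubQ (C (t 1)) U W),
   C (-t 4) * quadP (C (t 0)) (C (t 1)) (C (t 2)) U W + C (t 3) * quadQ (C (t 1)) (C (t 2)) U W +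
     C (fiveFactor t) * (C (-t 4) * cubP (C (t 0)) (C (t 1)) (C (t 2)) U W + C (t 3) * cubQ (C (t 1)) U W))

lemma isQuadCub_fiveForm (t : Fin 5 → A) : IsQuadCub (fiveForm t).1 ∧ IsQuadCub (fiveForm t).2 := by
  have hU : (C (t 3) * X 0 - C (t 4) * X 1 : MvPolynomial (Fin 2) A).IsHomogeneous 1 :=
    (isHomogeneous_C_mul_X _ _).sub (isHomogeneous_C_mul_X _ _)
  have hW : (C (t 4) * X 0 + C (t 3) * X 1 : MvPolynomial (Fin 2) A).IsHomogeneous 1 :=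
    (isHomogeneous_C_mul_X _ _).add (isHomogeneous_C_mul_X _ _)
  have h1 := isHomogeneous_quadP (t 0) (t 1) (t 2) hU hW
  have h2 := isHomogeneous_quadQ (t 1) (t 2) hU hW
  have h3 := isHomogeneous_cubP (t 0) (t 1) (t 2) hU hW
  have h4 := isHomogeneous_cubQ (t 1) hU hW
  exact ⟨⟨_, _, rfl, (isHomogeneous_C_mul _ h1).add (isHomogeneous_C_mul _ h2),
      isHomogeneous_C_mul _ ((isHomogeneous_C_mul _ h3).add (isHomogeneous_C_mul _ h4))⟩,
    ⟨_, _, rfl, (isHomogeneous_C_mul _ h1).add (isHomogeneous_C_mul _ h2),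
      isHomogeneous_C_mul _ ((isHomogeneous_C_mul _ h3).add (isHomogeneous_C_mul _ h4))⟩⟩

lemma mapForm_fiveForm (e : A →+* B) (t : Fin 5 → A) :
    mapForm e (fiveForm t) = fiveForm (fun i => e (t i)) := by
  ext1 <;> simp only [mapForm, fiveForm, fiveFactor, linFactor, quadP, quadQ, cubP, cubQ, map_add, map_sub,
    map_neg, map_mul, map_pow, map_one, map_ofNat, MvPolynomial.map_C, MvPolynomial.map_X]

/-- The parametrization of the normal forms of the special forms. -/
def fiveParam : MvPolynomial (Fin 2 × HigherExp) ℂ →ₐ[ℂ] MvPolynomial (Fin 5) ℂ :=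
  aeval (highCoeff (fiveForm X))

lemma eval_fiveParam (t : Fin 5 → ℂ) :
    (fun i => eval t (fiveParam (X i))) = highCoeff (fiveForm t) := by
  ext i
  rw [fiveParam, aeval_X, ← highCoeff_mapForm, mapForm_fiveForm]
  simp

lemma eval_normalizedForm_fst (b θ ε : ℂ) (v : Fin 2 → ℂ) : eval v (normalizedForm b θ ε).1 =
    linFactor θ ε * v 0 + quadP b θ ε (v 0) (v 1) + cubP b θ ε (v 0) (v 1) := by
  simp only [normalizedForm, quadP, cubP, map_add, map_sub, map_neg, map_mul, map_pow, eval_C, eval_X,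
    map_one, map_ofNat]

lemma eval_normalizedForm_snd (b θ ε : ℂ) (v : Fin 2 → ℂ) : eval v (normalizedForm b θ ε).2 =
    linFactor θ ε * v 1 + quadQ θ ε (v 0) (v 1) + cubQ θ (v 0) (v 1) := by
  simp only [normalizedForm, quadQ, cubQ, map_add, map_mul, map_pow, eval_C, eval_X, map_one]

/-- The similarity by which the normalized form is pulled back. -/
def fiveMatrix (t : Fin 5 → ℂ) : Matrix (Fin 2) (Fin 2) ℂ :=
  !![fiveFactor t * t 3, -(fiveFactor t * t 4); fiveFactor t * t 4, fiveFactor t * t 3]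

/-- The similarity is scaled by `f = fiveFactor t`. The linear part is then multiplied by `f ^ 2`
and by `t 3 ^ 2 + t 4 ^ 2`, which together with `linFactor` makes `f ^ 3`; the quadratic part
acquires `f ^ 3` and the cubic part `f ^ 4`. Division by `f ^ 3` leaves coefficients that are
polynomials in `t`, without roots. -/
theorem pullback_normalizedForm (t : Fin 5 → ℂ) :
    pullback 0 (fiveMatrix t) (normalizedForm (t 0) (t 1) (t 2)) =
      fiveFactor t ^ 3 • normalForm (fun i => eval t (fiveParam (X i))) := by
  obtain ⟨h1, h2⟩ := isQuadCub_fiveForm t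
  rw [eval_fiveParam, normalForm_highCoeff h1 h2]
  have a0 (v : Fin 2 → ℂ) : affMap 0 (fiveMatrix t) v 0 = fiveFactor t * (t 3 * v 0 - t 4 * v 1) := by
    simp [affMap, fiveMatrix]; ring
  have a1 (v : Fin 2 → ℂ) : affMap 0 (fiveMatrix t) v 1 = fiveFactor t * (t 4 * v 0 + t 3 * v 1) := by
    simp [affMap, fiveMatrix]; ring
  have c00 : fiveMatrix t 0 0 = fiveFactor t * t 3 := rfl
  have c01 : fiveMatrix t 0 1 = -(fiveFactor t * t 4) := rfl
  have c10 : fiveMatrix t 1 0 = fiveFactor t * t 4 := rfl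
  have c11 : fiveMatrix t 1 1 = fiveFactor t * t 3 := rfl
  have hf : linFactor (t 1) (t 2) * (t 3 ^ 2 + t 4 ^ 2) = fiveFactor t := rfl
  ext1 <;> refine MvPolynomial.funext fun v => ?_
  · simp only [pullback_fst, Prod.smul_fst, smul_eq_C_mul, map_add, map_mul, eval_C, eval_affSubst,
      eval_normalizedForm_fst, eval_normalizedForm_snd, a0, a1, c00, c10, fiveForm, eval_X,
      quadP, quadQ, cubP, cubQ, map_sub, map_neg, map_pow, map_one, map_ofNat]
    linear_combination fiveFactor t ^ 2 * v 0 * hf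
  · simp only [pullback_snd, Prod.smul_snd, smul_eq_C_mul, map_add, map_mul, eval_C, eval_affSubst,
      eval_normalizedForm_fst, eval_normalizedForm_snd, a0, a1, c01, c11, fiveForm, eval_X,
      quadP, quadQ, cubP, cubQ, map_sub, map_neg, map_pow, map_one, map_ofNat]
    linear_combination fiveFactor t ^ 2 * v 1 * hf

end HigherPart

/-! ### Affine equivalence of forms. -/

section AffineEquivalence

variable {ω η ζ : PolyForm ℂ}

lemma AffinelyEquivalent.symm (h : AffinelyEquivalent ω η) : AffinelyEquivalent η ω := by
  obtain ⟨p, M, t, hM, ht, h⟩ := h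
  refine ⟨invShift p M, M⁻¹, t⁻¹, det_inv_ne_zero hM, inv_ne_zero ht, ?_⟩
  have : η = t⁻¹ • pullback p M ω := by rw [h, smul_smul, inv_mul_cancel₀ ht, one_smul]
  rw [this, pullback_smul, pullback_inv_pullback _ hM]

lemma AffinelyEquivalent.trans (h : AffinelyEquivalent ω η) (h' : AffinelyEquivalent η ζ) :
    AffinelyEquivalent ω ζ := by
  obtain ⟨p, M, t, hM, ht, h⟩ := h
  obtain ⟨p', M', t', hM', ht', h'⟩ := h'
  refine ⟨affMap p M p', M * M', t * t', ?_, mul_ne_zero ht ht', ?_⟩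
  · rw [Matrix.det_mul]; exact mul_ne_zero hM hM'
  · rw [← pullback_pullback, h, pullback_smul, h', smul_smul]

lemma AffinelyEquivalent.exists_special (h : AffinelyEquivalent ω η) {c : Configuration}
    {P D E F H I J : Fin 2 → ℂ} (hc : c.IsSpecial P D E F H I J) (hω : ω ∈ c.forms 3) :
    ∃ (c' : Configuration) (P D E F H I J : Fin 2 → ℂ), c'.IsSpecial P D E F H I J ∧ η ∈ c'.forms 3 := by
  obtain ⟨p, M, t, hM, ht, h⟩ := h
  obtain ⟨P', rfl⟩ := affMap_surj (p := p) hM P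
  obtain ⟨D', rfl⟩ := affMap_surj (p := 0) hM D
  obtain ⟨E', rfl⟩ := affMap_surj (p := p) hM E
  obtain ⟨F', rfl⟩ := affMap_surj (p := p) hM F
  obtain ⟨H', rfl⟩ := affMap_surj (p := p) hM H
  obtain ⟨I', rfl⟩ := affMap_surj (p := p) hM I
  obtain ⟨J', rfl⟩ := affMap_surj (p := p) hM J
  refine ⟨c.comap p M, P', D', E', F', H', I', J', hc.comap hM, ?_⟩
  have : η = t⁻¹ • pullback p M ω := by rw [h, smul_smul, inv_mul_cancel₀ ht, one_smul]
  rw [this]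
  exact Submodule.smul_mem _ _ (Configuration.forms_comap hω)

lemma normalForm_ne_zero (a : Fin 2 × HigherExp → ℂ) : normalForm a ≠ 0 := fun h => by
  have := congrArg (fun ω : PolyForm ℂ => coeff (expo 1 0) ω.1) h
  rw [normalForm_eq] at this
  simp only [coeff_add, higherForm, coeff_higher, Prod.fst_zero, coeff_zero] at this
  rw [dif_neg (by omega), add_zero, coeff_X] at this
  simp [expo] at this

lemma affineOrbit_subset : affineOrbit specialNormalForms ⊆ specialForms := by
  rintro a ⟨n, ⟨c, P, D, E, F, H, I, J, hc, hn, -⟩, h⟩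
  refine ⟨?_, h.symm.exists_special hc hn⟩
  rintro rfl
  obtain ⟨p, M, t, hM, ht, h⟩ := h
  have : cubicForm (0 : Fin 2 × CubicExp → ℂ) = 0 := by ext1 <;> simp [cubicForm]
  rw [this] at h
  refine smul_ne_zero ht (normalForm_ne_zero n) ?_
  rw [← h]
  ext1 <;> simp [pullback_fst, pullback_snd]

end AffineEquivalence

/-! ### Parametrization of the special normal forms. -/

section Parametrization

variable {t : Fin 5 → ℂ} {m₁ m₂ : ℂ}

lemma Linked.linFactor_ne_zero {b θ ε : ℂ} (h : Linked b m₁ m₂ θ ε) : linFactor θ ε ≠ 0 :=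
  mul_ne_zero (mul_ne_zero h.hθ h.hε) h.hu

lemma det_fiveMatrix (t : Fin 5 → ℂ) :
    (fiveMatrix t).det = fiveFactor t ^ 2 * (t 3 ^ 2 + t 4 ^ 2) := by
  rw [fiveMatrix, Matrix.det_fin_two_of]; ring

lemma affMap_zero_right (p : Fin 2 → ℂ) (M : Matrix (Fin 2) (Fin 2) ℂ) : affMap p M 0 = p := by
  ext i; simp [affMap]

lemma Linked.pullback_five (h : Linked (t 0) m₁ m₂ (t 1) (t 2)) :
    pullback (centerPoint (t 0) m₁ m₂ (t 1) (t 2))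
      (centerMatrix (t 0) m₁ m₂ (t 1) (t 2) * fiveMatrix t) (stdForm (t 0) m₁ m₂) =
    (centerFactor m₁ m₂ (t 1) (t 2) * fiveFactor t ^ 3) •
      normalForm (fun i => eval t (fiveParam (X i))) := by
  conv_lhs => rw [← affMap_zero_right (centerPoint (t 0) m₁ m₂ (t 1) (t 2))
    (centerMatrix (t 0) m₁ m₂ (t 1) (t 2))]
  rw [← pullback_pullback, h.pullback_eq, pullback_smul, pullback_normalizedForm, smul_smul]

lemma Linked.det_mul_ne_zero (h : Linked (t 0) m₁ m₂ (t 1) (t 2)) (h0 : t 3 ^ 2 + t 4 ^ 2 ≠ 0) :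
    (centerMatrix (t 0) m₁ m₂ (t 1) (t 2) * fiveMatrix t).det ≠ 0 := by
  rw [Matrix.det_mul, det_fiveMatrix]
  exact mul_ne_zero h.det_ne_zero (mul_ne_zero (pow_ne_zero 2 (mul_ne_zero h.linFactor_ne_zero h0)) h0)

lemma Linked.scalar_ne_zero (h : Linked (t 0) m₁ m₂ (t 1) (t 2)) (h0 : t 3 ^ 2 + t 4 ^ 2 ≠ 0) :
    centerFactor m₁ m₂ (t 1) (t 2) * fiveFactor t ^ 3 ≠ 0 :=
  mul_ne_zero h.factor_ne_zero (pow_ne_zero 3 (mul_ne_zero h.linFactor_ne_zero h0))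

lemma Linked.affinelyEquivalent (h : Linked (t 0) m₁ m₂ (t 1) (t 2)) (h0 : t 3 ^ 2 + t 4 ^ 2 ≠ 0) :
    AffinelyEquivalent (stdForm (t 0) m₁ m₂) (normalForm (fun i => eval t (fiveParam (X i)))) :=
  ⟨_, _, _, h.det_mul_ne_zero h0, h.scalar_ne_zero h0, h.pullback_five⟩

theorem Linked.mem_specialNormalForms (h : Linked (t 0) m₁ m₂ (t 1) (t 2)) (h₁₂ : m₁ - m₂ ≠ 0)
    (h0 : t 3 ^ 2 + t 4 ^ 2 ≠ 0) : (fun i => eval t (fiveParam (X i))) ∈ specialNormalForms := by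
  obtain ⟨P, D, E, F, H, I, J, hc⟩ := isSpecial_comap (h.admissible h₁₂)
    (centerPoint (t 0) m₁ m₂ (t 1) (t 2)) (h.det_mul_ne_zero h0)
  refine ⟨_, P, D, E, F, H, I, J, hc, ?_, ?_⟩
  · have := pullback_stdForm_mem' (t 0) m₁ m₂ (centerPoint (t 0) m₁ m₂ (t 1) (t 2))
      (centerMatrix (t 0) m₁ m₂ (t 1) (t 2) * fiveMatrix t)
    rw [h.pullback_five] at this
    exact (Submodule.smul_mem_iff _ (h.scalar_ne_zero h0)).1 this
  · have h1 := h.eval_ne_zero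
    rw [← scale_one (stdConfig (t 0) m₁ m₂), Γ_comap_scale, L₄_comap_scale]
    rw [map_mul] at h1
    simp only [map_mul, eval_C, eval_affSubst, affMap_zero_right]
    simpa using h1

/-- The product of the conditions on the five parameters. -/
def fivePoly : MvPolynomial (Fin 5) ℂ :=
  X 0 * (1 + X 0) * X 1 * X 2 * (X 1 - X 2) * (1 + X 1 ^ 2) * (X 3 ^ 2 + X 4 ^ 2) *
    (((1 + X 0) * (1 + X 1 ^ 2) - X 1 * (X 1 - X 2) + X 0) ^ 2 - 4 * X 0 * (1 + X 0) * (1 + X 1 ^ 2))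

/-- The slopes are the roots of the quadratic equation whose coefficients are prescribed by
`Linked`. The last factor of `fivePoly` is its discriminant up to a nonzero factor, so the roots are
distinct. -/
lemma exists_linked_of_fivePoly (h : eval t fivePoly ≠ 0) :
    ∃ m₁ m₂, Linked (t 0) m₁ m₂ (t 1) (t 2) ∧ m₁ - m₂ ≠ 0 ∧ t 3 ^ 2 + t 4 ^ 2 ≠ 0 := by
  simp only [fivePoly, map_mul, map_sub, map_add, map_one, map_pow, map_ofNat, eval_X, ne_eq, mul_eq_zero,
    not_or] at h
  obtain ⟨⟨⟨⟨⟨⟨⟨h1, h2⟩, h3⟩, h4⟩, h5⟩, h6⟩, h7⟩, h8⟩ := h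
  obtain ⟨P, hP⟩ : ∃ P : ℂ, P = 1 / (t 0 * (1 + t 0) * (1 + t 1 ^ 2)) := ⟨_, rfl⟩
  obtain ⟨S, hS⟩ : ∃ S : ℂ, S = P * ((1 + t 0) * (1 + t 1 ^ 2) - t 1 * (t 1 - t 2)) + t 0 * P := ⟨_, rfl⟩
  obtain ⟨d, hd⟩ := IsAlgClosed.exists_pow_nat_eq (S ^ 2 - 4 * P) (n := 2) (by norm_num)
  have hP0 : P ≠ 0 := by
    rw [hP]; exact one_div_ne_zero (mul_ne_zero (mul_ne_zero h1 h2) h6)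
  have hP1 : P * (t 0 * (1 + t 0) * (1 + t 1 ^ 2)) = 1 := by rw [hP]; field_simp
  have hprod : (S + d) / 2 * ((S - d) / 2) = P := by linear_combination (-1 / 4) * hd
  refine ⟨(S + d) / 2, (S - d) / 2, ⟨h1, h2, h3, h4, h5, h6, hprod.trans hP, ?_⟩, ?_, h7⟩
  · rw [hprod]; linear_combination hS
  · have : d ≠ 0 := by
      rintro rfl
      refine mul_ne_zero (pow_ne_zero 2 hP0) h8 ?_
      linear_combination -hd - 4 * P * hP1 +
        (-S - (P * ((1 + t 0) * (1 + t 1 ^ 2) - t 1 * (t 1 - t 2)) + t 0 * P)) * hS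
    intro h0
    exact this (by linear_combination h0)

lemma eval_zero_pderiv {f : MvPolynomial (Fin 2) ℂ} {n : ℕ} (h : f.IsHomogeneous n) (hn : 2 ≤ n)
    (k : Fin 2) : eval 0 (pderiv k f) = 0 := by
  have := (h.pderiv (i := k)).coeff_eq_zero (d := 0) (by simp; omega)
  simpa [constantCoeff_eq] using this

lemma eval_pderiv_normalForm (a : Fin 2 × HigherExp → ℂ) (k : Fin 2) :
    eval 0 (pderiv k (normalForm a).1) = eval 0 (pderiv k (X 0 : MvPolynomial (Fin 2) ℂ)) ∧
    eval 0 (pderiv k (normalForm a).2) = eval 0 (pderiv k (X 1 : MvPolynomial (Fin 2) ℂ)) := by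
  have h : ∀ a : HigherExp → ℂ, eval (0 : Fin 2 → ℂ) (pderiv k
      (∑ e : HigherExp, C (a e) * (X 0 ^ (e.1.1 : ℕ) * X 1 ^ (e.1.2 : ℕ)))) = 0 := fun a => by
    rw [map_sum, map_sum]
    refine Finset.sum_eq_zero fun e _ => eval_zero_pderiv (isHomogeneous_C_mul _
      (((isHomogeneous_X _ _).pow _).mul ((isHomogeneous_X _ _).pow _))) ?_ k
    have := e.2.1
    omega
  simp only [normalForm, map_add, h, add_zero, and_self]

lemma eval_pderiv_normalizedForm (b θ ε : ℂ) (k : Fin 2) :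
    eval 0 (pderiv k (normalizedForm b θ ε).1) =
      linFactor θ ε * eval 0 (pderiv k (X 0 : MvPolynomial (Fin 2) ℂ)) ∧
    eval 0 (pderiv k (normalizedForm b θ ε).2) =
      linFactor θ ε * eval 0 (pderiv k (X 1 : MvPolynomial (Fin 2) ℂ)) := by
  have h0 := isHomogeneous_X ℂ (0 : Fin 2)
  have h1 := isHomogeneous_X ℂ (1 : Fin 2)
  have hC : pderiv k (C (linFactor θ ε) : MvPolynomial (Fin 2) ℂ) = 0 := pderiv_C
  simp only [normalizedForm, map_add, eval_zero_pderiv (isHomogeneous_quadP b θ ε h0 h1) le_rfl,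
    eval_zero_pderiv (isHomogeneous_cubP b θ ε h0 h1) (by norm_num),
    eval_zero_pderiv (isHomogeneous_quadQ θ ε h0 h1) le_rfl,
    eval_zero_pderiv (isHomogeneous_cubQ θ h0 h1) (by norm_num), Derivation.leibniz, hC, smul_eq_mul,
    mul_zero, add_zero, map_mul, eval_C, and_self]

/-- The reflection in the `y`-axis is absorbed by a change of sign of `θ` and `ε`; hence
similarities without reflections suffice in the parametrization. -/
lemma normalizedForm_neg (b θ ε : ℂ) :
    normalizedForm b θ ε = pullback 0 !![-1, 0; 0, 1] (normalizedForm b (-θ) (-ε)) := by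
  ext1 <;> refine MvPolynomial.funext fun v => ?_
  · simp only [pullback_fst, map_add, map_mul, eval_C, eval_affSubst, eval_normalizedForm_fst,
      eval_normalizedForm_snd]
    simp [affMap, quadP, cubP, linFactor]
    ring
  · simp only [pullback_snd, map_add, map_mul, eval_C, eval_affSubst, eval_normalizedForm_fst,
      eval_normalizedForm_snd]
    simp [affMap, quadQ, cubQ, linFactor]
    ring

/-- A cube root of `1 / k` is absorbed into the similarity, since `pullback_normalizedForm` has the
factor `fiveFactor t ^ 3`. -/
lemma exists_fiveParam_of_similarity {a : Fin 2 × HigherExp → ℂ} {k b θ ε : ℂ}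
    {M : Matrix (Fin 2) (Fin 2) ℂ} (h : normalForm a = k • pullback 0 M (normalizedForm b θ ε))
    (h1 : k * linFactor θ ε * (M 0 0 ^ 2 + M 1 0 ^ 2) = 1) (h01 : M 0 1 = -M 1 0) (h11 : M 1 1 = M 0 0) :
    ∃ t, a = fun i => eval t (fiveParam (X i)) := by
  have hk : k ≠ 0 := by rintro rfl; simp at h1
  obtain ⟨l, hl⟩ := IsAlgClosed.exists_pow_nat_eq (1 / k) (n := 3) (by norm_num)
  have hl0 : l ≠ 0 := by
    rintro rfl
    rw [zero_pow three_ne_zero] at hl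
    exact one_div_ne_zero hk hl.symm
  have hlk : l ^ 3 * k = 1 := by rw [hl]; field_simp
  set t : Fin 5 → ℂ := ![b, θ, ε, M 0 0 / l, M 1 0 / l] with ht
  have hf : fiveFactor t = l := by
    have : fiveFactor t = linFactor θ ε * ((M 0 0 / l) ^ 2 + (M 1 0 / l) ^ 2) := rfl
    rw [this, div_pow, div_pow, ← add_div, mul_div_assoc', div_eq_iff (pow_ne_zero 2 hl0)]
    have : linFactor θ ε * (M 0 0 ^ 2 + M 1 0 ^ 2) = l ^ 3 :=
      mul_right_cancel₀ hk (by linear_combination h1 - hlk)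
    rw [this]; ring
  have hM : fiveMatrix t = M := by
    rw [fiveMatrix, hf]
    have h3 : t 3 = M 0 0 / l := rfl
    have h4 : t 4 = M 1 0 / l := rfl
    rw [h3, h4, mul_div_cancel₀ _ hl0, mul_div_cancel₀ _ hl0, ← h01]
    conv_rhs => rw [Matrix.eta_fin_two M]
    rw [h11]
  have hp := pullback_normalizedForm t
  rw [hM, hf] at hp
  refine ⟨t, normalForm_injective ?_⟩
  rw [h]
  have e : normalizedForm (t 0) (t 1) (t 2) = normalizedForm b θ ε := rfl
  rw [e] at hp
  rw [hp, smul_smul, mul_comm, hlk, one_smul]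

lemma exists_fiveParam_of_pullback {a : Fin 2 × HigherExp → ℂ} {k b θ ε : ℂ}
    {M : Matrix (Fin 2) (Fin 2) ℂ} (h : normalForm a = k • pullback 0 M (normalizedForm b θ ε)) :
    ∃ t, a = fun i => eval t (fiveParam (X i)) := by
  have hd (i : Fin 2) := eval_pderiv_normalForm a i
  have h0 : affMap 0 M 0 = 0 := affMap_zero_right 0 M
  simp only [h, Prod.smul_fst, Prod.smul_snd, smul_eq_C_mul, pullback_fst, pullback_snd, Derivation.leibniz,
    map_add, map_mul, smul_eq_mul, pderiv_C, mul_zero, add_zero, eval_C, pderiv_affSubst, eval_affSubst,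
    h0, eval_pderiv_normalizedForm] at hd
  obtain ⟨e1, e2⟩ := hd 0
  obtain ⟨-, e3⟩ := hd 1
  have x00 : pderiv 0 (X 0 : MvPolynomial (Fin 2) ℂ) = 1 := pderiv_X_self 0
  have x11 : pderiv 1 (X 1 : MvPolynomial (Fin 2) ℂ) = 1 := pderiv_X_self 1
  have x10 : pderiv 1 (X 0 : MvPolynomial (Fin 2) ℂ) = 0 := pderiv_X_of_ne (by simp)
  have x01 : pderiv 0 (X 1 : MvPolynomial (Fin 2) ℂ) = 0 := pderiv_X_of_ne (by simp)
  simp only [x00, x11, x10, x01, map_one, map_zero] at e1 e2 e3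
  set f := k * linFactor θ ε with hf
  have e1' : f * (M 0 0 ^ 2 + M 1 0 ^ 2) = 1 := by rw [hf]; linear_combination e1
  have e2' : f * (M 0 0 * M 0 1 + M 1 0 * M 1 1) = 0 := by
    rw [hf]; linear_combination e2
  have e3' : f * (M 0 1 ^ 2 + M 1 1 ^ 2) = 1 := by rw [hf]; linear_combination e3
  -- Both linear parts are multiples of `x dx + y dy`, so `M` is orthogonal up to a factor, and `e =
  -- ±1` separates the similarities from their products with a reflection.
  set e := f * (M 0 0 * M 1 1 - M 0 1 * M 1 0) with he
  have k1 : M 0 1 = -(M 1 0 * e) := by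
    rw [he]; linear_combination -M 0 1 * e1' + M 0 0 * e2'
  have k2 : M 1 1 = M 0 0 * e := by
    rw [he]; linear_combination -M 1 1 * e1' + M 1 0 * e2'
  have k3 : (e - 1) * (e + 1) = 0 := by
    rw [k1, k2] at e3'
    linear_combination e3' - e ^ 2 * e1'
  rcases mul_eq_zero.1 k3 with k3 | k3
  · have : e = 1 := by linear_combination k3
    rw [this, mul_one] at k1 k2
    exact exists_fiveParam_of_similarity h e1' k1 k2
  · have : e = -1 := by linear_combination k3
    rw [this] at k1 k2
    rw [normalizedForm_neg, pullback_pullback, affMap_zero_right] at h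
    refine exists_fiveParam_of_similarity h ?_ ?_ ?_
    · refine Eq.trans ?_ e1'
      rw [hf]
      simp [Matrix.mul_apply, Fin.sum_univ_two, linFactor]
    · simp [Matrix.mul_apply, Fin.sum_univ_two, k1]
    · simp [Matrix.mul_apply, Fin.sum_univ_two, k2]

theorem specialNormalForms_subset {a : Fin 2 × HigherExp → ℂ} (ha : a ∈ specialNormalForms) :
    ∃ t, a = fun i => eval t (fiveParam (X i)) := by
  obtain ⟨c, P, D, E, F, H, I, J, hc, hω, hv⟩ := ha
  obtain ⟨p, M, b, m₁, m₂, l, hM, hl, had, rfl⟩ := exists_comap_standard hc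
  obtain ⟨k, hk⟩ := exists_smul_pullback hM hl had hω
  have hk0 : k ≠ 0 := by
    rintro rfl
    exact normalForm_ne_zero a (by rw [hk, zero_smul])
  rw [Γ_comap_scale, L₄_comap_scale] at hv
  simp only [map_mul, eval_C, eval_affSubst, affMap_zero_right] at hv
  have hv' : eval p ((stdConfig b m₁ m₂).Γ * affinePart (stdConfig b m₁ m₂).L₄) ≠ 0 := by
    rw [map_mul]
    exact mul_ne_zero (right_ne_zero_of_mul (left_ne_zero_of_mul hv))
      (right_ne_zero_of_mul (right_ne_zero_of_mul hv))
  have hz : ∀ e : HigherExp, (0 : ℂ) ^ (e.1.1 : ℕ) * 0 ^ (e.1.2 : ℕ) = 0 := fun e => by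
    rw [← pow_add, zero_pow]
    have := e.2.1
    omega
  -- The origin is a zero of the normal form, so its image `p` is a zero of the standard form, and
  -- it lies outside the curves.
  have h1 : eval 0 (normalForm a).1 = 0 := by simp only [normalForm, map_add, map_sum, map_mul, map_pow, eval_X, eval_C, Pi.zero_apply, hz, mul_zero, Finset.sum_const_zero, add_zero]
  have h2 : eval 0 (normalForm a).2 = 0 := by simp only [normalForm, map_add, map_sum, map_mul, map_pow, eval_X, eval_C, Pi.zero_apply, hz, mul_zero, Finset.sum_const_zero, add_zero]
  rw [hk] at h1 h2
  simp only [Prod.smul_fst, Prod.smul_snd, smul_eq_C_mul, pullback_fst, pullback_snd, map_mul, map_add,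
    eval_C, eval_affSubst, affMap_zero_right] at h1 h2
  replace h1 := (mul_eq_zero.1 h1).resolve_left hk0
  replace h2 := (mul_eq_zero.1 h2).resolve_left hk0
  rw [Matrix.det_fin_two] at hM
  have z1 : eval p (stdForm b m₁ m₂).1 = 0 :=
    (mul_eq_zero.1 (by linear_combination M 1 1 * h1 - M 1 0 * h2 :
      (M 0 0 * M 1 1 - M 0 1 * M 1 0) * eval p (stdForm b m₁ m₂).1 = 0)).resolve_left hM
  have z2 : eval p (stdForm b m₁ m₂).2 = 0 :=
    (mul_eq_zero.1 (by linear_combination M 0 0 * h2 - M 0 1 * h1 :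
      (M 0 0 * M 1 1 - M 0 1 * M 1 0) * eval p (stdForm b m₁ m₂).2 = 0)).resolve_left hM
  obtain ⟨θ, ε, hL, rfl⟩ := linked_of_zero had z1 z2 hv'
  have hMM : M = centerMatrix b m₁ m₂ θ ε * ((centerMatrix b m₁ m₂ θ ε)⁻¹ * M) := by
    rw [← mul_assoc, Matrix.mul_nonsing_inv _ (isUnit_iff_ne_zero.2 hL.det_ne_zero), one_mul]
  rw [hMM] at hk
  conv_rhs at hk => rw [← affMap_zero_right (centerPoint b m₁ m₂ θ ε) (centerMatrix b m₁ m₂ θ ε)]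
  rw [← pullback_pullback, hL.pullback_eq, pullback_smul, smul_smul] at hk
  exact exists_fiveParam_of_pullback hk

theorem vanishingIdeal_specialNormalForms :
    vanishingIdeal ℂ specialNormalForms = RingHom.ker fiveParam := by
  refine le_antisymm (vanishingIdeal_le_ker fiveParam (g := fivePoly) (fun h => ?_) fun t ht => ?_)
    (ker_le_vanishingIdeal fiveParam fun a => specialNormalForms_subset)
  -- `b = θ = 1`, `ε = -1` and the similarity `(1, 0)` satisfy all conditions.
  · have := congrArg (eval ![1, 1, -1, 1, 0]) h
    simp [fivePoly] at this
    norm_num at this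
  · obtain ⟨m₁, m₂, hL, h₁₂, h0⟩ := exists_linked_of_fivePoly ht
    exact hL.mem_specialNormalForms h₁₂ h0

end Parametrization

/-! ### Dimension of the normal forms, and density of their affine orbit. -/

section NormalFormDimension

/-- As in `tenForm_jacobian`, the test point may violate the conditions on the parameters: here `b =
0` and `θ = ε`. -/
lemma fiveForm_jacobian {v : Fin 5 → ℂ}
    (hv : ∀ i, dirDeriv ![0, 1, 1, 1, 0] v (fiveParam (X i)) = 0) : v = 0 := by
  obtain ⟨q1, q2⟩ := isQuadCub_fiveForm (X : Fin 5 → MvPolynomial (Fin 5) ℂ)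
  have hc : ∀ (k : Fin 2) (i j : ℕ), dirDeriv ![0, 1, 1, 1, 0] v
      (coeff (expo i j) (if k = 0 then (fiveForm X).1 else (fiveForm X).2)) = 0 := by
    intro k i j
    by_cases hij : 2 ≤ i + j ∧ i + j ≤ 3
    · have := hv (k, ⟨(⟨i, by omega⟩, ⟨j, by omega⟩), hij⟩)
      rwa [fiveParam, aeval_X] at this
    · have : IsQuadCub (if k = 0 then (fiveForm X).1 else (fiveForm (X : Fin 5 → MvPolynomial (Fin 5) ℂ)).2) := by
        split_ifs
        exacts [q1, q2]
      rw [this.coeff_eq_zero hij, dirDeriv_zero]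
  have h1 := fun x y => dirDeriv_eval_eq_zero _ v (F := (fiveForm X).1)
    (fun m => by have := hc 0 (m 0) (m 1); rwa [expo_eta, if_pos rfl] at this) ![x, y]
  have h2 := fun x y => dirDeriv_eval_eq_zero _ v (F := (fiveForm X).2)
    (fun m => by have := hc 1 (m 0) (m 1); rwa [expo_eta, if_neg (by simp)] at this) ![x, y]
  simp only [fiveForm, fiveFactor, linFactor, quadP, quadQ, cubP, cubQ, pow_succ, pow_zero, one_mul,
    map_mul, map_add, map_sub, map_neg, eval_C, eval_X, map_one, map_ofNat, dirDeriv_add, dirDeriv_sub,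
    dirDeriv_mul, dirDeriv_neg, dirDeriv_X, dirDeriv_C, dirDeriv_one] at h1 h2
  simp at h1 h2
  ext i
  fin_cases i <;> simp only [Pi.zero_apply] <;> simp only [Fin.zero_eta, Fin.mk_one, Fin.reduceFinMk]
  · linear_combination (-1/3) * (h1 1 0) + (-1/3) * (h2 1 0) + (1/18) * (h2 1 1)
  · linear_combination (1/9) * (h1 1 0) + (2/9) * (h2 1 0) + (1/3) * (h1 0 1) + (-1/6) * (h1 1 1) + (-7/54) * (h2 1 1)
  · linear_combination (-2/9) * (h1 1 0) + (2/9) * (h2 1 0) + (-2/3) * (h1 0 1) + (-1/6) * (h1 1 1) + (-2/27) * (h2 1 1)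
  · linear_combination (-1/54) * (h1 1 0) + (-4/27) * (h2 1 0) + (-1/18) * (h1 0 1) + (1/9) * (h1 1 1) + (17/162) * (h2 1 1)
  · linear_combination (1/6) * (h2 1 0)

theorem ringKrullDim_specialNormalForms :
    ringKrullDim (MvPolynomial (Fin 2 × HigherExp) ℂ ⧸ vanishingIdeal ℂ specialNormalForms) = 5 := by
  rw [vanishingIdeal_specialNormalForms]
  exact ringKrullDim_quotient_ker_of_jacobian fiveParam _ fun v => fiveForm_jacobian

theorem isPrime_specialNormalForms : (vanishingIdeal ℂ specialNormalForms).IsPrime := by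
  rw [vanishingIdeal_specialNormalForms]
  exact RingHom.ker_isPrime _

/-- The condition on the parameters of the standard form for a zero outside the integral curves. -/
def zeroPoly : MvPolynomial (Fin 10) ℂ :=
  let r := X 7 * (1 + X 7) * (X 8 * X 9)
  X 7 * (1 - r) * (1 - r - (1 + X 7) * ((1 - X 7 * X 8) * (1 - X 7 * X 9)))

lemma tenParam_mem_affineOrbit {t : Fin 10 → ℂ} (h : eval t (tenPoly * zeroPoly) ≠ 0) :
    (fun i => eval t (tenParam (X i))) ∈ affineOrbit specialNormalForms := by
  rw [map_mul] at h
  obtain ⟨h0, hM, had⟩ := tenPoly_spec (left_ne_zero_of_mul h)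
  have hz := right_ne_zero_of_mul h
  simp only [zeroPoly, map_mul, map_sub, map_add, map_one, eval_X] at hz
  have hb : t 7 ≠ 0 := left_ne_zero_of_mul (left_ne_zero_of_mul hz)
  have h1 := right_ne_zero_of_mul (left_ne_zero_of_mul hz)
  have h2 := right_ne_zero_of_mul hz
  have hd : (1 + t 7) * ((1 - t 7 * t 8) * (1 - t 7 * t 9)) ≠ 0 :=
    mul_ne_zero had.hb (mul_ne_zero had.hb₁ had.hb₂)
  -- The abscissa solves the equation in `exists_linked`; the last two factors of `zeroPoly` say
  -- that it is neither 0 nor 1.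
  obtain ⟨θ, ε, hL, -⟩ := exists_linked had (x := (1 - t 7 * (1 + t 7) * (t 8 * t 9)) /
      ((1 + t 7) * ((1 - t 7 * t 8) * (1 - t 7 * t 9)))) hb (div_ne_zero h1 hd)
    (by rw [div_sub_one hd]; exact div_ne_zero h2 hd) (by
      rw [mul_right_comm, mul_div_cancel₀ _ hd])
  have h3 : (![t 7, θ, ε, 1, 0] : Fin 5 → ℂ) 3 ^ 2 + (![t 7, θ, ε, 1, 0] : Fin 5 → ℂ) 4 ^ 2 ≠ 0 := by simp
  have hL' : Linked ((![t 7, θ, ε, 1, 0] : Fin 5 → ℂ) 0) (t 8) (t 9) ((![t 7, θ, ε, 1, 0] : Fin 5 → ℂ) 1)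
    ((![t 7, θ, ε, 1, 0] : Fin 5 → ℂ) 2) := hL
  refine ⟨_, hL'.mem_specialNormalForms had.h₁₂ h3, ?_⟩
  refine AffinelyEquivalent.trans (AffinelyEquivalent.symm ?_) (hL'.affinelyEquivalent h3)
  refine ⟨![t 1, t 2], !![t 3, t 4; t 5, t 6], (t 0)⁻¹, hM, inv_ne_zero h0, ?_⟩
  rw [cubicForm_eval_tenParam, smul_smul, inv_mul_cancel₀ h0, one_smul]
  rfl

theorem vanishingIdeal_affineOrbit :
    vanishingIdeal ℂ (affineOrbit specialNormalForms) = vanishingIdeal ℂ specialForms := by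
  refine le_antisymm ?_ (vanishingIdeal_anti_mono affineOrbit_subset)
  rw [vanishingIdeal_specialForms]
  refine vanishingIdeal_le_ker tenParam (g := tenPoly * zeroPoly) (fun h => ?_)
    fun t => tenParam_mem_affineOrbit
  have := congrArg (eval ![1, 0, 0, 1, 0, 0, 1, 1, 2, 3]) h
  simp [tenPoly, zeroPoly, admissiblePoly] at this
  norm_num at this

end NormalFormDimension

/-! ### The criterion for a component of the center variety. -/

section Component

/-- An element of `Q` outside `P` is a nonzerodivisor modulo `P`, and dividing by it lowers the
dimension. -/
lemma ringKrullDim_quotient_add_one_le {R : Type} [CommRing R] {P Q : Ideal R} [P.IsPrime] (h : P < Q) :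
    ringKrullDim (R ⧸ Q) + 1 ≤ ringKrullDim (R ⧸ P) := by
  obtain ⟨f, hf, hfP⟩ := SetLike.exists_of_lt h
  have h0 : Ideal.Quotient.mk P f ≠ 0 := fun h0 => hfP (Ideal.Quotient.eq_zero_iff_mem.1 h0)
  refine le_trans (add_le_add_left ?_ 1) (ringKrullDim_quotient_succ_le_of_nonZeroDivisor
    (mem_nonZeroDivisors_of_ne_zero h0))
  refine ringKrullDim_le_of_surjective (Ideal.Quotient.lift _ (Ideal.Quotient.factor h.le) fun a ha => ?_)
    (Ideal.Quotient.lift_surjective_of_surjective _ _ (Ideal.Quotient.factor_surjective h.le))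
  obtain ⟨c, rfl⟩ := Ideal.mem_span_singleton'.1 ha
  rw [map_mul, Ideal.Quotient.factor_mk, Ideal.Quotient.eq_zero_iff_mem.2 hf, mul_zero]

variable {s : ℕ → CoeffPoly}

lemma mem_centerVariety_of_special (hs : IsFocalSequence s) {n : Fin 2 × HigherExp → ℂ}
    (hn : n ∈ specialNormalForms) : n ∈ centerVariety s := by
  obtain ⟨c, P, D, E, F, H, I, J, hc, hω, hv⟩ := hn
  rw [map_mul] at hv
  exact mem_centerVariety_of_integratingFactor hs (isRationalIntegratingFactor_of_isSpecial hc hω)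
    (right_ne_zero_of_mul hv) (left_ne_zero_of_mul hv)

lemma map_mem_vanishingIdeal (V : Set (Fin 2 × HigherExp → ℂ)) (hV : V ⊆ centerVariety s) {j : ℕ}
    (hj : 1 ≤ j) : MvPolynomial.map (algebraMap ℚ ℂ) (s j) ∈ vanishingIdeal ℂ V := by
  rw [mem_vanishingIdeal_iff]
  intro x hx
  have := hV hx j hj
  rwa [aeval_map_algebraMap]

lemma mem_focalTangentSpace {k : ℕ} {n v : Fin 2 × HigherExp → ℂ} :
    v ∈ focalTangentSpace s k n ↔
      ∀ j : Fin k, dirDeriv n v (MvPolynomial.map (algebraMap ℚ ℂ) (s (j + 1))) = 0 := by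
  rw [focalTangentSpace, LinearMap.mem_ker, funext_iff]
  refine forall_congr' fun j => ?_
  simp only [Matrix.mulVecLin_apply, Matrix.mulVec, dotProduct, Matrix.of_apply, Pi.zero_apply, dirDeriv,
    pderiv_map, ← aeval_eq_eval, aeval_map_algebraMap]

/-- The tangent space of the center variety at a special form has at least the dimension of the
family. -/
theorem le_finrank_focalTangentSpace (hs : IsFocalSequence s) (k : ℕ) {n : Fin 2 × HigherExp → ℂ}
    (hn : n ∈ specialNormalForms) : 5 ≤ Module.finrank ℂ (focalTangentSpace s k n) := by
  have := isPrime_specialNormalForms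
  have h := ringKrullDim_quotient_le_of_jacobian (vanishingIdeal ℂ specialNormalForms) n
    (fun f hf => mem_vanishingIdeal_iff.1 hf n hn)
    (fun j : Fin k => MvPolynomial.map (algebraMap ℚ ℂ) (s (j + 1)))
    (fun j => map_mem_vanishingIdeal _ (fun _ => mem_centerVariety_of_special hs) (by omega))
    (focalTangentSpace s k n) fun v hv => mem_focalTangentSpace.2 hv
  rw [ringKrullDim_specialNormalForms] at h
  exact_mod_cast h

/-- The family is a component of the center variety, if the tangent space is small at one point. -/
theorem mem_minimalPrimes (hs : IsFocalSequence s) {k : ℕ} {n : Fin 2 × HigherExp → ℂ}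
    (hn : n ∈ specialNormalForms) (hk : Module.finrank ℂ (focalTangentSpace s k n) ≤ 5) :
    vanishingIdeal ℂ specialNormalForms ∈ (vanishingIdeal ℂ (centerVariety s)).minimalPrimes := by
  have hP := isPrime_specialNormalForms
  refine ⟨⟨hP, vanishingIdeal_anti_mono fun _ => mem_centerVariety_of_special hs⟩, ?_⟩
  rintro P ⟨hP', hle⟩ hPN
  by_contra hne
  have hlt : P < vanishingIdeal ℂ specialNormalForms := lt_of_le_of_ne hPN fun h => hne h.ge
  -- A prime strictly below would define a variety through `n` of dimension at least 6, against the
  -- bound 5 from the focal values in `P`.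
  have h1 := ringKrullDim_quotient_le_of_jacobian P n
    (fun f hf => mem_vanishingIdeal_iff.1 (hPN hf) n hn)
    (fun j : Fin k => MvPolynomial.map (algebraMap ℚ ℂ) (s (j + 1)))
    (fun j => hle (map_mem_vanishingIdeal _ subset_rfl (by omega)))
    (focalTangentSpace s k n) fun v hv => mem_focalTangentSpace.2 hv
  have h2 := ringKrullDim_quotient_add_one_le hlt
  rw [ringKrullDim_specialNormalForms] at h2
  have h3 := h2.trans (h1.trans (by exact_mod_cast hk : _ ≤ ((5 : ℕ) : WithBot ℕ∞)))
  exact absurd h3 (by decide)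

end Component

/-! ### Integer certificates for the tangent space at the example. -/

section Annihilators

/-- Weights of linear functionals, listed by degree, that annihilate the deformations of a special
form which are induced by deformations of an inverse integrating factor. -/
def annihilators : List (List (List ℤ)) := [
  [[], [], [],
   [-2900, -9600, 19140, 281160],
   [25, 0, -55, 0, 1089]],
  [[], [], [],
   [167828100, -147396600, -8429385060, -66447343440],
   [0, 1778625, 2817120, -66912615, -651644136],
   [14500, 1800, 19140, 79200, -378972, -5619240],
   [125, 0, -165, 0, 1089, 0, -35937]],
  [[], [], [],
   [-100361814835500, 396536429178000, 8493150456942300, 62711425587040200],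
   [0, -1050070786875, 1407223782900, 78308377356825, 663836404484880],
   [-9305283000, -1752745500, -11897125200, -17110912500, 647541342360, 6607146971700],
   [0, 44274375, 121692150, 16847325, -318698820, 4673851875, 59839123410],
   [1522500, 810000, -478500, -1841400, -1894860, 5227200, 62530380, 452806200],
   [4375, 0, -4125, 0, 16335, 0, -179685, 0, 8301447]],
  [[], [], [],
   [109071449271588865500, -431573462245244583000, -9246919486291144710300,
     -68283516833303662807200],
   [0, 1143700485963924375, -1507499248736219400, -85157158618923096825, -722349848271842716680],
   [10125528548385000, 1804008409546500, 12855277781998200, 18989122299583500,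
     -702286708821714360, -7177403143615898700],
   [0, -49392143173125, -135052502256450, -22081169413125, 345522995558820, -5050218623113125,
     -64769177285177310],
   [-1563233542500, -775668150000, 649025290500, 2155793589000, 2176518019500, -5797725120000,
     -68107849771500, -486002863269000],
   [0, 4655503125, 7017502500, -3068814375, -29200089600, -11537818875, 226225048500,
     130351584825, -9259584919200],
   [38062500, 18375000, -16747500, -40590000, 15790500, 192753000, 104217300, -1811224800,
     -4814839260, 38850771960],
   [65625, 0, -48125, 0, 136125, 0, -898425, 0, 13835745, 0, -821843253]],
  [[], [], [],
   [-349123817820467330016277500, 1380178766986232713601490000, 29582099456936319219172171500,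
     218455363653364406031185241000],
   [0, -3660272140418748160059375, 4819713597970764458494500, 272430405286247571381199125,
     2310977063381196464263400400],
   [-32398944180285911715000, -5795445652133026927500, -41164272887576507766000,
     -60792555836671501162500, 2246809645888374292723800, 22963450452587874260698500],
   [0, 157775956672558246875, 431551737314875770750, 69708545734621181625,
     -1107300411329871338100, 16155968685880499634375, 207249711894362906779050],
   [5002468157061112500, 2480394299856075000, -2079691914851842500, -6902314602428772000,
     -6978864137927730300, 18489423452289381000, 217786489927722549900, 1555515981985984326000],
   [0, -14844376569290625, -22222691162145000, 10458752509636875, 94647533662450800,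
     38033250683484375, -726195573401383800, -427733413164028125, 29645447446757086560],
   [-111162643900000, -41839002187500, 75293868405000, 144447321037500, -74193523074000,
     -715722057517500, -431798981625000, 6211121548747500, 16925986317240000, -131040485309695500],
   [0, 194035078125, 214227343750, -209903203125, -825924082500, 257211590625, 5253688019250,
     1705475685375, -66303657189000, -61438386638475, 3205939552581150],
   [976937500, 409500000, -418687500, -768075000, 552667500, 2994750000, -868477500, -21885633000,
     -8024732100, 318775564800, 476669086740, -14826052284120],
   [1203125, 0, -721875, 0, 1588125, 0, -7486875, 0, 69178725, 0, -1369738755, 0, 99443033613]],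
  [[], [], [],
   [7383226254367317552076733175262500, -29189212879242820797636676845075000,
     -625615543045875425010332711064682500, -4619982887906231335303547382830130000],
   [0, 77407400051568030441522617015625, -101935212148934333968362584760000,
     -5761488304777388429889574334589375, -48873517984547831148541512377697000],
   [685180868293514064719049375000, 122546300695336538383316287500,
     870524933126114447534905155000, 1285583081019941708879050462500,
     -47516676277794851861030628369000, -485640512743569618009975104542500],
   [0, -3336881548371093074427609375, -9126991427996099489182323750,
     -1474964074997957002269571875, 23415550648623044830748965500, -341677757602611792974131734375,
     -4382993019138818035425146030250],
   [-105793960841251543437937500, -52458289231699751962500000, 43978181366152783290637500,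
     145966941758646671910525000, 147577629292298225494132500, -391074076414267437499650000,
     -4605972618539237826986572500, -32896525150546245850748625000],
   [0, 313908744101233291171875, 469927130041422803812500, -221225528581872761390625,
     -2001652871772879526860000, -804500644716821973628125, 15356618172388922305882500,
     9041690745146517645639375, -626952735324485015699484000],
   [2348827786499187000000, 881473900238865937500, -1595932151139007500000,
     -3054250780683674737500, 1583953105954320900000, 15176722070542018387500,
     9173273941397776320000, -131474907772961568007500, -358482789120995630784000,
     2772670695153593250901500],
   [0, -4019952144843140625, -4277006526842918750, 4903244595341859375, 17873994087592222500,
     -6135810745989065625, -114515855272659926250, -39426370181977865625, 1422111470472610533000,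
     1368557575592803509375, -68229027988720861288950],
   [-18318302574687500, -5108665865625000, 12574579303387500, 16834684387500000,
     -19123002171157500, -76878675534375000, 29866338003397500, 564623190074790000,
     250696456387492500, -7761320493962805000, -12970976897416576500, 345378351572521344000],
   [0, 20919558515625, 18400528125000, -23429842734375, -61636719375000, 43918842515625,
     321658692300000, -79842468234375, -2832569936658000, -749194177260375, 48980139479271000,
     39919823795676825, -3023261683736956200],
   [81644062500, 29885625000, -32238937500, -47817000000, 41450062500, 153412875000, -91190137500,
     -867878550000, 200618302500, 8591997645000, 2383345433700, -166341074407200, -173030878486620,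
     10704048138103320],
   [78203125, 0, -39703125, 0, 71465625, 0, -262040625, 0, 1729468125, 0, -20546081325, 0,
     497215168065, 0, -42661061419977]],
  [[], [], [],
   [-19319867143388977136691163011139218172500, 76380050342459999008784249523391537710000,
     1637062494669702128826665630726101519198500, 12089215360231402153776160032044693787339000],
   [0, -202553801798054414780659536511969753125, 266735855096980993714050705715659715500,
     15076217598183395067408914576691817878375, 127888454751835584362232262654591834791600],
   [-1792928785362066505080600384465525000, -320670500708285324722324014075742500,
     -2277924203798088190053494330002734000, -3364019819180329663719519327556807500,
     124337961242585769626897825047453468200, 1270786654001308538231066669325987631500],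
   [0, 8731687457786147374155103424165625, 23882793464454554290042533561410250,
     3859539543578015090556513984601875, -61272119820011259599397237799035900,
     894075711850264401164201849743528125, 11469078343837928941243203981854155950],
   [276833509589581742378092780537500, 137268735031015661966211577125000,
     -115078886891587321652364661747500, -381955306288693542828740872740000,
     -386170398861237168125289304936500, 1023330024115235818987363226955000,
     12052546753389565797105918044314500, 86081090602185344572491971904210000],
   [0, -821413171943424080135826046875, -1229670459024436065107515275000,
     578886080349256776070565315625, 5237774301993376136241649986000,
     2105152110080640307542786418125, -40184077562479509763670724609000,
     -23659829788153538163663510483375, 1640561590727915964043748416480800],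
   [-6146136370006195249235500000, -2306442336125857982384062500, 4176243853535147829717975000,
     7992122051082480813437512500, -4145233614692640676058430000, -39714580689936124111808872500,
     -24005363982175477983051531000, 344036515389374765331715918500,
     938062404238918908590840707200, -7255381560596934954881430053700],
   [0, 10514931550463068179609375, 11179524624015795246281250, -12851635027076291825859375,
     -46786172485612425566377500, 16101779778336350240071875, 299845033609798337990199750,
     103359879932566487111083125, -3722248211424661489655561400, -3584725131312212601205193625,
     178556343754024450494654322410],
   [47800198952589135937500, 13203262094949675000000, -32970422763533575687500,
     -43717853330903341275000, 51111290109629851447500, 202472891585046002250000,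
     -80082699772028860417500, -1489265664294569130585000, -667205124067173777970500,
     20402865049121648940924000, 34245292242979675769303700, -906372852123137765256336600],
   [0, -52746808237181953125, -43015351716743437500, 68350522730765034375, 162277617818101170000,
     -135605851637561353125, -883036800530344597500, 247500844518690984375, 7776746274929457672000,
     2258533200546921634875, -132328200961108440495900, -116034988731621280623225,
     8065131840641857266386640],
   [-185728985316875000, -39451014992812500, 117718735673000000, 118634538200062500,
     -182708770905045000, -477007405052062500, 426095204112270000, 2901101989513612500,
     -917719804110879000, -28513905473191792500, -10096713684520293600, 527836301191553300100,
     656728936882953663960, -32536396675674527896260],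
   [0, 149862603515625, 109871966531250, -159733652203125, -320114466787500, 304152340078125,
     1398197748543750, -819336310340625, -9575891432415000, 1985327368880625, 108535589833844250,
     24003062238337875, -2373070042565796420, -1645572878709394635, 179492840151950571246],
   [498935937500, 161411250000, -179616937500, -223925625000, 212776987500, 606028500000,
     -455950687500, -2773437975000, 1404328117500, 20670603030000, -3972242389500,
     -258551887393800, -57676959495540, 6205245297451200, 4948683124717332, -496574754928532280],
   [391015625, 0, -172046875, 0, 262040625, 0, -786121875, 0, 4035425625, 0, -34243468875, 0,
     497215168065, 0, -14220353806659, 0, 1407815026859241]],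
  [[], [], [],
   [1260028240475027180570008137673611632461835887500,
     -4981453614108373201142456711614184665659105075000,
     -106768073436175412614943164824871913683287172807500,
     -788450188441078068227012359582881824364380863380000],
   [0, 13210417495381581829934606449549170995924671875,
     -17396326701700554955051620107953420087577385000,
     -983260391024747548717229826922273424326296658125,
     -8340795765146181624192338287407530879239419897000],
   [116933563744937509692221174990783607705525000, 20913905304094060673256742446031776337612500,
     148564624859251086673382484314324421324855000, 219399019207179750892149155007974335308037500,
     -8109235071961306700828144849106958802641599000,
     -82879818689178219411883364157505587389819917500],
   [0, -569474570779648183155064559822300060015625, -1557619139546141818049422107945459745646250,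
     -251716514938290741772070265378072662375625, 3996124763883272810935759535878537196800500,
     -58310994282648377105737336210504259358515625, -748005285031206624284366706015498602473077750],
   [-18054888274336838988545351391777256312500, -8952571204207670436644747424883065750000,
     7505364461820439070840197314237276412500, 24910858167680882645613271073667086145000,
     25185763117771071674446634414531244025500, -66740872950716294884538628485445938760000,
     -786058696168159103562149768075205314641500, -5614148650156967692372110962326471049985000],
   [0, 53571991844932012567708105626665015625, 80198244773582927626502899100821012500,
     -37754552443450938108172733246903071875, -341603992140336857017638961428455928000,
     -137296567695661295282904190078540434375, 2620777427647649728547732091475266910500,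
     1543077374414256301345370960049578548125, -106996282081965145431699145743604908477600],
   [400846497743348865443019225399000000, 150424200025757264800434919551562500,
     -272372111981879066500955643623550000, -521240661006257303854864216668562500,
     270350527728066209980877154543840000, 2590160920447009677133845664149412500,
     1565616876862751864627309922156930000, -22437832884644353423162770363930592500,
     -61179823872820222303453858990191816000, 473191069270957554460977550516782478500],
   [0, -685767302358662916540025590234375, -729093292344757316652967789531250,
     838223686567153614070002589453125, 3051399549517249485152253755587500,
     -1050240658686354209639002139859375, -19556092988748562508164455268803750,
     -6741471210907817516237250563131875, 242764643095248552324653090502207000,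
     233801165724667870992708610930451625, -11645367187158123356032818392226145050],
   [-3117193690151059706601476562500, -860724711270802268654203125000,
     2150507937635882108623401562500, 2850637582032451326913407750000,
     -3335577036838948532900359912500, -13207760146701981667424964375000,
     5227062479834813854294558612500, 97153635199465468869648735780000,
     43538037286697011422538781953500, -1330857486072252865345149795033000,
     -2234088637387456143893740855767900, 59118548918970518427631871023765200],
   [0, 3435885762631060217776171875, 2795092282430247278981250000, -4469851239834770247483703125,
     -10576876909214616113044575000, 8906273266102984802186296875, 57695953982963437851771825000,
     -16267063094620353768417328125, -508191513038520112267750746000,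
     -148181981068171947564045118125, 8640780790179836518317442144800,
     7598394391791733700281729954875, -526373853761421332961693623781480],
   [12057033535498223146875000, 2515251755387643989062500, -7675901508030406179375000,
     -7580577589452593440312500, 12241736079263158609575000, 31219870064688079499812500,
     -28936499279949932222475000, -191911438194862266142762500, 62326874012462841068595000,
     1886550593614323884417362500, 679962633023466943047513000, -34783649616154003790576620500,
     -43778142875947486397323501800, 2137713220989247448048655453300],
   [0, -9283450680310447265625, -6068694091986884531250, 11576923049012565234375,
     20386744496600182312500, -23846189773788426515625, -95333585588034562518750,
     66138670158341594034375, 668245314314690027685000, -159708207228280827125625,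
     -7549012323428978931086250, -1883722737104537703845625, 162610064014357419492671100,
     124975434306331752717749175, -12127558841954682576701681430],
   [-27917606843689062500, -4649709426862500000, 15945990794796562500, 12666246409884375000,
     -23344544386937812500, -44866753784448750000, 55026684892984612500, 230983841601946125000,
     -173600378332748482500, -1785531808705491000000, 478440221223519670500,
     22075059150187126083000, 6518188355760147458700, -510851524521973436802000,
     -511562047242923631814860, 39343989768409840809695400],
   [0, 16790893259765625, 10566244125937500, -16646936478046875, -27078422505750000,
     29930706003515625, 101225139029437500, -80983150728046875, -567784561528800000,
     285809766444365625, 4867401220665637500, -867487913619586875, -67664934621092516400,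
     -12816643291012135575, 1785226810759205633820, 1063972204446903877125,
     -159784200157124875812480],
   [50120382812500, 14498859375000, -16464885937500, -17713946250000, 17782076812500,
     41350010625000, -35108202937500, -158482170000000, 105324608812500, 945742349475000,
     -417085450897500, -8769067509510000, 1441923987388500, 132637118233019400, 24743415623586660,
     -3788302254093957600, -2449598146735079340, 358992831849106455000],
   [33236328125, 0, -12903515625, 0, 17032640625, 0, -43236703125, 0, 181594153125, 0,
     -1198521410625, 0, 12430379201625, 0, -213305307099885, 0, 7039075134296205, 0,
     -789784230068034201]],
  [[], [], [],
   [-126458965226240123053928894659525389014663697164635462500,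
     499948690865118891914792750349193220076285488544354150000,
     10715458313759622006038922302586093372739146623647863952500,
     79130444662628253426021954019936798415602906514430309735000],
   [0, -1325824035525410829733713916383860141775011357175515625,
     1745930291106755329628955990071124725144126261545657500,
     98681987905154473165574558812130233622267397298983481875,
     837099017044620858689762463200711043507705827762135334000],
   [-11735687340775085318684812555349524245019503019125000,
     -2098961546136027679567373919799498416180544411012500,
     -14910244172039807387786185064475617189811543691410000,
     -22019326278824643427673215610047936621963989134737500,
     813859120716832195915798482269775414880651595564193000,
     8317985083266453432136236385548132584065871346986497500],
   [0, 57153611818306841799974081109051290197889911078125,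
     156325785613215621013583407623417787679986567991250,
     25262775043074627093498234906653976257235347559375,
     -401059108385635065001430243515965170570555405203500,
     5852208514282907082352568525405804566097616990890625,
     75071312913367821873714050042855053702376916225471750],
   [1812024853916611422759918093550894110931446187500,
     898498028992594972301272049471767299741013125000,
     -753253453357244940553693901295182137022580337500,
     -2500103763914643979677512860044221769693482100000,
     -2527693777102664435964665988520524449473923622500,
     6698248069124808429230633289114823022524362075000,
     78890429685244536961871381087033123306950631692500,
     563447235572477529931250245605475719083030317650000],
   [0, -5376592709569402165450807155898926795210234375,
     -8048856932744740064387048970606756575977875000,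
     3789122736782879354740443805249784937044578125,
     34284062858809185960125851925152503669669690000,
     13779359350203060315770637320943114611876990625,
     -263026487028505202538656145777083807534412585000,
     -154866345210732079704792344588080666660584556875,
     10738361791824323109662897156434731528424422852000],
   [-40229758627831433292467859147346831402500000, -15096873279679476206555488375265519545312500,
     27335813966780720213260156769054991430875000, 52312759749552138050909815026814759280062500,
     -27132927926662411386102446565383004181950000, -259953769407806091401021107864289949358462500,
     -157128472171088570405940874254093624673815000,
     2251906025613462943318275184568171587922752500,
     6140130209948727140761308714148394586709128000,
     -47490406939004760836394425610959108445429100500],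
   [0, 68824939541671490279227342571062450546875, 73173135413114768636360116406888383406250,
     -84126046333509428668341943953725723671875, -306244765553068093059233311327717088137500,
     105404719366898656779833205578713816734375, 1962690741227384183590472056610448235158750,
     676589575871879021606107311645406372715625, -24364357762607478011923431954572524251411000,
     -23464792603471307432011630360099542367498125, 1168752663273592503038846388084706161183229650],
   [312846391544148684295101078598504687500, 86382250070675187755870559837000000000,
     -215830222102107402781998931005410437500, -286092740150995216388850149096460375000,
     334775521859807315021687390159899537500, 1325570042786880348833349620329121250000,
     -524617964141931335073014151125983987500, -9750652149228291638887608165885212925000,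
     -4369676346276496766488723674136132732500, 133568473190078450336051460352608906660000,
     224220659051749458592193375391092593870500, -5933282870338610267024563555300156223139000],
   [0, -344812270181229035220819814709765625, -280471352865834351377612057667187500,
     448663187589744837787799889530671875, 1061491791302772470250591190063050000,
     -894132307537190032834388524466390625, -5790965911067149700962510152236587500,
     1633163633622623478487617519108046875, 51007711923936971403349869761663160000,
     14875864151031685833501787621301064375, -867254586767120142227118698932916623500,
     -762731612488276513039058233023181954125, 52829674822885053125495953848929280771600],
   [-1209801263266031404733861971875000, -252155053571129652362954751562500,
     770385804263860953262220857500000, 760124042887027476472691447812500,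
     -1230010452648699673927948589925000, -3133573756761569022512281262812500,
     2909839016540295900883187779050000, 19273464212116950324104810256562500,
     -6267917582450517860491570264935000, -189468487144020552361805322604462500,
     -68348893669746235909301238793416000, 3492660426276213216517140625279648500,
     4398217011742267507711927648836720600, -214619359310165460169270757612909402100],
   [0, 929601482314708870199736328125, 604746006109943728289165156250,
     -1165074479811384653872713515625, -2039395697029729325543732437500,
     2416906706157626369953115390625, 9583750150225891754956681218750,
     -6727753031895532719364687453125, -67325496371378176218376579875000,
     16246676484108270105170501053125, 760477519623016803753746189993250,
     191199000127009540681284990249375, -16364279629236175681932594771995700,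
     -12651678797752643469535921866434775, 1219424816201436099914283211765888710],
   [2784627997305136068023437500, 451521438269193288871875000, -1595226479079914225232187500,
     -1226715598647272361993750000, 2409515470733274656979187500, 4480570310997695157455625000,
     -5802101601898425822782437500, -23517908645027102504352000000, 18458054132558857925438137500,
     183124358780221384019715375000, -50770999473304907435352367500,
     -2262272678046966605934315402000, -685733065498724072646603194100,
     52133560340458301055857278773000, 53237930226747551968658979783780,
     -4000323738305344815847537166311200],
   [0, -1581167632077883458984375, -854939496158676678750000, 1840920632115860998828125,
     2563242242710579179750000, -3626952368308870412109375, -10450542510016716145500000,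
     10280233172905892582203125, 61156090255835420237700000, -36834586554676493996634375,
     -531213878505689236138050000, 111030236009396477848738125, 7348004331388464201112947600,
     1604526257095292664869360625, -191235528971804500408472607360,
     -129380424959578984303043806875, 16878294813300668156874834008640],
   [-4276329539951218750000, -572586001526601562500, 2191932404189653125000,
     1416499269267895312500, -2960019959706810000000, -4459690900345570312500,
     6573802599295036875000, 19845658272250026562500, -20791171606050742050000,
     -126867769090151729062500, 82939894564310926065000, 1198598827954665727012500,
     -279075371241105932724000, -17892249627215388449524500, -4535655090505308402633000,
     495606113762154682249462500, 416931947407363285731834000, -45410515420827649511505586500],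
   [0, 1993458292998046875, 1099436858050781250, -1828264482966796875, -2508118547622187500,
     3045483409327734375, 8178108604952343750, -7739738019902109375, -38840324871954375000,
     27237011936719921875, 269028826900412906250, -119164423484476321875, -2783074009162537282500,
     435135554711932449375, 45895206763662980273550, 7591306576479774773625,
     -1416785368244019563790000, -736809452836220806967925, 146291427791594903310743250],
   [5493965039062500, 1435809375000000, -1653972632812500, -1565454515625000, 1630023707812500,
     3208949493750000, -2934042674062500, -10568779711875000, 8109994878562500, 52560611680500000,
     -31281408817312500, -387601824196125000, 151402018675792500, 4304888925106770000,
     -618585390589666500, -76405961003178807000, -12247990733675396700, 2527309536217709443200,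
     1374224560318379509740, -275508330816933050676840],
   [3157451171875, 0, -1096798828125, 0, 1277448046875, 0, -2810385703125, 0, 9987678421875, 0,
     -53933463478125, 0, 435063272056875, 0, -5332632677497125, 0, 105586127014443075, 0,
     -3948921150340171005, 0, 495194712252657444027]]]

/-- The weight of `x ^ (a - 1) * y ^ (b - 1)` in the functional with number `k`. -/
def annihilator (k a b : ℕ) : ℤ :=
  (((annihilators.getD k []).getD (a + b - 2) []).getD (a - 1) 0)

/-- The value of a functional on the deformation induced by `x ^ i * y ^ j`. -/
def annihilatorDefect (w : ℕ → ℕ → ℤ) (i j : ℕ) : ℤ :=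
  -- The constants are the coefficients of the example after the rescaling described by
  -- `ScaledCoeffs`.
  i * (33 * w i (j + 2)) - j * (-5 * w (i + 2) j) +
    ((i - 1) * -3870 + (2 - j) * 3060) * w (i + 1) (j + 2) + (1 - j) * (-1740 * w (i + 2) (j + 1)) -
    j * (750 * w (i + 3) j) + ((i - 2) * 113400 + (2 - j) * -127575) * w (i + 2) (j + 2) +
    (1 - j) * (80325 * w (i + 3) (j + 1)) - j * (-23625 * w (i + 4) j) +
    (3 - j) * (-42525 * w (i + 1) (j + 3))

-- The functionals involve degrees up to 20 only, so the monomials of degrees 3 to 20 are tested.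
-- The truncated `a - 1` in `annihilator` gives meaningless values for `a = 0`, but they occur only
-- with the factor `i = 0`.
set_option maxRecDepth 100000 in
lemma annihilatorDefect_check : ((List.range 9).all fun k => (List.range 18).all fun d =>
    (List.range (d + 4)).all fun i =>
      decide (annihilatorDefect (annihilator k) i (d + 3 - i) = 0)) = true := by
  decide +kernel

lemma annihilatorDefect_eq_zero {k : ℕ} (hk : k < 9) {i j : ℕ} (h : 3 ≤ i + j) (h' : i + j < 21) :
    annihilatorDefect (annihilator k) i j = 0 := by
  have h1 := List.all_eq_true.1 annihilatorDefect_check k (List.mem_range.2 hk)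
  have h2 := List.all_eq_true.1 h1 (i + j - 3) (List.mem_range.2 (by omega))
  have h3 := List.all_eq_true.1 h2 i (List.mem_range.2 (by omega))
  rw [show i + j - 3 + 3 - i = j by omega] at h3
  exact of_decide_eq_true h3

lemma length_annihilators : ((List.range 9).all fun k =>
    decide ((annihilators.getD k []).length ≤ 21)) = true := by
  decide +kernel

lemma annihilator_eq_zero {k : ℕ} (hk : k < 9) {a b : ℕ} (h : 23 ≤ a + b) : annihilator k a b = 0 := by
  have h1 := of_decide_eq_true (List.all_eq_true.1 length_annihilators k (List.mem_range.2 hk))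
  rw [annihilator, List.getD_eq_default (annihilators.getD k []) [] (n := a + b - 2) (by omega)]
  rfl

/-- The value of a functional on the deformation given by a multiple of the `dy`-component. -/
def annihilatorRowP (k i j : ℕ) : ℤ :=
  33 * annihilator k (i + 1) (j + 2) - 3870 * annihilator k (i + 2) (j + 2) +
    113400 * annihilator k (i + 3) (j + 2)

/-- The value of a functional on the deformation given by a multiple of the `dx`-component. -/
def annihilatorRowQ (k i j : ℕ) : ℤ :=
  -(-5 * annihilator k (i + 2) (j + 1) + 750 * annihilator k (i + 3) (j + 1) -
    1740 * annihilator k (i + 2) (j + 2) + 3060 * annihilator k (i + 1) (j + 3) -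
    23625 * annihilator k (i + 4) (j + 1) + 80325 * annihilator k (i + 3) (j + 2) -
    127575 * annihilator k (i + 2) (j + 3) - 42525 * annihilator k (i + 1) (j + 4))

/-- The values of the functionals on nine coordinate directions. -/
def annihilatorMatrix : Matrix (Fin 9) (Fin 9) ℤ := Matrix.of fun k =>
  ![annihilatorRowP k 2 0, annihilatorRowP k 1 1, annihilatorRowP k 0 2, annihilatorRowP k 3 0,
    annihilatorRowP k 2 1, annihilatorRowQ k 2 0, annihilatorRowQ k 0 2, annihilatorRowQ k 3 0,
    annihilatorRowQ k 1 2]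

/-- The inverse of the matrix modulo 17. -/
def annihilatorInverse : Matrix (Fin 9) (Fin 9) ℤ := Matrix.of
  ![![12, 13, 6, 7, 16, 7, 0, 12, 16],
    ![13, 7, 6, 6, 12, 13, 15, 9, 13],
    ![16, 4, 8, 16, 8, 2, 13, 6, 0],
    ![9, 0, 5, 2, 15, 1, 0, 1, 13],
    ![15, 8, 3, 4, 14, 8, 11, 5, 13],
    ![8, 12, 9, 14, 3, 3, 3, 16, 8],
    ![0, 4, 2, 10, 15, 5, 0, 4, 0],
    ![3, 14, 7, 6, 15, 6, 0, 0, 8],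
    ![0, 4, 16, 12, 11, 1, 15, 3, 12]]

set_option maxRecDepth 100000 in
lemma annihilatorInverse_check :
    ∀ i j, (∑ k, annihilatorInverse i k * annihilatorMatrix k j) % 17 = if i = j then 1 else 0 := by
  decide +kernel

/-- Reduction modulo 17 with an explicit inverse avoids the determinant of a matrix with very large
entries. -/
theorem det_annihilatorMatrix_ne_zero : annihilatorMatrix.det ≠ 0 := by
  intro h
  have hm : (annihilatorInverse * annihilatorMatrix).map (Int.castRingHom (ZMod 17)) = 1 := by
    ext i j
    have h1 := annihilatorInverse_check i j
    rw [Matrix.map_apply, Matrix.mul_apply, Matrix.one_apply]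
    have h2 := (ZMod.intCast_mod (∑ k, annihilatorInverse i k * annihilatorMatrix k j) 17).symm
    rw [eq_intCast, h2]
    push_cast at h1 ⊢
    rw [h1]
    split_ifs <;> simp
  have hd := congrArg Matrix.det hm
  have : Fact (Nat.Prime 17) := ⟨by norm_num⟩
  rw [← RingHom.mapMatrix_apply, ← RingHom.map_det, Matrix.det_mul, h, mul_zero, map_zero,
    Matrix.det_one] at hd
  exact zero_ne_one hd

end Annihilators

/-! ### Weight functionals and the deformation operator. -/

section WeightFunctional

/-- The linear functional on power series with the given weights. -/
def weightFunctional (w : ℕ → ℕ → ℂ) : MvPowerSeries (Fin 2) ℂ →ₗ[ℂ] ℂ :=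
  ∑ a ∈ Finset.range 24, ∑ b ∈ Finset.range 24, w a b • MvPowerSeries.coeff (expo a b)

/-- The monomials as power series. -/
def serMono (i j : ℕ) : MvPowerSeries (Fin 2) ℂ := MvPowerSeries.X 0 ^ i * MvPowerSeries.X 1 ^ j

lemma weightFunctional_apply (w : ℕ → ℕ → ℂ) (F : MvPowerSeries (Fin 2) ℂ) : weightFunctional w F =
    ∑ a ∈ Finset.range 24, ∑ b ∈ Finset.range 24, w a b * cf F a b := by
  simp [weightFunctional, cf, LinearMap.sum_apply]

lemma cf_serMono (i j a b : ℕ) : cf (serMono i j) a b = if i = a ∧ j = b then 1 else 0 := by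
  have : serMono i j = ((C 1 * (X 0 ^ i * X 1 ^ j) : MvPolynomial (Fin 2) ℂ) : MvPowerSeries (Fin 2) ℂ) := by
    simp [serMono]
  rw [this, cf_coe, coeff_expo_monomial]
  simp only [eq_comm]

lemma serMono_mem (i j : ℕ) : serMono i j ∈ lowIdeal ℂ (i + j) := fun a b h => by
  rw [cf_serMono, if_neg (by omega)]

variable {w : ℕ → ℕ → ℂ}

lemma weightFunctional_of_mem (hw : ∀ a b, 23 ≤ a + b → w a b = 0) {F : MvPowerSeries (Fin 2) ℂ} (hF : F ∈ lowIdeal ℂ 23) :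
    weightFunctional w F = 0 := by
  rw [weightFunctional_apply]
  refine Finset.sum_eq_zero fun a _ => Finset.sum_eq_zero fun b _ => ?_
  rcases lt_or_ge (a + b) 23 with h | h
  · rw [hF a b h, mul_zero]
  · rw [hw a b h, zero_mul]

lemma weightFunctional_serMono (hw : ∀ a b, 23 ≤ a + b → w a b = 0) (i j : ℕ) :
    weightFunctional w (serMono i j) = w i j := by
  rcases lt_or_ge (i + j) 23 with h | h
  · rw [weightFunctional_apply, Finset.sum_eq_single i, Finset.sum_eq_single j]
    · rw [cf_serMono, if_pos ⟨rfl, rfl⟩, mul_one]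
    · intro b _ hb
      rw [cf_serMono, if_neg (by tauto), mul_zero]
    · intro hj
      exact absurd (Finset.mem_range.2 (by omega)) hj
    · intro a _ ha
      refine Finset.sum_eq_zero fun b _ => ?_
      rw [cf_serMono, if_neg (by tauto), mul_zero]
    · intro hi
      exact absurd (Finset.mem_range.2 (by omega)) hi
  · rw [weightFunctional_of_mem hw (lowIdeal_anti h (serMono_mem i j)), hw i j h]

lemma weightFunctional_C_mul (c : ℂ) (F : MvPowerSeries (Fin 2) ℂ) :
    weightFunctional w (MvPowerSeries.C c * F) = c * weightFunctional w F := by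
  rw [← MvPowerSeries.smul_eq_C_mul, map_smul, smul_eq_mul]

/-- The deformation of a form which is induced by a deformation of an inverse integrating factor. -/
def factorDeform (P Q G : MvPowerSeries (Fin 2) ℂ) : MvPowerSeries (Fin 2) ℂ :=
  serWedge P Q G - G * (MvPowerSeries.pderiv ℂ 0 Q - MvPowerSeries.pderiv ℂ 1 P)

lemma factorDeform_add (P Q F G : MvPowerSeries (Fin 2) ℂ) :
    factorDeform P Q (F + G) = factorDeform P Q F + factorDeform P Q G := by
  rw [factorDeform, factorDeform, factorDeform, serWedge_add]; ring

lemma factorDeform_C_mul (P Q G : MvPowerSeries (Fin 2) ℂ) (c : ℂ) :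
    factorDeform P Q (MvPowerSeries.C c * G) = MvPowerSeries.C c * factorDeform P Q G := by
  rw [factorDeform, factorDeform, serWedge_C_mul]; ring

lemma factorDeform_zero (P Q : MvPowerSeries (Fin 2) ℂ) : factorDeform P Q 0 = 0 := by
  simp [factorDeform, serWedge]

lemma factorDeform_sum {ι : Type} (P Q : MvPowerSeries (Fin 2) ℂ) (S : Finset ι)
    (G : ι → MvPowerSeries (Fin 2) ℂ) :
    factorDeform P Q (∑ i ∈ S, G i) = ∑ i ∈ S, factorDeform P Q (G i) := by
  classical
  induction S using Finset.induction_on with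
  | empty => simp [factorDeform_zero]
  | insert a S ha ih => rw [Finset.sum_insert ha, Finset.sum_insert ha, factorDeform_add, ih]

lemma factorDeform_mem {P Q G : MvPowerSeries (Fin 2) ℂ} (hP : P ∈ lowIdeal ℂ 1) (hQ : Q ∈ lowIdeal ℂ 1)
    {N : ℕ} (hG : G ∈ lowIdeal ℂ N) : factorDeform P Q G ∈ lowIdeal ℂ N :=
  sub_mem (sub_mem
    (lowIdeal_anti (by omega) (mul_mem_lowIdeal (pderiv_mem_lowIdeal hG 0) hQ))
    (lowIdeal_anti (by omega) (mul_mem_lowIdeal (pderiv_mem_lowIdeal hG 1) hP))) (Ideal.mul_mem_right _ _ hG)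

lemma X_mul_pderiv_serMono (i j : ℕ) :
    MvPowerSeries.X 0 * MvPowerSeries.pderiv ℂ 0 (serMono i j) = (i : MvPowerSeries (Fin 2) ℂ) * serMono i j ∧
    MvPowerSeries.X 1 * MvPowerSeries.pderiv ℂ 1 (serMono i j) = (j : MvPowerSeries (Fin 2) ℂ) * serMono i j := by
  have h10 : MvPowerSeries.pderiv ℂ 0 (MvPowerSeries.X 1 : MvPowerSeries (Fin 2) ℂ) = 0 := by
    rw [MvPowerSeries.pderiv_X_of_ne (by simp)]
  have h01 : MvPowerSeries.pderiv ℂ 1 (MvPowerSeries.X 0 : MvPowerSeries (Fin 2) ℂ) = 0 := by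
    rw [MvPowerSeries.pderiv_X_of_ne (by simp)]
  simp only [serMono, Derivation.leibniz, Derivation.leibniz_pow, smul_eq_mul, nsmul_eq_mul,
    MvPowerSeries.pderiv_X_self, h10, h01, mul_zero, add_zero, zero_add, mul_one]
  constructor
  · rcases i with _ | i
    · simp
    · rw [Nat.add_sub_cancel]; ring
  · rcases j with _ | j
    · simp
    · rw [Nat.add_sub_cancel]; ring

end WeightFunctional

/-! ### The functionals annihilate all deformations by integrating factors. -/

section ScaledForm

variable {p₂₀ p₁₁ p₀₂ p₃₀ p₂₁ p₁₂ p₀₃ q₁₁ q₂₁ : ℂ}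

/-- A form with the given higher coefficients, first component. -/
def serP (p₂₀ p₁₁ p₀₂ p₃₀ p₂₁ p₁₂ p₀₃ : ℂ) : MvPowerSeries (Fin 2) ℂ :=
  serMono 1 0 + MvPowerSeries.C p₂₀ * serMono 2 0 + MvPowerSeries.C p₁₁ * serMono 1 1 +
    MvPowerSeries.C p₀₂ * serMono 0 2 + MvPowerSeries.C p₃₀ * serMono 3 0 +
    MvPowerSeries.C p₂₁ * serMono 2 1 + MvPowerSeries.C p₁₂ * serMono 1 2 + MvPowerSeries.C p₀₃ * serMono 0 3

/-- A form with the given higher coefficients, second component. -/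
def serQ (q₁₁ q₂₁ : ℂ) : MvPowerSeries (Fin 2) ℂ :=
  serMono 0 1 + MvPowerSeries.C q₁₁ * serMono 1 1 + MvPowerSeries.C q₂₁ * serMono 2 1

/-- Multiplication by `x y` turns the derivatives into the Euler operators `x ∂/∂x` and `y ∂/∂y`,
which are diagonal on monomials; so no exponent has to be lowered. -/
lemma XX_mul_factorDeform (i j : ℕ) :
    serMono 1 1 * factorDeform (serP p₂₀ p₁₁ p₀₂ p₃₀ p₂₁ p₁₂ p₀₃) (serQ q₁₁ q₂₁) (serMono i j) =
      MvPowerSeries.C (i : ℂ) * serMono i (j + 2) - MvPowerSeries.C (j : ℂ) * serMono (i + 2) j +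
      MvPowerSeries.C ((i - 1) * q₁₁ + (2 - j) * p₀₂) * serMono (i + 1) (j + 2) +
      MvPowerSeries.C ((1 - j) * p₁₁) * serMono (i + 2) (j + 1) -
      MvPowerSeries.C (j * p₂₀) * serMono (i + 3) j +
      MvPowerSeries.C ((i - 2) * q₂₁ + (2 - j) * p₁₂) * serMono (i + 2) (j + 2) +
      MvPowerSeries.C ((1 - j) * p₂₁) * serMono (i + 3) (j + 1) -
      MvPowerSeries.C (j * p₃₀) * serMono (i + 4) j +
      MvPowerSeries.C ((3 - j) * p₀₃) * serMono (i + 1) (j + 3) := by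
  obtain ⟨hx, hy⟩ := X_mul_pderiv_serMono i j
  have dx : MvPowerSeries.X 0 * MvPowerSeries.pderiv ℂ 0 (serQ q₁₁ q₂₁) =
      MvPowerSeries.C q₁₁ * serMono 1 1 + 2 * (MvPowerSeries.C q₂₁ * serMono 2 1) := by
    simp only [serQ, map_add, Derivation.leibniz, MvPowerSeries.pderiv_C, smul_eq_mul, mul_zero, add_zero]
    have h1 := (X_mul_pderiv_serMono 0 1).1
    have h2 := (X_mul_pderiv_serMono 1 1).1
    have h3 := (X_mul_pderiv_serMono 2 1).1
    push_cast at h1 h2 h3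
    linear_combination h1 + MvPowerSeries.C q₁₁ * h2 + MvPowerSeries.C q₂₁ * h3
  have dy : MvPowerSeries.X 1 * MvPowerSeries.pderiv ℂ 1 (serP p₂₀ p₁₁ p₀₂ p₃₀ p₂₁ p₁₂ p₀₃) =
      MvPowerSeries.C p₁₁ * serMono 1 1 + 2 * (MvPowerSeries.C p₀₂ * serMono 0 2) +
      MvPowerSeries.C p₂₁ * serMono 2 1 + 2 * (MvPowerSeries.C p₁₂ * serMono 1 2) +
      3 * (MvPowerSeries.C p₀₃ * serMono 0 3) := by
    simp only [serP, map_add, Derivation.leibniz, MvPowerSeries.pderiv_C, smul_eq_mul, mul_zero, add_zero]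
    have h1 := (X_mul_pderiv_serMono 1 0).2
    have h2 := (X_mul_pderiv_serMono 2 0).2
    have h3 := (X_mul_pderiv_serMono 1 1).2
    have h4 := (X_mul_pderiv_serMono 0 2).2
    have h5 := (X_mul_pderiv_serMono 3 0).2
    have h6 := (X_mul_pderiv_serMono 2 1).2
    have h7 := (X_mul_pderiv_serMono 1 2).2
    have h8 := (X_mul_pderiv_serMono 0 3).2
    push_cast at h1 h2 h3 h4 h5 h6 h7 h8
    linear_combination h1 + MvPowerSeries.C p₂₀ * h2 + MvPowerSeries.C p₁₁ * h3 +
      MvPowerSeries.C p₀₂ * h4 + MvPowerSeries.C p₃₀ * h5 + MvPowerSeries.C p₂₁ * h6 +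
      MvPowerSeries.C p₁₂ * h7 + MvPowerSeries.C p₀₃ * h8
  have hX : serMono 1 1 = MvPowerSeries.X 0 * MvPowerSeries.X 1 := by simp [serMono]
  have e : serMono 1 1 * factorDeform (serP p₂₀ p₁₁ p₀₂ p₃₀ p₂₁ p₁₂ p₀₃) (serQ q₁₁ q₂₁) (serMono i j) =
      (i : MvPowerSeries (Fin 2) ℂ) * serMono i j * (MvPowerSeries.X 1 * serQ q₁₁ q₂₁) -
      (j : MvPowerSeries (Fin 2) ℂ) * serMono i j *
        (MvPowerSeries.X 0 * serP p₂₀ p₁₁ p₀₂ p₃₀ p₂₁ p₁₂ p₀₃) -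
      serMono i j * (MvPowerSeries.X 1 * (MvPowerSeries.X 0 * MvPowerSeries.pderiv ℂ 0 (serQ q₁₁ q₂₁)) -
        MvPowerSeries.X 0 * (MvPowerSeries.X 1 *
          MvPowerSeries.pderiv ℂ 1 (serP p₂₀ p₁₁ p₀₂ p₃₀ p₂₁ p₁₂ p₀₃))) := by
    rw [hX, factorDeform, serWedge]
    linear_combination MvPowerSeries.X 1 * serQ q₁₁ q₂₁ * hx -
      MvPowerSeries.X 0 * serP p₂₀ p₁₁ p₀₂ p₃₀ p₂₁ p₁₂ p₀₃ * hy
  rw [e, dx, dy]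
  simp only [serP, serQ, serMono, pow_add, map_add, map_sub, map_mul, map_natCast, map_one, map_ofNat]
  ring

variable {w : ℕ → ℕ → ℂ}

lemma weightFunctional_factorDeform (hw : ∀ a b, 23 ≤ a + b → w a b = 0) (i j : ℕ) :
    weightFunctional w (serMono 1 1 *
      factorDeform (serP p₂₀ p₁₁ p₀₂ p₃₀ p₂₁ p₁₂ p₀₃) (serQ q₁₁ q₂₁) (serMono i j)) =
      i * w i (j + 2) - j * w (i + 2) j + ((i - 1) * q₁₁ + (2 - j) * p₀₂) * w (i + 1) (j + 2) +
      (1 - j) * p₁₁ * w (i + 2) (j + 1) - j * p₂₀ * w (i + 3) j +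
      ((i - 2) * q₂₁ + (2 - j) * p₁₂) * w (i + 2) (j + 2) + (1 - j) * p₂₁ * w (i + 3) (j + 1) -
      j * p₃₀ * w (i + 4) j + (3 - j) * p₀₃ * w (i + 1) (j + 3) := by
  rw [XX_mul_factorDeform]
  simp only [map_add (weightFunctional w), map_sub (weightFunctional w), weightFunctional_C_mul, weightFunctional_serMono hw]

lemma weightFunctional_mul_serQ (hw : ∀ a b, 23 ≤ a + b → w a b = 0) (i j : ℕ) :
    weightFunctional w (serMono 1 1 * (serMono i j * serQ q₁₁ q₂₁)) =
      w (i + 1) (j + 2) + q₁₁ * w (i + 2) (j + 2) + q₂₁ * w (i + 3) (j + 2) := by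
  have : serMono 1 1 * (serMono i j * serQ q₁₁ q₂₁) = serMono (i + 1) (j + 2) +
      MvPowerSeries.C q₁₁ * serMono (i + 2) (j + 2) + MvPowerSeries.C q₂₁ * serMono (i + 3) (j + 2) := by
    simp only [serQ, serMono, pow_add]; ring
  rw [this]
  simp only [map_add, weightFunctional_C_mul, weightFunctional_serMono hw]

lemma weightFunctional_mul_serP (hw : ∀ a b, 23 ≤ a + b → w a b = 0) (i j : ℕ) :
    weightFunctional w (serMono 1 1 * (serMono i j * serP p₂₀ p₁₁ p₀₂ p₃₀ p₂₁ p₁₂ p₀₃)) =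
      w (i + 2) (j + 1) + p₂₀ * w (i + 3) (j + 1) + p₁₁ * w (i + 2) (j + 2) + p₀₂ * w (i + 1) (j + 3) +
      p₃₀ * w (i + 4) (j + 1) + p₂₁ * w (i + 3) (j + 2) + p₁₂ * w (i + 2) (j + 3) +
      p₀₃ * w (i + 1) (j + 4) := by
  have : serMono 1 1 * (serMono i j * serP p₂₀ p₁₁ p₀₂ p₃₀ p₂₁ p₁₂ p₀₃) = serMono (i + 2) (j + 1) +
      MvPowerSeries.C p₂₀ * serMono (i + 3) (j + 1) + MvPowerSeries.C p₁₁ * serMono (i + 2) (j + 2) +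
      MvPowerSeries.C p₀₂ * serMono (i + 1) (j + 3) + MvPowerSeries.C p₃₀ * serMono (i + 4) (j + 1) +
      MvPowerSeries.C p₂₁ * serMono (i + 3) (j + 2) + MvPowerSeries.C p₁₂ * serMono (i + 2) (j + 3) +
      MvPowerSeries.C p₀₃ * serMono (i + 1) (j + 4) := by
    simp only [serP, serMono, pow_add]; ring
  rw [this]
  simp only [map_add, weightFunctional_C_mul, weightFunctional_serMono hw]

/-- The coefficients of a form for which the annihilators are computed, up to scaling the variables by
`ξ` and `η`. -/
structure ScaledCoeffs (p₂₀ p₁₁ p₀₂ p₃₀ p₂₁ p₁₂ p₀₃ q₁₁ q₂₁ κ ξ η : ℂ) : Prop where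
  hκ : κ ≠ 0
  hξ : ξ ≠ 0
  hη : η ≠ 0
  h₁₀ : κ * ξ ^ 2 = -5
  h₂₀ : κ * p₂₀ * ξ ^ 3 = 750
  h₁₁ : κ * p₁₁ * ξ ^ 2 * η = -1740
  h₀₂ : κ * p₀₂ * ξ * η ^ 2 = 3060
  h₃₀ : κ * p₃₀ * ξ ^ 4 = -23625
  h₂₁ : κ * p₂₁ * ξ ^ 3 * η = 80325
  h₁₂ : κ * p₁₂ * ξ ^ 2 * η ^ 2 = -127575
  h₀₃ : κ * p₀₃ * ξ * η ^ 3 = -42525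
  k₀₁ : κ * η ^ 2 = 33
  k₁₁ : κ * q₁₁ * ξ * η ^ 2 = -3870
  k₂₁ : κ * q₂₁ * ξ ^ 2 * η ^ 2 = 113400

/-- The weights of the annihilators. -/
def scaledWeight (ξ η : ℂ) (k a b : ℕ) : ℂ := ξ ^ a * η ^ b * annihilator k a b

lemma scaledWeight_eq_zero {ξ η : ℂ} {k : ℕ} (hk : k < 9) (a b : ℕ) (h : 23 ≤ a + b) :
    scaledWeight ξ η k a b = 0 := by
  rw [scaledWeight, annihilator_eq_zero hk h, Int.cast_zero, mul_zero]

variable {κ ξ η : ℂ}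

/-- The weights contain `ξ ^ a * η ^ b`. After multiplication by `κ` every term is `ξ ^ i * η ^ j`
times an integer, and the integers add up to `annihilatorDefect`, which is 0. -/
lemma ScaledCoeffs.weight_serMono (h : ScaledCoeffs p₂₀ p₁₁ p₀₂ p₃₀ p₂₁ p₁₂ p₀₃ q₁₁ q₂₁ κ ξ η) {k : ℕ}
    (hk : k < 9) {i j : ℕ} (h3 : 3 ≤ i + j) (h21 : i + j < 21) :
    weightFunctional (scaledWeight ξ η k) (serMono 1 1 *
      factorDeform (serP p₂₀ p₁₁ p₀₂ p₃₀ p₂₁ p₁₂ p₀₃) (serQ q₁₁ q₂₁) (serMono i j)) = 0 := by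
  have hT : ((annihilatorDefect (annihilator k) i j : ℤ) : ℂ) = 0 := by
    rw [annihilatorDefect_eq_zero hk h3 h21, Int.cast_zero]
  simp only [annihilatorDefect] at hT
  push_cast at hT
  refine (mul_eq_zero.1 (?_ : κ * _ = 0)).resolve_left h.hκ
  rw [weightFunctional_factorDeform (scaledWeight_eq_zero hk)]
  simp only [scaledWeight]
  linear_combination ξ ^ i * η ^ j * (hT +
    i * annihilator k i (j + 2) * h.k₀₁ - j * annihilator k (i + 2) j * h.h₁₀ +
    annihilator k (i + 1) (j + 2) * ((i - 1) * h.k₁₁ + (2 - j) * h.h₀₂) +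
    (1 - j) * annihilator k (i + 2) (j + 1) * h.h₁₁ - j * annihilator k (i + 3) j * h.h₂₀ +
    annihilator k (i + 2) (j + 2) * ((i - 2) * h.k₂₁ + (2 - j) * h.h₁₂) +
    (1 - j) * annihilator k (i + 3) (j + 1) * h.h₂₁ - j * annihilator k (i + 4) j * h.h₃₀ +
    (3 - j) * annihilator k (i + 1) (j + 3) * h.h₀₃)

lemma serP_mem : serP p₂₀ p₁₁ p₀₂ p₃₀ p₂₁ p₁₂ p₀₃ ∈ lowIdeal ℂ 1 := by
  have h (i j : ℕ) (hij : 1 ≤ i + j) : serMono i j ∈ lowIdeal ℂ 1 := lowIdeal_anti hij (serMono_mem i j)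
  exact add_mem (add_mem (add_mem (add_mem (add_mem (add_mem (add_mem (h 1 0 (by norm_num))
    (Ideal.mul_mem_left _ _ (h 2 0 (by norm_num)))) (Ideal.mul_mem_left _ _ (h 1 1 (by norm_num))))
    (Ideal.mul_mem_left _ _ (h 0 2 (by norm_num)))) (Ideal.mul_mem_left _ _ (h 3 0 (by norm_num))))
    (Ideal.mul_mem_left _ _ (h 2 1 (by norm_num)))) (Ideal.mul_mem_left _ _ (h 1 2 (by norm_num))))
    (Ideal.mul_mem_left _ _ (h 0 3 (by norm_num)))

lemma serQ_mem : serQ q₁₁ q₂₁ ∈ lowIdeal ℂ 1 := by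
  have h (i j : ℕ) (hij : 1 ≤ i + j) : serMono i j ∈ lowIdeal ℂ 1 := lowIdeal_anti hij (serMono_mem i j)
  exact add_mem (add_mem (h 0 1 (by norm_num)) (Ideal.mul_mem_left _ _ (h 1 1 (by norm_num))))
    (Ideal.mul_mem_left _ _ (h 2 1 (by norm_num)))

lemma sub_truncation_mem (G : MvPowerSeries (Fin 2) ℂ) (N : ℕ) :
    G - ∑ i ∈ Finset.range N, ∑ j ∈ Finset.range N, MvPowerSeries.C (cf G i j) * serMono i j ∈
      lowIdeal ℂ N := fun a b hab => by
  have hs : ∀ (S : Finset ℕ) (f : ℕ → MvPowerSeries (Fin 2) ℂ), cf (∑ i ∈ S, f i) a b = ∑ i ∈ S, cf (f i) a b :=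
    fun S f => by simp [cf]
  have hm : ∀ i j, cf (MvPowerSeries.C (cf G i j) * serMono i j) a b =
      if i = a ∧ j = b then cf G i j else 0 := fun i j => by
    have : cf (MvPowerSeries.C (cf G i j) * serMono i j) a b = cf G i j * cf (serMono i j) a b := by
      simp [cf]
    rw [this, cf_serMono]; simp
  rw [cf_sub, hs, Finset.sum_eq_single a, hs, Finset.sum_eq_single b, hm, if_pos ⟨rfl, rfl⟩, sub_self]
  · intro j _ hj; rw [hm, if_neg (by tauto)]
  · intro hb; exact absurd (Finset.mem_range.2 (by omega)) hb
  · intro i _ hi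
    rw [hs]
    exact Finset.sum_eq_zero fun j _ => by rw [hm, if_neg (by tauto)]
  · intro ha; exact absurd (Finset.mem_range.2 (by omega)) ha

/-- The annihilators vanish on the deformations induced by deformations of an inverse integrating
factor. -/
theorem ScaledCoeffs.weight_factorDeform (h : ScaledCoeffs p₂₀ p₁₁ p₀₂ p₃₀ p₂₁ p₁₂ p₀₃ q₁₁ q₂₁ κ ξ η)
    {k : ℕ} (hk : k < 9) {G : MvPowerSeries (Fin 2) ℂ} (hG : G ∈ lowIdeal ℂ 3) :
    weightFunctional (scaledWeight ξ η k) (serMono 1 1 *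
      factorDeform (serP p₂₀ p₁₁ p₀₂ p₃₀ p₂₁ p₁₂ p₀₃) (serQ q₁₁ q₂₁) G) = 0 := by
  -- Terms of degree at least 21 end up in degree at least 23, where the weights vanish; this
  -- reduces `G` to finitely many monomials.
  have hlow : ∀ F ∈ lowIdeal ℂ 21, weightFunctional (scaledWeight ξ η k) (serMono 1 1 *
      factorDeform (serP p₂₀ p₁₁ p₀₂ p₃₀ p₂₁ p₁₂ p₀₃) (serQ q₁₁ q₂₁) F) = 0 := fun F hF =>
    weightFunctional_of_mem (scaledWeight_eq_zero hk)
      (lowIdeal_anti (by omega) (mul_mem_lowIdeal (serMono_mem 1 1) (factorDeform_mem serP_mem serQ_mem hF)))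
  have h1 := hlow _ (sub_truncation_mem G 21)
  rw [← sub_add_cancel G (∑ i ∈ Finset.range 21, ∑ j ∈ Finset.range 21,
    MvPowerSeries.C (cf G i j) * serMono i j), factorDeform_add, mul_add, map_add, h1, zero_add,
    factorDeform_sum, Finset.mul_sum, map_sum]
  refine Finset.sum_eq_zero fun i _ => ?_
  rw [factorDeform_sum, Finset.mul_sum, map_sum]
  refine Finset.sum_eq_zero fun j _ => ?_
  rw [factorDeform_C_mul, mul_left_comm, weightFunctional_C_mul]
  rcases lt_or_ge (i + j) 3 with h3 | h3
  · rw [hG i j h3, zero_mul]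
  rcases lt_or_ge (i + j) 21 with h21 | h21
  · rw [h.weight_serMono hk h3 h21, mul_zero]
  · rw [hlow _ (lowIdeal_anti h21 (serMono_mem i j)), mul_zero]

end ScaledForm

/-! ### The upper bound for the tangent space. -/

section KernelBound

variable {p₂₀ p₁₁ p₀₂ p₃₀ p₂₁ p₁₂ p₀₃ q₁₁ q₂₁ κ ξ η : ℂ}

/-- The exponent of a monomial of degree two or three. -/
def higherExp (i j : ℕ) (h : 2 ≤ i + j ∧ i + j ≤ 3 := by decide) : HigherExp :=
  ⟨(⟨i, by omega⟩, ⟨j, by omega⟩), h⟩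

lemma sum_higherExp {M : Type} [AddCommMonoid M] (f : HigherExp → M) : ∑ e, f e =
    f (higherExp 2 0) + f (higherExp 1 1) + f (higherExp 0 2) + f (higherExp 3 0) + f (higherExp 2 1) +
      f (higherExp 1 2) + f (higherExp 0 3) := by
  have : (Finset.univ : Finset HigherExp) = {higherExp 2 0, higherExp 1 1, higherExp 0 2, higherExp 3 0,
      higherExp 2 1, higherExp 1 2, higherExp 0 3} := by decide
  rw [this]
  repeat rw [Finset.sum_insert (by decide)]
  rw [Finset.sum_singleton]
  abel

lemma coe_higherForm (v : Fin 2 × HigherExp → ℂ) :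
    ((higherForm v).1 : MvPowerSeries (Fin 2) ℂ) =
      ∑ e : HigherExp, MvPowerSeries.C (v (0, e)) * serMono e.1.1 e.1.2 ∧
    ((higherForm v).2 : MvPowerSeries (Fin 2) ℂ) =
      ∑ e : HigherExp, MvPowerSeries.C (v (1, e)) * serMono e.1.1 e.1.2 := by
  constructor <;>
  · simp [higherForm, sum_higherExp, serMono]

lemma ScaledCoeffs.rowP (h : ScaledCoeffs p₂₀ p₁₁ p₀₂ p₃₀ p₂₁ p₁₂ p₀₃ q₁₁ q₂₁ κ ξ η) {k : ℕ}
    (hk : k < 9) (i j : ℕ) :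
    κ * weightFunctional (scaledWeight ξ η k) (serMono 1 1 * (serMono i j * serQ q₁₁ q₂₁)) =
      ξ ^ (i + 1) * η ^ j * annihilatorRowP k i j := by
  rw [weightFunctional_mul_serQ (scaledWeight_eq_zero hk), annihilatorRowP]
  simp only [scaledWeight]
  push_cast
  linear_combination ξ ^ (i + 1) * η ^ j * (annihilator k (i + 1) (j + 2) * h.k₀₁ +
    annihilator k (i + 2) (j + 2) * h.k₁₁ + annihilator k (i + 3) (j + 2) * h.k₂₁)

lemma ScaledCoeffs.rowQ (h : ScaledCoeffs p₂₀ p₁₁ p₀₂ p₃₀ p₂₁ p₁₂ p₀₃ q₁₁ q₂₁ κ ξ η) {k : ℕ}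
    (hk : k < 9) (i j : ℕ) :
    κ * weightFunctional (scaledWeight ξ η k)
      (serMono 1 1 * (serMono i j * serP p₂₀ p₁₁ p₀₂ p₃₀ p₂₁ p₁₂ p₀₃)) =
      -(ξ ^ i * η ^ (j + 1) * annihilatorRowQ k i j) := by
  rw [weightFunctional_mul_serP (scaledWeight_eq_zero hk), annihilatorRowQ]
  simp only [scaledWeight]
  push_cast
  linear_combination ξ ^ i * η ^ (j + 1) * (annihilator k (i + 2) (j + 1) * h.h₁₀ +
    annihilator k (i + 3) (j + 1) * h.h₂₀ + annihilator k (i + 2) (j + 2) * h.h₁₁ +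
    annihilator k (i + 1) (j + 3) * h.h₀₂ + annihilator k (i + 4) (j + 1) * h.h₃₀ +
    annihilator k (i + 3) (j + 2) * h.h₂₁ + annihilator k (i + 2) (j + 3) * h.h₁₂ +
    annihilator k (i + 1) (j + 4) * h.h₀₃)

variable {s : ℕ → CoeffPoly} {n v : Fin 2 × HigherExp → ℂ}

/-- The linear equations of the tangent space given by the annihilators. -/
lemma ScaledCoeffs.equation (h : ScaledCoeffs p₂₀ p₁₁ p₀₂ p₃₀ p₂₁ p₁₂ p₀₃ q₁₁ q₂₁ κ ξ η)
    (hP : ((normalForm n).1 : MvPowerSeries (Fin 2) ℂ) = serP p₂₀ p₁₁ p₀₂ p₃₀ p₂₁ p₁₂ p₀₃)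
    (hQ : ((normalForm n).2 : MvPowerSeries (Fin 2) ℂ) = serQ q₁₁ q₂₁)
    (hs : IsFocalSequence s) (hn : n ∈ centerVariety s) (hv : v ∈ focalTangentSpace s 10 n) {k : ℕ}
    (hk : k < 9) :
    ∑ e : HigherExp, v (0, e) * (ξ ^ ((e.1.1 : ℕ) + 1) * η ^ (e.1.2 : ℕ)) * annihilatorRowP k e.1.1 e.1.2 +
    ∑ e : HigherExp, v (1, e) * (ξ ^ (e.1.1 : ℕ) * η ^ ((e.1.2 : ℕ) + 1)) * annihilatorRowQ k e.1.1 e.1.2 =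
      0 := by
  obtain ⟨G, hG, hE⟩ := exists_deformation_of_focal hs hn (v := v) fun j h1 h10 => by
    have := congrFun (LinearMap.mem_ker.1 hv) ⟨j - 1, by omega⟩
    simp only [Matrix.mulVecLin_apply, Matrix.mulVec, dotProduct, Matrix.of_apply, Pi.zero_apply,
      Nat.sub_add_cancel h1] at this
    rw [← this]
    exact Finset.sum_congr rfl fun i _ => mul_comm _ _
  rw [hP, hQ, (coe_higherForm v).1, (coe_higherForm v).2] at hE
  -- The congruence holds below degree 24, of which the functionals use only the degrees up to 20.
  have hE' := weightFunctional_of_mem (scaledWeight_eq_zero (ξ := ξ) (η := η) hk)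
    (lowIdeal_anti (by omega) (mul_mem_lowIdeal (serMono_mem 1 1) hE))
  have hF := h.weight_factorDeform hk hG
  rw [factorDeform] at hF
  rw [mul_sub, map_sub, hF, zero_sub, neg_eq_zero, Finset.sum_mul, Finset.sum_mul, mul_sub, Finset.mul_sum,
    Finset.mul_sum, map_sub, map_sum, map_sum] at hE'
  simp only [mul_assoc (MvPowerSeries.C _), mul_left_comm (serMono 1 1) (MvPowerSeries.C _),
    weightFunctional_C_mul] at hE'
  have hE2 := congrArg (κ * ·) hE'
  simp only [mul_zero, mul_sub, Finset.mul_sum, mul_left_comm κ, h.rowP hk, h.rowQ hk] at hE2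
  rw [← hE2, sub_eq_add_neg, ← Finset.sum_neg_distrib]
  congr 1 <;> exact Finset.sum_congr rfl fun e _ => by ring

/-- The coordinates of tangent vectors outside the nine directions used for the annihilators. -/
def freeCoords : (Fin 2 × HigherExp → ℂ) →ₗ[ℂ] (Fin 5 → ℂ) where
  toFun v := ![v (0, higherExp 1 2), v (0, higherExp 0 3), v (1, higherExp 1 1), v (1, higherExp 2 1),
    v (1, higherExp 0 3)]
  map_add' v w := by simp
  map_smul' c v := by simp

theorem ScaledCoeffs.finrank_le (h : ScaledCoeffs p₂₀ p₁₁ p₀₂ p₃₀ p₂₁ p₁₂ p₀₃ q₁₁ q₂₁ κ ξ η)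
    (hP : ((normalForm n).1 : MvPowerSeries (Fin 2) ℂ) = serP p₂₀ p₁₁ p₀₂ p₃₀ p₂₁ p₁₂ p₀₃)
    (hQ : ((normalForm n).2 : MvPowerSeries (Fin 2) ℂ) = serQ q₁₁ q₂₁)
    (hs : IsFocalSequence s) (hn : n ∈ centerVariety s) :
    Module.finrank ℂ (focalTangentSpace s 10 n) ≤ 5 := by
  have hinj : Function.Injective (freeCoords ∘ₗ (focalTangentSpace s 10 n).subtype) := by
    rw [injective_iff_map_eq_zero]
    rintro ⟨v, hv⟩ h0
    have h0' : freeCoords v = 0 := h0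
    have c0 : v (0, higherExp 1 2) = 0 := congrFun h0' 0
    have c1 : v (0, higherExp 0 3) = 0 := congrFun h0' 1
    have c2 : v (1, higherExp 1 1) = 0 := congrFun h0' 2
    have c3 : v (1, higherExp 2 1) = 0 := congrFun h0' 3
    have c4 : v (1, higherExp 0 3) = 0 := congrFun h0' 4
    -- When the five free coordinates vanish, the other nine, rescaled, satisfy a square system with
    -- the integer matrix `annihilatorMatrix`.
    set u : Fin 9 → ℂ := ![v (0, higherExp 2 0) * (ξ ^ 3 * η ^ 0), v (0, higherExp 1 1) * (ξ ^ 2 * η ^ 1),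
      v (0, higherExp 0 2) * (ξ ^ 1 * η ^ 2), v (0, higherExp 3 0) * (ξ ^ 4 * η ^ 0),
      v (0, higherExp 2 1) * (ξ ^ 3 * η ^ 1), v (1, higherExp 2 0) * (ξ ^ 2 * η ^ 1),
      v (1, higherExp 0 2) * (ξ ^ 0 * η ^ 3), v (1, higherExp 3 0) * (ξ ^ 3 * η ^ 1),
      v (1, higherExp 1 2) * (ξ ^ 1 * η ^ 3)] with hu
    have hu0 : u = 0 := by
      refine Matrix.eq_zero_of_mulVec_eq_zero (M := annihilatorMatrix.map (Int.castRingHom ℂ)) ?_ ?_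
      · rw [← RingHom.mapMatrix_apply, ← RingHom.map_det, eq_intCast]
        exact Int.cast_ne_zero.2 det_annihilatorMatrix_ne_zero
      · ext k
        have := h.equation hP hQ hs hn hv k.2
        rw [sum_higherExp, sum_higherExp, c0, c1, c2, c3, c4] at this
        rw [Matrix.mulVec, dotProduct, Fin.sum_univ_castSucc, Fin.sum_univ_eight, Pi.zero_apply, ← this]
        simp only [zero_mul, add_zero, hu]
        change ((annihilatorRowP k 2 0 : ℤ) : ℂ) * (v (0, higherExp 2 0) * (ξ ^ 3 * η ^ 0)) +
          ((annihilatorRowP k 1 1 : ℤ) : ℂ) * (v (0, higherExp 1 1) * (ξ ^ 2 * η ^ 1)) +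
          ((annihilatorRowP k 0 2 : ℤ) : ℂ) * (v (0, higherExp 0 2) * (ξ ^ 1 * η ^ 2)) +
          ((annihilatorRowP k 3 0 : ℤ) : ℂ) * (v (0, higherExp 3 0) * (ξ ^ 4 * η ^ 0)) +
          ((annihilatorRowP k 2 1 : ℤ) : ℂ) * (v (0, higherExp 2 1) * (ξ ^ 3 * η ^ 1)) +
          ((annihilatorRowQ k 2 0 : ℤ) : ℂ) * (v (1, higherExp 2 0) * (ξ ^ 2 * η ^ 1)) +
          ((annihilatorRowQ k 0 2 : ℤ) : ℂ) * (v (1, higherExp 0 2) * (ξ ^ 0 * η ^ 3)) +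
          ((annihilatorRowQ k 3 0 : ℤ) : ℂ) * (v (1, higherExp 3 0) * (ξ ^ 3 * η ^ 1)) +
          ((annihilatorRowQ k 1 2 : ℤ) : ℂ) * (v (1, higherExp 1 2) * (ξ ^ 1 * η ^ 3)) =
          v (0, higherExp 2 0) * (ξ ^ 3 * η ^ 0) * ((annihilatorRowP k 2 0 : ℤ) : ℂ) +
          v (0, higherExp 1 1) * (ξ ^ 2 * η ^ 1) * ((annihilatorRowP k 1 1 : ℤ) : ℂ) +
          v (0, higherExp 0 2) * (ξ ^ 1 * η ^ 2) * ((annihilatorRowP k 0 2 : ℤ) : ℂ) +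
          v (0, higherExp 3 0) * (ξ ^ 4 * η ^ 0) * ((annihilatorRowP k 3 0 : ℤ) : ℂ) +
          v (0, higherExp 2 1) * (ξ ^ 3 * η ^ 1) * ((annihilatorRowP k 2 1 : ℤ) : ℂ) +
          (v (1, higherExp 2 0) * (ξ ^ 2 * η ^ 1) * ((annihilatorRowQ k 2 0 : ℤ) : ℂ) +
          v (1, higherExp 0 2) * (ξ ^ 0 * η ^ 3) * ((annihilatorRowQ k 0 2 : ℤ) : ℂ) +
          v (1, higherExp 3 0) * (ξ ^ 3 * η ^ 1) * ((annihilatorRowQ k 3 0 : ℤ) : ℂ) +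
          v (1, higherExp 1 2) * (ξ ^ 1 * η ^ 3) * ((annihilatorRowQ k 1 2 : ℤ) : ℂ))
        ring
    have hne : ∀ a b : ℕ, ξ ^ a * η ^ b ≠ 0 := fun a b =>
      mul_ne_zero (pow_ne_zero a h.hξ) (pow_ne_zero b h.hη)
    have z (x : ℂ) (a b : ℕ) (hx : x * (ξ ^ a * η ^ b) = 0) : x = 0 :=
      (mul_eq_zero.1 hx).resolve_right (hne a b)
    have d0 := z _ _ _ (congrFun hu0 0)
    have d1 := z _ _ _ (congrFun hu0 1)
    have d2 := z _ _ _ (congrFun hu0 2)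
    have d3 := z _ _ _ (congrFun hu0 3)
    have d4 := z _ _ _ (congrFun hu0 4)
    have d5 := z _ _ _ (congrFun hu0 5)
    have d6 := z _ _ _ (congrFun hu0 6)
    have d7 := z _ _ _ (congrFun hu0 7)
    have d8 := z _ _ _ (congrFun hu0 8)
    refine Subtype.ext (funext fun i => ?_)
    obtain ⟨k, e⟩ := i
    have he : e = higherExp 2 0 ∨ e = higherExp 1 1 ∨ e = higherExp 0 2 ∨ e = higherExp 3 0 ∨
        e = higherExp 2 1 ∨ e = higherExp 1 2 ∨ e = higherExp 0 3 := by
      revert e; decide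
    change v (k, e) = 0
    fin_cases k <;> rcases he with rfl | rfl | rfl | rfl | rfl | rfl | rfl <;> assumption
  have := LinearMap.finrank_le_finrank_of_injective hinj
  simpa using this

end KernelBound

/-! ### Multiplication of the equations of the curves by constants. -/

section Scaling

lemma transversalAt_C_mul {l l' : ℂ} (hl : l ≠ 0) (hl' : l' ≠ 0) (p : Fin 3 → ℂ)
    (G G' : MvPolynomial (Fin 3) ℂ) : TransversalAt p (C l * G) (C l' * G') ↔ TransversalAt p G G' := by
  have hg : ∀ (a : ℂ) (F : MvPolynomial (Fin 3) ℂ), gradAt p (C a * F) = a • gradAt p F := fun a F => by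
    ext i; simp [gradAt, Derivation.leibniz]
  have hu : LinearIndependent ℂ ![l • gradAt p G, l' • gradAt p G'] ↔
      LinearIndependent ℂ ![gradAt p G, gradAt p G'] := by
    rw [LinearIndependent.pair_iff, LinearIndependent.pair_iff]
    refine ⟨fun h x y hxy => ?_, fun h x y hxy => ?_⟩
    · have := h (x * l⁻¹) (y * l'⁻¹) (by
        rw [smul_smul, smul_smul, inv_mul_cancel_right₀ hl, inv_mul_cancel_right₀ hl']; exact hxy)
      simpa [hl, hl'] using this
    · have := h (x * l) (y * l') (by rw [mul_smul, mul_smul]; exact hxy)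
      simpa [hl, hl'] using this
  rw [TransversalAt, TransversalAt, hg, hg, hu]
  simp [hl, hl']

lemma irreducible_C_mul {l : ℂ} (hl : l ≠ 0) {G : MvPolynomial (Fin 3) ℂ} (h : Irreducible G) :
    Irreducible (C l * G) :=
  (irreducible_isUnit_mul ((isUnit_iff_ne_zero.2 hl).map C)).2 h

theorem Configuration.IsSpecial.scale {c : Configuration} {P D E F H I J : Fin 2 → ℂ}
    (h : c.IsSpecial P D E F H I J) {l : Fin 5 → ℂ} (hl : ∀ i, l i ≠ 0) :
    (c.scale l).IsSpecial P D E F H I J where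
  line₁ := by
    have := (isHomogeneous_C (Fin 3) (l 0)).mul h.line₁
    rwa [zero_add] at this
  line₂ := by
    have := (isHomogeneous_C (Fin 3) (l 1)).mul h.line₂
    rwa [zero_add] at this
  line₃ := by
    have := (isHomogeneous_C (Fin 3) (l 2)).mul h.line₃
    rwa [zero_add] at this
  line₄ := by
    have := (isHomogeneous_C (Fin 3) (l 3)).mul h.line₄
    rwa [zero_add] at this
  conic := by
    have := (isHomogeneous_C (Fin 3) (l 4)).mul h.conic
    rwa [zero_add] at this
  irreducible := irreducible_C_mul (hl 4) h.irreducible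
  direction := h.direction
  fourfold := by
    simpa [OrdinaryPoint, Configuration.scale, transversalAt_C_mul (hl _) (hl _), hl] using h.fourfold
  triple := by
    simpa [OrdinaryPoint, Configuration.scale, transversalAt_C_mul (hl _) (hl _), hl] using h.triple
  nodeE := by
    simpa [OrdinaryPoint, Configuration.scale, transversalAt_C_mul (hl _) (hl _), hl] using h.nodeE
  nodeF := by
    simpa [OrdinaryPoint, Configuration.scale, transversalAt_C_mul (hl _) (hl _), hl] using h.nodeF
  nodeH := by
    simpa [OrdinaryPoint, Configuration.scale, transversalAt_C_mul (hl _) (hl _), hl] using h.nodeH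
  nodeI := by
    simpa [OrdinaryPoint, Configuration.scale, transversalAt_C_mul (hl _) (hl _), hl] using h.nodeI
  nodeJ := by
    simpa [OrdinaryPoint, Configuration.scale, transversalAt_C_mul (hl _) (hl _), hl] using h.nodeJ

end Scaling

/-! ### The explicit example. -/

section Example

/-- The coordinate change that relates the example to the standard configuration. -/
def exampleMatrix : Matrix (Fin 2) (Fin 2) ℂ := !![4, 0; 20 / 3, -4 / 3]

lemma det_exampleMatrix : exampleMatrix.det ≠ 0 := by
  rw [exampleMatrix, Matrix.det_fin_two_of]; norm_num

lemma admissible_example : Admissible (1 / 2) (5 / 3) 3 := by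
  constructor <;> norm_num

/-- The factors between the equations of the example and those of the standard configuration. -/
def exampleFactors : Fin 5 → ℂ := ![-3 / 4, -3 / 4, 1, 1 / 2, -3 / 4]

lemma exampleFactors_ne_zero (i : Fin 5) : exampleFactors i ≠ 0 := by
  fin_cases i <;> simp [exampleFactors]

lemma exampleConfiguration_eq : exampleConfiguration =
    ((stdConfig (1 / 2) (5 / 3) 3).comap ![2, 2 / 3] exampleMatrix).scale exampleFactors := by
  rw [Configuration.comap, Configuration.scale, exampleConfiguration, stdConfig, Configuration.mk.injEq]
  refine ⟨?_, ?_, ?_, ?_, ?_⟩ <;> refine MvPolynomial.funext fun v => ?_ <;>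
    rw [map_mul, eval_C, eval_projSubst] <;> simp [exampleFactors, projMap, exampleMatrix] <;> ring

lemma exampleForm_eq :
    exampleForm = (9 / 16 : ℂ) • pullback ![2, 2 / 3] exampleMatrix (stdForm (1 / 2) (5 / 3) 3) := by
  have a0 (v : Fin 2 → ℂ) : affMap ![2, 2 / 3] exampleMatrix v 0 = 2 + 4 * v 0 := by
    simp [affMap, exampleMatrix]
  have a1 (v : Fin 2 → ℂ) : affMap ![2, 2 / 3] exampleMatrix v 1 = 2 / 3 + 20 / 3 * v 0 - 4 / 3 * v 1 := by
    simp [affMap, exampleMatrix]; ring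
  have c00 : exampleMatrix 0 0 = 4 := rfl
  have c01 : exampleMatrix 0 1 = 0 := rfl
  have c10 : exampleMatrix 1 0 = 20 / 3 := rfl
  have c11 : exampleMatrix 1 1 = -4 / 3 := rfl
  ext1 <;> refine MvPolynomial.funext fun v => ?_
  · rw [Prod.smul_fst, smul_eq_C_mul, pullback_fst]
    simp only [map_add, map_mul, eval_C, eval_affSubst, eval_stdForm_fst, eval_stdForm_snd, a0, a1, c00, c10,
      exampleForm, map_sub, map_neg, map_pow, map_ofNat, eval_X]
    ring
  · rw [Prod.smul_snd, smul_eq_C_mul, pullback_snd]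
    simp only [map_add, map_mul, eval_C, eval_affSubst, eval_stdForm_fst, eval_stdForm_snd, a0, a1, c01, c11,
      exampleForm, map_sub, map_pow, map_ofNat, eval_X]
    ring

theorem isSpecial_example :
    ∃ P D E F H I J : Fin 2 → ℂ, exampleConfiguration.IsSpecial P D E F H I J := by
  obtain ⟨P, D, E, F, H, I, J, h⟩ := isSpecial_comap admissible_example ![2, 2 / 3] det_exampleMatrix
  rw [exampleConfiguration_eq]
  exact ⟨P, D, E, F, H, I, J, h.scale exampleFactors_ne_zero⟩

theorem exampleForm_mem : exampleForm ∈ exampleConfiguration.forms 3 := by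
  rw [exampleConfiguration_eq, exampleForm_eq, Configuration.forms_scale exampleFactors_ne_zero]
  exact Submodule.smul_mem _ _ (pullback_stdForm_mem' _ _ _ _ _)

variable {θ : ℂ}

/-- Here `b (1 + b) m₁ m₂ = 15 / 4`, which gives `θ² = -11 / 15`; the zero has abscissa 22, which
gives `ε = 21 / 22 θ`. -/
lemma linked_example (hθ : θ ^ 2 = -11 / 15) : Linked (1 / 2) (5 / 3) 3 θ (21 / 22 * θ) := by
  have h0 : θ ≠ 0 := by rintro rfl; norm_num at hθ
  refine ⟨by norm_num, by norm_num, h0, mul_ne_zero (by norm_num) h0, ?_, ?_, ?_, ?_⟩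
  · have : θ - 21 / 22 * θ = 1 / 22 * θ := by ring
    rw [this]; exact mul_ne_zero (by norm_num) h0
  · rw [hθ]; norm_num
  · rw [hθ]; norm_num
  · linear_combination (-80 / 11 : ℂ) * hθ

lemma coe_normalForm_fiveParam (b ε : ℂ) :
    ((normalForm (fun i => eval ![b, θ, ε, 1, 0] (fiveParam (X i)))).1 : MvPowerSeries (Fin 2) ℂ) =
      serP (-(θ * (b * θ ^ 2 - 1 - θ * ε))) (-(θ * (-3 * (θ - ε) + θ * (1 + b * θ ^ 2 + θ * ε - b))))
        (b * θ ^ 3 - (θ - ε)) (linFactor θ ε * -(b * θ ^ 2))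
        (linFactor θ ε * -(θ * (1 + b * θ ^ 2 + θ * ε - b)))
        (linFactor θ ε * (b * θ ^ 2 - 2 * θ * (θ - ε))) (linFactor θ ε * (θ - ε)) ∧
    ((normalForm (fun i => eval ![b, θ, ε, 1, 0] (fiveParam (X i)))).2 : MvPowerSeries (Fin 2) ℂ) =
      serQ ((1 + θ ^ 2) * (θ + ε)) (linFactor θ ε * (1 + θ ^ 2)) := by
  obtain ⟨h1, h2⟩ := isQuadCub_fiveForm ![b, θ, ε, 1, 0]
  rw [eval_fiveParam, normalForm_highCoeff h1 h2]
  have hf : fiveFactor ![b, θ, ε, 1, 0] = linFactor θ ε := by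
    rw [fiveFactor]; simp
  have hC : ∀ a : ℂ, MvPowerSeries.C a = ((C a : MvPolynomial (Fin 2) ℂ) : MvPowerSeries (Fin 2) ℂ) :=
    fun a => (MvPolynomial.coe_C a).symm
  have hM : ∀ i j, serMono i j = ((X 0 ^ i * X 1 ^ j : MvPolynomial (Fin 2) ℂ) : MvPowerSeries (Fin 2) ℂ) :=
    fun i j => by simp [serMono]
  have hC2 : (C 2 : MvPolynomial (Fin 2) ℂ) = 2 := map_ofNat C 2
  have hC3 : (C 3 : MvPolynomial (Fin 2) ℂ) = 3 := map_ofNat C 3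
  constructor
  · simp only [serP, hC, hM, ← MvPolynomial.coe_mul, ← MvPolynomial.coe_add, fiveForm, hf]
    congr 1
    simp [quadP, quadQ, cubP, cubQ, hC2, hC3]
    ring
  · simp only [serQ, hC, hM, ← MvPolynomial.coe_mul, ← MvPolynomial.coe_add, fiveForm, hf]
    congr 1
    simp [quadP, quadQ, cubP, cubQ]
    ring

/-- Scaling `x` by a rational multiple of the irrational `θ` makes all coefficients even in `θ`,
hence rational; `κ` and `η` make them integers. -/
lemma scaledCoeffs_example (hθ : θ ^ 2 = -11 / 15) : ScaledCoeffs
    (-(θ * (1 / 2 * θ ^ 2 - 1 - θ * (21 / 22 * θ))))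
    (-(θ * (-3 * (θ - 21 / 22 * θ) + θ * (1 + 1 / 2 * θ ^ 2 + θ * (21 / 22 * θ) - 1 / 2))))
    (1 / 2 * θ ^ 3 - (θ - 21 / 22 * θ)) (linFactor θ (21 / 22 * θ) * -(1 / 2 * θ ^ 2))
    (linFactor θ (21 / 22 * θ) * -(θ * (1 + 1 / 2 * θ ^ 2 + θ * (21 / 22 * θ) - 1 / 2)))
    (linFactor θ (21 / 22 * θ) * (1 / 2 * θ ^ 2 - 2 * θ * (θ - 21 / 22 * θ)))
    (linFactor θ (21 / 22 * θ) * (θ - 21 / 22 * θ))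
    ((1 + θ ^ 2) * (θ + 21 / 22 * θ)) (linFactor θ (21 / 22 * θ) * (1 + θ ^ 2))
    (11 / 151875) (3375 / 11 * θ) (-675) := by
  have h0 : θ ≠ 0 := by rintro rfl; norm_num at hθ
  refine ⟨by norm_num, mul_ne_zero (by norm_num) h0, by norm_num, ?_, ?_, ?_, ?_, ?_, ?_, ?_, ?_, by norm_num,
    ?_, ?_⟩ <;> try simp only [linFactor]
  · linear_combination (75/11) * hθ
  · linear_combination ((-11250/11) + (168750/121) * θ ^ 2 + (1265625/1331) * θ ^ 4) * hθ
  · linear_combination ((26100/11) + (-391500/121) * θ ^ 2 + (810000/121) * θ ^ 4) * hθ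
  · linear_combination ((-45900/11) + (10125/2) * θ ^ 2) * hθ
  · linear_combination ((354375/11) + (-5315625/121) * θ ^ 2 + (79734375/1331) * θ ^ 4 +
      (-1196015625/14641) * θ ^ 6 + (-17940234375/58564) * θ ^ 8) * hθ
  · linear_combination ((-1204875/11) + (18073125/121) * θ ^ 2 + (-271096875/1331) * θ ^ 4 +
      (70086515625/58564) * θ ^ 6 + (28704375000/14641) * θ ^ 8) * hθ
  · linear_combination ((1913625/11) + (-28704375/121) * θ ^ 2 + (430565625/1331) * θ ^ 4 +
      (6458484375/5324) * θ ^ 6) * hθ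
  · linear_combination ((637875/11) + (-9568125/121) * θ ^ 2 + (-143521875/484) * θ ^ 4) * hθ
  · linear_combination ((58050/11) + (435375/22) * θ ^ 2) * hθ
  · linear_combination ((-1701000/11) + (25515000/121) * θ ^ 2 + (908971875/242) * θ ^ 4 +
      (717609375/242) * θ ^ 6) * hθ

/-- The example has a normal form at which the tangent space has the dimension of the family. -/
theorem exists_normalForm_example : ∃ n ∈ specialNormalForms, AffinelyEquivalent exampleForm (normalForm n) ∧
    ∀ s : ℕ → CoeffPoly, IsFocalSequence s → Module.finrank ℂ (focalTangentSpace s 10 n) = 5 := by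
  obtain ⟨θ, hθ⟩ := IsAlgClosed.exists_pow_nat_eq (-11 / 15 : ℂ) (n := 2) (by norm_num)
  have hL : Linked ((![1 / 2, θ, 21 / 22 * θ, 1, 0] : Fin 5 → ℂ) 0) (5 / 3) 3
    ((![1 / 2, θ, 21 / 22 * θ, 1, 0] : Fin 5 → ℂ) 1) ((![1 / 2, θ, 21 / 22 * θ, 1, 0] : Fin 5 → ℂ) 2) :=
    linked_example hθ
  have h0 : (![1 / 2, θ, 21 / 22 * θ, 1, 0] : Fin 5 → ℂ) 3 ^ 2 +
    (![1 / 2, θ, 21 / 22 * θ, 1, 0] : Fin 5 → ℂ) 4 ^ 2 ≠ 0 := by simp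
  have hn := hL.mem_specialNormalForms admissible_example.h₁₂ h0
  -- The lower bound is the dimension of the family contained in the center variety; the upper bound
  -- comes from the annihilators.
  refine ⟨_, hn, ?_, fun s hs => le_antisymm ?_ (le_finrank_focalTangentSpace hs 10 hn)⟩
  · refine AffinelyEquivalent.trans (AffinelyEquivalent.symm ?_) (hL.affinelyEquivalent h0)
    refine ⟨![2, 2 / 3], exampleMatrix, 16 / 9, det_exampleMatrix, by norm_num, ?_⟩
    rw [exampleForm_eq, smul_smul]
    norm_num
  · obtain ⟨hP, hQ⟩ := coe_normalForm_fiveParam (θ := θ) (1 / 2) (21 / 22 * θ)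
    exact (scaledCoeffs_example hθ).finrank_le hP hQ hs (mem_centerVariety_of_special hs hn)

end Example

end CenterProblem

end

open CenterProblem
theorem mainTheorem1 :
    -- every configuration in special position
    (∀ (c : Configuration) (C D E F H I J : Fin 2 → ℂ), c.IsSpecial C D E F H I J →
      (∀ q : MvPolynomial (Fin 2) ℂ, q.totalDegree ≤ 2 →
        (∀ p ∈ [C, E, F, H, I, J], eval p q = 0) → q = 0) ∧
      Module.finrank ℂ (c.forms 3) = 1 ∧
      ∀ ω ∈ c.forms 3,
        IsAlgebraicIntegralCurve ω c.Γ ∧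
        (∀ K₄ KΓ : MvPolynomial (Fin 2) ℂ,
          IsCofactor ω (affinePart c.L₄) K₄ → IsCofactor ω c.Γ KΓ →
            K₄ - KΓ + dForm ω = 0) ∧
        IsRationalIntegratingFactor (affinePart c.L₄) c.Γ ω) ∧
    -- the family of forms is irreducible, of dimension 9 up to scaling (10 as a cone)
    ((vanishingIdeal ℂ specialForms).IsPrime ∧
      ringKrullDim (MvPolynomial (Fin 2 × CubicExp) ℂ ⧸ vanishingIdeal ℂ specialForms) = 10) ∧
    -- its members in Poincaré normal form; they generate the family, and have codimension 9 = 14 - 5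
    (vanishingIdeal ℂ (affineOrbit specialNormalForms) = vanishingIdeal ℂ specialForms ∧
      ringKrullDim (MvPolynomial (Fin 2 × HigherExp) ℂ ⧸ vanishingIdeal ℂ specialNormalForms)
        = 5) ∧
    -- they form an irreducible component of the center variety
    (∃ s : ℕ → CoeffPoly, IsFocalSequence s) ∧
    (∀ s : ℕ → CoeffPoly, IsFocalSequence s →
      vanishingIdeal ℂ specialNormalForms ∈
        (vanishingIdeal ℂ (centerVariety s)).minimalPrimes) ∧
    -- the tangent space computation at the explicit example
    ((∃ C D E F H I J : Fin 2 → ℂ, exampleConfiguration.IsSpecial C D E F H I J) ∧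
      exampleForm ∈ exampleConfiguration.forms 3 ∧
      ∃ n ∈ specialNormalForms, AffinelyEquivalent exampleForm (normalForm n) ∧
        ∀ s : ℕ → CoeffPoly, IsFocalSequence s →
          Module.finrank ℂ (focalTangentSpace s 10 n) = 5) := by
  refine ⟨fun c P D E F H I J h => ⟨fun q hq hv => eq_zero_of_conic h hq hv, finrank_forms h, fun ω hω =>
    ⟨?_, fun K₄ K h₄ hK => cofactor_identity h hω h₄ hK, isRationalIntegratingFactor_of_isSpecial h hω⟩⟩,
    ⟨isPrime_specialForms, ringKrullDim_specialForms⟩,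
    ⟨vanishingIdeal_affineOrbit, ringKrullDim_specialNormalForms⟩, exists_isFocalSequence, fun s hs => ?_,
    isSpecial_example, exampleForm_mem, exists_normalForm_example⟩
  · obtain ⟨K, hK⟩ := cofactor_Γ hω.2.2
    exact ⟨K, hK⟩
  · obtain ⟨n, hn, -, hk⟩ := exists_normalForm_example
    exact mem_minimalPrimes hs hn (hk s hs).le
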